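/- **Setting.** A half-duplex discrete memoryless cognitive relay channel has finite input alphabets $\mathcal X_{11},\mathcal X_{12},\mathcal X_{22}$, finite output alphabets $\mathcal Y_{11},\mathcal Y_{21},\mathcal Y,\mathcal Y_{12},\mathcal Y_{22}$, and transition probabilities $p(y_{11},y_{21},y\mid x_{11})$ in the first phase (the first $\tau n$ of $n$ channel uses, rounded down) and $p(y_{12},y_{22}\mid x_{12},x_{22})$ in the second phase, $0\le\tau\le1$. Sender $S_1$ has a message $w_1$ for $T_1$ and sends $x_{11}$ in phase 1 and $x_{12}$ in phase 2. Sender $S_2$ has a message $w_2$ for $T_2$, is silent and receives $y$ in phase 1, and sends $x_{22}$, which may depend on $w_2$ and on all of phase 1's $y$, in phase 2. $T_1$ receives $y_{11}$, $y_{12}$ and $T_2$ receives $y_{21}$, $y_{22}$ in the two phases. A pair of non-negative rates $(R_1,R_2)$ is achieved by a class of codes at phase fraction $\tau$ if for every $\epsilon>0$ and all sufficiently large $n$ there is a code of the class of length $n$ with at least $2^{nR_1}$ and $2^{nR_2}$ messages whose average probability that $T_1$ or $T_2$ errs is at most $\epsilon$. **Half-duplex HK-PDF-binning scheme.** Fix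 finite alphabets of auxiliary variables $U_{11},U_{21},U_{22}$ and $$P_4=p(x_{11})\,p(u_{11})\,p(x_{12}|u_{11},x_{11})\,p(u_{21})\,p(u_{22}|u_{21},x_{11})\,p(x_{22}|x_{11},u_{21},u_{22})\,p(y_{11},y_{21},y|x_{11})\,p(y_{12},y_{22}|x_{12},x_{22}).$$ Split $w_1=(w_{10},w_{11},w_{12})$, $w_2=(w_{21},w_{22})$ and use codewords $x_{11}(w_{10})$ (over both phases) and, in the second phase, $u_{11}(w_{11})$, $x_{12}(w_{12}|w_{10},w_{11})$, $u_{21}(w_{21})$, $u_{22}(w_{22},v_{22}|w_{21})$, $x_{22}(w_{10},w_{21},w_{22},v_{22})$. In phase 1, $S_1$ sends the first part of $x_{11}(w_{10})$; in phase 2 it sends $x_{12}(w_{12}|w_{10},w_{11})$. After phase 1, $S_2$ decodes the unique $\hat w_{10}$ with $(x_{11}(\hat w_{10}),y)$ jointly typical; it then looks for some $v_{22}$ for which the second part of $x_{11}(\hat w_{10})$ is jointly typical with $u_{21}(w_{21})$ and $u_{22}(w_{22},v_{22}|w_{21})$ (conditional binning), and sends $x_{22}(\hat w_{10},w_{21},w_{22},v_{22})$.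 After phase 2, $T_1$ decodes the unique $(w_{10},w_{11},w_{12})$ such that for some $w_{21}$ the second part of $x_{11}(w_{10})$ is jointly typical with $u_{11}(w_{11})$, $x_{12}(w_{12}|w_{10},w_{11})$, $u_{21}(w_{21})$, $y_{12}$, and the first part of $x_{11}(w_{10})$ is jointly typical with $y_{11}$; $T_2$ decodes the unique $(w_{21},w_{22})$ such that $u_{11}(w_{11}),u_{21}(w_{21}),u_{22}(w_{22},v_{22}|w_{21}),y_{22}$ are jointly typical for some $(w_{11},v_{22})$. Time sharing between finitely many such codes is allowed. **Theorem.** With $\bar\tau=1-\tau$, let $\mathcal R(\tau,P_4)$ be the set of all $(R_1,R_2)$ with $R_1,R_2\ge0$ and $$\begin{aligned} R_1&\le\min\{I_2+I_5,\,I_6\}\\ R_2&\le I_{12}-I_1\\ R_1+R_2&\le\min\{I_2+I_7,\,I_8\}+I_{13}-I_1\\ R_1+R_2&\le\min\{I_2+I_3,\,I_4\}+I_{14}-I_1\\ R_1+R_2&\le\min\{I_2+I_9,\,I_{10}\}+I_{11}-I_1\\ 2R_1+R_2&\le\min\{I_2+I_3,\,I_4\}+\min\{I_2+I_9,\,I_{10}\}+I_{13}-I_1\\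 R_1+2R_2&\le\min\{I_2+I_7,\,I_8\}+I_{11}-I_1+I_{14}-I_1 \end{aligned}$$ where the mutual informations (in bits) are those of $P_4$ and $$\begin{aligned} I_1&=\bar\tau I(U_{22};X_{11}|U_{21}), & I_2&=\tau I(X_{11};Y),\\ I_3&=\bar\tau I(X_{12};Y_{12}|X_{11},U_{11},U_{21}), & I_4&=\tau I(X_{11};Y_{11})+\bar\tau I(X_{11},X_{12};Y_{12}|U_{11},U_{21}),\\ I_5&=\bar\tau I(U_{11},X_{12};Y_{12}|X_{11},U_{21}), & I_6&=\tau I(X_{11};Y_{11})+\bar\tau I(X_{11},U_{11},X_{12};Y_{12}|U_{21}),\\ I_7&=\bar\tau I(X_{12},U_{21};Y_{12}|X_{11},U_{11}), & I_8&=\tau I(X_{11};Y_{11})+\bar\tau I(X_{11},X_{12},U_{21};Y_{12}|U_{11}),\\ I_9&=\bar\tau I(U_{11},X_{12},U_{21};Y_{12}|X_{11}), & I_{10}&=\tau I(X_{11};Y_{11})+\bar\tau I(X_{11},U_{11},X_{12},U_{21};Y_{12}),\\ I_{11}&=\bar\tau I(U_{22};Y_{22}|U_{21},U_{11}), & I_{12}&=\bar\tau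 I(U_{21},U_{22};Y_{22}|U_{11}),\\ I_{13}&=\bar\tau I(U_{11},U_{22};Y_{22}|U_{21}), & I_{14}&=\bar\tau I(U_{11},U_{21},U_{22};Y_{22}). \end{aligned}$$ Then for every $\tau\in[0,1]$ the convex hull of $\bigcup_{P_4}\mathcal R(\tau,P_4)$ lies in the closure of the set of rate pairs that the half-duplex HK-PDF-binning scheme achieves at phase fraction $\tau$. Moreover the convex hull of $\bigcup_{\tau\in[0,1]}\bigcup_{P_4}\mathcal R(\tau,P_4)$ lies in the closure of the set of rate pairs that the scheme achieves at some phase fraction $\tau\in[0,1]$. -/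

import Mathlib

universe u

noncomputable section

/-! ### Entropy and mutual information on finite alphabets (in bits) -/

open Classical in
/-- The probability mass function of the random variable `f` when the outcome has mass
function `p`. -/
def pmfOf {Ω A : Type*} [Fintype Ω] (p : Ω → ℝ) (f : Ω → A) (a : A) : ℝ :=
  ∑ ω, if f ω = a then p ω else 0

/-- Shannon entropy `H(f)` in bits. -/
def shannonEntropy {Ω A : Type*} [Fintype Ω] [Fintype A] (p : Ω → ℝ) (f : Ω → A) : ℝ :=
  ∑ a, Real.negMulLog (pmfOf p f a) / Real.log 2

/-- Mutual information `I(f; g) = H(f) + H(g) - H(f, g)`. -/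
def mutualInfo {Ω A B : Type*} [Fintype Ω] [Fintype A] [Fintype B]
    (p : Ω → ℝ) (f : Ω → A) (g : Ω → B) : ℝ :=
  shannonEntropy p f + shannonEntropy p g - shannonEntropy p (fun ω => (f ω, g ω))

/-- Conditional mutual information
`I(f; g | h) = H(f | h) - H(f | g, h) = H(f, h) + H(g, h) - H(f, g, h) - H(h)`. -/
def condMutualInfo {Ω A B C : Type*} [Fintype Ω] [Fintype A] [Fintype B] [Fintype C]
    (p : Ω → ℝ) (f : Ω → A) (g : Ω → B) (h : Ω → C) : ℝ :=
  shannonEntropy p (fun ω => (f ω, h ω)) + shannonEntropy p (fun ω => (g ω, h ω))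
    - shannonEntropy p (fun ω => (f ω, g ω, h ω)) - shannonEntropy p h


open Classical in
/-- The (strongly, letter-) `ε`-typical sequences of length `n` for the mass function `q`: the
number of occurrences of each letter `a` differs from `n q(a)` by at most `ε n q(a)`. -/
def IsTypical {A : Type*} (ε : ℝ) (q : A → ℝ) {n : ℕ} (x : Fin n → A) : Prop :=
  ∀ a, |((Finset.univ.filter fun i => x i = a).card : ℝ) - n * q a| ≤ ε * (n * q a)

/-! ### The channel and its codes -/

/-- A half-duplex discrete memoryless cognitive relay channel: finite alphabets and the transition
probabilities `p(y₁₁, y₂₁, y | x₁₁)` of the first and `p(y₁₂, y₂₂ | x₁₂, x₂₂)` of the second phase.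
The letter `Y` (without index) is what the second sender receives in the first phase. -/
structure HDChannel where
  (X₁₁ X₁₂ X₂₂ Y₁₁ Y₂₁ Y Y₁₂ Y₂₂ : Type u)
  [finX₁₁ : Fintype X₁₁] [finX₁₂ : Fintype X₁₂] [finX₂₂ : Fintype X₂₂]
  [finY₁₁ : Fintype Y₁₁] [finY₂₁ : Fintype Y₂₁] [finY : Fintype Y]
  [finY₁₂ : Fintype Y₁₂] [finY₂₂ : Fintype Y₂₂]
  phase1 : X₁₁ → stdSimplex ℝ (Y₁₁ × Y₂₁ × Y)
  phase2 : X₁₂ → X₂₂ → stdSimplex ℝ (Y₁₂ × Y₂₂)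

attribute [instance] HDChannel.finX₁₁ HDChannel.finX₁₂ HDChannel.finX₂₂ HDChannel.finY₁₁
  HDChannel.finY₂₁ HDChannel.finY HDChannel.finY₁₂ HDChannel.finY₂₂

/-- A code for the half-duplex channel, with `k` channel uses in the first and `m` channel uses in
the second phase. The second sender is silent in the first phase and knows its own message and what
it received in the first phase. -/
structure HDCode (W : HDChannel.{u}) where
  (k m : ℕ)
  (M₁ M₂ : Type)
  [finM₁ : Fintype M₁] [finM₂ : Fintype M₂] [neM₁ : Nonempty M₁] [neM₂ : Nonempty M₂]
  enc₁₁ : M₁ → Fin k → W.X₁₁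
  enc₁₂ : M₁ → Fin m → W.X₁₂
  enc₂₂ : M₂ → (Fin k → W.Y) → Fin m → W.X₂₂
  dec₁ : (Fin k → W.Y₁₁) → (Fin m → W.Y₁₂) → M₁
  dec₂ : (Fin k → W.Y₂₁) → (Fin m → W.Y₂₂) → M₂

attribute [instance] HDCode.finM₁ HDCode.finM₂ HDCode.neM₁ HDCode.neM₂

namespace HDCode

variable {W : HDChannel.{u}}

open Classical in
/-- The probability that one of the destinations errs when `(w₁, w₂)` is sent. -/
def errorProbAt (c : HDCode W) (w₁ : c.M₁) (w₂ : c.M₂) : ℝ :=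
  ∑ y : Fin c.k → W.Y₁₁ × W.Y₂₁ × W.Y, ∑ z : Fin c.m → W.Y₁₂ × W.Y₂₂,
    (∏ i, W.phase1 (c.enc₁₁ w₁ i) (y i)) *
    (∏ j, W.phase2 (c.enc₁₂ w₁ j) (c.enc₂₂ w₂ (fun i => (y i).2.2) j) (z j)) *
    if c.dec₁ (fun i => (y i).1) (fun j => (z j).1) = w₁ ∧
        c.dec₂ (fun i => (y i).2.1) (fun j => (z j).2) = w₂ then 0 else 1

/-- The average error probability, for independent uniformly distributed messages. -/
def errorProb (c : HDCode W) : ℝ :=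
  (∑ w₁, ∑ w₂, c.errorProbAt w₁ w₂) / (Fintype.card c.M₁ * Fintype.card c.M₂)

/-- Time sharing: finitely many codes used one after the other, first the first phases of all of
them and then the second phases of all of them. -/
def timeShare {L : ℕ} (c : Fin L → HDCode W) : HDCode W where
  k := ∑ l, (c l).k
  m := ∑ l, (c l).m
  M₁ := ∀ l, (c l).M₁
  M₂ := ∀ l, (c l).M₂
  enc₁₁ w i := (c (finSigmaFinEquiv.symm i).1).enc₁₁ (w _) (finSigmaFinEquiv.symm i).2
  enc₁₂ w j := (c (finSigmaFinEquiv.symm j).1).enc₁₂ (w _) (finSigmaFinEquiv.symm j).2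
  enc₂₂ w y j := (c (finSigmaFinEquiv.symm j).1).enc₂₂ (w _)
    (fun i => y (finSigmaFinEquiv ⟨_, i⟩)) (finSigmaFinEquiv.symm j).2
  dec₁ y z l := (c l).dec₁ (fun i => y (finSigmaFinEquiv ⟨l, i⟩))
    (fun j => z (finSigmaFinEquiv ⟨l, j⟩))
  dec₂ y z l := (c l).dec₂ (fun i => y (finSigmaFinEquiv ⟨l, i⟩))
    (fun j => z (finSigmaFinEquiv ⟨l, j⟩))

end HDCode

/-- The rate pairs that are achievable by codes of the class `𝒞` which spend the fraction `τ` of the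
block on the first phase. For `𝒞 = Set.univ` these are all achievable rate pairs. -/
def achievableRates (W : HDChannel.{u}) (𝒞 : Set (HDCode W)) (τ : ℝ) : Set (ℝ × ℝ) :=
  {R | 0 ≤ R.1 ∧ 0 ≤ R.2 ∧ ∀ ε > 0, ∃ N : ℕ, ∀ n ≥ N, ∃ c ∈ 𝒞,
    c.k = ⌊τ * n⌋₊ ∧ c.k + c.m = n ∧
    (2 : ℝ) ^ (n * R.1) ≤ Fintype.card c.M₁ ∧ (2 : ℝ) ^ (n * R.2) ≤ Fintype.card c.M₂ ∧
    c.errorProb ≤ ε}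

/-! ### Input distributions and the rate region -/

/-- Auxiliary finite alphabets and an input distribution of the form
`p(x₁₁) p(u₁₁) p(x₁₂ | u₁₁, x₁₁) p(u₂₁) p(u₂₂ | u₂₁, x₁₁) p(x₂₂ | x₁₁, u₂₁, u₂₂)`. -/
structure HKInput (W : HDChannel.{u}) where
  (U₁₁ U₂₁ U₂₂ : Type)
  [finU₁₁ : Fintype U₁₁] [finU₂₁ : Fintype U₂₁] [finU₂₂ : Fintype U₂₂]
  pX₁₁ : stdSimplex ℝ W.X₁₁
  pU₁₁ : stdSimplex ℝ U₁₁
  pX₁₂ : U₁₁ → W.X₁₁ → stdSimplex ℝ W.X₁₂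
  pU₂₁ : stdSimplex ℝ U₂₁
  pU₂₂ : U₂₁ → W.X₁₁ → stdSimplex ℝ U₂₂
  pX₂₂ : W.X₁₁ → U₂₁ → U₂₂ → stdSimplex ℝ W.X₂₂

attribute [instance] HKInput.finU₁₁ HKInput.finU₂₁ HKInput.finU₂₂

namespace HKInput

variable {W : HDChannel.{u}} (P : HKInput W)

/-- Values of `(x₁₁, u₁₁, x₁₂, u₂₁, u₂₂, x₂₂, (y₁₁, y₂₁, y), (y₁₂, y₂₂))`. -/
abbrev Outcome : Type u :=
  W.X₁₁ × P.U₁₁ × W.X₁₂ × P.U₂₁ × P.U₂₂ × W.X₂₂ × (W.Y₁₁ × W.Y₂₁ × W.Y) × (W.Y₁₂ × W.Y₂₂)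

/-- The joint distribution of the inputs, the auxiliary variables and the outputs. -/
def joint : P.Outcome → ℝ := fun (x₁₁, u₁₁, x₁₂, u₂₁, u₂₂, x₂₂, y, z) =>
  P.pX₁₁ x₁₁ * P.pU₁₁ u₁₁ * P.pX₁₂ u₁₁ x₁₁ x₁₂ * P.pU₂₁ u₂₁ * P.pU₂₂ u₂₁ x₁₁ u₂₂ *
    P.pX₂₂ x₁₁ u₂₁ u₂₂ x₂₂ * W.phase1 x₁₁ y * W.phase2 x₁₂ x₂₂ z

/-- The random variable `X₁₁`. -/
def rX₁₁ (ω : P.Outcome) : W.X₁₁ := ω.1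
/-- The random variable `U₁₁`. -/
def rU₁₁ (ω : P.Outcome) : P.U₁₁ := ω.2.1
/-- The random variable `X₁₂`. -/
def rX₁₂ (ω : P.Outcome) : W.X₁₂ := ω.2.2.1
/-- The random variable `U₂₁`. -/
def rU₂₁ (ω : P.Outcome) : P.U₂₁ := ω.2.2.2.1
/-- The random variable `U₂₂`. -/
def rU₂₂ (ω : P.Outcome) : P.U₂₂ := ω.2.2.2.2.1
/-- The random variable `Y₁₁`. -/
def rY₁₁ (ω : P.Outcome) : W.Y₁₁ := ω.2.2.2.2.2.2.1.1
/-- The random variable `Y`. -/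
def rY (ω : P.Outcome) : W.Y := ω.2.2.2.2.2.2.1.2.2
/-- The random variable `Y₁₂`. -/
def rY₁₂ (ω : P.Outcome) : W.Y₁₂ := ω.2.2.2.2.2.2.2.1
/-- The random variable `Y₂₂`. -/
def rY₂₂ (ω : P.Outcome) : W.Y₂₂ := ω.2.2.2.2.2.2.2.2

/-- `(1 - τ) I(U₂₂; X₁₁ | U₂₁)`. -/
def I₁ (τ : ℝ) : ℝ := (1 - τ) * condMutualInfo P.joint P.rU₂₂ P.rX₁₁ P.rU₂₁

/-- `τ I(X₁₁; Y)`. -/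
def I₂ (τ : ℝ) : ℝ := τ * mutualInfo P.joint P.rX₁₁ P.rY

/-- `(1 - τ) I(X₁₂; Y₁₂ | X₁₁, U₁₁, U₂₁)`. -/
def I₃ (τ : ℝ) : ℝ := (1 - τ) * condMutualInfo P.joint P.rX₁₂ P.rY₁₂
  fun ω => (P.rX₁₁ ω, P.rU₁₁ ω, P.rU₂₁ ω)

/-- `τ I(X₁₁; Y₁₁) + (1 - τ) I(X₁₁, X₁₂; Y₁₂ | U₁₁, U₂₁)`. -/
def I₄ (τ : ℝ) : ℝ := τ * mutualInfo P.joint P.rX₁₁ P.rY₁₁ +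
  (1 - τ) * condMutualInfo P.joint (fun ω => (P.rX₁₁ ω, P.rX₁₂ ω)) P.rY₁₂
    fun ω => (P.rU₁₁ ω, P.rU₂₁ ω)

/-- `(1 - τ) I(U₁₁, X₁₂; Y₁₂ | X₁₁, U₂₁)`. -/
def I₅ (τ : ℝ) : ℝ := (1 - τ) * condMutualInfo P.joint (fun ω => (P.rU₁₁ ω, P.rX₁₂ ω)) P.rY₁₂
  fun ω => (P.rX₁₁ ω, P.rU₂₁ ω)

/-- `τ I(X₁₁; Y₁₁) + (1 - τ) I(X₁₁, U₁₁, X₁₂; Y₁₂ | U₂₁)`. -/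
def I₆ (τ : ℝ) : ℝ := τ * mutualInfo P.joint P.rX₁₁ P.rY₁₁ +
  (1 - τ) * condMutualInfo P.joint (fun ω => (P.rX₁₁ ω, P.rU₁₁ ω, P.rX₁₂ ω)) P.rY₁₂ P.rU₂₁

/-- `(1 - τ) I(X₁₂, U₂₁; Y₁₂ | X₁₁, U₁₁)`. -/
def I₇ (τ : ℝ) : ℝ := (1 - τ) * condMutualInfo P.joint (fun ω => (P.rX₁₂ ω, P.rU₂₁ ω)) P.rY₁₂
  fun ω => (P.rX₁₁ ω, P.rU₁₁ ω)

/-- `τ I(X₁₁; Y₁₁) + (1 - τ) I(X₁₁, X₁₂, U₂₁; Y₁₂ | U₁₁)`. -/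
def I₈ (τ : ℝ) : ℝ := τ * mutualInfo P.joint P.rX₁₁ P.rY₁₁ +
  (1 - τ) * condMutualInfo P.joint (fun ω => (P.rX₁₁ ω, P.rX₁₂ ω, P.rU₂₁ ω)) P.rY₁₂ P.rU₁₁

/-- `(1 - τ) I(U₁₁, X₁₂, U₂₁; Y₁₂ | X₁₁)`. -/
def I₉ (τ : ℝ) : ℝ := (1 - τ) * condMutualInfo P.joint
  (fun ω => (P.rU₁₁ ω, P.rX₁₂ ω, P.rU₂₁ ω)) P.rY₁₂ P.rX₁₁

/-- `τ I(X₁₁; Y₁₁) + (1 - τ) I(X₁₁, U₁₁, X₁₂, U₂₁; Y₁₂)`. -/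
def I₁₀ (τ : ℝ) : ℝ := τ * mutualInfo P.joint P.rX₁₁ P.rY₁₁ +
  (1 - τ) * mutualInfo P.joint (fun ω => (P.rX₁₁ ω, P.rU₁₁ ω, P.rX₁₂ ω, P.rU₂₁ ω)) P.rY₁₂

/-- `(1 - τ) I(U₂₂; Y₂₂ | U₂₁, U₁₁)`. -/
def I₁₁ (τ : ℝ) : ℝ := (1 - τ) * condMutualInfo P.joint P.rU₂₂ P.rY₂₂
  fun ω => (P.rU₂₁ ω, P.rU₁₁ ω)

/-- `(1 - τ) I(U₂₁, U₂₂; Y₂₂ | U₁₁)`. -/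
def I₁₂ (τ : ℝ) : ℝ := (1 - τ) * condMutualInfo P.joint (fun ω => (P.rU₂₁ ω, P.rU₂₂ ω)) P.rY₂₂
  P.rU₁₁

/-- `(1 - τ) I(U₁₁, U₂₂; Y₂₂ | U₂₁)`. -/
def I₁₃ (τ : ℝ) : ℝ := (1 - τ) * condMutualInfo P.joint (fun ω => (P.rU₁₁ ω, P.rU₂₂ ω)) P.rY₂₂
  P.rU₂₁

/-- `(1 - τ) I(U₁₁, U₂₁, U₂₂; Y₂₂)`. -/
def I₁₄ (τ : ℝ) : ℝ := (1 - τ) * mutualInfo P.joint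
  (fun ω => (P.rU₁₁ ω, P.rU₂₁ ω, P.rU₂₂ ω)) P.rY₂₂

/-- The rate pairs `(R₁, R₂)` that satisfy the seven inequalities for the distribution `P` and the
phase fraction `τ`. -/
def rateRegion (τ : ℝ) : Set (ℝ × ℝ) :=
  {R | 0 ≤ R.1 ∧ 0 ≤ R.2 ∧
    R.1 ≤ min (P.I₂ τ + P.I₅ τ) (P.I₆ τ) ∧
    R.2 ≤ P.I₁₂ τ - P.I₁ τ ∧
    R.1 + R.2 ≤ min (P.I₂ τ + P.I₇ τ) (P.I₈ τ) + P.I₁₃ τ - P.I₁ τ ∧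
    R.1 + R.2 ≤ min (P.I₂ τ + P.I₃ τ) (P.I₄ τ) + P.I₁₄ τ - P.I₁ τ ∧
    R.1 + R.2 ≤ min (P.I₂ τ + P.I₉ τ) (P.I₁₀ τ) + P.I₁₁ τ - P.I₁ τ ∧
    2 * R.1 + R.2 ≤ min (P.I₂ τ + P.I₃ τ) (P.I₄ τ) + min (P.I₂ τ + P.I₉ τ) (P.I₁₀ τ)
      + P.I₁₃ τ - P.I₁ τ ∧
    R.1 + 2 * R.2 ≤ min (P.I₂ τ + P.I₇ τ) (P.I₈ τ) + P.I₁₁ τ - P.I₁ τ + P.I₁₄ τ - P.I₁ τ}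

end HKInput

/-! ### The Han-Kobayashi partial decode-forward binning scheme -/

open Classical in
/-- The unique element with the property `S`; the default `d` if there is none or more than one. -/
def uniqueOr {A : Type*} (d : A) (S : A → Prop) : A := if h : ∃! a, S a then h.choose else d

open Classical in
/-- Some element with the property `S`; the default `d` if there is none. -/
def someOr {A : Type*} (d : A) (S : A → Prop) : A := if h : ∃ a, S a then h.choose else d

/-- The data of a Han-Kobayashi partial decode-forward binning code: a distribution, the lengths of
the phases, the sizes of the sets of message parts `w₁₀, w₁₁, w₁₂, w₂₁, w₂₂` and of the set of
binning indices `v₂₂`, the tolerances of the typicality tests in binning and in decoding, and the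
codebooks. The codeword `x₁₁(w₁₀)` has a first part `x₁₁`, sent in the first phase, and a second
part `x₁₁'`, on which the second phase is superimposed and against which it is binned. -/
structure HKScheme (W : HDChannel.{u}) where
  P : HKInput W
  (k m : ℕ)
  (n₁₀ n₁₁ n₁₂ n₂₁ n₂₂ nᵥ : ℕ)
  [ne₁₀ : NeZero n₁₀] [ne₁₁ : NeZero n₁₁] [ne₁₂ : NeZero n₁₂] [ne₂₁ : NeZero n₂₁]
  [ne₂₂ : NeZero n₂₂] [neᵥ : NeZero nᵥ]
  (εbin εdec : ℝ)
  εbin_pos : 0 < εbin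
  εdec_pos : 0 < εdec
  x₁₁ : Fin n₁₀ → Fin k → W.X₁₁
  x₁₁' : Fin n₁₀ → Fin m → W.X₁₁
  u₁₁ : Fin n₁₁ → Fin m → P.U₁₁
  x₁₂ : Fin n₁₀ → Fin n₁₁ → Fin n₁₂ → Fin m → W.X₁₂
  u₂₁ : Fin n₂₁ → Fin m → P.U₂₁
  u₂₂ : Fin n₂₁ → Fin n₂₂ → Fin nᵥ → Fin m → P.U₂₂
  x₂₂ : Fin n₁₀ → Fin n₂₁ → Fin n₂₂ → Fin nᵥ → Fin m → W.X₂₂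

attribute [instance] HKScheme.ne₁₀ HKScheme.ne₁₁ HKScheme.ne₁₂ HKScheme.ne₂₁ HKScheme.ne₂₂
  HKScheme.neᵥ

namespace HKScheme

variable {W : HDChannel.{u}} (s : HKScheme W)

/-- At the end of the first phase the second sender looks for the unique `w₁₀` whose codeword is
jointly typical with what it received. -/
def relayDecode (y : Fin s.k → W.Y) : Fin s.n₁₀ :=
  uniqueOr 0 fun w₁₀ => IsTypical s.εdec
    (pmfOf s.P.joint fun ω => (s.P.rX₁₁ ω, s.P.rY ω))
    (fun i => (s.x₁₁ w₁₀ i, y i))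

/-- Conditional binning: the second sender looks for some `v₂₂` such that the codeword of `w₂₂` with
index `v₂₂` is jointly typical with the codewords of `w₁₀` and `w₂₁`. -/
def binIndex (w₁₀ : Fin s.n₁₀) (w₂₁ : Fin s.n₂₁) (w₂₂ : Fin s.n₂₂) : Fin s.nᵥ :=
  someOr 0 fun v => IsTypical s.εbin
    (pmfOf s.P.joint fun ω => (s.P.rX₁₁ ω, s.P.rU₂₁ ω, s.P.rU₂₂ ω))
    (fun j => (s.x₁₁' w₁₀ j, s.u₂₁ w₂₁ j, s.u₂₂ w₂₁ w₂₂ v j))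

/-- The first destination looks, jointly over both phases, for the unique `(w₁₀, w₁₁, w₁₂)` that is
jointly typical with the received signals for some `w₂₁`. -/
def decode₁ (y : Fin s.k → W.Y₁₁) (z : Fin s.m → W.Y₁₂) :
    Fin s.n₁₀ × Fin s.n₁₁ × Fin s.n₁₂ :=
  uniqueOr (0, 0, 0) fun (w₁₀, w₁₁, w₁₂) => ∃ w₂₁,
    IsTypical s.εdec
      (pmfOf s.P.joint fun ω =>
        (s.P.rX₁₁ ω, s.P.rU₁₁ ω, s.P.rX₁₂ ω, s.P.rU₂₁ ω, s.P.rY₁₂ ω))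
      (fun j => (s.x₁₁' w₁₀ j, s.u₁₁ w₁₁ j, s.x₁₂ w₁₀ w₁₁ w₁₂ j, s.u₂₁ w₂₁ j, z j)) ∧
    IsTypical s.εdec
      (pmfOf s.P.joint fun ω => (s.P.rX₁₁ ω, s.P.rY₁₁ ω))
      (fun i => (s.x₁₁ w₁₀ i, y i))

/-- The second destination looks for the unique `(w₂₁, w₂₂)` that is, for some `(w₁₁, v₂₂)`, jointly
typical with the signal received in the second phase. -/
def decode₂ (z : Fin s.m → W.Y₂₂) : Fin s.n₂₁ × Fin s.n₂₂ :=
  uniqueOr (0, 0) fun (w₂₁, w₂₂) => ∃ w₁₁ v, IsTypical s.εdec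
    (pmfOf s.P.joint fun ω => (s.P.rU₁₁ ω, s.P.rU₂₁ ω, s.P.rU₂₂ ω, s.P.rY₂₂ ω))
    (fun j => (s.u₁₁ w₁₁ j, s.u₂₁ w₂₁ j, s.u₂₂ w₂₁ w₂₂ v j, z j))

/-- The half-duplex code that the scheme uses. -/
def toCode : HDCode W where
  k := s.k
  m := s.m
  M₁ := Fin s.n₁₀ × Fin s.n₁₁ × Fin s.n₁₂
  M₂ := Fin s.n₂₁ × Fin s.n₂₂
  enc₁₁ w := s.x₁₁ w.1
  enc₁₂ w := s.x₁₂ w.1 w.2.1 w.2.2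
  enc₂₂ w y := s.x₂₂ (s.relayDecode y) w.1 w.2 (s.binIndex (s.relayDecode y) w.1 w.2)
  dec₁ y z := s.decode₁ y z
  dec₂ _ z := s.decode₂ z

end HKScheme

/-- The codes that arise by time sharing between finitely many Han-Kobayashi partial decode-forward
binning codes. -/
def hkBinningCodes (W : HDChannel.{u}) : Set (HDCode W) :=
  {c | ∃ (L : ℕ) (s : Fin L → HKScheme W), c = HDCode.timeShare fun l => (s l).toCode}

end

noncomputable section

open Filter Topology

/-! ### Finite expectations -/

/-! The proof consists of random coding, an elimination of the rates of the message parts, and time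
sharing.

Random coding. For a fixed input distribution all codebooks are drawn at random. A superimposed
codeword is read off from a sequence of independent letter tables at the codewords below it, so the
codebooks have a product law and any coordinate may be redrawn independently. The wrong codewords of
a candidate can be redrawn without changing the law of the channel outputs
(`Resamples.expect_law_le`, `Resamples.expect_mul_law_le`). By `packing`, fresh codewords look
typical together with fixed correct codewords and a fixed output with probability about `2 ^ (-m
I)`, where `I` is the mutual information for that pattern of right and wrong codewords. Conditional
binning succeeds once there are slightly more than `2 ^ (m I(U₂₂; X₁₁ | U₂₁))` indices (`covering`,
`expect_not_typBin_le`), and after a successful binning the true codewords and outputs are typical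
by `conditional_typicality`. Averaging over codebooks gives `exists_scheme_errorProb_le`. The bound
tends to zero when the rates of the parts lie slightly inside the linear constraints `Admissible`
(`Admissible.exists_scheme`).

Elimination. A split of `(R₁, R₂)` for the given distribution needs three conditions besides the
seven inequalities: `I₁₁ ≥ I₁`, then `R₁ ≤ min {I₂ + I₃, I₄} + I₁₃ - I₁`, and `R₂ ≤ I₁₁ - I₁ + I₇`.
If they hold, an explicit split exists (`splittable_of_mem_rateRegion`). If one fails, its reversal,
subtracted from the sum inequalities, places the point in the region of a simpler distribution:
without `U₂₂`, without `U₁₁` and `U₂₂`, or with `U₂₁` merged into `U₂₂`. Hence every point of a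
region can be split for some distribution (`splittable`).

Convex hull. The constraints are homogeneous in the phase lengths and the rates, so a convex
combination is realised by giving each code its share of the block in both phases
(`mem_achievableRates_of_splittable`). By the union bound, finitely many small error probabilities
add up to a small one. -/

open Classical in
/-- The indicator of a proposition. -/
def ind (p : Prop) : ℝ := if p then 1 else 0

theorem ind_of {p : Prop} (h : p) : ind p = 1 := by simp [ind, h]

theorem ind_of_not {p : Prop} (h : ¬ p) : ind p = 0 := by simp [ind, h]

theorem ind_nonneg (p : Prop) : 0 ≤ ind p := by unfold ind; split_ifs <;> simp

theorem ind_le_one (p : Prop) : ind p ≤ 1 := by unfold ind; split_ifs <;> simp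

theorem ind_mono {p q : Prop} (h : p → q) : ind p ≤ ind q := by
  by_cases hp : p
  · rw [ind_of hp, ind_of (h hp)]
  · rw [ind_of_not hp]; exact ind_nonneg q

theorem ind_and (p q : Prop) : ind (p ∧ q) = ind p * ind q := by
  by_cases hp : p <;> by_cases hq : q <;> simp [ind, hp, hq]

theorem ind_not (p : Prop) : ind (¬ p) = 1 - ind p := by
  by_cases hp : p <;> simp [ind, hp]

theorem ind_or_le (p q : Prop) : ind (p ∨ q) ≤ ind p + ind q := by
  by_cases hp : p <;> by_cases hq : q <;> simp [ind, hp, hq]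

theorem ind_le_add {p q r : Prop} (h : p → q ∨ r) : ind p ≤ ind q + ind r :=
  (ind_mono h).trans (ind_or_le q r)

theorem ind_exists_le {A : Type*} [Fintype A] (p : A → Prop) :
    ind (∃ a, p a) ≤ ∑ a, ind (p a) := by
  by_cases h : ∃ a, p a
  · obtain ⟨a, ha⟩ := h
    rw [ind_of ⟨a, ha⟩, ← ind_of ha]
    exact Finset.single_le_sum (f := fun a => ind (p a)) (fun i _ => ind_nonneg _)
      (Finset.mem_univ a)
  · rw [ind_of_not h]
    exact Finset.sum_nonneg fun i _ => ind_nonneg _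

section Expect

variable {A B ι Ω : Type*} [Fintype A] [Fintype B] [Fintype Ω]

/-- The expectation of `f` with respect to the weights `p`. -/
def expect {A : Type*} [Fintype A] (p f : A → ℝ) : ℝ := ∑ a, p a * f a

theorem expect_mono {p f g : A → ℝ} (hp : ∀ a, 0 ≤ p a) (h : ∀ a, f a ≤ g a) :
    expect p f ≤ expect p g :=
  Finset.sum_le_sum fun a _ => mul_le_mul_of_nonneg_left (h a) (hp a)

theorem expect_nonneg {p f : A → ℝ} (hp : ∀ a, 0 ≤ p a) (h : ∀ a, 0 ≤ f a) :
    0 ≤ expect p f :=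
  Finset.sum_nonneg fun a _ => mul_nonneg (hp a) (h a)

theorem expect_const {p : A → ℝ} (hp : p ∈ stdSimplex ℝ A) (c : ℝ) :
    expect p (fun _ => c) = c := by
  unfold expect
  rw [← Finset.sum_mul, hp.2, one_mul]

theorem expect_le_of_le {p f : A → ℝ} (hp : p ∈ stdSimplex ℝ A) {c : ℝ} (h : ∀ a, f a ≤ c) :
    expect p f ≤ c :=
  (expect_mono hp.1 h).trans_eq (expect_const hp c)

/-- This is the random coding step: a bound on the average over codebooks is met by some codebook.
If every value exceeded `c`, a point of positive weight would push the average strictly above `c`.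
-/
theorem exists_le_of_expect_le {p f : A → ℝ} (hp : p ∈ stdSimplex ℝ A) {c : ℝ}
    (h : expect p f ≤ c) : ∃ a, f a ≤ c := by
  by_contra! hc
  have h1 : ∃ a, 0 < p a := by
    by_contra! h0
    have := hp.2
    rw [Finset.sum_eq_zero fun a _ => le_antisymm (h0 a) (hp.1 a)] at this
    exact zero_ne_one this
  obtain ⟨a, ha⟩ := h1
  have : expect p (fun _ => c) < expect p f :=
    Finset.sum_lt_sum (fun b _ => mul_le_mul_of_nonneg_left (hc b).le (hp.1 b))
      ⟨a, Finset.mem_univ a, mul_lt_mul_of_pos_left (hc a) ha⟩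
  rw [expect_const hp] at this
  exact absurd h (not_le.2 this)

theorem expect_add (p f g : A → ℝ) :
    expect p (fun a => f a + g a) = expect p f + expect p g := by
  simp [expect, mul_add, Finset.sum_add_distrib]

theorem expect_sum {κ : Type*} (s : Finset κ) (p : A → ℝ) (f : κ → A → ℝ) :
    expect p (fun a => ∑ i ∈ s, f i a) = ∑ i ∈ s, expect p (f i) := by
  simp only [expect, Finset.mul_sum]
  exact Finset.sum_comm

theorem expect_mul_left (p f : A → ℝ) (c : ℝ) :
    expect p (fun a => c * f a) = c * expect p f := by
  simp only [expect, Finset.mul_sum]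
  exact Finset.sum_congr rfl fun a _ => by ring

theorem expect_mul_right (p f : A → ℝ) (c : ℝ) :
    expect p (fun a => f a * c) = expect p f * c := by
  simp only [expect, Finset.sum_mul]
  exact Finset.sum_congr rfl fun a _ => by ring

theorem expect_comm (p : A → ℝ) (q : B → ℝ) (f : A → B → ℝ) :
    expect p (fun a => expect q fun b => f a b) = expect q (fun b => expect p fun a => f a b) := by
  simp only [expect, Finset.mul_sum]
  rw [Finset.sum_comm]
  exact Finset.sum_congr rfl fun a _ => Finset.sum_congr rfl fun b _ => by ring

/-- The product of two weights. -/
def prodW {A B : Type*} (p : A → ℝ) (q : B → ℝ) (x : A × B) : ℝ := p x.1 * q x.2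

theorem expect_prodW (p : A → ℝ) (q : B → ℝ) (f : A × B → ℝ) :
    expect (prodW p q) f = expect p fun a => expect q fun b => f (a, b) := by
  simp only [expect, prodW, Fintype.sum_prod_type, Finset.mul_sum, mul_assoc]

/-- The product weight on tuples. -/
def prodWeight {ι A : Type*} [Fintype ι] (p : ι → A → ℝ) (C : ι → A) : ℝ := ∏ i, p i (C i)

variable [Fintype ι] [DecidableEq ι]

theorem expect_prodWeight_prod (p f : ι → A → ℝ) :
    expect (prodWeight p) (fun C => ∏ i, f i (C i)) = ∏ i, expect (p i) (f i) := by
  simp only [expect, prodWeight, ← Finset.prod_mul_distrib]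
  rw [Finset.prod_univ_sum, Fintype.piFinset_univ]

theorem prodWeight_mem {p : ι → A → ℝ} (hp : ∀ i, p i ∈ stdSimplex ℝ A) :
    prodWeight p ∈ stdSimplex ℝ (ι → A) := by
  refine ⟨fun C => Finset.prod_nonneg fun i _ => (hp i).1 _, ?_⟩
  have := expect_prodWeight_prod p (fun _ _ => 1)
  simpa [expect, (hp _).2] using this

/-- Replacing a part of a random object by an independent copy does not change its law. -/
def Resamples {R : Type*} [Fintype R] (μ : Ω → ℝ) (r : R → ℝ) (upd : Ω → R → Ω) : Prop :=
  ∀ f : Ω → ℝ, expect μ f = expect μ fun ω => expect r fun a => f (upd ω a)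

theorem resamples_self {μ : Ω → ℝ} (hμ : μ ∈ stdSimplex ℝ Ω) :
    Resamples μ μ (fun _ a => a) := fun _ => (expect_const hμ _).symm

/-- Fubini for one distinguished coordinate: the others are summed outside, so the inner average can
be replaced by any resampling of that coordinate. -/
theorem expect_prodWeight_split (p : ι → A → ℝ) (i : ι) (f : (ι → A) → ℝ) :
    expect (prodWeight p) f = ∑ C : {j // j ≠ i} → A, (∏ j : {j // j ≠ i}, p j (C j)) *
      expect (p i) fun a => f ((Equiv.funSplitAt i A).symm (a, C)) := by
  have : expect (prodWeight p) f = ∑ x : A × ({j // j ≠ i} → A),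
      p i x.1 * (∏ j : {j // j ≠ i}, p j (x.2 j)) * f ((Equiv.funSplitAt i A).symm x) := by
    refine Fintype.sum_equiv (Equiv.funSplitAt i A) _ _ fun C => ?_
    rw [Equiv.symm_apply_apply]
    congr 1
    unfold prodWeight
    rw [Fintype.prod_eq_mul_prod_compl i]
    congr 1
    exact Finset.prod_subtype (p := fun j => j ≠ i) ({i}ᶜ : Finset ι) (by simp)
      (fun j => p j (C j))
  rw [this, Fintype.sum_prod_type, Finset.sum_comm]
  refine Finset.sum_congr rfl fun C _ => ?_
  rw [expect, Finset.mul_sum]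
  exact Finset.sum_congr rfl fun a _ => by ring

/-- Resampling inside one coordinate lifts to the whole tuple. Nested use reaches a single index
inside a single bin. -/
theorem Resamples.pi {R : Type*} [Fintype R] {p : ι → A → ℝ} {i : ι} {r : R → ℝ}
    {upd : A → R → A} (h : Resamples (p i) r upd) :
    Resamples (prodWeight p) r (fun C b => Function.update C i (upd (C i) b)) := by
  intro f
  rw [expect_prodWeight_split p i, expect_prodWeight_split p i]
  refine Finset.sum_congr rfl fun C _ => ?_
  congr 1
  rw [h]
  refine Finset.sum_congr rfl fun a _ => ?_
  congr 1
  refine Finset.sum_congr rfl fun b _ => ?_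
  congr 1
  refine congrArg f (funext fun j => ?_)
  by_cases hj : j = i
  · subst hj; simp [Equiv.funSplitAt, Equiv.piSplitAt]
  · simp [Equiv.funSplitAt, Equiv.piSplitAt, hj]

theorem resamples_pi {p : ι → A → ℝ} (hp : ∀ i, p i ∈ stdSimplex ℝ A) (i : ι) :
    Resamples (prodWeight p) (p i) (fun C a => Function.update C i a) :=
  Resamples.pi (resamples_self (hp i))

/-! ### Images of weights -/

theorem pmfOf_eq_expect {C : Type*} (p : Ω → ℝ) (f : Ω → C) (a : C) :
    pmfOf p f a = expect p fun ω => ind (f ω = a) := by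
  unfold pmfOf expect ind
  exact Finset.sum_congr rfl fun ω _ => by split_ifs <;> simp_all

theorem expect_pmfOf (p : Ω → ℝ) (φ : Ω → A) (f : A → ℝ) :
    expect (pmfOf p φ) f = expect p fun ω => f (φ ω) := by
  classical
  simp only [expect, pmfOf, Finset.sum_mul]
  rw [Finset.sum_comm]
  refine Finset.sum_congr rfl fun ω _ => ?_
  rw [Finset.sum_eq_single (φ ω)] <;> simp +contextual [eq_comm]

theorem pmfOf_comp {C : Type*} (p : Ω → ℝ) (φ : Ω → A) (ψ : A → C) :
    pmfOf (pmfOf p φ) ψ = pmfOf p fun ω => ψ (φ ω) := by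
  ext c
  rw [pmfOf_eq_expect, pmfOf_eq_expect, expect_pmfOf]

theorem pmfOf_nonneg {C : Type*} {p : Ω → ℝ} (hp : ∀ ω, 0 ≤ p ω) (f : Ω → C) (a : C) :
    0 ≤ pmfOf p f a :=
  Finset.sum_nonneg fun ω _ => by split_ifs <;> simp [hp]

theorem le_pmfOf {C : Type*} {p : Ω → ℝ} (hp : ∀ ω, 0 ≤ p ω) (f : Ω → C) (ω : Ω) :
    p ω ≤ pmfOf p f (f ω) := by
  classical
  unfold pmfOf
  refine le_trans (by simp) (Finset.single_le_sum (f := fun ω' => if f ω' = f ω then p ω' else 0)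
    (fun ω _ => ?_) (Finset.mem_univ ω))
  split_ifs <;> simp [hp]

theorem pmfOf_mem {p : Ω → ℝ} (hp : p ∈ stdSimplex ℝ Ω) (f : Ω → A) :
    pmfOf p f ∈ stdSimplex ℝ A := by
  refine ⟨pmfOf_nonneg hp.1 f, ?_⟩
  have := expect_pmfOf p f (fun _ => 1)
  rw [expect_const hp] at this
  simpa [expect] using this

theorem pmfOf_of_injective {D C : Type*} (p : Ω → ℝ) (f : Ω → D) {e : D → C}
    (he : Function.Injective e) (a : D) : pmfOf p (fun ω => e (f ω)) (e a) = pmfOf p f a := by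
  simp only [pmfOf_eq_expect, he.eq_iff]

/-- Distributivity expands the product of fibre sums: coordinatewise images of independent letters
are again independent. -/
theorem expect_prodWeight_map (p : ι → A → ℝ) (φ : ι → A → B) (f : (ι → B) → ℝ) :
    expect (prodWeight p) (fun T => f fun j => φ j (T j)) =
      expect (prodWeight fun j => pmfOf (p j) (φ j)) f := by
  classical
  have h : ∀ b : ι → B, prodWeight (fun j => pmfOf (p j) (φ j)) b =
      ∑ a : ι → A, if (fun j => φ j (a j)) = b then prodWeight p a else 0 := by
    intro b
    unfold prodWeight pmfOf
    rw [Finset.prod_univ_sum, Fintype.piFinset_univ]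
    refine Finset.sum_congr rfl fun a _ => ?_
    split_ifs with hab
    · exact Finset.prod_congr rfl fun j _ => by simp [← hab]
    · obtain ⟨j, hj⟩ := Function.ne_iff.1 hab
      exact Finset.prod_eq_zero (Finset.mem_univ j) (by simp [hj])
  simp only [expect, h, Finset.sum_mul]
  rw [Finset.sum_comm]
  refine Finset.sum_congr rfl fun a _ => ?_
  rw [Finset.sum_eq_single (fun j => φ j (a j))] <;> simp +contextual [eq_comm]

theorem pmfOf_prodWeight_eval {κ : ι → A → ℝ} (hκ : ∀ c, κ c ∈ stdSimplex ℝ A) (c : ι) :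
    pmfOf (prodWeight κ) (fun t => t c) = κ c := by
  ext a
  rw [pmfOf_eq_expect, resamples_pi hκ c]
  simp only [Function.update_self]
  rw [expect_const (prodWeight_mem hκ)]
  classical
  simp [expect, ind]

/-- Evaluating a sequence of independent tables at a sequence of arguments gives a sequence of
independent letters. -/
theorem expect_table {m : ℕ} {κ : ι → A → ℝ} (hκ : ∀ c, κ c ∈ stdSimplex ℝ A) (c : Fin m → ι)
    (f : (Fin m → A) → ℝ) :
    expect (prodWeight fun _ : Fin m => prodWeight κ) (fun T => f fun j => T j (c j)) =
      expect (prodWeight fun j => κ (c j)) f := by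
  rw [expect_prodWeight_map (fun _ => prodWeight κ) (fun j t => t (c j)) f]
  simp only [pmfOf_prodWeight_eval hκ]

/-- Codewords generated in layers become one codeword over a product alphabet, the form in which
packing and conditional typicality apply. -/
theorem expect_prodWeight_pair (p : ι → A → ℝ) (q : ι → A → B → ℝ) (f : (ι → A × B) → ℝ) :
    expect (prodWeight p) (fun a => expect (prodWeight fun j => q j (a j)) fun b =>
      f fun j => (a j, b j)) =
    expect (prodWeight fun j (x : A × B) => p j x.1 * q j x.1 x.2) f := by
  simp only [expect, Finset.mul_sum]
  rw [← Fintype.sum_prod_type' (f := fun a b => prodWeight p a *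
    (prodWeight (fun j => q j (a j)) b * f fun j => (a j, b j)))]
  refine Fintype.sum_equiv (Equiv.arrowProdEquivProdArrow ι (fun _ => A) (fun _ => B)).symm _ _ fun x => ?_
  simp only [prodWeight, Finset.prod_mul_distrib, ← mul_assoc]
  rfl

end Expect

/-! ### Typical sequences -/

/-- The tolerance is relative, so the deviations over a fibre of `φ` add up to at most `ε` times the
expected count of the fibre. Projecting or permuting the coordinates of a joint test therefore costs
nothing in `ε`. -/
theorem IsTypical.map {A B : Type*} [Fintype A] {ε : ℝ} {q : A → ℝ} {n : ℕ} {x : Fin n → A}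
    (h : IsTypical ε q x) (φ : A → B) : IsTypical ε (pmfOf q φ) (fun i => φ (x i)) := by
  classical
  intro b
  have h1 : ((Finset.univ.filter fun i => φ (x i) = b).card : ℝ) =
      ∑ a, if φ a = b then ((Finset.univ.filter fun i => x i = a).card : ℝ) else 0 := by
    rw [← Finset.sum_filter]
    have := Finset.card_eq_sum_card_fiberwise (s := Finset.univ.filter fun i => φ (x i) = b)
      (t := Finset.univ.filter fun a => φ a = b) (f := x) (by intro i; simp)
    rw [this]
    push_cast
    refine Finset.sum_congr rfl fun a ha => ?_
    congr 2
    ext i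
    simp only [Finset.mem_filter, Finset.mem_univ, true_and] at ha ⊢
    constructor
    · rintro ⟨_, h⟩; exact h
    · rintro rfl; exact ⟨ha, rfl⟩
  have h2 : (n : ℝ) * pmfOf q φ b = ∑ a, if φ a = b then n * q a else 0 := by
    simp only [pmfOf, Finset.mul_sum, mul_ite, mul_zero]
  have h3 : ε * ((n : ℝ) * pmfOf q φ b) = ∑ a, if φ a = b then ε * (n * q a) else 0 := by
    rw [h2, Finset.mul_sum]
    simp only [mul_ite, mul_zero]
  convert_to |((Finset.univ.filter fun i => φ (x i) = b).card : ℝ) - n * pmfOf q φ b| ≤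
    ε * (n * pmfOf q φ b)
  rw [h3, h1, h2, ← Finset.sum_sub_distrib]
  refine (Finset.abs_sum_le_sum_abs _ _).trans (Finset.sum_le_sum fun a _ => ?_)
  split_ifs
  · exact h a
  · simp

/-- A phase can be empty, for instance at `τ = 0` or `τ = 1`; its tests then always succeed. -/
theorem isTypical_of_length_zero {A : Type*} {ε : ℝ} {q : A → ℝ} {x : Fin 0 → A} :
    IsTypical ε q x := fun a => by simp

end

noncomputable section

open Filter Topology

/-! ### Entropy -/

section Entropy

variable {Ω A B C D : Type*} [Fintype Ω] [Fintype A] [Fintype B] [Fintype C] [Fintype D]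

/-- In this form the entropy involves only the probabilities of the level sets of `f`, so
relabelling or permuting the values is immediate. -/
theorem shannonEntropy_eq_expect (p : Ω → ℝ) (f : Ω → A) :
    shannonEntropy p f = -expect p fun ω => Real.logb 2 (pmfOf p f (f ω)) := by
  rw [← expect_pmfOf p f (fun a => Real.logb 2 (pmfOf p f a)), expect, ← Finset.sum_neg_distrib]
  refine Finset.sum_congr rfl fun a _ => ?_
  simp only [Real.negMulLog, Real.logb]
  ring

theorem shannonEntropy_comp_injective (p : Ω → ℝ) (f : Ω → A) {e : A → B}
    (he : Function.Injective e) : shannonEntropy p (fun ω => e (f ω)) = shannonEntropy p f := by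
  simp only [shannonEntropy_eq_expect, pmfOf_of_injective p f he]

theorem shannonEntropy_congr_left (p : Ω → ℝ) {f : Ω → A} {g : Ω → B} (e : A → B)
    (he : Function.Injective e) (h : ∀ ω, g ω = e (f ω)) :
    shannonEntropy p g = shannonEntropy p f := by
  rw [← shannonEntropy_comp_injective p f he]
  congr 1
  exact funext h

theorem shannonEntropy_pmfOf (p : Ω → ℝ) (φ : Ω → A) (f : A → B) :
    shannonEntropy (pmfOf p φ) f = shannonEntropy p fun ω => f (φ ω) := by
  simp only [shannonEntropy, pmfOf_comp]

theorem condMutualInfo_pmfOf (p : Ω → ℝ) (φ : Ω → D) (f : D → A) (g : D → B) (h : D → C) :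
    condMutualInfo (pmfOf p φ) f g h =
      condMutualInfo p (fun ω => f (φ ω)) (fun ω => g (φ ω)) (fun ω => h (φ ω)) := by
  simp only [condMutualInfo, shannonEntropy_pmfOf]

theorem mutualInfo_pmfOf (p : Ω → ℝ) (φ : Ω → D) (f : D → A) (g : D → B) :
    mutualInfo (pmfOf p φ) f g =
      mutualInfo p (fun ω => f (φ ω)) (fun ω => g (φ ω)) := by
  simp only [mutualInfo, shannonEntropy_pmfOf]

theorem shannonEntropy_const {p : Ω → ℝ} (hp : p ∈ stdSimplex ℝ Ω) (a : A) :
    shannonEntropy p (fun _ => a) = 0 := by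
  rw [shannonEntropy_eq_expect, expect_const hp, pmfOf_eq_expect, expect_const hp, ind_of rfl]
  simp

theorem mutualInfo_eq_condMutualInfo {p : Ω → ℝ} (hp : p ∈ stdSimplex ℝ Ω) (f : Ω → A)
    (g : Ω → B) : mutualInfo p f g = condMutualInfo p f g (fun _ => ()) := by
  unfold mutualInfo condMutualInfo
  rw [shannonEntropy_const hp,
    shannonEntropy_congr_left p (fun a : A => (a, ())) (fun _ _ h => (Prod.mk.inj h).1)
      (fun ω => rfl : ∀ ω, (f ω, ()) = _),
    shannonEntropy_congr_left p (fun a : B => (a, ())) (fun _ _ h => (Prod.mk.inj h).1)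
      (fun ω => rfl : ∀ ω, (g ω, ()) = _),
    shannonEntropy_congr_left p (f := fun ω => (f ω, g ω)) (fun a : A × B => (a.1, a.2, ()))
      (fun x y h => by simpa [Prod.ext_iff] using h) (fun ω => rfl : ∀ ω, (f ω, g ω, ()) = _)]
  ring

theorem pmfOf_pos {E : Type*} {p : Ω → ℝ} (hp : ∀ ω, 0 ≤ p ω) (f : Ω → E) {ω : Ω} (h : 0 < p ω) :
    0 < pmfOf p f (f ω) := h.trans_le (le_pmfOf hp f ω)

/-- The information density of the conditional mutual information. -/
def infoDensity (p : Ω → ℝ) (f : Ω → A) (g : Ω → B) (h : Ω → C) (x : A × B × C) : ℝ :=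
  Real.logb 2 (pmfOf p (fun ω => (f ω, g ω, h ω)) x) + Real.logb 2 (pmfOf p h x.2.2)
    - Real.logb 2 (pmfOf p (fun ω => (f ω, h ω)) (x.1, x.2.2))
    - Real.logb 2 (pmfOf p (fun ω => (g ω, h ω)) x.2)

theorem condMutualInfo_eq_expect (p : Ω → ℝ) (f : Ω → A) (g : Ω → B) (h : Ω → C) :
    condMutualInfo p f g h =
      expect (pmfOf p fun ω => (f ω, g ω, h ω)) (infoDensity p f g h) := by
  rw [expect_pmfOf]
  simp only [condMutualInfo, shannonEntropy_eq_expect, infoDensity, expect, mul_sub, mul_add,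
    Finset.sum_sub_distrib, Finset.sum_add_distrib]
  ring

theorem sum_pmfOf_pair {E : Type*} (p : Ω → ℝ) (f : Ω → A) (h : Ω → E) (c : E) :
    ∑ a, pmfOf p (fun ω => (f ω, h ω)) (a, c) = pmfOf p h c := by
  simp only [pmfOf_eq_expect, Prod.mk.injEq, ind_and]
  rw [← expect_sum]
  congr 1
  ext ω
  rw [← Finset.sum_mul]
  classical
  have : ∑ a, ind (f ω = a) = 1 := by simp [ind]
  rw [this, one_mul]

/-- The density ratio `p(a|c) p(b|c) / p(a,b|c)` of a joint law. -/
def densityRatio (p : Ω → ℝ) (f : Ω → A) (g : Ω → B) (h : Ω → C) (x : A × B × C) : ℝ :=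
  pmfOf p (fun ω => (f ω, h ω)) (x.1, x.2.2) * pmfOf p (fun ω => (g ω, h ω)) x.2 /
    (pmfOf p (fun ω => (f ω, g ω, h ω)) x * pmfOf p h x.2.2)

/-- On the support the joint mass cancels, and the sum of `p(a,c) p(b,c) / p(c)` collapses to the
total mass of `h`. Only an inequality holds because the product law may charge triples outside the
support. -/
theorem expect_densityRatio_le {p : Ω → ℝ} (hp : p ∈ stdSimplex ℝ Ω) (f : Ω → A) (g : Ω → B)
    (h : Ω → C) :
    expect (pmfOf p fun ω => (f ω, g ω, h ω)) (densityRatio p f g h) ≤ 1 := by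
  calc expect (pmfOf p fun ω => (f ω, g ω, h ω)) (densityRatio p f g h)
      ≤ ∑ x : A × B × C, pmfOf p (fun ω => (f ω, h ω)) (x.1, x.2.2) *
          pmfOf p (fun ω => (g ω, h ω)) x.2 / pmfOf p h x.2.2 := by
        refine Finset.sum_le_sum fun x _ => ?_
        unfold densityRatio
        rcases (pmfOf_nonneg hp.1 (fun ω => (f ω, g ω, h ω)) x).eq_or_lt with h1 | h1
        · rw [← h1, zero_mul]
          exact div_nonneg (mul_nonneg (pmfOf_nonneg hp.1 _ _) (pmfOf_nonneg hp.1 _ _))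
            (pmfOf_nonneg hp.1 _ _)
        · apply le_of_eq
          rw [← mul_div_assoc, mul_div_mul_left _ _ h1.ne']
    _ = ∑ c, pmfOf p h c * pmfOf p h c / pmfOf p h c := by
        simp only [Fintype.sum_prod_type]
        calc _ = ∑ a, ∑ c, pmfOf p (fun ω => (f ω, h ω)) (a, c) * pmfOf p h c / pmfOf p h c := by
              refine Finset.sum_congr rfl fun a _ => ?_
              rw [Finset.sum_comm]
              refine Finset.sum_congr rfl fun c _ => ?_
              rw [← Finset.sum_div, ← Finset.mul_sum, sum_pmfOf_pair]
          _ = _ := by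
              rw [Finset.sum_comm]
              refine Finset.sum_congr rfl fun c _ => ?_
              rw [← Finset.sum_div, ← Finset.sum_mul, sum_pmfOf_pair]
    _ = 1 := by
        rw [← (pmfOf_mem hp h).2]
        exact Finset.sum_congr rfl fun c _ => mul_self_div_self _

/-- The logarithm of the ratio can be separated only where all marginals are positive; positivity of
the joint mass ensures this. -/
theorem rpow_infoDensity {p : Ω → ℝ} (hp : p ∈ stdSimplex ℝ Ω) (f : Ω → A) (g : Ω → B)
    (h : Ω → C) {x : A × B × C} (hx : 0 < pmfOf p (fun ω => (f ω, g ω, h ω)) x) :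
    0 < pmfOf p h x.2.2 ∧ 0 < pmfOf p (fun ω => (f ω, h ω)) (x.1, x.2.2) ∧
      0 < pmfOf p (fun ω => (g ω, h ω)) x.2 ∧
      infoDensity p f g h x = -Real.logb 2 (densityRatio p f g h x) := by
  have hq := pmfOf_mem hp (fun ω => (f ω, g ω, h ω))
  have h1 : 0 < pmfOf p h x.2.2 := by
    have := pmfOf_pos hq.1 (fun x => x.2.2) hx
    rwa [pmfOf_comp] at this
  have h2 : 0 < pmfOf p (fun ω => (f ω, h ω)) (x.1, x.2.2) := by
    have := pmfOf_pos hq.1 (fun x => (x.1, x.2.2)) hx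
    rwa [pmfOf_comp] at this
  have h3 : 0 < pmfOf p (fun ω => (g ω, h ω)) x.2 := by
    have := pmfOf_pos hq.1 (fun x => x.2) hx
    rwa [pmfOf_comp] at this
  refine ⟨h1, h2, h3, ?_⟩
  rw [densityRatio, infoDensity, Real.logb_div (mul_pos h2 h3).ne' (mul_pos hx h1).ne',
    Real.logb_mul h2.ne' h3.ne', Real.logb_mul hx.ne' h1.ne']
  ring

/-- Gibbs' inequality: `log t ≤ t - 1` at the density ratio, whose mean is at most one. -/
theorem condMutualInfo_nonneg {p : Ω → ℝ} (hp : p ∈ stdSimplex ℝ Ω) (f : Ω → A) (g : Ω → B)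
    (h : Ω → C) : 0 ≤ condMutualInfo p f g h := by
  have hq := pmfOf_mem hp (fun ω => (f ω, g ω, h ω))
  have hl : 0 < Real.log 2 := Real.log_pos (by norm_num)
  have key : expect (pmfOf p fun ω => (f ω, g ω, h ω))
      (fun x => (1 - densityRatio p f g h x) / Real.log 2) ≤ condMutualInfo p f g h := by
    rw [condMutualInfo_eq_expect]
    refine Finset.sum_le_sum fun x _ => ?_
    rcases (hq.1 x).eq_or_lt with h0 | h0
    · rw [← h0, zero_mul, zero_mul]
    · obtain ⟨h1, h2, h3, h4⟩ := rpow_infoDensity hp f g h h0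
      refine mul_le_mul_of_nonneg_left ?_ h0.le
      rw [h4, Real.logb, ← neg_div]
      refine div_le_div_of_nonneg_right ?_ hl.le
      have := Real.log_le_sub_one_of_pos
        (show 0 < densityRatio p f g h x from div_pos (mul_pos h2 h3) (mul_pos h0 h1))
      linarith
  refine le_trans ?_ key
  have : (fun x => (1 - densityRatio p f g h x) / Real.log 2) =
      fun x => (Real.log 2)⁻¹ * (1 + (-1) * densityRatio p f g h x) := by
    ext x; rw [div_eq_inv_mul]; ring
  rw [this, expect_mul_left, expect_add, expect_const hq, expect_mul_left]
  have := expect_densityRatio_le hp f g h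
  have := inv_pos.2 hl
  apply mul_nonneg this.le
  linarith

theorem mutualInfo_nonneg {p : Ω → ℝ} (hp : p ∈ stdSimplex ℝ Ω) (f : Ω → A) (g : Ω → B) :
    0 ≤ mutualInfo p f g := by
  rw [mutualInfo_eq_condMutualInfo hp]
  exact condMutualInfo_nonneg hp _ _ _

end Entropy

end

/-! ### Packing, conditional typicality and covering -/

noncomputable section

open Filter Topology

section Typicality

variable {Ω A B C D : Type*} [Fintype Ω] [Fintype A] [Fintype B] [Fintype C] [Fintype D]

/-- At a letter of mass zero the relative tolerance vanishes, which forces its count to be zero. -/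
theorem IsTypical.pos {A : Type*} {ε : ℝ} {q : A → ℝ} (hq : ∀ a, 0 ≤ q a) {n : ℕ} {x : Fin n → A}
    (h : IsTypical ε q x) (i : Fin n) : 0 < q (x i) := by
  classical
  refine (hq _).lt_of_ne fun h0 => ?_
  have h1 := h (x i)
  rw [← h0, mul_zero, mul_zero, sub_zero] at h1
  have h2 := abs_nonpos_iff.1 h1
  rw [Nat.cast_eq_zero, Finset.card_eq_zero] at h2
  exact Finset.eq_empty_iff_forall_notMem.1 h2 i (Finset.mem_filter.2 ⟨Finset.mem_univ i, rfl⟩)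

theorem card_eq_sum_ind {E : Type*} {n : ℕ} (x : Fin n → E) (a : E)
    [DecidablePred fun i => x i = a] :
    ((Finset.univ.filter fun i => x i = a).card : ℝ) = ∑ i, ind (x i = a) := by
  rw [Finset.card_filter]
  push_cast
  exact Finset.sum_congr rfl fun i _ => by unfold ind; split_ifs <;> rfl

theorem isTypical_iff {A : Type*} {ε : ℝ} {q : A → ℝ} {n : ℕ} {x : Fin n → A} :
    IsTypical ε q x ↔ ∀ a, |∑ i, ind (x i = a) - n * q a| ≤ ε * (n * q a) := by
  classical
  unfold IsTypical
  refine forall_congr' fun a => ?_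
  rw [card_eq_sum_ind]

/-- Averages along a typical sequence are close to expectations. -/
theorem IsTypical.abs_sum_sub_le {ε : ℝ} {q : A → ℝ} {n : ℕ} {x : Fin n → A}
    (h : IsTypical ε q x) (d : A → ℝ) :
    |∑ i, d (x i) - n * expect q d| ≤ ε * (n * expect q fun a => |d a|) := by
  classical
  have h1 : ∑ i, d (x i) = ∑ a, (∑ i, ind (x i = a)) * d a := by
    simp only [Finset.sum_mul]
    rw [Finset.sum_comm]
    exact Finset.sum_congr rfl fun i _ => by simp [ind]
  rw [h1, expect, expect, Finset.mul_sum, Finset.mul_sum, Finset.mul_sum, ← Finset.sum_sub_distrib]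
  refine (Finset.abs_sum_le_sum_abs _ _).trans (Finset.sum_le_sum fun a _ => ?_)
  rw [← mul_assoc, ← sub_mul, abs_mul, ← mul_assoc, ← mul_assoc]
  refine mul_le_mul_of_nonneg_right ?_ (abs_nonneg _)
  rw [mul_assoc]
  exact isTypical_iff.1 h a

section Packing

variable {p : Ω → ℝ} (hp : p ∈ stdSimplex ℝ Ω) (f : Ω → A) (g : Ω → B) (h : Ω → C)
  {r : C → A → ℝ}
  (hr : ∀ a c, r c a * pmfOf p h c = pmfOf p (fun ω => (f ω, h ω)) (a, c))

include hp hr in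
/-- On the support of the joint law, the conditional law of `f` given `h` is a change of measure of
the conditional law of `f` given `g` and `h`. -/
theorem eq_mul_rpow_infoDensity {x : A × B × C} (hx : 0 < pmfOf p (fun ω => (f ω, g ω, h ω)) x) :
    r x.2.2 x.1 = pmfOf p (fun ω => (f ω, g ω, h ω)) x / pmfOf p (fun ω => (g ω, h ω)) x.2 *
      (2 : ℝ) ^ (-infoDensity p f g h x) := by
  obtain ⟨h1, h2, h3, h4⟩ := rpow_infoDensity hp f g h hx
  have h5 := div_pos (mul_pos h2 h3) (mul_pos hx h1)
  rw [h4, neg_neg, densityRatio, Real.rpow_logb (by norm_num) (by norm_num) h5]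
  have := hr x.1 x.2.2
  rw [← this]
  field_simp

/-- Where `d` has no mass, division by zero makes the sum `0` instead of `1`. A subprobability is
enough for the upper bound in packing. -/
theorem sum_condLaw_le {E : Type*} (p : Ω → ℝ) (f : Ω → A) (k : Ω → E) (d : E) :
    ∑ a, pmfOf p (fun ω => (f ω, k ω)) (a, d) / pmfOf p k d ≤ 1 := by
  rw [← Finset.sum_div, sum_pmfOf_pair]
  exact div_self_le_one _

include hp hr in
-- All letters of a typical sequence lie in the support, so the change of measure holds factor by
-- factor and the information densities add up in the exponent.
theorem prodWeight_eq_of_isTypical {ε : ℝ} {m : ℕ} {a : Fin m → A} {b : Fin m → B}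
    {c : Fin m → C}
    (ht : IsTypical ε (pmfOf p fun ω => (f ω, g ω, h ω)) (fun j => (a j, b j, c j))) :
    prodWeight (fun j => r (c j)) a =
      prodWeight (fun j a => pmfOf p (fun ω => (f ω, g ω, h ω)) (a, b j, c j) /
        pmfOf p (fun ω => (g ω, h ω)) (b j, c j)) a *
      (2 : ℝ) ^ (-∑ j, infoDensity p f g h (a j, b j, c j)) := by
  unfold prodWeight
  rw [← Finset.sum_neg_distrib, Real.rpow_sum_of_pos (by norm_num), ← Finset.prod_mul_distrib]
  exact Finset.prod_congr rfl fun j _ =>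
    eq_mul_rpow_infoDensity hp f g h hr (ht.pos (pmfOf_nonneg hp.1 _) j)

include hp hr in
/-- The packing lemma: a codeword that is generated independently of `b` given `c` is jointly
typical with `b` and `c` with exponentially small probability. -/
theorem packing {δ : ℝ} (hδ : 0 < δ) :
    ∀ᶠ ε in 𝓝[>] (0 : ℝ),
    ∀ (m : ℕ) (b : Fin m → B) (c : Fin m → C),
      expect (prodWeight fun j => r (c j)) (fun a =>
        ind (IsTypical ε (pmfOf p fun ω => (f ω, g ω, h ω)) (fun j => (a j, b j, c j)))) ≤
      (2 : ℝ) ^ (-(m * (condMutualInfo p f g h - δ))) := by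
  set q := pmfOf p fun ω => (f ω, g ω, h ω) with hq
  have hq0 : ∀ x, 0 ≤ q x := pmfOf_nonneg hp.1 _
  set K := expect q fun x => |infoDensity p f g h x|
  have hK : 0 ≤ K := expect_nonneg hq0 fun _ => abs_nonneg _
  -- Along an `ε`-typical sequence the densities sum to `m I` with an error of at most `ε m K`,
  -- which has to stay below `m δ`.
  have h1 : ∀ᶠ ε in 𝓝[>] (0 : ℝ), ε * K < δ := by
    have : Tendsto (fun ε : ℝ => ε * K) (𝓝[>] 0) (𝓝 0) := by
      have : Tendsto (fun ε : ℝ => ε * K) (𝓝 0) (𝓝 (0 * K)) := tendsto_id.mul_const K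
      rw [zero_mul] at this
      exact this.mono_left nhdsWithin_le_nhds
    exact this.eventually_lt_const hδ
  filter_upwards [h1] with ε hε m b c
  set t : Fin m → A → ℝ := fun j a => q (a, b j, c j) / pmfOf p (fun ω => (g ω, h ω)) (b j, c j)
  have ht0 : ∀ j a, 0 ≤ t j a := fun j a => div_nonneg (hq0 _) (pmfOf_nonneg hp.1 _ _)
  calc _ ≤ ∑ a : Fin m → A, prodWeight t a *
        (2 : ℝ) ^ (-(m * (condMutualInfo p f g h - δ))) := by
        refine Finset.sum_le_sum fun a _ => ?_
        have hta : 0 ≤ prodWeight t a := Finset.prod_nonneg fun j _ => ht0 j _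
        beta_reduce
        by_cases hty : IsTypical ε q (fun j => (a j, b j, c j))
        · rw [ind_of hty, mul_one, prodWeight_eq_of_isTypical hp f g h hr hty]
          refine mul_le_mul_of_nonneg_left ?_ hta
          refine Real.rpow_le_rpow_of_exponent_le (by norm_num) (neg_le_neg ?_)
          have h2 := (abs_le.1 (hty.abs_sum_sub_le (infoDensity p f g h))).1
          rw [condMutualInfo_eq_expect]
          have h3 : (m : ℝ) * (ε * K) ≤ m * δ := mul_le_mul_of_nonneg_left hε.le (Nat.cast_nonneg _)
          have h4 : ε * (m * K) = m * (ε * K) := by ring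
          rw [mul_sub]
          linarith
        · rw [ind_of_not hty, mul_zero]
          positivity
    -- What remains is the total mass of the conditional law given `b` and `c`, a product of sums
    -- that are at most one.
    _ ≤ 1 * (2 : ℝ) ^ (-(m * (condMutualInfo p f g h - δ))) := by
        rw [← Finset.sum_mul]
        refine mul_le_mul_of_nonneg_right ?_ (by positivity)
        have := expect_prodWeight_prod t (fun _ _ => 1)
        simp only [expect, Finset.prod_const_one, mul_one] at this
        rw [this]
        exact Finset.prod_le_one (fun j _ => Finset.sum_nonneg fun a _ => ht0 j a)
          fun j _ => sum_condLaw_le p f (fun ω => (g ω, h ω)) (b j, c j)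
    _ = _ := one_mul _

end Packing

/-! ### Conditional typicality -/

theorem expect_prodWeight_eval {ι : Type*} [Fintype ι] [DecidableEq ι] {p : ι → A → ℝ}
    (hp : ∀ i, p i ∈ stdSimplex ℝ A) (i : ι) (f : A → ℝ) :
    expect (prodWeight p) (fun C => f (C i)) = expect (p i) f := by
  rw [resamples_pi hp i]
  simp only [Function.update_self]
  exact expect_const (prodWeight_mem hp) _

/-- Centred independent letters are uncorrelated: in a cross term the coordinate `j` is redrawn with
mean zero while the factor at `i` stays. -/
theorem expect_sq_sum {m : ℕ} {p : Fin m → A → ℝ} (hp : ∀ i, p i ∈ stdSimplex ℝ A)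
    (g : Fin m → A → ℝ) (hg : ∀ i, expect (p i) (g i) = 0) :
    expect (prodWeight p) (fun C => (∑ i, g i (C i)) ^ 2) =
      ∑ i, expect (p i) fun a => g i a ^ 2 := by
  simp only [sq, Finset.sum_mul_sum]
  rw [expect_sum]
  refine Finset.sum_congr rfl fun i _ => ?_
  rw [expect_sum, Finset.sum_eq_single i]
  · exact expect_prodWeight_eval hp i (fun a => g i a * g i a)
  · intro j _ hj
    rw [resamples_pi hp j]
    simp only [Function.update_self, Function.update_of_ne hj.symm, expect_mul_left, hg, mul_zero]
    exact expect_const (prodWeight_mem hp) 0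
  · simp

/-- The conditional typicality lemma. -/
theorem conditional_typicality {q : A × D → ℝ} {qD : D → ℝ} {κ : D → A → ℝ}
    (hqD : ∀ d, 0 ≤ qD d) (hq0 : ∀ x, 0 ≤ q x) (hq : ∀ a d, q (a, d) = κ d a * qD d) {ε' ε : ℝ} (hε : ε' < ε) :
    ∃ K : ℝ, 0 ≤ K ∧ ∀ (m : ℕ) (d : Fin m → D), IsTypical ε' qD d →
      (∀ j, κ (d j) ∈ stdSimplex ℝ A) →
      expect (prodWeight fun j => κ (d j)) (fun a => ind (¬ IsTypical ε q fun j => (a j, d j))) ≤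
        K / m := by
  -- Chebyshev's inequality for each letter, followed by a union bound. Letters of mass zero
  -- contribute `1 / 0 = 0`, and indeed they never occur.
  refine ⟨∑ x : A × D, 1 / ((ε - ε') * q x) ^ 2, Finset.sum_nonneg fun x _ => by positivity, ?_⟩
  intro m d hd hκ
  have hw := prodWeight_mem hκ
  -- For `m = 0` the claimed bound is `K / 0 = 0`; it holds because the empty sequence is typical.
  rcases Nat.eq_zero_or_pos m with rfl | hm
  · have : ∀ a : Fin 0 → A, ind (¬ IsTypical ε q fun j => (a j, d j)) = 0 := fun a =>
      ind_of_not (not_not.2 isTypical_of_length_zero)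
    simp only [this, expect_const hw, Nat.cast_zero, div_zero, le_refl]
  have hm' : (0 : ℝ) < m := Nat.cast_pos.2 hm
  let dev : (Fin m → A) → A × D → Prop := fun a x =>
    ε * (m * q x) < |∑ i, ind ((a i, d i) = x) - m * q x|
  have h1 : ∀ a, ind (¬ IsTypical ε q fun j => (a j, d j)) ≤ ∑ x, ind (dev a x) := fun a => by
    refine le_trans (ind_mono fun h => ?_) (ind_exists_le _)
    rw [isTypical_iff] at h
    push Not at h
    exact h
  refine (expect_mono hw.1 h1).trans ?_
  rw [expect_sum, Finset.sum_div]
  refine Finset.sum_le_sum fun x _ => ?_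
  obtain ⟨a₀, d₀⟩ := x
  have hsplit : ∀ (a : A) (j : Fin m), ind ((a, d j) = (a₀, d₀)) = ind (a = a₀) * ind (d j = d₀) :=
    fun a j => by rw [Prod.mk.injEq, ind_and]
  have hmean : ∀ j, expect (κ (d j)) (fun a => ind (a = a₀)) = κ (d j) a₀ := fun j => by
    classical
    simp [expect, ind]
  rcases eq_or_ne (q (a₀, d₀)) 0 with h0 | h0
  · rw [h0, mul_zero]
    simp only [ne_eq, OfNat.ofNat_ne_zero, not_false_eq_true, zero_pow, div_zero, zero_div]
    have h2 : ∀ a, ind (dev a (a₀, d₀)) ≤ ∑ i, ind ((a i, d i) = (a₀, d₀)) := by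
      intro a
      by_cases h : ∃ i, (a i, d i) = (a₀, d₀)
      · exact (ind_mono fun _ => h).trans (ind_exists_le _)
      · push Not at h
        have : ¬ dev a (a₀, d₀) := by
          simp only [dev, h0, mul_zero, sub_zero, not_lt]
          rw [Finset.sum_eq_zero fun i _ => ind_of_not (h i), abs_zero]
        rw [ind_of_not this]
        exact Finset.sum_nonneg fun _ _ => ind_nonneg _
    refine (expect_mono hw.1 h2).trans ?_
    rw [expect_sum]
    refine Finset.sum_nonpos fun j _ => ?_
    rw [expect_prodWeight_eval hκ j (fun a => ind ((a, d j) = (a₀, d₀)))]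
    simp only [hsplit, expect_mul_right, hmean]
    -- If `d₀` occurs, typicality gives it positive mass, so the kernel must vanish at `a₀` for the
    -- pair to have mass zero.
    by_cases hj : d j = d₀
    · have h3 : 0 < qD d₀ := hj ▸ hd.pos hqD j
      rw [hj]
      rw [hq] at h0
      rw [(mul_eq_zero.1 h0).resolve_right h3.ne', zero_mul]
    · rw [ind_of_not hj, mul_zero]
  · have hqpos : 0 < q (a₀, d₀) := (hq0 _).lt_of_ne h0.symm
    have hκ0 : 0 ≤ κ d₀ a₀ := by
      rw [hq] at hqpos
      exact (pos_of_mul_pos_left hqpos (hqD _)).le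
    -- The fluctuation of the count of `(a₀, d₀)` around its conditional mean given `d`. That mean
    -- is off by at most `ε' m q`, since `d` is `ε'`-typical, so a violation at level `ε` forces the
    -- fluctuation to exceed `t = (ε - ε') m q`.
    set g : Fin m → A → ℝ := fun j a => (ind (a = a₀) - κ (d j) a₀) * ind (d j = d₀) with hg
    have hg0 : ∀ j, expect (κ (d j)) (g j) = 0 := by
      intro j
      simp only [hg, expect_mul_right, sub_eq_add_neg]
      rw [expect_add, hmean, expect_const (hκ j)]
      ring
    set t : ℝ := (ε - ε') * (m * q (a₀, d₀)) with ht
    have htpos : 0 < t := mul_pos (sub_pos.2 hε) (mul_pos hm' hqpos)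
    have hS : ∀ a : Fin m → A, ∑ j, g j (a j) =
        ∑ j, ind ((a j, d j) = (a₀, d₀)) - κ d₀ a₀ * ∑ j, ind (d j = d₀) := by
      intro a
      rw [Finset.mul_sum, ← Finset.sum_sub_distrib]
      refine Finset.sum_congr rfl fun j _ => ?_
      rw [hsplit, hg]
      by_cases hj : d j = d₀
      · simp only [hj]; ring
      · simp only [ind_of_not hj]; ring
    have hdev : ∀ a : Fin m → A, ind (dev a (a₀, d₀)) ≤ (1 / t ^ 2) * (∑ j, g j (a j)) ^ 2 := by
      intro a
      by_cases h : dev a (a₀, d₀)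
      · rw [ind_of h, one_div, ← div_eq_inv_mul, one_le_div (by positivity)]
        rw [← sq_abs (∑ j, g j (a j))]
        refine pow_le_pow_left₀ htpos.le ?_ 2
        have h5 := isTypical_iff.1 hd d₀
        have h6 : |κ d₀ a₀ * ∑ j, ind (d j = d₀) - m * q (a₀, d₀)| ≤ ε' * (m * q (a₀, d₀)) := by
          have : κ d₀ a₀ * ∑ j, ind (d j = d₀) - m * q (a₀, d₀) =
              κ d₀ a₀ * (∑ j, ind (d j = d₀) - m * qD d₀) := by rw [hq]; ring
          rw [this, abs_mul, abs_of_nonneg hκ0, hq]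
          calc _ ≤ κ d₀ a₀ * (ε' * (m * qD d₀)) := mul_le_mul_of_nonneg_left h5 hκ0
            _ = _ := by ring
        have h7 : ε * (m * q (a₀, d₀)) < |∑ i, ind ((a i, d i) = (a₀, d₀)) - m * q (a₀, d₀)| := h
        have h8 := abs_add_le (∑ j, g j (a j)) (κ d₀ a₀ * ∑ j, ind (d j = d₀) - m * q (a₀, d₀))
        rw [show ∑ j, g j (a j) + (κ d₀ a₀ * ∑ j, ind (d j = d₀) - m * q (a₀, d₀)) =
          ∑ i, ind ((a i, d i) = (a₀, d₀)) - m * q (a₀, d₀) by rw [hS]; ring] at h8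
        rw [ht, sub_mul]
        linarith
      · rw [ind_of_not h]
        positivity
    refine (expect_mono hw.1 hdev).trans ?_
    rw [expect_mul_left, expect_sq_sum hκ g hg0]
    have hvar : ∑ j, expect (κ (d j)) (fun a => g j a ^ 2) ≤ m := by
      calc _ ≤ ∑ _j : Fin m, (1 : ℝ) := by
            refine Finset.sum_le_sum fun j _ => expect_le_of_le (hκ j) fun a => ?_
            rw [sq_le_one_iff_abs_le_one, hg]
            have h1 : 0 ≤ κ (d j) a₀ := (hκ j).1 a₀
            have h2 : κ (d j) a₀ ≤ 1 := by
              rw [← (hκ j).2]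
              exact Finset.single_le_sum (fun a _ => (hκ j).1 a) (Finset.mem_univ a₀)
            rw [abs_mul, abs_of_nonneg (ind_nonneg (d j = d₀))]
            refine mul_le_one₀ (abs_le.2 ⟨?_, ?_⟩) (ind_nonneg _) (ind_le_one _)
            · have := ind_nonneg (a = a₀); linarith
            · have := ind_le_one (a = a₀); linarith
        _ = m := by simp
    calc 1 / t ^ 2 * ∑ j, expect (κ (d j)) (fun a => g j a ^ 2) ≤ 1 / t ^ 2 * m :=
          mul_le_mul_of_nonneg_left hvar (by positivity)
      _ = _ := by
          rw [ht]
          have := (sub_pos.2 hε).ne'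
          field_simp

/-- The covering lemma: a codeword that is generated given `c` is jointly typical with `b` and `c`
with a probability that is not much smaller than `2 ^ (-m I)`. -/
theorem covering {p : Ω → ℝ} (hp : p ∈ stdSimplex ℝ Ω) (f : Ω → A) (g : Ω → B) (h : Ω → C)
    {r : C → A → ℝ}
    (hr : ∀ a c, r c a * pmfOf p h c = pmfOf p (fun ω => (f ω, h ω)) (a, c))
    {δ : ℝ} (hδ : 0 < δ) :
    ∀ᶠ ε in 𝓝[>] (0 : ℝ), ∀ ε' < ε, ∃ K : ℝ, 0 ≤ K ∧ ∀ (m : ℕ) (b : Fin m → B) (c : Fin m → C),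
      IsTypical ε' (pmfOf p fun ω => (g ω, h ω)) (fun j => (b j, c j)) →
      (1 - K / m) * (2 : ℝ) ^ (-(m * (condMutualInfo p f g h + δ))) ≤
      expect (prodWeight fun j => r (c j)) (fun a =>
        ind (IsTypical ε (pmfOf p fun ω => (f ω, g ω, h ω)) (fun j => (a j, b j, c j)))) := by
  set q := pmfOf p fun ω => (f ω, g ω, h ω) with hq
  have hq0 : ∀ x, 0 ≤ q x := pmfOf_nonneg hp.1 _
  set qD := pmfOf p fun ω => (g ω, h ω) with hqD
  have hqD0 : ∀ x, 0 ≤ qD x := pmfOf_nonneg hp.1 _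
  set M := expect q fun x => |infoDensity p f g h x|
  have h1 : ∀ᶠ ε in 𝓝[>] (0 : ℝ), ε * M < δ := by
    have : Tendsto (fun ε : ℝ => ε * M) (𝓝[>] 0) (𝓝 0) := by
      have : Tendsto (fun ε : ℝ => ε * M) (𝓝 0) (𝓝 (0 * M)) := tendsto_id.mul_const M
      rw [zero_mul] at this
      exact this.mono_left nhdsWithin_le_nhds
    exact this.eventually_lt_const hδ
  filter_upwards [h1] with ε hε ε' hε'
  -- The conditional law given both `g` and `h`. Under it the drawn sequence is typical with
  -- probability at least `1 - K / m`; passing to `r` costs the factor of the change of measure.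
  set κ : B × C → A → ℝ := fun d a => q (a, d) / qD d with hκ
  obtain ⟨K, hK0, hK⟩ := conditional_typicality (q := q) (qD := qD) (κ := κ) hqD0 hq0
    (fun a d => by
      rcases eq_or_ne (qD d) 0 with h0 | h0
      · have h2 : ∑ a, q (a, d) = 0 := (sum_pmfOf_pair p f (fun ω => (g ω, h ω)) d).trans h0
        rw [h0, mul_zero]
        exact (Finset.sum_eq_zero_iff_of_nonneg fun a _ => hq0 _).1 h2 a (Finset.mem_univ a)
      · rw [hκ, div_mul_cancel₀ _ h0]) hε'
  refine ⟨K, hK0, fun m b c hbc => ?_⟩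
  -- The kernel is normalised only at pairs of positive mass; typicality of `(b, c)` guarantees this
  -- at every position.
  have hsimp : ∀ j, κ (b j, c j) ∈ stdSimplex ℝ A := fun j => by
    refine ⟨fun a => div_nonneg (hq0 _) (hqD0 _), ?_⟩
    rw [hκ, ← Finset.sum_div]
    have : ∑ a, q (a, b j, c j) = qD (b j, c j) :=
      sum_pmfOf_pair p f (fun ω => (g ω, h ω)) (b j, c j)
    rw [this]
    exact div_self (hbc.pos hqD0 j).ne'
  have hw := prodWeight_mem hsimp
  have h2 := hK m (fun j => (b j, c j)) hbc hsimp
  simp only [ind_not, sub_eq_add_neg] at h2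
  rw [expect_add, expect_const hw] at h2
  have h3 : expect (prodWeight fun j => κ (b j, c j)) (fun a => -ind (IsTypical ε q fun j =>
      (a j, b j, c j))) = -expect (prodWeight fun j => κ (b j, c j)) (fun a =>
      ind (IsTypical ε q fun j => (a j, b j, c j))) := by
    simp [expect]
  rw [h3] at h2
  have h4 : 1 - K / m ≤ expect (prodWeight fun j => κ (b j, c j)) (fun a =>
      ind (IsTypical ε q fun j => (a j, b j, c j))) := by linarith
  refine (mul_le_mul_of_nonneg_right h4 (by positivity)).trans ?_
  rw [expect, Finset.sum_mul]
  refine Finset.sum_le_sum fun a _ => ?_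
  beta_reduce
  by_cases hty : IsTypical ε q (fun j => (a j, b j, c j))
  · rw [ind_of hty, mul_one, mul_one, prodWeight_eq_of_isTypical hp f g h hr hty]
    refine mul_le_mul_of_nonneg_left ?_ (hw.1 a)
    refine Real.rpow_le_rpow_of_exponent_le (by norm_num) (neg_le_neg ?_)
    have h2 := (abs_le.1 (hty.abs_sum_sub_le (infoDensity p f g h))).2
    rw [condMutualInfo_eq_expect]
    have h3 : (m : ℝ) * (ε * M) ≤ m * δ := mul_le_mul_of_nonneg_left hε.le (Nat.cast_nonneg _)
    have h4 : ε * (m * M) = m * (ε * M) := by ring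
    rw [mul_add]
    linarith
  · rw [ind_of_not hty, mul_zero, zero_mul, mul_zero]

end Typicality

end

/-! ### Marginals of the input distribution -/

noncomputable section

open Filter Topology

theorem expect_ind_mul {A : Type*} [Fintype A] (p : A → ℝ) (a : A) (g : A → ℝ) :
    expect p (fun x => ind (x = a) * g x) = p a * g a := by
  classical
  simp [expect, ind]

theorem expect_ind {A : Type*} [Fintype A] (p : A → ℝ) (a : A) :
    expect p (fun x => ind (x = a)) = p a := by
  classical
  simp [expect, ind]

theorem expect_stdSimplex_const {A : Type*} [Fintype A] (p : stdSimplex ℝ A) (c : ℝ) :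
    expect p (fun _ => c) = c := expect_const p.2 c

namespace HKInput

variable {W : HDChannel.{u}} (P : HKInput W)

/-- The joint law as successive sampling. Marginals are obtained by pushing indicators through this
chain and discarding the layers that they do not mention. -/
theorem expect_joint (f : P.Outcome → ℝ) : expect P.joint f =
    expect P.pX₁₁ fun x₁₁ => expect P.pU₁₁ fun u₁₁ => expect (P.pX₁₂ u₁₁ x₁₁) fun x₁₂ =>
    expect P.pU₂₁ fun u₂₁ => expect (P.pU₂₂ u₂₁ x₁₁) fun u₂₂ =>
    expect (P.pX₂₂ x₁₁ u₂₁ u₂₂) fun x₂₂ => expect (W.phase1 x₁₁) fun y =>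
    expect (W.phase2 x₁₂ x₂₂) fun z => f (x₁₁, u₁₁, x₁₂, u₂₁, u₂₂, x₂₂, y, z) := by
  unfold expect joint
  rw [Fintype.sum_prod_type]
  refine Finset.sum_congr rfl fun _ _ => ?_
  rw [Fintype.sum_prod_type, Finset.mul_sum]
  refine Finset.sum_congr rfl fun _ _ => ?_
  rw [Fintype.sum_prod_type, Finset.mul_sum, Finset.mul_sum]
  refine Finset.sum_congr rfl fun _ _ => ?_
  simp only [Fintype.sum_prod_type (α₁ := P.U₂₁), Finset.mul_sum]
  refine Finset.sum_congr rfl fun _ _ => ?_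
  simp only [Fintype.sum_prod_type (α₁ := P.U₂₂)]
  refine Finset.sum_congr rfl fun _ _ => ?_
  simp only [Fintype.sum_prod_type (α₁ := W.X₂₂)]
  refine Finset.sum_congr rfl fun _ _ => ?_
  rw [Fintype.sum_prod_type]
  refine Finset.sum_congr rfl fun _ _ => ?_
  refine Finset.sum_congr rfl fun _ _ => ?_
  ring

theorem joint_mem : P.joint ∈ stdSimplex ℝ P.Outcome := by
  refine ⟨fun ω => ?_, ?_⟩
  · have h : ∀ {A : Type _} [Fintype A] (p : stdSimplex ℝ A) (a : A), 0 ≤ p a := fun p a => p.2.1 a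
    have h' : ∀ {A : Type} [Fintype A] (p : stdSimplex ℝ A) (a : A), 0 ≤ p a := fun p a => p.2.1 a
    unfold joint
    have := h P.pX₁₁; have := h' P.pU₁₁; have := fun a b => h (P.pX₁₂ a b)
    have := h' P.pU₂₁; have := fun a b => h' (P.pU₂₂ a b); have := fun a b c => h (P.pX₂₂ a b c)
    have := fun a => h (W.phase1 a); have := fun a b => h (W.phase2 a b)
    apply_rules [mul_nonneg]
  · have := P.expect_joint fun _ => 1
    simp only [expect_stdSimplex_const] at this
    simpa only [expect, mul_one] using this

/-- The law of `U₂₂` given `U₂₁`. -/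
def pU₂₂' (u₂₁ : P.U₂₁) (u₂₂ : P.U₂₂) : ℝ := expect P.pX₁₁ fun x₁₁ => P.pU₂₂ u₂₁ x₁₁ u₂₂

theorem pU₂₂'_mem (u₂₁ : P.U₂₁) : P.pU₂₂' u₂₁ ∈ stdSimplex ℝ P.U₂₂ := by
  refine ⟨fun a => expect_nonneg P.pX₁₁.2.1 fun x => (P.pU₂₂ u₂₁ x).2.1 a, ?_⟩
  unfold pU₂₂'
  rw [← expect_sum]
  have : ∀ x, ∑ i, P.pU₂₂ u₂₁ x i = 1 := fun x => (P.pU₂₂ u₂₁ x).2.2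
  simp only [this, expect_stdSimplex_const]

theorem pmfOf_inputs (a : W.X₁₁) (b : P.U₁₁) (c : W.X₁₂) (d : P.U₂₁) :
    pmfOf P.joint (fun ω => (P.rX₁₁ ω, P.rU₁₁ ω, P.rX₁₂ ω, P.rU₂₁ ω)) (a, b, c, d) =
      P.pX₁₁ a * (P.pU₁₁ b * (P.pX₁₂ b a c * P.pU₂₁ d)) := by
  rw [pmfOf_eq_expect, expect_joint]
  simp only [rX₁₁, rU₁₁, rX₁₂, rU₂₁, Prod.mk.injEq, ind_and, expect_stdSimplex_const,
    expect_mul_left, expect_ind_mul, expect_ind]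

theorem pmfOf_X₁₁_U₁₁_U₂₁ (a : W.X₁₁) (b : P.U₁₁) (d : P.U₂₁) :
    pmfOf P.joint (fun ω => (P.rX₁₁ ω, P.rU₁₁ ω, P.rU₂₁ ω)) (a, b, d) =
      P.pX₁₁ a * (P.pU₁₁ b * P.pU₂₁ d) := by
  rw [pmfOf_eq_expect, expect_joint]
  simp only [rX₁₁, rU₁₁, rU₂₁, Prod.mk.injEq, ind_and, expect_stdSimplex_const,
    expect_mul_left, expect_ind_mul, expect_ind]

theorem pmfOf_U₁₁_U₂₁_U₂₂ (b : P.U₁₁) (d : P.U₂₁) (e : P.U₂₂) :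
    pmfOf P.joint (fun ω => (P.rU₁₁ ω, P.rU₂₁ ω, P.rU₂₂ ω)) (b, d, e) =
      P.pU₁₁ b * (P.pU₂₁ d * P.pU₂₂' d e) := by
  rw [pmfOf_eq_expect, expect_joint]
  simp only [rU₁₁, rU₂₂, rU₂₁, Prod.mk.injEq, ind_and, expect_stdSimplex_const,
    expect_mul_left, expect_ind_mul, expect_ind, pU₂₂']

theorem pmfOf_X₁₁_U₂₁_U₂₂ (a : W.X₁₁) (d : P.U₂₁) (e : P.U₂₂) :
    pmfOf P.joint (fun ω => (P.rX₁₁ ω, P.rU₂₁ ω, P.rU₂₂ ω)) (a, d, e) =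
      P.pX₁₁ a * (P.pU₂₁ d * P.pU₂₂ d a e) := by
  rw [pmfOf_eq_expect, expect_joint]
  simp only [rX₁₁, rU₂₂, rU₂₁, Prod.mk.injEq, ind_and, expect_stdSimplex_const,
    expect_mul_left, expect_ind_mul, expect_ind]

theorem pmfOf_X₁₁_U₁₁ (a : W.X₁₁) (b : P.U₁₁) :
    pmfOf P.joint (fun ω => (P.rX₁₁ ω, P.rU₁₁ ω)) (a, b) = P.pX₁₁ a * P.pU₁₁ b := by
  rw [pmfOf_eq_expect, expect_joint]
  simp only [rX₁₁, rU₁₁, Prod.mk.injEq, ind_and, expect_stdSimplex_const, expect_mul_left, expect_ind_mul,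
    expect_ind]

theorem pmfOf_X₁₁_U₂₁ (a : W.X₁₁) (b : P.U₂₁) :
    pmfOf P.joint (fun ω => (P.rX₁₁ ω, P.rU₂₁ ω)) (a, b) = P.pX₁₁ a * P.pU₂₁ b := by
  rw [pmfOf_eq_expect, expect_joint]
  simp only [rX₁₁, rU₂₁, Prod.mk.injEq, ind_and, expect_stdSimplex_const, expect_mul_left, expect_ind_mul,
    expect_ind]

theorem pmfOf_U₁₁_U₂₁ (a : P.U₁₁) (b : P.U₂₁) :
    pmfOf P.joint (fun ω => (P.rU₁₁ ω, P.rU₂₁ ω)) (a, b) = P.pU₁₁ a * P.pU₂₁ b := by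
  rw [pmfOf_eq_expect, expect_joint]
  simp only [rU₁₁, rU₂₁, Prod.mk.injEq, ind_and, expect_stdSimplex_const, expect_mul_left, expect_ind_mul,
    expect_ind]

theorem pmfOf_X₁₁ (a : W.X₁₁) :
    pmfOf P.joint P.rX₁₁ a = P.pX₁₁ a := by
  rw [pmfOf_eq_expect, expect_joint]
  simp only [rX₁₁, expect_stdSimplex_const, expect_ind]

theorem pmfOf_U₁₁ (a : P.U₁₁) :
    pmfOf P.joint P.rU₁₁ a = P.pU₁₁ a := by
  rw [pmfOf_eq_expect, expect_joint]
  simp only [rU₁₁, expect_stdSimplex_const, expect_ind]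

theorem pmfOf_U₂₁ (a : P.U₂₁) :
    pmfOf P.joint P.rU₂₁ a = P.pU₂₁ a := by
  rw [pmfOf_eq_expect, expect_joint]
  simp only [rU₂₁, expect_stdSimplex_const, expect_ind]

end HKInput

end

/-! ### Packing bounds for each pattern of wrong codewords -/

noncomputable section

open Filter Topology

section Pairs

variable {A B C D ι : Type*} [Fintype A] [Fintype B] [Fintype C] [Fintype D] [Fintype ι]
  [DecidableEq ι]

theorem expect_prodWeight_triple (p : ι → A → ℝ) (q : ι → A → B → ℝ) (s : ι → A → B → C → ℝ)
    (f : (ι → A × B × C) → ℝ) :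
    expect (prodWeight p) (fun a => expect (prodWeight fun j => q j (a j)) fun b =>
      expect (prodWeight fun j => s j (a j) (b j)) fun c => f fun j => (a j, b j, c j)) =
    expect (prodWeight fun j (x : A × B × C) => p j x.1 * (q j x.1 x.2.1 * s j x.1 x.2.1 x.2.2))
      f := by
  rw [← expect_prodWeight_pair p (fun j a (x : B × C) => q j a x.1 * s j a x.1 x.2)]
  congr 1
  ext a
  rw [← expect_prodWeight_pair (fun j => q j (a j)) (fun j => s j (a j))
    (fun x => f fun j => (a j, x j))]

theorem expect_prodWeight_quadruple (p : ι → A → ℝ) (q : ι → A → B → ℝ) (s : ι → A → B → C → ℝ)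
    (t : ι → A → B → C → D → ℝ) (f : (ι → A × B × C × D) → ℝ) :
    expect (prodWeight p) (fun a => expect (prodWeight fun j => q j (a j)) fun b =>
      expect (prodWeight fun j => s j (a j) (b j)) fun c =>
      expect (prodWeight fun j => t j (a j) (b j) (c j)) fun d => f fun j => (a j, b j, c j, d j)) =
    expect (prodWeight fun j (x : A × B × C × D) => p j x.1 * (q j x.1 x.2.1 *
      (s j x.1 x.2.1 x.2.2.1 * t j x.1 x.2.1 x.2.2.1 x.2.2.2))) f := by
  rw [← expect_prodWeight_pair p (fun j a (x : B × C × D) => q j a x.1 * (s j a x.1 x.2.1 *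
    t j a x.1 x.2.1 x.2.2))]
  congr 1
  ext a
  rw [← expect_prodWeight_triple (fun j => q j (a j)) (fun j => s j (a j)) (fun j => t j (a j))
    (fun x => f fun j => (a j, x j))]

end Pairs

/-- The packing lemma for a typicality test on a tuple `Δ` that lists the entries of `f`, `g` and
`h` in some order. -/
theorem packing_of_map {Ω A B C E : Type*} [Fintype Ω] [Fintype A] [Fintype B] [Fintype C]
    [Fintype E] {p : Ω → ℝ} (hp : p ∈ stdSimplex ℝ Ω) (Δ : Ω → E) (f : Ω → A) (g : Ω → B)
    (h : Ω → C) (φ : E → A × B × C) (hφ : ∀ ω, φ (Δ ω) = (f ω, g ω, h ω)) {r : C → A → ℝ}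
    (hr : ∀ a c, r c a * pmfOf p h c = pmfOf p (fun ω => (f ω, h ω)) (a, c))
    (hr0 : ∀ c a, 0 ≤ r c a) {δ : ℝ} (hδ : 0 < δ) :
    ∀ᶠ ε in 𝓝[>] (0 : ℝ),
    ∀ (m : ℕ) (b : Fin m → B) (c : Fin m → C)
      (x : (Fin m → A) → Fin m → E), (∀ a j, φ (x a j) = (a j, b j, c j)) →
      expect (prodWeight fun j => r (c j)) (fun a => ind (IsTypical ε (pmfOf p Δ) (x a))) ≤
      (2 : ℝ) ^ (-(m * (condMutualInfo p f g h - δ))) := by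
  filter_upwards [packing hp f g h hr hδ] with ε hε m b c x hx
  refine (expect_mono (fun a => Finset.prod_nonneg fun j _ => hr0 _ _) fun a =>
    ind_mono fun ht => ?_).trans (hε m b c)
  have := ht.map φ
  simpa only [pmfOf_comp, hφ, hx] using this

namespace HKInput

variable {W : HDChannel.{u}} (P : HKInput W)

/-- The joint typicality test of the first destination in the second phase. -/
abbrev Typ₁ (ε : ℝ) {m : ℕ} (x : Fin m → W.X₁₁) (u : Fin m → P.U₁₁) (a : Fin m → W.X₁₂)
    (v : Fin m → P.U₂₁) (z : Fin m → W.Y₁₂) : Prop :=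
  IsTypical ε (pmfOf P.joint fun ω => (P.rX₁₁ ω, P.rU₁₁ ω, P.rX₁₂ ω, P.rU₂₁ ω, P.rY₁₂ ω))
    (fun j => (x j, u j, a j, v j, z j))

/-- The joint typicality test of the second destination. -/
abbrev Typ₂ (ε : ℝ) {m : ℕ} (u : Fin m → P.U₁₁) (v : Fin m → P.U₂₁) (s : Fin m → P.U₂₂)
    (z : Fin m → W.Y₂₂) : Prop :=
  IsTypical ε (pmfOf P.joint fun ω => (P.rU₁₁ ω, P.rU₂₁ ω, P.rU₂₂ ω, P.rY₂₂ ω))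
    (fun j => (u j, v j, s j, z j))

/-- The joint typicality test in conditional binning. -/
abbrev TypBin (ε : ℝ) {m : ℕ} (x : Fin m → W.X₁₁) (v : Fin m → P.U₂₁) (s : Fin m → P.U₂₂) : Prop :=
  IsTypical ε (pmfOf P.joint fun ω => (P.rX₁₁ ω, P.rU₂₁ ω, P.rU₂₂ ω)) (fun j => (x j, v j, s j))

/-- The joint typicality test of the second sender. -/
abbrev TypY (ε : ℝ) {k : ℕ} (x : Fin k → W.X₁₁) (y : Fin k → W.Y) : Prop :=
  IsTypical ε (pmfOf P.joint fun ω => (P.rX₁₁ ω, P.rY ω)) (fun i => (x i, y i))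

/-- The joint typicality test of the first destination in the first phase. -/
abbrev TypY₁₁ (ε : ℝ) {k : ℕ} (x : Fin k → W.X₁₁) (y : Fin k → W.Y₁₁) : Prop :=
  IsTypical ε (pmfOf P.joint fun ω => (P.rX₁₁ ω, P.rY₁₁ ω)) (fun i => (x i, y i))

/-- `I(U₂₂; X₁₁ | U₂₁)`. -/
def i₁ : ℝ := condMutualInfo P.joint P.rU₂₂ P.rX₁₁ P.rU₂₁

/-- `I(X₁₁; Y)`. -/
def i₂ : ℝ := mutualInfo P.joint P.rX₁₁ P.rY

/-- `I(X₁₁; Y₁₁)`. -/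
def iY₁₁ : ℝ := mutualInfo P.joint P.rX₁₁ P.rY₁₁

/-- `I(X₁₂; Y₁₂ | X₁₁, U₁₁, U₂₁)`. -/
def i₃ : ℝ := condMutualInfo P.joint P.rX₁₂ P.rY₁₂
  (fun ω => (P.rX₁₁ ω, P.rU₁₁ ω, P.rU₂₁ ω))

/-- `I(X₁₁, X₁₂; Y₁₂ | U₁₁, U₂₁)`. -/
def i₄ : ℝ := condMutualInfo P.joint (fun ω => (P.rX₁₁ ω, P.rX₁₂ ω)) P.rY₁₂
  (fun ω => (P.rU₁₁ ω, P.rU₂₁ ω))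

/-- `I(U₁₁, X₁₂; Y₁₂ | X₁₁, U₂₁)`. -/
def i₅ : ℝ := condMutualInfo P.joint (fun ω => (P.rU₁₁ ω, P.rX₁₂ ω)) P.rY₁₂
  (fun ω => (P.rX₁₁ ω, P.rU₂₁ ω))

/-- `I(X₁₁, U₁₁, X₁₂; Y₁₂ | U₂₁)`. -/
def i₆ : ℝ := condMutualInfo P.joint (fun ω => (P.rX₁₁ ω, P.rU₁₁ ω, P.rX₁₂ ω)) P.rY₁₂
  P.rU₂₁

/-- `I(X₁₂, U₂₁; Y₁₂ | X₁₁, U₁₁)`. -/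
def i₇ : ℝ := condMutualInfo P.joint (fun ω => (P.rX₁₂ ω, P.rU₂₁ ω)) P.rY₁₂
  (fun ω => (P.rX₁₁ ω, P.rU₁₁ ω))

/-- `I(X₁₁, X₁₂, U₂₁; Y₁₂ | U₁₁)`. -/
def i₈ : ℝ := condMutualInfo P.joint (fun ω => (P.rX₁₁ ω, P.rX₁₂ ω, P.rU₂₁ ω)) P.rY₁₂
  P.rU₁₁

/-- `I(U₁₁, X₁₂, U₂₁; Y₁₂ | X₁₁)`. -/
def i₉ : ℝ := condMutualInfo P.joint (fun ω => (P.rU₁₁ ω, P.rX₁₂ ω, P.rU₂₁ ω)) P.rY₁₂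
  P.rX₁₁

/-- `I(X₁₁, U₁₁, X₁₂, U₂₁; Y₁₂)`. -/
def i₁₀ : ℝ := mutualInfo P.joint (fun ω => (P.rX₁₁ ω, P.rU₁₁ ω, P.rX₁₂ ω, P.rU₂₁ ω)) P.rY₁₂

/-- `I(U₂₂; Y₂₂ | U₂₁, U₁₁)`. -/
def i₁₁ : ℝ := condMutualInfo P.joint P.rU₂₂ P.rY₂₂
  (fun ω => (P.rU₂₁ ω, P.rU₁₁ ω))

/-- `I(U₂₁, U₂₂; Y₂₂ | U₁₁)`. -/
def i₁₂ : ℝ := condMutualInfo P.joint (fun ω => (P.rU₂₁ ω, P.rU₂₂ ω)) P.rY₂₂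
  P.rU₁₁

/-- `I(U₁₁, U₂₂; Y₂₂ | U₂₁)`. -/
def i₁₃ : ℝ := condMutualInfo P.joint (fun ω => (P.rU₁₁ ω, P.rU₂₂ ω)) P.rY₂₂
  P.rU₂₁

/-- `I(U₁₁, U₂₁, U₂₂; Y₂₂)`. -/
def i₁₄ : ℝ := mutualInfo P.joint (fun ω => (P.rU₁₁ ω, P.rU₂₁ ω, P.rU₂₂ ω)) P.rY₂₂

/-- `X₁₁`, `U₁₁`, `U₂₁` are independent and `X₁₂` is drawn from `(U₁₁, X₁₁)` alone, so the
conditional law required by packing is the one by which wrong codewords are generated. The same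
reason covers the other patterns of the first destination. -/
theorem condLaw_X₁₂_given_X₁₁_U₁₁_U₂₁ (x : W.X₁₁) (u : P.U₁₁) (a : W.X₁₂) (v : P.U₂₁) :
    (P.pX₁₂ u x a) * pmfOf P.joint (fun ω => (P.rX₁₁ ω, P.rU₁₁ ω, P.rU₂₁ ω)) (x, u, v) =
      pmfOf P.joint (fun ω => (P.rX₁₂ ω, (P.rX₁₁ ω, P.rU₁₁ ω, P.rU₂₁ ω))) (a, (x, u, v)) := by
  have h := pmfOf_of_injective P.joint (fun ω => (P.rX₁₁ ω, P.rU₁₁ ω, P.rX₁₂ ω, P.rU₂₁ ω))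
    (e := fun (x, u, a, v) => (a, (x, u, v)))
    (by rintro ⟨x, u, a, v⟩ ⟨x', u', a', v'⟩ h; simp only [Prod.mk.injEq] at h ⊢; tauto)
    (x, u, a, v)
  refine Eq.trans ?_ h.symm
  rw [pmfOf_inputs, pmfOf_X₁₁_U₁₁_U₂₁]
  ring

/-- The averaged codewords are the wrong ones; the others are arbitrary. Here only `x₁₂` is wrong.
The next bounds have `(x₁₁, x₁₂)`, `(u₁₁, x₁₂)` and `(x₁₁, u₁₁, x₁₂)` wrong, and then the same four
patterns together with a wrong `u₂₁`. -/
theorem packing₃ {δ : ℝ} (hδ : 0 < δ) : ∀ᶠ ε in 𝓝[>] (0 : ℝ),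
    ∀ (m : ℕ) (x : Fin m → W.X₁₁) (u : Fin m → P.U₁₁) (v : Fin m → P.U₂₁) (z : Fin m → W.Y₁₂),
      (expect (prodWeight fun j => P.pX₁₂ (u j) (x j)) fun a =>
      ind (P.Typ₁ ε x u a v z)) ≤ (2 : ℝ) ^ (-(m * (P.i₃ - δ))) := by
  filter_upwards [packing_of_map P.joint_mem
    (fun ω => (P.rX₁₁ ω, P.rU₁₁ ω, P.rX₁₂ ω, P.rU₂₁ ω, P.rY₁₂ ω)) P.rX₁₂ P.rY₁₂
    (fun ω => (P.rX₁₁ ω, P.rU₁₁ ω, P.rU₂₁ ω)) (fun (x, u, a, v, z) => (a, z, (x, u, v))) (fun _ => rfl)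
    (r := fun (x, u, v) a => P.pX₁₂ u x a) (fun a (x, u, v) => P.condLaw_X₁₂_given_X₁₁_U₁₁_U₂₁ x u a v)
    (fun _ _ => (P.pX₁₂ _ _).2.1 _) hδ] with ε h m x u v z
  have := h m z (fun j => (x j, u j, v j)) (fun w j => (x j, u j, w j, v j, z j)) (fun _ _ => rfl)
  exact this

theorem condLaw_X₁₁_X₁₂_given_U₁₁_U₂₁ (x : W.X₁₁) (u : P.U₁₁) (a : W.X₁₂) (v : P.U₂₁) :
    (P.pX₁₁ x * P.pX₁₂ u x a) * pmfOf P.joint (fun ω => (P.rU₁₁ ω, P.rU₂₁ ω)) (u, v) =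
      pmfOf P.joint (fun ω => ((P.rX₁₁ ω, P.rX₁₂ ω), (P.rU₁₁ ω, P.rU₂₁ ω))) ((x, a), (u, v)) := by
  have h := pmfOf_of_injective P.joint (fun ω => (P.rX₁₁ ω, P.rU₁₁ ω, P.rX₁₂ ω, P.rU₂₁ ω))
    (e := fun (x, u, a, v) => ((x, a), (u, v)))
    (by rintro ⟨x, u, a, v⟩ ⟨x', u', a', v'⟩ h; simp only [Prod.mk.injEq] at h ⊢; tauto)
    (x, u, a, v)
  refine Eq.trans ?_ h.symm
  rw [pmfOf_inputs, pmfOf_U₁₁_U₂₁]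
  ring

theorem packing₄ {δ : ℝ} (hδ : 0 < δ) : ∀ᶠ ε in 𝓝[>] (0 : ℝ),
    ∀ (m : ℕ) (u : Fin m → P.U₁₁) (v : Fin m → P.U₂₁) (z : Fin m → W.Y₁₂),
      (expect (prodWeight fun _ : Fin m => P.pX₁₁) fun x =>
      expect (prodWeight fun j => P.pX₁₂ (u j) (x j)) fun a =>
      ind (P.Typ₁ ε x u a v z)) ≤ (2 : ℝ) ^ (-(m * (P.i₄ - δ))) := by
  filter_upwards [packing_of_map P.joint_mem
    (fun ω => (P.rX₁₁ ω, P.rU₁₁ ω, P.rX₁₂ ω, P.rU₂₁ ω, P.rY₁₂ ω)) (fun ω => (P.rX₁₁ ω, P.rX₁₂ ω)) P.rY₁₂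
    (fun ω => (P.rU₁₁ ω, P.rU₂₁ ω)) (fun (x, u, a, v, z) => ((x, a), z, (u, v))) (fun _ => rfl)
    (r := fun (u, v) (x, a) => P.pX₁₁ x * P.pX₁₂ u x a) (fun (x, a) (u, v) => P.condLaw_X₁₁_X₁₂_given_U₁₁_U₂₁ x u a v)
    (fun _ _ => mul_nonneg (P.pX₁₁.2.1 _) ((P.pX₁₂ _ _).2.1 _)) hδ] with ε h m u v z
  have := h m z (fun j => (u j, v j)) (fun w j => ((w j).1, u j, (w j).2, v j, z j)) (fun _ _ => rfl)
  refine (expect_prodWeight_pair (fun _ => P.pX₁₁)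
    (fun j x => P.pX₁₂ (u j) x)
    (fun w => ind (IsTypical ε _ fun j => ((w j).1, u j, (w j).2, v j, z j)))).trans_le ?_
  exact this

theorem condLaw_U₁₁_X₁₂_given_X₁₁_U₂₁ (x : W.X₁₁) (u : P.U₁₁) (a : W.X₁₂) (v : P.U₂₁) :
    (P.pU₁₁ u * P.pX₁₂ u x a) * pmfOf P.joint (fun ω => (P.rX₁₁ ω, P.rU₂₁ ω)) (x, v) =
      pmfOf P.joint (fun ω => ((P.rU₁₁ ω, P.rX₁₂ ω), (P.rX₁₁ ω, P.rU₂₁ ω))) ((u, a), (x, v)) := by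
  have h := pmfOf_of_injective P.joint (fun ω => (P.rX₁₁ ω, P.rU₁₁ ω, P.rX₁₂ ω, P.rU₂₁ ω))
    (e := fun (x, u, a, v) => ((u, a), (x, v)))
    (by rintro ⟨x, u, a, v⟩ ⟨x', u', a', v'⟩ h; simp only [Prod.mk.injEq] at h ⊢; tauto)
    (x, u, a, v)
  refine Eq.trans ?_ h.symm
  rw [pmfOf_inputs, pmfOf_X₁₁_U₂₁]
  ring

theorem packing₅ {δ : ℝ} (hδ : 0 < δ) : ∀ᶠ ε in 𝓝[>] (0 : ℝ),
    ∀ (m : ℕ) (x : Fin m → W.X₁₁) (v : Fin m → P.U₂₁) (z : Fin m → W.Y₁₂),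
      (expect (prodWeight fun _ : Fin m => P.pU₁₁) fun u =>
      expect (prodWeight fun j => P.pX₁₂ (u j) (x j)) fun a =>
      ind (P.Typ₁ ε x u a v z)) ≤ (2 : ℝ) ^ (-(m * (P.i₅ - δ))) := by
  filter_upwards [packing_of_map P.joint_mem
    (fun ω => (P.rX₁₁ ω, P.rU₁₁ ω, P.rX₁₂ ω, P.rU₂₁ ω, P.rY₁₂ ω)) (fun ω => (P.rU₁₁ ω, P.rX₁₂ ω)) P.rY₁₂
    (fun ω => (P.rX₁₁ ω, P.rU₂₁ ω)) (fun (x, u, a, v, z) => ((u, a), z, (x, v))) (fun _ => rfl)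
    (r := fun (x, v) (u, a) => P.pU₁₁ u * P.pX₁₂ u x a) (fun (u, a) (x, v) => P.condLaw_U₁₁_X₁₂_given_X₁₁_U₂₁ x u a v)
    (fun _ _ => mul_nonneg (P.pU₁₁.2.1 _) ((P.pX₁₂ _ _).2.1 _)) hδ] with ε h m x v z
  have := h m z (fun j => (x j, v j)) (fun w j => (x j, (w j).1, (w j).2, v j, z j)) (fun _ _ => rfl)
  refine (expect_prodWeight_pair (fun _ => P.pU₁₁)
    (fun j u => P.pX₁₂ u (x j))
    (fun w => ind (IsTypical ε _ fun j => (x j, (w j).1, (w j).2, v j, z j)))).trans_le ?_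
  exact this

theorem condLaw_X₁₁_U₁₁_X₁₂_given_U₂₁ (x : W.X₁₁) (u : P.U₁₁) (a : W.X₁₂) (v : P.U₂₁) :
    (P.pX₁₁ x * (P.pU₁₁ u * P.pX₁₂ u x a)) * pmfOf P.joint P.rU₂₁ v =
      pmfOf P.joint (fun ω => ((P.rX₁₁ ω, P.rU₁₁ ω, P.rX₁₂ ω), P.rU₂₁ ω)) ((x, u, a), v) := by
  have h := pmfOf_of_injective P.joint (fun ω => (P.rX₁₁ ω, P.rU₁₁ ω, P.rX₁₂ ω, P.rU₂₁ ω))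
    (e := fun (x, u, a, v) => ((x, u, a), v))
    (by rintro ⟨x, u, a, v⟩ ⟨x', u', a', v'⟩ h; simp only [Prod.mk.injEq] at h ⊢; tauto)
    (x, u, a, v)
  refine Eq.trans ?_ h.symm
  rw [pmfOf_inputs, pmfOf_U₂₁]
  ring

theorem packing₆ {δ : ℝ} (hδ : 0 < δ) : ∀ᶠ ε in 𝓝[>] (0 : ℝ),
    ∀ (m : ℕ) (v : Fin m → P.U₂₁) (z : Fin m → W.Y₁₂),
      (expect (prodWeight fun _ : Fin m => P.pX₁₁) fun x =>
      expect (prodWeight fun _ : Fin m => P.pU₁₁) fun u =>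
      expect (prodWeight fun j => P.pX₁₂ (u j) (x j)) fun a =>
      ind (P.Typ₁ ε x u a v z)) ≤ (2 : ℝ) ^ (-(m * (P.i₆ - δ))) := by
  filter_upwards [packing_of_map P.joint_mem
    (fun ω => (P.rX₁₁ ω, P.rU₁₁ ω, P.rX₁₂ ω, P.rU₂₁ ω, P.rY₁₂ ω)) (fun ω => (P.rX₁₁ ω, P.rU₁₁ ω, P.rX₁₂ ω)) P.rY₁₂
    P.rU₂₁ (fun (x, u, a, v, z) => ((x, u, a), z, v)) (fun _ => rfl)
    (r := fun v (x, u, a) => P.pX₁₁ x * (P.pU₁₁ u * P.pX₁₂ u x a)) (fun (x, u, a) v => P.condLaw_X₁₁_U₁₁_X₁₂_given_U₂₁ x u a v)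
    (fun _ _ => mul_nonneg (P.pX₁₁.2.1 _) (mul_nonneg (P.pU₁₁.2.1 _) ((P.pX₁₂ _ _).2.1 _))) hδ] with ε h m v z
  have := h m z (fun j => v j) (fun w j => ((w j).1, (w j).2.1, (w j).2.2, v j, z j)) (fun _ _ => rfl)
  refine (expect_prodWeight_triple (fun _ => P.pX₁₁)
    (fun _ _ => P.pU₁₁)
    (fun _ x u => P.pX₁₂ u x)
    (fun w => ind (IsTypical ε _ fun j => ((w j).1, (w j).2.1, (w j).2.2, v j, z j)))).trans_le ?_
  exact this

theorem condLaw_X₁₂_U₂₁_given_X₁₁_U₁₁ (x : W.X₁₁) (u : P.U₁₁) (a : W.X₁₂) (v : P.U₂₁) :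
    (P.pX₁₂ u x a * P.pU₂₁ v) * pmfOf P.joint (fun ω => (P.rX₁₁ ω, P.rU₁₁ ω)) (x, u) =
      pmfOf P.joint (fun ω => ((P.rX₁₂ ω, P.rU₂₁ ω), (P.rX₁₁ ω, P.rU₁₁ ω))) ((a, v), (x, u)) := by
  have h := pmfOf_of_injective P.joint (fun ω => (P.rX₁₁ ω, P.rU₁₁ ω, P.rX₁₂ ω, P.rU₂₁ ω))
    (e := fun (x, u, a, v) => ((a, v), (x, u)))
    (by rintro ⟨x, u, a, v⟩ ⟨x', u', a', v'⟩ h; simp only [Prod.mk.injEq] at h ⊢; tauto)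
    (x, u, a, v)
  refine Eq.trans ?_ h.symm
  rw [pmfOf_inputs, pmfOf_X₁₁_U₁₁]
  ring

theorem packing₇ {δ : ℝ} (hδ : 0 < δ) : ∀ᶠ ε in 𝓝[>] (0 : ℝ),
    ∀ (m : ℕ) (x : Fin m → W.X₁₁) (u : Fin m → P.U₁₁) (z : Fin m → W.Y₁₂),
      (expect (prodWeight fun j => P.pX₁₂ (u j) (x j)) fun a =>
      expect (prodWeight fun _ : Fin m => P.pU₂₁) fun v =>
      ind (P.Typ₁ ε x u a v z)) ≤ (2 : ℝ) ^ (-(m * (P.i₇ - δ))) := by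
  filter_upwards [packing_of_map P.joint_mem
    (fun ω => (P.rX₁₁ ω, P.rU₁₁ ω, P.rX₁₂ ω, P.rU₂₁ ω, P.rY₁₂ ω)) (fun ω => (P.rX₁₂ ω, P.rU₂₁ ω)) P.rY₁₂
    (fun ω => (P.rX₁₁ ω, P.rU₁₁ ω)) (fun (x, u, a, v, z) => ((a, v), z, (x, u))) (fun _ => rfl)
    (r := fun (x, u) (a, v) => P.pX₁₂ u x a * P.pU₂₁ v) (fun (a, v) (x, u) => P.condLaw_X₁₂_U₂₁_given_X₁₁_U₁₁ x u a v)
    (fun _ _ => mul_nonneg ((P.pX₁₂ _ _).2.1 _) (P.pU₂₁.2.1 _)) hδ] with ε h m x u z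
  have := h m z (fun j => (x j, u j)) (fun w j => (x j, u j, (w j).1, (w j).2, z j)) (fun _ _ => rfl)
  refine (expect_prodWeight_pair (fun j => P.pX₁₂ (u j) (x j))
    (fun _ _ => P.pU₂₁)
    (fun w => ind (IsTypical ε _ fun j => (x j, u j, (w j).1, (w j).2, z j)))).trans_le ?_
  exact this

theorem condLaw_X₁₁_X₁₂_U₂₁_given_U₁₁ (x : W.X₁₁) (u : P.U₁₁) (a : W.X₁₂) (v : P.U₂₁) :
    (P.pX₁₁ x * (P.pX₁₂ u x a * P.pU₂₁ v)) * pmfOf P.joint P.rU₁₁ u =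
      pmfOf P.joint (fun ω => ((P.rX₁₁ ω, P.rX₁₂ ω, P.rU₂₁ ω), P.rU₁₁ ω)) ((x, a, v), u) := by
  have h := pmfOf_of_injective P.joint (fun ω => (P.rX₁₁ ω, P.rU₁₁ ω, P.rX₁₂ ω, P.rU₂₁ ω))
    (e := fun (x, u, a, v) => ((x, a, v), u))
    (by rintro ⟨x, u, a, v⟩ ⟨x', u', a', v'⟩ h; simp only [Prod.mk.injEq] at h ⊢; tauto)
    (x, u, a, v)
  refine Eq.trans ?_ h.symm
  rw [pmfOf_inputs, pmfOf_U₁₁]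
  ring

theorem packing₈ {δ : ℝ} (hδ : 0 < δ) : ∀ᶠ ε in 𝓝[>] (0 : ℝ),
    ∀ (m : ℕ) (u : Fin m → P.U₁₁) (z : Fin m → W.Y₁₂),
      (expect (prodWeight fun _ : Fin m => P.pX₁₁) fun x =>
      expect (prodWeight fun j => P.pX₁₂ (u j) (x j)) fun a =>
      expect (prodWeight fun _ : Fin m => P.pU₂₁) fun v =>
      ind (P.Typ₁ ε x u a v z)) ≤ (2 : ℝ) ^ (-(m * (P.i₈ - δ))) := by
  filter_upwards [packing_of_map P.joint_mem
    (fun ω => (P.rX₁₁ ω, P.rU₁₁ ω, P.rX₁₂ ω, P.rU₂₁ ω, P.rY₁₂ ω)) (fun ω => (P.rX₁₁ ω, P.rX₁₂ ω, P.rU₂₁ ω)) P.rY₁₂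
    P.rU₁₁ (fun (x, u, a, v, z) => ((x, a, v), z, u)) (fun _ => rfl)
    (r := fun u (x, a, v) => P.pX₁₁ x * (P.pX₁₂ u x a * P.pU₂₁ v)) (fun (x, a, v) u => P.condLaw_X₁₁_X₁₂_U₂₁_given_U₁₁ x u a v)
    (fun _ _ => mul_nonneg (P.pX₁₁.2.1 _) (mul_nonneg ((P.pX₁₂ _ _).2.1 _) (P.pU₂₁.2.1 _))) hδ] with ε h m u z
  have := h m z (fun j => u j) (fun w j => ((w j).1, u j, (w j).2.1, (w j).2.2, z j)) (fun _ _ => rfl)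
  refine (expect_prodWeight_triple (fun _ => P.pX₁₁)
    (fun j x => P.pX₁₂ (u j) x)
    (fun _ _ _ => P.pU₂₁)
    (fun w => ind (IsTypical ε _ fun j => ((w j).1, u j, (w j).2.1, (w j).2.2, z j)))).trans_le ?_
  exact this

theorem condLaw_U₁₁_X₁₂_U₂₁_given_X₁₁ (x : W.X₁₁) (u : P.U₁₁) (a : W.X₁₂) (v : P.U₂₁) :
    (P.pU₁₁ u * (P.pX₁₂ u x a * P.pU₂₁ v)) * pmfOf P.joint P.rX₁₁ x =
      pmfOf P.joint (fun ω => ((P.rU₁₁ ω, P.rX₁₂ ω, P.rU₂₁ ω), P.rX₁₁ ω)) ((u, a, v), x) := by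
  have h := pmfOf_of_injective P.joint (fun ω => (P.rX₁₁ ω, P.rU₁₁ ω, P.rX₁₂ ω, P.rU₂₁ ω))
    (e := fun (x, u, a, v) => ((u, a, v), x))
    (by rintro ⟨x, u, a, v⟩ ⟨x', u', a', v'⟩ h; simp only [Prod.mk.injEq] at h ⊢; tauto)
    (x, u, a, v)
  refine Eq.trans ?_ h.symm
  rw [pmfOf_inputs, pmfOf_X₁₁]
  ring

theorem packing₉ {δ : ℝ} (hδ : 0 < δ) : ∀ᶠ ε in 𝓝[>] (0 : ℝ),
    ∀ (m : ℕ) (x : Fin m → W.X₁₁) (z : Fin m → W.Y₁₂),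
      (expect (prodWeight fun _ : Fin m => P.pU₁₁) fun u =>
      expect (prodWeight fun j => P.pX₁₂ (u j) (x j)) fun a =>
      expect (prodWeight fun _ : Fin m => P.pU₂₁) fun v =>
      ind (P.Typ₁ ε x u a v z)) ≤ (2 : ℝ) ^ (-(m * (P.i₉ - δ))) := by
  filter_upwards [packing_of_map P.joint_mem
    (fun ω => (P.rX₁₁ ω, P.rU₁₁ ω, P.rX₁₂ ω, P.rU₂₁ ω, P.rY₁₂ ω)) (fun ω => (P.rU₁₁ ω, P.rX₁₂ ω, P.rU₂₁ ω)) P.rY₁₂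
    P.rX₁₁ (fun (x, u, a, v, z) => ((u, a, v), z, x)) (fun _ => rfl)
    (r := fun x (u, a, v) => P.pU₁₁ u * (P.pX₁₂ u x a * P.pU₂₁ v)) (fun (u, a, v) x => P.condLaw_U₁₁_X₁₂_U₂₁_given_X₁₁ x u a v)
    (fun _ _ => mul_nonneg (P.pU₁₁.2.1 _) (mul_nonneg ((P.pX₁₂ _ _).2.1 _) (P.pU₂₁.2.1 _))) hδ] with ε h m x z
  have := h m z (fun j => x j) (fun w j => (x j, (w j).1, (w j).2.1, (w j).2.2, z j)) (fun _ _ => rfl)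
  refine (expect_prodWeight_triple (fun _ => P.pU₁₁)
    (fun j u => P.pX₁₂ u (x j))
    (fun _ _ _ => P.pU₂₁)
    (fun w => ind (IsTypical ε _ fun j => (x j, (w j).1, (w j).2.1, (w j).2.2, z j)))).trans_le ?_
  exact this

theorem condLaw_X₁₁_U₁₁_X₁₂_U₂₁ (x : W.X₁₁) (u : P.U₁₁) (a : W.X₁₂) (v : P.U₂₁) :
    (P.pX₁₁ x * (P.pU₁₁ u * (P.pX₁₂ u x a * P.pU₂₁ v))) * pmfOf P.joint (fun _ => ()) () =
      pmfOf P.joint (fun ω => ((P.rX₁₁ ω, P.rU₁₁ ω, P.rX₁₂ ω, P.rU₂₁ ω), ())) ((x, u, a, v), ()) := by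
  have h := pmfOf_of_injective P.joint (fun ω => (P.rX₁₁ ω, P.rU₁₁ ω, P.rX₁₂ ω, P.rU₂₁ ω))
    (e := fun (x, u, a, v) => ((x, u, a, v), ()))
    (by rintro ⟨x, u, a, v⟩ ⟨x', u', a', v'⟩ h; simp only [Prod.mk.injEq] at h ⊢; tauto)
    (x, u, a, v)
  refine Eq.trans ?_ h.symm
  rw [pmfOf_inputs, pmfOf_eq_expect, expect_const P.joint_mem, ind_of rfl]
  ring

theorem packing₁₀ {δ : ℝ} (hδ : 0 < δ) : ∀ᶠ ε in 𝓝[>] (0 : ℝ),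
    ∀ (m : ℕ) (z : Fin m → W.Y₁₂),
      (expect (prodWeight fun _ : Fin m => P.pX₁₁) fun x =>
      expect (prodWeight fun _ : Fin m => P.pU₁₁) fun u =>
      expect (prodWeight fun j => P.pX₁₂ (u j) (x j)) fun a =>
      expect (prodWeight fun _ : Fin m => P.pU₂₁) fun v =>
      ind (P.Typ₁ ε x u a v z)) ≤ (2 : ℝ) ^ (-(m * (P.i₁₀ - δ))) := by
  filter_upwards [packing_of_map P.joint_mem
    (fun ω => (P.rX₁₁ ω, P.rU₁₁ ω, P.rX₁₂ ω, P.rU₂₁ ω, P.rY₁₂ ω)) (fun ω => (P.rX₁₁ ω, P.rU₁₁ ω, P.rX₁₂ ω, P.rU₂₁ ω)) P.rY₁₂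
    (fun _ => ()) (fun (x, u, a, v, z) => ((x, u, a, v), z, ())) (fun _ => rfl)
    (r := fun _ (x, u, a, v) => P.pX₁₁ x * (P.pU₁₁ u * (P.pX₁₂ u x a * P.pU₂₁ v))) (fun (x, u, a, v) _ => P.condLaw_X₁₁_U₁₁_X₁₂_U₂₁ x u a v)
    (fun _ _ => mul_nonneg (P.pX₁₁.2.1 _) (mul_nonneg (P.pU₁₁.2.1 _) (mul_nonneg ((P.pX₁₂ _ _).2.1 _) (P.pU₂₁.2.1 _)))) hδ] with ε h m  z
  have := h m z (fun _ => ()) (fun w j => ((w j).1, (w j).2.1, (w j).2.2.1, (w j).2.2.2, z j)) (fun _ _ => rfl)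
  -- When no codeword is correct, the conditioning is on a one-point variable.
  rw [← mutualInfo_eq_condMutualInfo P.joint_mem] at this
  refine (expect_prodWeight_quadruple (fun _ => P.pX₁₁)
    (fun _ _ => P.pU₁₁)
    (fun _ x u => P.pX₁₂ u x)
    (fun _ _ _ _ => P.pU₂₁)
    (fun w => ind (IsTypical ε _ fun j => ((w j).1, (w j).2.1, (w j).2.2.1, (w j).2.2.2, z j)))).trans_le ?_
  exact this

/-- Bins are filled without regard to `x₁₁`, so `u₂₂` is drawn from the averaged law `pU₂₂'`. Given
`U₂₁`, the variable `U₂₂` does not depend on `U₁₁`. -/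
theorem condLaw_U₂₂_given_U₂₁_U₁₁ (u : P.U₁₁) (v : P.U₂₁) (s : P.U₂₂) :
    (P.pU₂₂' v s) * pmfOf P.joint (fun ω => (P.rU₂₁ ω, P.rU₁₁ ω)) (v, u) =
      pmfOf P.joint (fun ω => (P.rU₂₂ ω, (P.rU₂₁ ω, P.rU₁₁ ω))) (s, (v, u)) := by
  have h := pmfOf_of_injective P.joint (fun ω => (P.rU₁₁ ω, P.rU₂₁ ω, P.rU₂₂ ω))
    (e := fun (u, v, s) => (s, (v, u)))
    (by rintro ⟨u, v, s⟩ ⟨u', v', s'⟩ h; simp only [Prod.mk.injEq] at h ⊢; tauto)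
    (u, v, s)
  have h' := pmfOf_of_injective P.joint (fun ω => (P.rU₁₁ ω, P.rU₂₁ ω)) (e := fun (u, v) => (v, u))
    (by rintro ⟨u, v⟩ ⟨u', v'⟩ h; simp only [Prod.mk.injEq] at h ⊢; tauto) (u, v)
  refine Eq.trans ?_ h.symm
  refine (congrArg _ h').trans ?_
  rw [pmfOf_U₁₁_U₂₁_U₂₂, pmfOf_U₁₁_U₂₁]
  ring

/-- For the second destination a wrong `u₂₁` makes `u₂₂` fresh as well. The four patterns are `u₂₂`
or `(u₂₁, u₂₂)` wrong, first with `u₁₁` correct and then with `u₁₁` wrong. -/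
theorem packing₁₁ {δ : ℝ} (hδ : 0 < δ) : ∀ᶠ ε in 𝓝[>] (0 : ℝ),
    ∀ (m : ℕ) (u : Fin m → P.U₁₁) (v : Fin m → P.U₂₁) (z : Fin m → W.Y₂₂),
      (expect (prodWeight fun j => P.pU₂₂' (v j)) fun s =>
      ind (P.Typ₂ ε u v s z)) ≤ (2 : ℝ) ^ (-(m * (P.i₁₁ - δ))) := by
  filter_upwards [packing_of_map P.joint_mem
    (fun ω => (P.rU₁₁ ω, P.rU₂₁ ω, P.rU₂₂ ω, P.rY₂₂ ω)) P.rU₂₂ P.rY₂₂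
    (fun ω => (P.rU₂₁ ω, P.rU₁₁ ω)) (fun (u, v, s, z) => (s, z, (v, u))) (fun _ => rfl)
    (r := fun (v, u) s => P.pU₂₂' v s) (fun s (v, u) => P.condLaw_U₂₂_given_U₂₁_U₁₁ u v s)
    (fun _ _ => (P.pU₂₂'_mem _).1 _) hδ] with ε h m u v z
  have := h m z (fun j => (v j, u j)) (fun w j => (u j, v j, w j, z j)) (fun _ _ => rfl)
  exact this

theorem condLaw_U₂₁_U₂₂_given_U₁₁ (u : P.U₁₁) (v : P.U₂₁) (s : P.U₂₂) :
    (P.pU₂₁ v * P.pU₂₂' v s) * pmfOf P.joint P.rU₁₁ u =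
      pmfOf P.joint (fun ω => ((P.rU₂₁ ω, P.rU₂₂ ω), P.rU₁₁ ω)) ((v, s), u) := by
  have h := pmfOf_of_injective P.joint (fun ω => (P.rU₁₁ ω, P.rU₂₁ ω, P.rU₂₂ ω))
    (e := fun (u, v, s) => ((v, s), u))
    (by rintro ⟨u, v, s⟩ ⟨u', v', s'⟩ h; simp only [Prod.mk.injEq] at h ⊢; tauto)
    (u, v, s)
  refine Eq.trans ?_ h.symm
  rw [pmfOf_U₁₁_U₂₁_U₂₂, pmfOf_U₁₁]
  ring

theorem packing₁₂ {δ : ℝ} (hδ : 0 < δ) : ∀ᶠ ε in 𝓝[>] (0 : ℝ),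
    ∀ (m : ℕ) (u : Fin m → P.U₁₁) (z : Fin m → W.Y₂₂),
      (expect (prodWeight fun _ : Fin m => P.pU₂₁) fun v =>
      expect (prodWeight fun j => P.pU₂₂' (v j)) fun s =>
      ind (P.Typ₂ ε u v s z)) ≤ (2 : ℝ) ^ (-(m * (P.i₁₂ - δ))) := by
  filter_upwards [packing_of_map P.joint_mem
    (fun ω => (P.rU₁₁ ω, P.rU₂₁ ω, P.rU₂₂ ω, P.rY₂₂ ω)) (fun ω => (P.rU₂₁ ω, P.rU₂₂ ω)) P.rY₂₂
    P.rU₁₁ (fun (u, v, s, z) => ((v, s), z, u)) (fun _ => rfl)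
    (r := fun u (v, s) => P.pU₂₁ v * P.pU₂₂' v s) (fun (v, s) u => P.condLaw_U₂₁_U₂₂_given_U₁₁ u v s)
    (fun _ _ => mul_nonneg (P.pU₂₁.2.1 _) ((P.pU₂₂'_mem _).1 _)) hδ] with ε h m u z
  have := h m z (fun j => u j) (fun w j => (u j, (w j).1, (w j).2, z j)) (fun _ _ => rfl)
  refine (expect_prodWeight_pair (fun _ => P.pU₂₁)
    (fun _ v => P.pU₂₂' v)
    (fun w => ind (IsTypical ε _ fun j => (u j, (w j).1, (w j).2, z j)))).trans_le ?_
  exact this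

theorem condLaw_U₁₁_U₂₂_given_U₂₁ (u : P.U₁₁) (v : P.U₂₁) (s : P.U₂₂) :
    (P.pU₁₁ u * P.pU₂₂' v s) * pmfOf P.joint P.rU₂₁ v =
      pmfOf P.joint (fun ω => ((P.rU₁₁ ω, P.rU₂₂ ω), P.rU₂₁ ω)) ((u, s), v) := by
  have h := pmfOf_of_injective P.joint (fun ω => (P.rU₁₁ ω, P.rU₂₁ ω, P.rU₂₂ ω))
    (e := fun (u, v, s) => ((u, s), v))
    (by rintro ⟨u, v, s⟩ ⟨u', v', s'⟩ h; simp only [Prod.mk.injEq] at h ⊢; tauto)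
    (u, v, s)
  refine Eq.trans ?_ h.symm
  rw [pmfOf_U₁₁_U₂₁_U₂₂, pmfOf_U₂₁]
  ring

theorem packing₁₃ {δ : ℝ} (hδ : 0 < δ) : ∀ᶠ ε in 𝓝[>] (0 : ℝ),
    ∀ (m : ℕ) (v : Fin m → P.U₂₁) (z : Fin m → W.Y₂₂),
      (expect (prodWeight fun _ : Fin m => P.pU₁₁) fun u =>
      expect (prodWeight fun j => P.pU₂₂' (v j)) fun s =>
      ind (P.Typ₂ ε u v s z)) ≤ (2 : ℝ) ^ (-(m * (P.i₁₃ - δ))) := by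
  filter_upwards [packing_of_map P.joint_mem
    (fun ω => (P.rU₁₁ ω, P.rU₂₁ ω, P.rU₂₂ ω, P.rY₂₂ ω)) (fun ω => (P.rU₁₁ ω, P.rU₂₂ ω)) P.rY₂₂
    P.rU₂₁ (fun (u, v, s, z) => ((u, s), z, v)) (fun _ => rfl)
    (r := fun v (u, s) => P.pU₁₁ u * P.pU₂₂' v s) (fun (u, s) v => P.condLaw_U₁₁_U₂₂_given_U₂₁ u v s)
    (fun _ _ => mul_nonneg (P.pU₁₁.2.1 _) ((P.pU₂₂'_mem _).1 _)) hδ] with ε h m v z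
  have := h m z (fun j => v j) (fun w j => ((w j).1, v j, (w j).2, z j)) (fun _ _ => rfl)
  refine (expect_prodWeight_pair (fun _ => P.pU₁₁)
    (fun j _ => P.pU₂₂' (v j))
    (fun w => ind (IsTypical ε _ fun j => ((w j).1, v j, (w j).2, z j)))).trans_le ?_
  exact this

theorem condLaw_U₁₁_U₂₁_U₂₂ (u : P.U₁₁) (v : P.U₂₁) (s : P.U₂₂) :
    (P.pU₁₁ u * (P.pU₂₁ v * P.pU₂₂' v s)) * pmfOf P.joint (fun _ => ()) () =
      pmfOf P.joint (fun ω => ((P.rU₁₁ ω, P.rU₂₁ ω, P.rU₂₂ ω), ())) ((u, v, s), ()) := by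
  have h := pmfOf_of_injective P.joint (fun ω => (P.rU₁₁ ω, P.rU₂₁ ω, P.rU₂₂ ω))
    (e := fun (u, v, s) => ((u, v, s), ()))
    (by rintro ⟨u, v, s⟩ ⟨u', v', s'⟩ h; simp only [Prod.mk.injEq] at h ⊢; tauto)
    (u, v, s)
  refine Eq.trans ?_ h.symm
  rw [pmfOf_U₁₁_U₂₁_U₂₂, pmfOf_eq_expect, expect_const P.joint_mem, ind_of rfl]
  ring

theorem packing₁₄ {δ : ℝ} (hδ : 0 < δ) : ∀ᶠ ε in 𝓝[>] (0 : ℝ),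
    ∀ (m : ℕ) (z : Fin m → W.Y₂₂),
      (expect (prodWeight fun _ : Fin m => P.pU₁₁) fun u =>
      expect (prodWeight fun _ : Fin m => P.pU₂₁) fun v =>
      expect (prodWeight fun j => P.pU₂₂' (v j)) fun s =>
      ind (P.Typ₂ ε u v s z)) ≤ (2 : ℝ) ^ (-(m * (P.i₁₄ - δ))) := by
  filter_upwards [packing_of_map P.joint_mem
    (fun ω => (P.rU₁₁ ω, P.rU₂₁ ω, P.rU₂₂ ω, P.rY₂₂ ω)) (fun ω => (P.rU₁₁ ω, P.rU₂₁ ω, P.rU₂₂ ω)) P.rY₂₂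
    (fun _ => ()) (fun (u, v, s, z) => ((u, v, s), z, ())) (fun _ => rfl)
    (r := fun _ (u, v, s) => P.pU₁₁ u * (P.pU₂₁ v * P.pU₂₂' v s)) (fun (u, v, s) _ => P.condLaw_U₁₁_U₂₁_U₂₂ u v s)
    (fun _ _ => mul_nonneg (P.pU₁₁.2.1 _) (mul_nonneg (P.pU₂₁.2.1 _) ((P.pU₂₂'_mem _).1 _))) hδ] with ε h m  z
  have := h m z (fun _ => ()) (fun w j => ((w j).1, (w j).2.1, (w j).2.2, z j)) (fun _ _ => rfl)
  rw [← mutualInfo_eq_condMutualInfo P.joint_mem] at this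
  refine (expect_prodWeight_triple (fun _ => P.pU₁₁)
    (fun _ _ => P.pU₂₁)
    (fun _ _ v => P.pU₂₂' v)
    (fun w => ind (IsTypical ε _ fun j => ((w j).1, (w j).2.1, (w j).2.2, z j)))).trans_le ?_
  exact this

end HKInput

end

/-! ### Typicality of the true codewords and outputs -/

noncomputable section

open Filter Topology

/-- Sequences of independent letters are typical with high probability. -/
theorem typicality_of_iid {A : Type*} [Fintype A] {q : A → ℝ} (hq : q ∈ stdSimplex ℝ A) {ε : ℝ}
    (hε : 0 < ε) : ∃ K : ℝ, 0 ≤ K ∧ ∀ m : ℕ,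
      expect (prodWeight fun _ : Fin m => q) (fun a => ind (¬ IsTypical ε q a)) ≤ K / m := by
  -- The side sequence is constant over a one-letter alphabet, hence typical even with tolerance
  -- zero.
  obtain ⟨K, hK, h⟩ := conditional_typicality (q := fun x : A × Unit => q x.1) (qD := fun _ => 1)
    (κ := fun _ => q) (fun _ => zero_le_one) (fun x => hq.1 _) (fun a d => (mul_one _).symm) hε
  refine ⟨K, hK, fun m => ?_⟩
  have h1 := h m (fun _ => ()) (isTypical_iff.2 fun a => by simp [ind]) (fun _ => hq)
  refine le_trans (expect_mono (prodWeight_mem fun _ => hq).1 fun a => ind_mono ?_) h1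
  intro ha ht
  refine ha ?_
  have h2 := ht.map Prod.fst
  have h3 : pmfOf (fun x : A × Unit => q x.1) Prod.fst = q := by
    ext a
    rw [pmfOf_eq_expect]
    classical
    simp [expect, ind, Fintype.sum_prod_type]
  rwa [h3] at h2

namespace HKInput

variable {W : HDChannel.{u}} (P : HKInput W)

theorem packing_Y {δ : ℝ} (hδ : 0 < δ) : ∀ᶠ ε in 𝓝[>] (0 : ℝ), ∀ (k : ℕ) (y : Fin k → W.Y),
    (expect (prodWeight fun _ : Fin k => P.pX₁₁) fun x => ind (P.TypY ε x y)) ≤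
      (2 : ℝ) ^ (-(k * (P.i₂ - δ))) := by
  filter_upwards [packing_of_map P.joint_mem (fun ω => (P.rX₁₁ ω, P.rY ω)) P.rX₁₁ P.rY
    (fun _ => ()) (fun (x, y) => (x, y, ())) (fun _ => rfl) (r := fun _ x => P.pX₁₁ x)
    (fun x _ => by
      rw [pmfOf_eq_expect P.joint (fun _ => ()), expect_const P.joint_mem, ind_of rfl, mul_one]
      exact (P.pmfOf_X₁₁ x).symm.trans (pmfOf_of_injective P.joint P.rX₁₁ (e := fun x => (x, ()))
        (fun _ _ h => (Prod.mk.inj h).1) x).symm)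
    (fun _ _ => P.pX₁₁.2.1 _) hδ] with ε h k y
  have := h k y (fun _ => ()) (fun x j => (x j, y j)) (fun _ _ => rfl)
  rwa [← mutualInfo_eq_condMutualInfo P.joint_mem] at this

theorem packing_Y₁₁ {δ : ℝ} (hδ : 0 < δ) : ∀ᶠ ε in 𝓝[>] (0 : ℝ), ∀ (k : ℕ) (y : Fin k → W.Y₁₁),
    (expect (prodWeight fun _ : Fin k => P.pX₁₁) fun x => ind (P.TypY₁₁ ε x y)) ≤
      (2 : ℝ) ^ (-(k * (P.iY₁₁ - δ))) := by
  filter_upwards [packing_of_map P.joint_mem (fun ω => (P.rX₁₁ ω, P.rY₁₁ ω)) P.rX₁₁ P.rY₁₁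
    (fun _ => ()) (fun (x, y) => (x, y, ())) (fun _ => rfl) (r := fun _ x => P.pX₁₁ x)
    (fun x _ => by
      rw [pmfOf_eq_expect P.joint (fun _ => ()), expect_const P.joint_mem, ind_of rfl, mul_one]
      exact (P.pmfOf_X₁₁ x).symm.trans (pmfOf_of_injective P.joint P.rX₁₁ (e := fun x => (x, ()))
        (fun _ _ h => (Prod.mk.inj h).1) x).symm)
    (fun _ _ => P.pX₁₁.2.1 _) hδ] with ε h k y
  have := h k y (fun _ => ()) (fun x j => (x j, y j)) (fun _ _ => rfl)
  rwa [← mutualInfo_eq_condMutualInfo P.joint_mem] at this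

/-- The typicality of the pair of codewords that conditional binning starts from. -/
abbrev TypPair (ε : ℝ) {m : ℕ} (x : Fin m → W.X₁₁) (v : Fin m → P.U₂₁) : Prop :=
  IsTypical ε (pmfOf P.joint fun ω => (P.rX₁₁ ω, P.rU₂₁ ω)) (fun j => (x j, v j))

theorem typicality_pair {ε : ℝ} (hε : 0 < ε) : ∃ K : ℝ, 0 ≤ K ∧ ∀ m : ℕ,
    (expect (prodWeight fun _ : Fin m => P.pX₁₁) fun x =>
      expect (prodWeight fun _ : Fin m => P.pU₂₁) fun v => ind (¬ P.TypPair ε x v)) ≤ K / m := by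
  obtain ⟨K, hK, h⟩ := typicality_of_iid
    (pmfOf_mem P.joint_mem fun ω => (P.rX₁₁ ω, P.rU₂₁ ω)) hε
  refine ⟨K, hK, fun m => le_trans (le_of_eq ?_) (h m)⟩
  refine (expect_prodWeight_pair (fun _ => P.pX₁₁) (fun _ _ => P.pU₂₁) (fun w => ind
    (¬ IsTypical ε (pmfOf P.joint fun ω => (P.rX₁₁ ω, P.rU₂₁ ω)) fun j =>
      ((w j).1, (w j).2)))).trans ?_
  congr 2
  ext j x
  exact (P.pmfOf_X₁₁_U₂₁ x.1 x.2).symm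

theorem pmfOf_X₁₁_outputs (x : W.X₁₁) (y : W.Y₁₁ × W.Y₂₁ × W.Y) :
    pmfOf P.joint (fun ω => (P.rX₁₁ ω, ω.2.2.2.2.2.2.1)) (x, y) = P.pX₁₁ x * W.phase1 x y := by
  rw [pmfOf_eq_expect, expect_joint]
  simp only [rX₁₁, Prod.mk.injEq, ind_and, expect_stdSimplex_const, expect_mul_left,
    expect_ind_mul, expect_ind]

/-- Both first-phase tests are projections of the typicality of `x₁₁` with all three outputs, so one
estimate serves the second sender and the first destination. -/
theorem typicality_phase1 {ε : ℝ} (hε : 0 < ε) : ∃ K : ℝ, 0 ≤ K ∧ ∀ k : ℕ,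
    (expect (prodWeight fun _ : Fin k => P.pX₁₁) fun x =>
      expect (prodWeight fun i => W.phase1 (x i)) fun y =>
        ind (¬ (P.TypY ε x (fun i => (y i).2.2) ∧ P.TypY₁₁ ε x (fun i => (y i).1)))) ≤ K / k := by
  obtain ⟨K, hK, h⟩ := typicality_of_iid
    (pmfOf_mem P.joint_mem fun ω => (P.rX₁₁ ω, ω.2.2.2.2.2.2.1)) hε
  refine ⟨K, hK, fun k => le_trans ?_ (h k)⟩
  refine (expect_prodWeight_pair (fun _ => P.pX₁₁) (fun _ x => W.phase1 x) (fun w => ind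
    (¬ (P.TypY ε (fun i => (w i).1) (fun i => (w i).2.2.2) ∧
      P.TypY₁₁ ε (fun i => (w i).1) (fun i => (w i).2.1))))).trans_le ?_
  have hw : (fun (_ : Fin k) (x : W.X₁₁ × W.Y₁₁ × W.Y₂₁ × W.Y) => P.pX₁₁ x.1 * W.phase1 x.1 x.2) =
      fun _ => pmfOf P.joint fun ω => (P.rX₁₁ ω, ω.2.2.2.2.2.2.1) := by
    ext j x
    exact (P.pmfOf_X₁₁_outputs x.1 x.2).symm
  rw [hw]
  refine expect_mono (prodWeight_mem fun _ => pmfOf_mem P.joint_mem _).1 fun w =>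
    ind_mono fun hn ht => hn ⟨?_, ?_⟩
  · have := ht.map fun x : W.X₁₁ × W.Y₁₁ × W.Y₂₁ × W.Y => (x.1, x.2.2.2)
    rwa [pmfOf_comp] at this
  · have := ht.map fun x : W.X₁₁ × W.Y₁₁ × W.Y₂₁ × W.Y => (x.1, x.2.1)
    rwa [pmfOf_comp] at this

theorem condLaw_U₂₂_given_U₂₁ (v : P.U₂₁) (s : P.U₂₂) :
    P.pU₂₂' v s * pmfOf P.joint P.rU₂₁ v =
      pmfOf P.joint (fun ω => (P.rU₂₂ ω, P.rU₂₁ ω)) (s, v) := by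
  have h := pmfOf_of_injective P.joint (fun ω => (P.rU₂₁ ω, P.rU₂₂ ω))
    (e := fun (v, s) => (s, v))
    (by rintro ⟨v, s⟩ ⟨v', s'⟩ h; simp only [Prod.mk.injEq] at h ⊢; tauto) (v, s)
  refine Eq.trans ?_ h.symm
  rw [pmfOf_U₂₁, pmfOf_eq_expect, expect_joint]
  simp only [rU₂₂, rU₂₁, Prod.mk.injEq, ind_and, expect_stdSimplex_const,
    expect_mul_left, expect_ind_mul, expect_ind, pU₂₂']
  ring

/-- `u₂₂` is drawn given `u₂₁` only; the exponent `I(U₂₂; X₁₁ | U₂₁)` is the price for imitating the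
dependence on `x₁₁`. -/
theorem covering_bin {δ : ℝ} (hδ : 0 < δ) : ∀ᶠ ε in 𝓝[>] (0 : ℝ), ∀ ε' < ε, ∃ K : ℝ, 0 ≤ K ∧
    ∀ (m : ℕ) (x : Fin m → W.X₁₁) (v : Fin m → P.U₂₁), P.TypPair ε' x v →
      (1 - K / m) * (2 : ℝ) ^ (-(m * (P.i₁ + δ))) ≤
        expect (prodWeight fun j => P.pU₂₂' (v j)) fun s => ind (P.TypBin ε x v s) := by
  filter_upwards [covering P.joint_mem P.rU₂₂ P.rX₁₁ P.rU₂₁ (r := P.pU₂₂')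
    (fun s v => P.condLaw_U₂₂_given_U₂₁ v s) hδ] with ε h ε' hε'
  obtain ⟨K, hK, h⟩ := h ε' hε'
  refine ⟨K, hK, fun m x v hxv => (h m x v hxv).trans ?_⟩
  refine expect_mono (prodWeight_mem fun j => P.pU₂₂'_mem _).1 fun s => ind_mono fun ht => ?_
  have := ht.map fun x : P.U₂₂ × W.X₁₁ × P.U₂₁ => (x.2.1, x.2.2, x.1)
  rwa [pmfOf_comp] at this

theorem pmfOf_inputs_outputs (x : W.X₁₁) (u : P.U₁₁) (a : W.X₁₂) (v : P.U₂₁) (s : P.U₂₂)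
    (t : W.X₂₂) (z : W.Y₁₂ × W.Y₂₂) :
    pmfOf P.joint (fun ω => (P.rX₁₁ ω, P.rU₁₁ ω, P.rX₁₂ ω, P.rU₂₁ ω, P.rU₂₂ ω,
      ω.2.2.2.2.2.1, ω.2.2.2.2.2.2.2)) (x, u, a, v, s, t, z) =
      P.pX₁₁ x * (P.pU₁₁ u * (P.pX₁₂ u x a * (P.pU₂₁ v * (P.pU₂₂ v x s *
        (P.pX₂₂ x v s t * W.phase2 a t z))))) := by
  rw [pmfOf_eq_expect, expect_joint]
  simp only [rX₁₁, rU₁₁, rX₁₂, rU₂₁, rU₂₂, Prod.mk.injEq, ind_and, expect_stdSimplex_const,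
    expect_mul_left, expect_ind_mul, expect_ind]

/-- Binning yields a typical triple `(x₁₁, u₂₁, u₂₂)` but not one with the right product law. Given
any typical triple, `u₁₁`, `x₁₂`, `x₂₂` and the outputs follow the correct kernel letter by letter,
so conditional typicality applies at the larger tolerance. Both decoding tests are projections of
the resulting joint typicality. -/
theorem typicality_phase2 {ε' ε : ℝ} (hε : ε' < ε) : ∃ K : ℝ, 0 ≤ K ∧ ∀ (m : ℕ)
    (x : Fin m → W.X₁₁) (v : Fin m → P.U₂₁) (s : Fin m → P.U₂₂), P.TypBin ε' x v s →
    (expect (prodWeight fun _ : Fin m => P.pU₁₁) fun u =>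
      expect (prodWeight fun j => P.pX₁₂ (u j) (x j)) fun a =>
      expect (prodWeight fun j => P.pX₂₂ (x j) (v j) (s j)) fun t =>
      expect (prodWeight fun j => W.phase2 (a j) (t j)) fun z =>
        ind (¬ (P.Typ₁ ε x u a v (fun j => (z j).1) ∧ P.Typ₂ ε u v s (fun j => (z j).2)))) ≤
      K / m := by
  set Δ : P.Outcome → (P.U₁₁ × W.X₁₂ × W.X₂₂ × (W.Y₁₂ × W.Y₂₂)) × (W.X₁₁ × P.U₂₁ × P.U₂₂) :=
    fun ω => ((P.rU₁₁ ω, P.rX₁₂ ω, ω.2.2.2.2.2.1, ω.2.2.2.2.2.2.2), P.rX₁₁ ω, P.rU₂₁ ω, P.rU₂₂ ω)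
  set κ : W.X₁₁ × P.U₂₁ × P.U₂₂ → P.U₁₁ × W.X₁₂ × W.X₂₂ × (W.Y₁₂ × W.Y₂₂) → ℝ := fun d a =>
    P.pU₁₁ a.1 * (P.pX₁₂ a.1 d.1 a.2.1 * (P.pX₂₂ d.1 d.2.1 d.2.2 a.2.2.1 *
      W.phase2 a.2.1 a.2.2.1 a.2.2.2)) with hκ
  have hκm : ∀ d, κ d ∈ stdSimplex ℝ _ := by
    intro d
    refine ⟨fun a => mul_nonneg (P.pU₁₁.2.1 _) (mul_nonneg ((P.pX₁₂ _ _).2.1 _)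
      (mul_nonneg ((P.pX₂₂ _ _ _).2.1 _) ((W.phase2 _ _).2.1 _))), ?_⟩
    simp only [hκ, Fintype.sum_prod_type, ← Finset.mul_sum]
    have e1 : ∀ a b, ∑ x, ∑ y, W.phase2 a b (x, y) = 1 := fun a b =>
      (Fintype.sum_prod_type _).symm.trans (W.phase2 a b).2.2
    have e2 : ∀ a b c, ∑ x, P.pX₂₂ a b c x = 1 := fun a b c => (P.pX₂₂ a b c).2.2
    have e3 : ∀ a b, ∑ x, P.pX₁₂ a b x = 1 := fun a b => (P.pX₁₂ a b).2.2
    have e4 : ∑ x, P.pU₁₁ x = 1 := P.pU₁₁.2.2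
    simp only [e1, e2, e3, e4, mul_one]
  obtain ⟨K, hK, h⟩ := conditional_typicality (q := pmfOf P.joint Δ)
    (qD := pmfOf P.joint fun ω => (P.rX₁₁ ω, P.rU₂₁ ω, P.rU₂₂ ω)) (κ := κ)
    (pmfOf_nonneg P.joint_mem.1 _) (pmfOf_nonneg P.joint_mem.1 _) (by
      rintro ⟨u, a, t, z⟩ ⟨x, v, s⟩
      refine (pmfOf_of_injective P.joint (fun ω => (P.rX₁₁ ω, P.rU₁₁ ω, P.rX₁₂ ω, P.rU₂₁ ω,
        P.rU₂₂ ω, ω.2.2.2.2.2.1, ω.2.2.2.2.2.2.2))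
        (e := fun (x, u, a, v, s, t, z) => ((u, a, t, z), (x, v, s))) ?_ (x, u, a, v, s, t, z)).trans ?_
      · rintro ⟨x, u, a, v, s, t, z⟩ ⟨x', u', a', v', s', t', z'⟩ h
        simp only [Prod.mk.injEq] at h ⊢
        tauto
      · rw [pmfOf_inputs_outputs, pmfOf_X₁₁_U₂₁_U₂₂]
        simp only [hκ]
        ring) hε
  refine ⟨K, hK, fun m x v s hb => le_trans ?_ (h m (fun j => (x j, v j, s j)) hb fun j => hκm _)⟩
  refine (expect_prodWeight_quadruple (fun _ => P.pU₁₁) (fun j u => P.pX₁₂ u (x j))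
    (fun j _ _ => P.pX₂₂ (x j) (v j) (s j)) (fun _ _ a t => W.phase2 a t) (fun w => ind
    (¬ (P.Typ₁ ε x (fun j => (w j).1) (fun j => (w j).2.1) v (fun j => (w j).2.2.2.1) ∧
      P.Typ₂ ε (fun j => (w j).1) v s (fun j => (w j).2.2.2.2))))).trans_le ?_
  refine expect_mono (prodWeight_mem fun j => hκm (x j, v j, s j)).1 fun w =>
    ind_mono fun hn ht => hn ⟨?_, ?_⟩
  · have := ht.map fun w => (w.2.1, w.1.1, w.1.2.1, w.2.2.1, w.1.2.2.2.1)
    rwa [pmfOf_comp] at this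
  · have := ht.map fun w => (w.1.1, w.2.2.1, w.2.2.2, w.1.2.2.2.2)
    rwa [pmfOf_comp] at this

end HKInput

end

/-! ### Union bound for a fixed code -/

noncomputable section

open Filter Topology

theorem uniqueOr_eq {A : Type*} {d a : A} {S : A → Prop} (h : S a) (h' : ∀ b, S b → b = a) :
    uniqueOr d S = a := by
  have hu : ∃! a, S a := ⟨a, h, h'⟩
  unfold uniqueOr
  rw [dif_pos hu]
  exact h' _ hu.choose_spec.1

/-- A unique-solution decoder that misses a valid candidate must have a second valid one. This
reduces decoding errors to counting wrong candidates. -/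
theorem exists_of_uniqueOr_ne {A : Type*} {d a : A} {S : A → Prop} (h : S a)
    (hne : uniqueOr d S ≠ a) : ∃ b, b ≠ a ∧ S b := by
  by_contra! hc
  exact hne (uniqueOr_eq h fun b hb => by_contra fun hba => hc b hba hb)

theorem someOr_spec {A : Type*} (d : A) {S : A → Prop} (h : ∃ a, S a) : S (someOr d S) := by
  unfold someOr
  rw [dif_pos h]
  exact h.choose_spec

theorem ind_exists_ne_le {A : Type*} [Fintype A] [DecidableEq A] (a : A) (p : A → Prop) :
    ind (∃ b, b ≠ a ∧ p b) ≤ ∑ b ∈ Finset.univ.filter (· ≠ a), ind (p b) := by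
  refine (ind_exists_le _).trans (le_of_eq ?_)
  rw [Finset.sum_filter]
  refine Finset.sum_congr rfl fun b _ => ?_
  rw [ind_and]
  split_ifs with h
  · rw [ind_of h, one_mul]
  · rw [ind_of_not h, zero_mul]

namespace HKScheme

variable {W : HDChannel.{u}} (s : HKScheme W)

/-- The law of the outputs of the first phase. -/
def law₁ (w₁₀ : Fin s.n₁₀) : (Fin s.k → W.Y₁₁ × W.Y₂₁ × W.Y) → ℝ :=
  prodWeight fun i => W.phase1 (s.x₁₁ w₁₀ i)

/-- The law of the outputs of the second phase if the second sender knows `w₁₀`. -/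
def law₂ (w₁₀ : Fin s.n₁₀) (w₁₁ : Fin s.n₁₁) (w₁₂ : Fin s.n₁₂) (w₂₁ : Fin s.n₂₁)
    (w₂₂ : Fin s.n₂₂) : (Fin s.m → W.Y₁₂ × W.Y₂₂) → ℝ :=
  prodWeight fun j => W.phase2 (s.x₁₂ w₁₀ w₁₁ w₁₂ j)
    (s.x₂₂ w₁₀ w₂₁ w₂₂ (s.binIndex w₁₀ w₂₁ w₂₂) j)

/-- The wrong message triples that pass the test of the first destination. -/
def wrong₁ (w : Fin s.n₁₀ × Fin s.n₁₁ × Fin s.n₁₂) (y : Fin s.k → W.Y₁₁ × W.Y₂₁ × W.Y)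
    (z : Fin s.m → W.Y₁₂ × W.Y₂₂) : ℝ :=
  ∑ w' ∈ Finset.univ.filter (· ≠ w), ∑ v,
    ind (s.P.Typ₁ s.εdec (s.x₁₁' w'.1) (s.u₁₁ w'.2.1) (s.x₁₂ w'.1 w'.2.1 w'.2.2) (s.u₂₁ v)
      (fun j => (z j).1) ∧ s.P.TypY₁₁ s.εdec (s.x₁₁ w'.1) (fun i => (y i).1))

/-- The wrong message pairs that pass the test of the second destination. -/
def wrong₂ (w : Fin s.n₂₁ × Fin s.n₂₂) (z : Fin s.m → W.Y₁₂ × W.Y₂₂) : ℝ :=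
  ∑ w' ∈ Finset.univ.filter (· ≠ w), ∑ w₁₁, ∑ v,
    ind (s.P.Typ₂ s.εdec (s.u₁₁ w₁₁) (s.u₂₁ w'.1) (s.u₂₂ w'.1 w'.2 v) (fun j => (z j).2))

theorem wrong₁_nonneg (w y z) : 0 ≤ s.wrong₁ w y z :=
  Finset.sum_nonneg fun _ _ => Finset.sum_nonneg fun _ _ => ind_nonneg _

theorem wrong₂_nonneg (w z) : 0 ≤ s.wrong₂ w z :=
  Finset.sum_nonneg fun _ _ => Finset.sum_nonneg fun _ _ => Finset.sum_nonneg fun _ _ =>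
    ind_nonneg _

/-- The decoder asks only for some `w₂₁`. Each `w₂₁` is counted separately because the correct and
the wrong ones lead to different exponents. -/
theorem ind_decode₁_ne_le (w : Fin s.n₁₀ × Fin s.n₁₁ × Fin s.n₁₂) (v : Fin s.n₂₁)
    (y : Fin s.k → W.Y₁₁ × W.Y₂₁ × W.Y) (z : Fin s.m → W.Y₁₂ × W.Y₂₂)
    (h₁ : s.P.Typ₁ s.εdec (s.x₁₁' w.1) (s.u₁₁ w.2.1) (s.x₁₂ w.1 w.2.1 w.2.2) (s.u₂₁ v)
      (fun j => (z j).1)) (h₂ : s.P.TypY₁₁ s.εdec (s.x₁₁ w.1) (fun i => (y i).1)) :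
    ind (s.decode₁ (fun i => (y i).1) (fun j => (z j).1) ≠ w) ≤ s.wrong₁ w y z := by
  classical
  refine (ind_mono fun h => ?_).trans ((ind_exists_ne_le w fun w' => ∃ v,
    (s.P.Typ₁ s.εdec (s.x₁₁' w'.1) (s.u₁₁ w'.2.1) (s.x₁₂ w'.1 w'.2.1 w'.2.2) (s.u₂₁ v)
      (fun j => (z j).1) ∧ s.P.TypY₁₁ s.εdec (s.x₁₁ w'.1) (fun i => (y i).1))).trans
    ?_)
  · obtain ⟨b, hb, hb'⟩ := exists_of_uniqueOr_ne (a := w) (by exact ⟨v, h₁, h₂⟩) h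
    exact ⟨b, hb, hb'⟩
  · refine le_of_eq_of_le ?_ (Finset.sum_le_sum fun w' _ => ind_exists_le _)
    exact Finset.sum_congr (by congr) fun _ _ => rfl

theorem ind_decode₂_ne_le (w : Fin s.n₂₁ × Fin s.n₂₂) (u : Fin s.n₁₁) (v : Fin s.nᵥ)
    (z : Fin s.m → W.Y₁₂ × W.Y₂₂)
    (h : s.P.Typ₂ s.εdec (s.u₁₁ u) (s.u₂₁ w.1) (s.u₂₂ w.1 w.2 v) (fun j => (z j).2)) :
    ind (s.decode₂ (fun j => (z j).2) ≠ w) ≤ s.wrong₂ w z := by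
  classical
  refine (ind_mono fun h' => ?_).trans ((ind_exists_ne_le w fun w' => ∃ w₁₁ v,
    s.P.Typ₂ s.εdec (s.u₁₁ w₁₁) (s.u₂₁ w'.1) (s.u₂₂ w'.1 w'.2 v) (fun j => (z j).2)).trans
    ?_)
  · obtain ⟨b, hb, hb'⟩ := exists_of_uniqueOr_ne (a := w) (by exact ⟨u, v, h⟩) h'
    exact ⟨b, hb, hb'⟩
  · refine le_of_eq_of_le ?_ (Finset.sum_le_sum fun w' _ => (ind_exists_le _).trans
      (Finset.sum_le_sum fun _ _ => ind_exists_le _))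
    exact Finset.sum_congr (by congr) fun _ _ => rfl

theorem law₁_mem (w₁₀) : s.law₁ w₁₀ ∈ stdSimplex ℝ _ := prodWeight_mem fun _ => (W.phase1 _).2

theorem law₂_mem (w₁₀ w₁₁ w₁₂ w₂₁ w₂₂) : s.law₂ w₁₀ w₁₁ w₁₂ w₂₁ w₂₂ ∈ stdSimplex ℝ _ :=
  prodWeight_mem fun _ => (W.phase2 _ _).2

/-- The union bound for the error probability of a code. -/
theorem errorProbAt_le (w₁₀ : Fin s.n₁₀) (w₁₁ : Fin s.n₁₁) (w₁₂ : Fin s.n₁₂) (w₂₁ : Fin s.n₂₁)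
    (w₂₂ : Fin s.n₂₂) :
    s.toCode.errorProbAt (w₁₀, w₁₁, w₁₂) (w₂₁, w₂₂) ≤
      expect (s.law₁ w₁₀) fun y =>
        (ind (¬ (s.P.TypY s.εdec (s.x₁₁ w₁₀) (fun i => (y i).2.2) ∧
          s.P.TypY₁₁ s.εdec (s.x₁₁ w₁₀) (fun i => (y i).1))) +
        ∑ w ∈ Finset.univ.filter (· ≠ w₁₀),
          ind (s.P.TypY s.εdec (s.x₁₁ w) (fun i => (y i).2.2))) +
        expect (s.law₂ w₁₀ w₁₁ w₁₂ w₂₁ w₂₂) fun z =>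
          (ind (¬ (s.P.Typ₁ s.εdec (s.x₁₁' w₁₀) (s.u₁₁ w₁₁) (s.x₁₂ w₁₀ w₁₁ w₁₂) (s.u₂₁ w₂₁)
            (fun j => (z j).1) ∧ s.P.Typ₂ s.εdec (s.u₁₁ w₁₁) (s.u₂₁ w₂₁)
              (s.u₂₂ w₂₁ w₂₂ (s.binIndex w₁₀ w₂₁ w₂₂)) (fun j => (z j).2))) +
          s.wrong₁ (w₁₀, w₁₁, w₁₂) y z) + s.wrong₂ (w₂₁, w₂₂) z := by
  classical
  have hsplit : s.toCode.errorProbAt (w₁₀, w₁₁, w₁₂) (w₂₁, w₂₂) =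
      expect (s.law₁ w₁₀) fun y => expect (prodWeight fun j => W.phase2 (s.x₁₂ w₁₀ w₁₁ w₁₂ j)
        (s.toCode.enc₂₂ (w₂₁, w₂₂) (fun i => (y i).2.2) j)) fun z =>
        ind (¬ (s.decode₁ (fun i => (y i).1) (fun j => (z j).1) = (w₁₀, w₁₁, w₁₂) ∧
          s.decode₂ (fun j => (z j).2) = (w₂₁, w₂₂))) := by
    unfold HDCode.errorProbAt expect
    refine Finset.sum_congr rfl fun y _ => ?_
    rw [Finset.mul_sum]
    refine Finset.sum_congr rfl fun z _ => ?_
    rw [← mul_assoc]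
    refine congrArg₂ (· * ·) rfl ?_
    split_ifs with h1
    · exact (ind_of_not (not_not.2 h1)).symm
    · exact (ind_of h1).symm
  rw [hsplit]
  refine expect_mono (s.law₁_mem w₁₀).1 fun y => ?_
  set G : (Fin s.m → W.Y₁₂ × W.Y₂₂) → ℝ := fun z =>
          (ind (¬ (s.P.Typ₁ s.εdec (s.x₁₁' w₁₀) (s.u₁₁ w₁₁) (s.x₁₂ w₁₀ w₁₁ w₁₂) (s.u₂₁ w₂₁)
            (fun j => (z j).1) ∧ s.P.Typ₂ s.εdec (s.u₁₁ w₁₁) (s.u₂₁ w₂₁)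
              (s.u₂₂ w₂₁ w₂₂ (s.binIndex w₁₀ w₂₁ w₂₂)) (fun j => (z j).2))) +
          s.wrong₁ (w₁₀, w₁₁, w₁₂) y z) + s.wrong₂ (w₂₁, w₂₂) z with hG
  have hG0 : 0 ≤ expect (s.law₂ w₁₀ w₁₁ w₁₂ w₂₁ w₂₂) G :=
    expect_nonneg (s.law₂_mem _ _ _ _ _).1 fun z =>
      add_nonneg (add_nonneg (ind_nonneg _) (s.wrong₁_nonneg _ _ _)) (s.wrong₂_nonneg _ _)
  have hS0 : 0 ≤ ∑ w ∈ Finset.univ.filter (· ≠ w₁₀),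
      ind (s.P.TypY s.εdec (s.x₁₁ w) (fun i => (y i).2.2)) :=
    Finset.sum_nonneg fun _ _ => ind_nonneg _
  have hle1 : expect (prodWeight fun j => W.phase2 (s.x₁₂ w₁₀ w₁₁ w₁₂ j)
        (s.toCode.enc₂₂ (w₂₁, w₂₂) (fun i => (y i).2.2) j)) (fun z =>
        ind (¬ (s.decode₁ (fun i => (y i).1) (fun j => (z j).1) = (w₁₀, w₁₁, w₁₂) ∧
          s.decode₂ (fun j => (z j).2) = (w₂₁, w₂₂)))) ≤ 1 :=
    expect_le_of_le (prodWeight_mem fun _ => (W.phase2 _ _).2) fun _ => ind_le_one _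
  -- If the true codeword fails a first-phase test, the first indicator is one. If the second sender
  -- decodes wrongly, some wrong `w₁₀` passes its test and the sum is at least one. Only otherwise
  -- do second-phase events matter, and then the output law is `law₂`.
  by_cases hA : s.P.TypY s.εdec (s.x₁₁ w₁₀) (fun i => (y i).2.2) ∧
      s.P.TypY₁₁ s.εdec (s.x₁₁ w₁₀) (fun i => (y i).1)
  swap
  · rw [ind_of hA]
    linarith
  by_cases hrel : s.relayDecode (fun i => (y i).2.2) = w₁₀
  · rw [ind_of_not (not_not.2 hA), zero_add]
    refine le_trans ?_ (le_add_of_nonneg_left hS0)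
    have hlaw : (prodWeight fun j => W.phase2 (s.x₁₂ w₁₀ w₁₁ w₁₂ j)
        (s.toCode.enc₂₂ (w₂₁, w₂₂) (fun i => (y i).2.2) j)) = s.law₂ w₁₀ w₁₁ w₁₂ w₂₁ w₂₂ := by
      unfold law₂ toCode
      simp only [hrel]
    rw [hlaw]
    refine expect_mono (s.law₂_mem _ _ _ _ _).1 fun z => ?_
    have h1 := s.wrong₁_nonneg (w₁₀, w₁₁, w₁₂) y z
    have h2 := s.wrong₂_nonneg (w₂₁, w₂₂) z
    simp only [hG]
    by_cases hB : s.P.Typ₁ s.εdec (s.x₁₁' w₁₀) (s.u₁₁ w₁₁) (s.x₁₂ w₁₀ w₁₁ w₁₂) (s.u₂₁ w₂₁)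
            (fun j => (z j).1) ∧ s.P.Typ₂ s.εdec (s.u₁₁ w₁₁) (s.u₂₁ w₂₁)
              (s.u₂₂ w₂₁ w₂₂ (s.binIndex w₁₀ w₂₁ w₂₂)) (fun j => (z j).2)
    · rw [ind_of_not (not_not.2 hB), zero_add]
      refine (ind_le_add fun h => not_and_or.1 h).trans (add_le_add ?_ ?_)
      · exact s.ind_decode₁_ne_le (w₁₀, w₁₁, w₁₂) w₂₁ y z hB.1 hA.2
      · exact s.ind_decode₂_ne_le (w₂₁, w₂₂) w₁₁ _ z hB.2
    · rw [ind_of hB]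
      have := ind_le_one (¬ (s.decode₁ (fun i => (y i).1) (fun j => (z j).1) = (w₁₀, w₁₁, w₁₂) ∧
          s.decode₂ (fun j => (z j).2) = (w₂₁, w₂₂)))
      linarith
  · have h1 : 1 ≤ ∑ w ∈ Finset.univ.filter (· ≠ w₁₀),
        ind (s.P.TypY s.εdec (s.x₁₁ w) (fun i => (y i).2.2)) := by
      rw [← ind_of (exists_of_uniqueOr_ne
        (S := fun w => s.P.TypY s.εdec (s.x₁₁ w) (fun i => (y i).2.2)) hA.1 hrel)]
      exact le_of_le_of_eq (ind_exists_ne_le w₁₀ fun w =>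
        s.P.TypY s.εdec (s.x₁₁ w) (fun i => (y i).2.2)) (Finset.sum_congr (by congr) fun _ _ => rfl)
    have := ind_nonneg (¬ (s.P.TypY s.εdec (s.x₁₁ w₁₀) (fun i => (y i).2.2) ∧
      s.P.TypY₁₁ s.εdec (s.x₁₁ w₁₀) (fun i => (y i).1)))
    linarith

end HKScheme

end

/-! ### Random codebooks with independent coordinates -/

noncomputable section

open Filter Topology

/-- Used to redraw several codewords of a candidate at once: the second replacement acts on the
result of the first, with independent new draws. -/
theorem Resamples.comp {Ω R₁ R₂ : Type*} [Fintype Ω] [Fintype R₁] [Fintype R₂] {μ : Ω → ℝ}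
    {r₁ : R₁ → ℝ} {r₂ : R₂ → ℝ} {upd₁ : Ω → R₁ → Ω} {upd₂ : Ω → R₂ → Ω}
    (h₁ : Resamples μ r₁ upd₁) (h₂ : Resamples μ r₂ upd₂) :
    Resamples μ (prodW r₁ r₂) (fun ω a => upd₂ (upd₁ ω a.1) a.2) := by
  intro f
  rw [h₂ f, h₁]
  simp only [expect_prodW]

/-- If a part of a random object does not enter the law of the output, it may be averaged for every
fixed output. -/
theorem Resamples.expect_law_le {Ω R Z : Type*} [Fintype Ω] [Fintype R] [Fintype Z] {μ : Ω → ℝ}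
    {r : R → ℝ} {upd : Ω → R → Ω} (h : Resamples μ r upd) (hμ : μ ∈ stdSimplex ℝ Ω)
    {law : Ω → Z → ℝ} (hlaw : ∀ ω, law ω ∈ stdSimplex ℝ Z) (hupd : ∀ ω a, law (upd ω a) = law ω)
    {f : Ω → Z → ℝ} {B : ℝ} (hB : ∀ ω z, expect r (fun a => f (upd ω a) z) ≤ B) :
    expect μ (fun ω => expect (law ω) (f ω)) ≤ B := by
  rw [h]
  refine expect_le_of_le hμ fun ω => ?_
  simp only [hupd]
  rw [expect_comm r (law ω) (fun a z => f (upd ω a) z)]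
  exact expect_le_of_le (hlaw ω) fun z => hB ω z

/-- The factor `g` does not see the redrawn part, so it survives the average while `f` is replaced
by its bound. -/
theorem Resamples.expect_mul_le {Ω R : Type*} [Fintype Ω] [Fintype R] {μ : Ω → ℝ}
    {r : R → ℝ} {upd : Ω → R → Ω} (h : Resamples μ r upd) (hμ : ∀ ω, 0 ≤ μ ω)
    {f g : Ω → ℝ} (hg : ∀ ω, 0 ≤ g ω) (hupd : ∀ ω a, g (upd ω a) = g ω) {B : ℝ}
    (hB : ∀ ω, expect r (fun a => f (upd ω a)) ≤ B) :
    expect μ (fun ω => f ω * g ω) ≤ B * expect μ g := by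
  rw [h, ← expect_mul_left]
  refine expect_mono hμ fun ω => ?_
  simp only [hupd, expect_mul_right]
  exact mul_le_mul_of_nonneg_right (hB ω) (hg ω)

/-- The lengths of the phases and the sizes of the message and index sets of a code. -/
structure HKSizes where
  (k m n₁₀ n₁₁ n₁₂ n₂₁ n₂₂ nᵥ : ℕ)
  [ne₁₀ : NeZero n₁₀] [ne₁₁ : NeZero n₁₁] [ne₁₂ : NeZero n₁₂] [ne₂₁ : NeZero n₂₁]
  [ne₂₂ : NeZero n₂₂] [neᵥ : NeZero nᵥ]

attribute [instance] HKSizes.ne₁₀ HKSizes.ne₁₁ HKSizes.ne₁₂ HKSizes.ne₂₁ HKSizes.ne₂₂ HKSizes.neᵥ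

/-- A table that assigns a letter to every argument. -/
def LetterTable (A B : Type*) : Type _ := A → B

open Classical in
instance {A B : Type*} [Fintype A] [Fintype B] : Fintype (LetterTable A B) :=
  inferInstanceAs (Fintype (A → B))

/-- The law of a sequence of tables with independent entries. -/
def tableLaw {A B : Type*} [Fintype A] (κ : A → B → ℝ) (m : ℕ) : (Fin m → LetterTable A B) → ℝ :=
  prodWeight fun _ => prodWeight κ

theorem tableLaw_mem {A B : Type*} [Fintype A] [Fintype B] {κ : A → B → ℝ}
    (hκ : ∀ a, κ a ∈ stdSimplex ℝ B) (m : ℕ) : tableLaw κ m ∈ stdSimplex ℝ _ := by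
  classical
  refine prodWeight_mem (A := LetterTable A B) fun _ => ?_
  exact prodWeight_mem hκ

theorem expect_tableLaw {A B : Type*} [Fintype A] [Fintype B] {κ : A → B → ℝ}
    (hκ : ∀ a, κ a ∈ stdSimplex ℝ B) {m : ℕ} (c : Fin m → A) (f : (Fin m → B) → ℝ) :
    expect (tableLaw κ m) (fun T => f fun j => T j (c j)) =
      expect (prodWeight fun j => κ (c j)) f := by
  classical
  exact expect_table hκ c f

namespace HKInput

variable {W : HDChannel.{u}} (P : HKInput W) (σ : HKSizes)

/-- The random tables from which the codebooks are made. A codeword that is superimposed on others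
consists of the values that a sequence of independent tables takes at the letters of the others. -/
structure Codebooks where
  /-- The first parts of the codewords `x₁₁`. -/
  x : Fin σ.n₁₀ → Fin σ.k → W.X₁₁
  /-- The second parts of the codewords `x₁₁`. -/
  x' : Fin σ.n₁₀ → Fin σ.m → W.X₁₁
  /-- The codewords `u₁₁`. -/
  u : Fin σ.n₁₁ → Fin σ.m → P.U₁₁
  /-- The tables for `x₁₂`. -/
  a : Fin σ.n₁₀ × Fin σ.n₁₁ × Fin σ.n₁₂ → Fin σ.m → LetterTable (P.U₁₁ × W.X₁₁) W.X₁₂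
  /-- The codewords `u₂₁`. -/
  v : Fin σ.n₂₁ → Fin σ.m → P.U₂₁
  /-- The tables for `u₂₂`. -/
  s : Fin σ.n₂₁ × Fin σ.n₂₂ → Fin σ.nᵥ → Fin σ.m → LetterTable P.U₂₁ P.U₂₂
  /-- The tables for `x₂₂`. -/
  t : Fin σ.n₁₀ × Fin σ.n₂₁ × Fin σ.n₂₂ × Fin σ.nᵥ → Fin σ.m →
    LetterTable (W.X₁₁ × P.U₂₁ × P.U₂₂) W.X₂₂

/-- The law of a sequence of independent letters `X₁₁`. -/
def seqX₁₁ (m : ℕ) : (Fin m → W.X₁₁) → ℝ := prodWeight fun _ => P.pX₁₁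

/-- The law of a sequence of independent letters `U₁₁`. -/
def seqU₁₁ (m : ℕ) : (Fin m → P.U₁₁) → ℝ := prodWeight fun _ => P.pU₁₁

/-- The law of a sequence of independent letters `U₂₁`. -/
def seqU₂₁ (m : ℕ) : (Fin m → P.U₂₁) → ℝ := prodWeight fun _ => P.pU₂₁

/-- The law of a sequence of tables for `X₁₂`. -/
def tabX₁₂ (m : ℕ) : (Fin m → LetterTable (P.U₁₁ × W.X₁₁) W.X₁₂) → ℝ :=
  tableLaw (fun c => P.pX₁₂ c.1 c.2) m

/-- The law of a sequence of tables for `U₂₂`. -/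
def tabU₂₂ (m : ℕ) : (Fin m → LetterTable P.U₂₁ P.U₂₂) → ℝ := tableLaw P.pU₂₂' m

/-- The law of a sequence of tables for `X₂₂`. -/
def tabX₂₂ (m : ℕ) : (Fin m → LetterTable (W.X₁₁ × P.U₂₁ × P.U₂₂) W.X₂₂) → ℝ :=
  tableLaw (fun c => P.pX₂₂ c.1 c.2.1 c.2.2) m

theorem seqX₁₁_mem (m : ℕ) : P.seqX₁₁ m ∈ stdSimplex ℝ _ := prodWeight_mem fun _ => P.pX₁₁.2

theorem seqU₁₁_mem (m : ℕ) : P.seqU₁₁ m ∈ stdSimplex ℝ _ := prodWeight_mem fun _ => P.pU₁₁.2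

theorem seqU₂₁_mem (m : ℕ) : P.seqU₂₁ m ∈ stdSimplex ℝ _ := prodWeight_mem fun _ => P.pU₂₁.2

theorem tabX₁₂_mem (m : ℕ) : P.tabX₁₂ m ∈ stdSimplex ℝ _ := tableLaw_mem (fun _ => (P.pX₁₂ _ _).2) m

theorem tabU₂₂_mem (m : ℕ) : P.tabU₂₂ m ∈ stdSimplex ℝ _ := tableLaw_mem P.pU₂₂'_mem m

theorem tabX₂₂_mem (m : ℕ) : P.tabX₂₂ m ∈ stdSimplex ℝ _ := tableLaw_mem (fun _ => (P.pX₂₂ _ _ _).2) m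

/-- With the lower codewords fixed, only one entry of each table is read, and it has the conditional
law that superposition requires. -/
theorem expect_tabX₁₂ {m : ℕ} (u : Fin m → P.U₁₁) (x : Fin m → W.X₁₁)
    (f : (Fin m → W.X₁₂) → ℝ) : expect (P.tabX₁₂ m) (fun T => f fun j => T j (u j, x j)) =
      expect (prodWeight fun j => P.pX₁₂ (u j) (x j)) f :=
  expect_tableLaw (κ := fun c : P.U₁₁ × W.X₁₁ => P.pX₁₂ c.1 c.2) (fun _ => (P.pX₁₂ _ _).2)
    (fun j => (u j, x j)) f

theorem expect_tabU₂₂ {m : ℕ} (v : Fin m → P.U₂₁) (f : (Fin m → P.U₂₂) → ℝ) :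
    expect (P.tabU₂₂ m) (fun T => f fun j => T j (v j)) =
      expect (prodWeight fun j => P.pU₂₂' (v j)) f :=
  expect_tableLaw P.pU₂₂'_mem v f

theorem expect_tabX₂₂ {m : ℕ} (x : Fin m → W.X₁₁) (v : Fin m → P.U₂₁) (s : Fin m → P.U₂₂)
    (f : (Fin m → W.X₂₂) → ℝ) : expect (P.tabX₂₂ m) (fun T => f fun j => T j (x j, v j, s j)) =
      expect (prodWeight fun j => P.pX₂₂ (x j) (v j) (s j)) f :=
  expect_tableLaw (κ := fun c : W.X₁₁ × P.U₂₁ × P.U₂₂ => P.pX₂₂ c.1 c.2.1 c.2.2)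
    (fun _ => (P.pX₂₂ _ _ _).2) (fun j => (x j, v j, s j)) f

/-- The codebooks as a tuple. -/
def codebooksEquiv : P.Codebooks σ ≃ (Fin σ.n₁₀ → Fin σ.k → W.X₁₁) × (Fin σ.n₁₀ → Fin σ.m → W.X₁₁) ×
    (Fin σ.n₁₁ → Fin σ.m → P.U₁₁) ×
    (Fin σ.n₁₀ × Fin σ.n₁₁ × Fin σ.n₁₂ → Fin σ.m → LetterTable (P.U₁₁ × W.X₁₁) W.X₁₂) ×
    (Fin σ.n₂₁ → Fin σ.m → P.U₂₁) ×
    (Fin σ.n₂₁ × Fin σ.n₂₂ → Fin σ.nᵥ → Fin σ.m → LetterTable P.U₂₁ P.U₂₂) ×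
    (Fin σ.n₁₀ × Fin σ.n₂₁ × Fin σ.n₂₂ × Fin σ.nᵥ → Fin σ.m →
      LetterTable (W.X₁₁ × P.U₂₁ × P.U₂₂) W.X₂₂) where
  toFun ω := (ω.x, ω.x', ω.u, ω.a, ω.v, ω.s, ω.t)
  invFun ω := ⟨ω.1, ω.2.1, ω.2.2.1, ω.2.2.2.1, ω.2.2.2.2.1, ω.2.2.2.2.2.1, ω.2.2.2.2.2.2⟩
  left_inv _ := rfl
  right_inv _ := rfl

set_option synthInstance.maxSize 1000 in
instance : Fintype (P.Codebooks σ) := Fintype.ofEquiv _ (P.codebooksEquiv σ).symm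

/-- The law of the tables. -/
def cbLaw (ω : P.Codebooks σ) : ℝ :=
  prodWeight (fun _ => P.seqX₁₁ σ.k) ω.x * (prodWeight (fun _ => P.seqX₁₁ σ.m) ω.x' *
  (prodWeight (fun _ => P.seqU₁₁ σ.m) ω.u * (prodWeight (fun _ => P.tabX₁₂ σ.m) ω.a *
  (prodWeight (fun _ => P.seqU₂₁ σ.m) ω.v *
  (prodWeight (fun _ => prodWeight fun _ => P.tabU₂₂ σ.m) ω.s *
  prodWeight (fun _ => P.tabX₂₂ σ.m) ω.t)))))

set_option synthInstance.maxSize 1000 in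
theorem expect_cbLaw (f : P.Codebooks σ → ℝ) : expect (P.cbLaw σ) f =
    expect (prodWeight fun _ => P.seqX₁₁ σ.k) fun x =>
    expect (prodWeight fun _ => P.seqX₁₁ σ.m) fun x' =>
    expect (prodWeight fun _ => P.seqU₁₁ σ.m) fun u =>
    expect (prodWeight fun _ => P.tabX₁₂ σ.m) fun a =>
    expect (prodWeight fun _ => P.seqU₂₁ σ.m) fun v =>
    expect (prodWeight fun _ => prodWeight fun _ => P.tabU₂₂ σ.m) fun s =>
    expect (prodWeight fun _ => P.tabX₂₂ σ.m) fun t => f ⟨x, x', u, a, v, s, t⟩ := by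
  have h : expect (P.cbLaw σ) f = ∑ c, P.cbLaw σ ((P.codebooksEquiv σ).symm c) *
      f ((P.codebooksEquiv σ).symm c) :=
    (Equiv.sum_comp (P.codebooksEquiv σ).symm fun ω => P.cbLaw σ ω * f ω).symm
  rw [h]
  simp only [Fintype.sum_prod_type, expect, Finset.mul_sum, cbLaw, codebooksEquiv,
    Equiv.coe_fn_symm_mk, mul_assoc]

theorem cbLaw_mem : P.cbLaw σ ∈ stdSimplex ℝ _ := by
  refine ⟨fun ω => ?_, ?_⟩
  · exact mul_nonneg ((prodWeight_mem fun _ => P.seqX₁₁_mem _).1 _) <|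
      mul_nonneg ((prodWeight_mem fun _ => P.seqX₁₁_mem _).1 _) <|
      mul_nonneg ((prodWeight_mem fun _ => P.seqU₁₁_mem _).1 _) <|
      mul_nonneg ((prodWeight_mem fun _ => P.tabX₁₂_mem _).1 _) <|
      mul_nonneg ((prodWeight_mem fun _ => P.seqU₂₁_mem _).1 _) <|
      mul_nonneg ((prodWeight_mem fun _ => prodWeight_mem fun _ => P.tabU₂₂_mem _).1 _) <|
      (prodWeight_mem fun _ => P.tabX₂₂_mem _).1 _
  · have h := P.expect_cbLaw σ fun _ => 1
    rw [expect_const (prodWeight_mem fun _ => P.tabX₂₂_mem _),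
      expect_const (prodWeight_mem fun _ => prodWeight_mem fun _ => P.tabU₂₂_mem _),
      expect_const (prodWeight_mem fun _ => P.seqU₂₁_mem _),
      expect_const (prodWeight_mem fun _ => P.tabX₁₂_mem _),
      expect_const (prodWeight_mem fun _ => P.seqU₁₁_mem _),
      expect_const (prodWeight_mem fun _ => P.seqX₁₁_mem _),
      expect_const (prodWeight_mem fun _ => P.seqX₁₁_mem _)] at h
    simpa only [expect, mul_one] using h

/-- The coordinates of the codebooks are independent, so any of them may be redrawn. Here and in the
analogous facts the new draw is commuted past the later layers. -/
theorem resamples_x (i : Fin σ.n₁₀) :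
    Resamples (P.cbLaw σ) (P.seqX₁₁ σ.k)
      (fun ω a => { ω with x := Function.update ω.x i a }) := by
  intro f
  rw [expect_cbLaw, expect_cbLaw]
  rw [(resamples_pi (fun _ => P.seqX₁₁_mem _) i)]
  simp only [expect_comm (P.seqX₁₁ σ.k)]

theorem resamples_x' (i : Fin σ.n₁₀) :
    Resamples (P.cbLaw σ) (P.seqX₁₁ σ.m)
      (fun ω a => { ω with x' := Function.update ω.x' i a }) := by
  intro f
  rw [expect_cbLaw, expect_cbLaw]
  refine congrArg _ (funext fun _ => ?_)
  rw [(resamples_pi (fun _ => P.seqX₁₁_mem _) i)]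
  simp only [expect_comm (P.seqX₁₁ σ.m)]

theorem resamples_u (i : Fin σ.n₁₁) :
    Resamples (P.cbLaw σ) (P.seqU₁₁ σ.m)
      (fun ω a => { ω with u := Function.update ω.u i a }) := by
  intro f
  rw [expect_cbLaw, expect_cbLaw]
  refine congrArg _ (funext fun _ => ?_)
  refine congrArg _ (funext fun _ => ?_)
  rw [(resamples_pi (fun _ => P.seqU₁₁_mem _) i)]
  simp only [expect_comm (P.seqU₁₁ σ.m)]

theorem resamples_a (i : Fin σ.n₁₀ × Fin σ.n₁₁ × Fin σ.n₁₂) :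
    Resamples (P.cbLaw σ) (P.tabX₁₂ σ.m)
      (fun ω a => { ω with a := Function.update ω.a i a }) := by
  intro f
  rw [expect_cbLaw, expect_cbLaw]
  refine congrArg _ (funext fun _ => ?_)
  refine congrArg _ (funext fun _ => ?_)
  refine congrArg _ (funext fun _ => ?_)
  rw [(resamples_pi (fun _ => P.tabX₁₂_mem _) i)]
  simp only [expect_comm (P.tabX₁₂ σ.m)]

theorem resamples_v (i : Fin σ.n₂₁) :
    Resamples (P.cbLaw σ) (P.seqU₂₁ σ.m)
      (fun ω a => { ω with v := Function.update ω.v i a }) := by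
  intro f
  rw [expect_cbLaw, expect_cbLaw]
  refine congrArg _ (funext fun _ => ?_)
  refine congrArg _ (funext fun _ => ?_)
  refine congrArg _ (funext fun _ => ?_)
  refine congrArg _ (funext fun _ => ?_)
  rw [(resamples_pi (fun _ => P.seqU₂₁_mem _) i)]
  simp only [expect_comm (P.seqU₂₁ σ.m)]

/-- All indices of a bin are redrawn together, as the success of binning requires. For wrong
candidates a single index is enough. -/
theorem resamples_s_all (i : Fin σ.n₂₁ × Fin σ.n₂₂) :
    Resamples (P.cbLaw σ) (prodWeight fun _ : Fin σ.nᵥ => P.tabU₂₂ σ.m)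
      (fun ω a => { ω with s := Function.update ω.s i a }) := by
  intro f
  rw [expect_cbLaw, expect_cbLaw]
  refine congrArg _ (funext fun _ => ?_)
  refine congrArg _ (funext fun _ => ?_)
  refine congrArg _ (funext fun _ => ?_)
  refine congrArg _ (funext fun _ => ?_)
  refine congrArg _ (funext fun _ => ?_)
  rw [(resamples_pi (fun _ => prodWeight_mem fun _ => P.tabU₂₂_mem _) i)]
  simp only [expect_comm (prodWeight fun _ : Fin σ.nᵥ => P.tabU₂₂ σ.m)]

theorem resamples_s (i : Fin σ.n₂₁ × Fin σ.n₂₂) (j : Fin σ.nᵥ) :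
    Resamples (P.cbLaw σ) (P.tabU₂₂ σ.m)
      (fun ω a => { ω with s := Function.update ω.s i (Function.update (ω.s i) j a) }) := by
  intro f
  rw [expect_cbLaw, expect_cbLaw]
  refine congrArg _ (funext fun _ => ?_)
  refine congrArg _ (funext fun _ => ?_)
  refine congrArg _ (funext fun _ => ?_)
  refine congrArg _ (funext fun _ => ?_)
  refine congrArg _ (funext fun _ => ?_)
  rw [(Resamples.pi (p := fun _ : Fin σ.n₂₁ × Fin σ.n₂₂ => prodWeight fun _ : Fin σ.nᵥ => P.tabU₂₂ σ.m)
    (i := i) (upd := fun C a => Function.update C j a)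
    (resamples_pi (fun _ => P.tabU₂₂_mem _) j))]
  simp only [expect_comm (P.tabU₂₂ σ.m)]

/-- The redrawn entry may depend on `x'`, `v` and `s`, since these are fixed when `t` is averaged.
It is meant to be the entry that binning selects. -/
theorem resamples_t (i : Fin σ.n₁₀) (j : Fin σ.n₂₁) (l : Fin σ.n₂₂)
    (b : (Fin σ.n₁₀ → Fin σ.m → W.X₁₁) → (Fin σ.n₂₁ → Fin σ.m → P.U₂₁) →
      (Fin σ.n₂₁ × Fin σ.n₂₂ → Fin σ.nᵥ → Fin σ.m → LetterTable P.U₂₁ P.U₂₂) → Fin σ.nᵥ) :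
    Resamples (P.cbLaw σ) (P.tabX₂₂ σ.m)
      (fun ω a => { ω with t := Function.update ω.t (i, j, l, b ω.x' ω.v ω.s) a }) := by
  intro f
  rw [expect_cbLaw, expect_cbLaw]
  refine congrArg _ (funext fun _ => ?_)
  refine congrArg _ (funext fun x' => ?_)
  refine congrArg _ (funext fun _ => ?_)
  refine congrArg _ (funext fun _ => ?_)
  refine congrArg _ (funext fun v => ?_)
  refine congrArg _ (funext fun s => ?_)
  exact resamples_pi (fun _ => P.tabX₂₂_mem _) (i, j, l, b x' v s) _

variable {ε₁ ε₂ : ℝ} (h₁ : 0 < ε₁) (h₂ : 0 < ε₂)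

/-- The code that the tables determine. -/
def scheme (ω : P.Codebooks σ) : HKScheme W where
  P := P
  k := σ.k
  m := σ.m
  n₁₀ := σ.n₁₀
  n₁₁ := σ.n₁₁
  n₁₂ := σ.n₁₂
  n₂₁ := σ.n₂₁
  n₂₂ := σ.n₂₂
  nᵥ := σ.nᵥ
  εbin := ε₁
  εdec := ε₂
  εbin_pos := h₁
  εdec_pos := h₂
  x₁₁ := ω.x
  x₁₁' := ω.x'
  u₁₁ := ω.u
  x₁₂ a b c j := ω.a (a, b, c) j (ω.u b j, ω.x' a j)
  u₂₁ := ω.v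
  u₂₂ a b v j := ω.s (a, b) v j (ω.v a j)
  x₂₂ a b c v j := ω.t (a, b, c, v) j (ω.x' a j, ω.v b j, ω.s (b, c) v j (ω.v b j))

end HKInput

end

/-! ### Averaging a single wrong candidate -/

noncomputable section

open Filter Topology

/-- The two parts of `x₁₁` are drawn independently. `g` stands for a first-phase probability that is
untouched when second-phase codewords are redrawn, so the two small probabilities multiply. -/
theorem Resamples.expect_mul_law_le {Ω R Z : Type*} [Fintype Ω] [Fintype R] [Fintype Z] {μ : Ω → ℝ}
    {r : R → ℝ} {upd : Ω → R → Ω} (h : Resamples μ r upd) (hμ : ∀ ω, 0 ≤ μ ω)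
    {law : Ω → Z → ℝ} (hlaw : ∀ ω, law ω ∈ stdSimplex ℝ Z) (hupd : ∀ ω a, law (upd ω a) = law ω)
    {g : Ω → ℝ} (hg : ∀ ω, 0 ≤ g ω) (hgu : ∀ ω a, g (upd ω a) = g ω)
    {f : Ω → Z → ℝ} {B : ℝ} (hB : ∀ ω z, expect r (fun a => f (upd ω a) z) ≤ B) :
    expect μ (fun ω => g ω * expect (law ω) (f ω)) ≤ B * expect μ g := by
  simp only [mul_comm (g _)]
  refine h.expect_mul_le hμ hg hgu fun ω => ?_
  simp only [hupd]
  rw [expect_comm r (law ω) (fun a z => f (upd ω a) z)]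
  exact expect_le_of_le (hlaw ω) fun z => hB ω z

namespace HKInput

variable {W : HDChannel.{u}} (P : HKInput W)

/-- The tolerance `ε` is small enough for the packing bounds with slack `δ` of both destinations
and of the second sender. -/
structure Packs (ε δ : ℝ) : Prop where
  packs₃ : ∀ (m : ℕ) (x : Fin m → W.X₁₁) (u : Fin m → P.U₁₁) (v : Fin m → P.U₂₁) (z : Fin m → W.Y₁₂),
      (expect (prodWeight fun j => P.pX₁₂ (u j) (x j)) fun a =>
      ind (P.Typ₁ ε x u a v z)) ≤ (2 : ℝ) ^ (-(m * (P.i₃ - δ)))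
  packs₄ : ∀ (m : ℕ) (u : Fin m → P.U₁₁) (v : Fin m → P.U₂₁) (z : Fin m → W.Y₁₂),
      (expect (prodWeight fun _ : Fin m => P.pX₁₁) fun x =>
      expect (prodWeight fun j => P.pX₁₂ (u j) (x j)) fun a =>
      ind (P.Typ₁ ε x u a v z)) ≤ (2 : ℝ) ^ (-(m * (P.i₄ - δ)))
  packs₅ : ∀ (m : ℕ) (x : Fin m → W.X₁₁) (v : Fin m → P.U₂₁) (z : Fin m → W.Y₁₂),
      (expect (prodWeight fun _ : Fin m => P.pU₁₁) fun u =>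
      expect (prodWeight fun j => P.pX₁₂ (u j) (x j)) fun a =>
      ind (P.Typ₁ ε x u a v z)) ≤ (2 : ℝ) ^ (-(m * (P.i₅ - δ)))
  packs₆ : ∀ (m : ℕ) (v : Fin m → P.U₂₁) (z : Fin m → W.Y₁₂),
      (expect (prodWeight fun _ : Fin m => P.pX₁₁) fun x =>
      expect (prodWeight fun _ : Fin m => P.pU₁₁) fun u =>
      expect (prodWeight fun j => P.pX₁₂ (u j) (x j)) fun a =>
      ind (P.Typ₁ ε x u a v z)) ≤ (2 : ℝ) ^ (-(m * (P.i₆ - δ)))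
  packs₇ : ∀ (m : ℕ) (x : Fin m → W.X₁₁) (u : Fin m → P.U₁₁) (z : Fin m → W.Y₁₂),
      (expect (prodWeight fun j => P.pX₁₂ (u j) (x j)) fun a =>
      expect (prodWeight fun _ : Fin m => P.pU₂₁) fun v =>
      ind (P.Typ₁ ε x u a v z)) ≤ (2 : ℝ) ^ (-(m * (P.i₇ - δ)))
  packs₈ : ∀ (m : ℕ) (u : Fin m → P.U₁₁) (z : Fin m → W.Y₁₂),
      (expect (prodWeight fun _ : Fin m => P.pX₁₁) fun x =>
      expect (prodWeight fun j => P.pX₁₂ (u j) (x j)) fun a =>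
      expect (prodWeight fun _ : Fin m => P.pU₂₁) fun v =>
      ind (P.Typ₁ ε x u a v z)) ≤ (2 : ℝ) ^ (-(m * (P.i₈ - δ)))
  packs₉ : ∀ (m : ℕ) (x : Fin m → W.X₁₁) (z : Fin m → W.Y₁₂),
      (expect (prodWeight fun _ : Fin m => P.pU₁₁) fun u =>
      expect (prodWeight fun j => P.pX₁₂ (u j) (x j)) fun a =>
      expect (prodWeight fun _ : Fin m => P.pU₂₁) fun v =>
      ind (P.Typ₁ ε x u a v z)) ≤ (2 : ℝ) ^ (-(m * (P.i₉ - δ)))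
  packs₁₀ : ∀ (m : ℕ) (z : Fin m → W.Y₁₂),
      (expect (prodWeight fun _ : Fin m => P.pX₁₁) fun x =>
      expect (prodWeight fun _ : Fin m => P.pU₁₁) fun u =>
      expect (prodWeight fun j => P.pX₁₂ (u j) (x j)) fun a =>
      expect (prodWeight fun _ : Fin m => P.pU₂₁) fun v =>
      ind (P.Typ₁ ε x u a v z)) ≤ (2 : ℝ) ^ (-(m * (P.i₁₀ - δ)))
  packs₁₁ : ∀ (m : ℕ) (u : Fin m → P.U₁₁) (v : Fin m → P.U₂₁) (z : Fin m → W.Y₂₂),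
      (expect (prodWeight fun j => P.pU₂₂' (v j)) fun s =>
      ind (P.Typ₂ ε u v s z)) ≤ (2 : ℝ) ^ (-(m * (P.i₁₁ - δ)))
  packs₁₂ : ∀ (m : ℕ) (u : Fin m → P.U₁₁) (z : Fin m → W.Y₂₂),
      (expect (prodWeight fun _ : Fin m => P.pU₂₁) fun v =>
      expect (prodWeight fun j => P.pU₂₂' (v j)) fun s =>
      ind (P.Typ₂ ε u v s z)) ≤ (2 : ℝ) ^ (-(m * (P.i₁₂ - δ)))
  packs₁₃ : ∀ (m : ℕ) (v : Fin m → P.U₂₁) (z : Fin m → W.Y₂₂),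
      (expect (prodWeight fun _ : Fin m => P.pU₁₁) fun u =>
      expect (prodWeight fun j => P.pU₂₂' (v j)) fun s =>
      ind (P.Typ₂ ε u v s z)) ≤ (2 : ℝ) ^ (-(m * (P.i₁₃ - δ)))
  packs₁₄ : ∀ (m : ℕ) (z : Fin m → W.Y₂₂),
      (expect (prodWeight fun _ : Fin m => P.pU₁₁) fun u =>
      expect (prodWeight fun _ : Fin m => P.pU₂₁) fun v =>
      expect (prodWeight fun j => P.pU₂₂' (v j)) fun s =>
      ind (P.Typ₂ ε u v s z)) ≤ (2 : ℝ) ^ (-(m * (P.i₁₄ - δ)))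
  packs_Y : ∀ (k : ℕ) (y : Fin k → W.Y),
    (expect (prodWeight fun _ : Fin k => P.pX₁₁) fun x => ind (P.TypY ε x y)) ≤
      (2 : ℝ) ^ (-(k * (P.i₂ - δ)))
  packs_Y₁₁ : ∀ (k : ℕ) (y : Fin k → W.Y₁₁),
    (expect (prodWeight fun _ : Fin k => P.pX₁₁) fun x => ind (P.TypY₁₁ ε x y)) ≤
      (2 : ℝ) ^ (-(k * (P.iY₁₁ - δ)))

theorem eventually_packs {δ : ℝ} (hδ : 0 < δ) : ∀ᶠ ε in 𝓝[>] (0 : ℝ), P.Packs ε δ := by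
  filter_upwards [P.packing₃ hδ, P.packing₄ hδ, P.packing₅ hδ, P.packing₆ hδ, P.packing₇ hδ, P.packing₈ hδ, P.packing₉ hδ, P.packing₁₀ hδ, P.packing₁₁ hδ, P.packing₁₂ hδ, P.packing₁₃ hδ, P.packing₁₄ hδ, P.packing_Y hδ, P.packing_Y₁₁ hδ] with ε
    h0 h1 h2 h3 h4 h5 h6 h7 h8 h9 h10 h11 h12 h13
  exact ⟨h0, h1, h2, h3, h4, h5, h6, h7, h8, h9, h10, h11, h12, h13⟩

variable {P} (σ : HKSizes) {ε₁ ε₂ δ : ℝ} (h₁ : 0 < ε₁) (h₂ : 0 < ε₂)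

open Classical in
/-- The index that conditional binning chooses. -/
def binIdx {σ : HKSizes} (ε₁ : ℝ) (x' : Fin σ.n₁₀ → Fin σ.m → W.X₁₁) (v : Fin σ.n₂₁ → Fin σ.m → P.U₂₁)
    (s : Fin σ.n₂₁ × Fin σ.n₂₂ → Fin σ.nᵥ → Fin σ.m → LetterTable P.U₂₁ P.U₂₂)
    (i : Fin σ.n₁₀) (j : Fin σ.n₂₁) (q : Fin σ.n₂₂) : Fin σ.nᵥ :=
  someOr 0 fun b => P.TypBin ε₁ (x' i) (v j) (fun m => s (j, q) b m (v j m))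

variable {σ} in
/-- The law of the outputs of the second phase if the second sender knows `w₁₀`. -/
def lawPhase2 (ε₁ : ℝ) (ω : P.Codebooks σ) (i : Fin σ.n₁₀) (j : Fin σ.n₁₁) (l : Fin σ.n₁₂)
    (v : Fin σ.n₂₁) (q : Fin σ.n₂₂) : (Fin σ.m → W.Y₁₂ × W.Y₂₂) → ℝ :=
  prodWeight fun m => W.phase2 (ω.a (i, j, l) m (ω.u j m, ω.x' i m))
    (ω.t (i, v, q, binIdx ε₁ ω.x' ω.v ω.s i v q) m
      (ω.x' i m, ω.v v m, ω.s (v, q) (binIdx ε₁ ω.x' ω.v ω.s i v q) m (ω.v v m)))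

variable {σ} in
theorem lawPhase2_mem (ε₁ : ℝ) (ω : P.Codebooks σ) (i j l v q) :
    lawPhase2 ε₁ ω i j l v q ∈ stdSimplex ℝ _ :=
  prodWeight_mem fun _ => (W.phase2 _ _).2

/-- The output law involves only the sent codewords, so redrawing wrong ones leaves it unchanged and
packing applies for every fixed output. The eight bounds of this kind differ in which of `x₁₁`,
`u₁₁`, `u₂₁` are wrong; the table of `x₁₂` is fresh in all of them, since its index is the whole
triple. -/
theorem expect_typ₁_le₃ (hP : P.Packs ε₂ δ) (i : Fin σ.n₁₀) (j : Fin σ.n₁₁) (l l' : Fin σ.n₁₂)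
    (v : Fin σ.n₂₁) (q : Fin σ.n₂₂)
    (hl : l' ≠ l) {g : (Fin σ.n₁₀ → Fin σ.k → W.X₁₁) → ℝ} (hg : ∀ x, 0 ≤ g x) :
    expect (P.cbLaw σ) (fun ω => g ω.x * expect (lawPhase2 ε₁ ω i j l v q) fun z =>
      ind (P.Typ₁ ε₂ (ω.x' i) (ω.u j) (fun m => ω.a (i, j, l') m (ω.u j m, ω.x' i m)) (ω.v v)
        fun m => (z m).1)) ≤
      (2 : ℝ) ^ (-(σ.m * (P.i₃ - δ))) * expect (P.cbLaw σ) fun ω => g ω.x := by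
  have hne : (i, j, l') ≠ (i, j, l) := fun h => hl (Prod.mk.inj (Prod.mk.inj h).2).2
  refine (P.resamples_a σ (i, j, l')).expect_mul_law_le (g := fun ω => g ω.x)
    (P.cbLaw_mem σ).1 (fun ω => lawPhase2_mem _ _ _ _ _ _ _) (fun ω a => ?_) (fun ω => hg ω.x)
    (fun _ _ => rfl) (fun ω z' => ?_)
  · simp only [lawPhase2, binIdx, Function.update_of_ne hne.symm]
  · simp only [Function.update_self]
    exact le_of_eq_of_le (P.expect_tabX₁₂ (ω.u j) (ω.x' i) (fun a => ind (P.Typ₁ ε₂ (ω.x' i) (ω.u j) a (ω.v v) fun m => (z' m).1)))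
      (hP.packs₃ σ.m (ω.x' i) (ω.u j) (ω.v v) fun m => (z' m).1)

theorem expect_typ₁_le₄ (hP : P.Packs ε₂ δ) (i i' : Fin σ.n₁₀) (j : Fin σ.n₁₁) (l l' : Fin σ.n₁₂)
    (v : Fin σ.n₂₁) (q : Fin σ.n₂₂)
    (hi : i' ≠ i) {g : (Fin σ.n₁₀ → Fin σ.k → W.X₁₁) → ℝ} (hg : ∀ x, 0 ≤ g x) :
    expect (P.cbLaw σ) (fun ω => g ω.x * expect (lawPhase2 ε₁ ω i j l v q) fun z =>
      ind (P.Typ₁ ε₂ (ω.x' i') (ω.u j) (fun m => ω.a (i', j, l') m (ω.u j m, ω.x' i' m)) (ω.v v)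
        fun m => (z m).1)) ≤
      (2 : ℝ) ^ (-(σ.m * (P.i₄ - δ))) * expect (P.cbLaw σ) fun ω => g ω.x := by
  have hne : (i', j, l') ≠ (i, j, l) := fun h => hi (Prod.mk.inj h).1
  refine ((P.resamples_x' σ i').comp (P.resamples_a σ (i', j, l'))).expect_mul_law_le (g := fun ω => g ω.x)
    (P.cbLaw_mem σ).1 (fun ω => lawPhase2_mem _ _ _ _ _ _ _) (fun ω a => ?_) (fun ω => hg ω.x)
    (fun _ _ => rfl) (fun ω z' => ?_)
  · simp only [lawPhase2, binIdx, Function.update_of_ne hi.symm, Function.update_of_ne hne.symm]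
  · simp only [expect_prodW, Function.update_self]
    exact le_of_eq_of_le (congrArg (expect (P.seqX₁₁ σ.m)) (funext fun x => P.expect_tabX₁₂ (ω.u j) x (fun a => ind (P.Typ₁ ε₂ x (ω.u j) a (ω.v v) fun m => (z' m).1))))
      (hP.packs₄ σ.m (ω.u j) (ω.v v) fun m => (z' m).1)

theorem expect_typ₁_le₅ (hP : P.Packs ε₂ δ) (i : Fin σ.n₁₀) (j j' : Fin σ.n₁₁) (l l' : Fin σ.n₁₂)
    (v : Fin σ.n₂₁) (q : Fin σ.n₂₂)
    (hj : j' ≠ j) {g : (Fin σ.n₁₀ → Fin σ.k → W.X₁₁) → ℝ} (hg : ∀ x, 0 ≤ g x) :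
    expect (P.cbLaw σ) (fun ω => g ω.x * expect (lawPhase2 ε₁ ω i j l v q) fun z =>
      ind (P.Typ₁ ε₂ (ω.x' i) (ω.u j') (fun m => ω.a (i, j', l') m (ω.u j' m, ω.x' i m)) (ω.v v)
        fun m => (z m).1)) ≤
      (2 : ℝ) ^ (-(σ.m * (P.i₅ - δ))) * expect (P.cbLaw σ) fun ω => g ω.x := by
  have hne : (i, j', l') ≠ (i, j, l) := fun h => hj (Prod.mk.inj (Prod.mk.inj h).2).1
  refine ((P.resamples_u σ j').comp (P.resamples_a σ (i, j', l'))).expect_mul_law_le (g := fun ω => g ω.x)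
    (P.cbLaw_mem σ).1 (fun ω => lawPhase2_mem _ _ _ _ _ _ _) (fun ω a => ?_) (fun ω => hg ω.x)
    (fun _ _ => rfl) (fun ω z' => ?_)
  · simp only [lawPhase2, binIdx, Function.update_of_ne hj.symm, Function.update_of_ne hne.symm]
  · simp only [expect_prodW, Function.update_self]
    exact le_of_eq_of_le (congrArg (expect (P.seqU₁₁ σ.m)) (funext fun u => P.expect_tabX₁₂ u (ω.x' i) (fun a => ind (P.Typ₁ ε₂ (ω.x' i) u a (ω.v v) fun m => (z' m).1))))
      (hP.packs₅ σ.m (ω.x' i) (ω.v v) fun m => (z' m).1)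

theorem expect_typ₁_le₆ (hP : P.Packs ε₂ δ) (i i' : Fin σ.n₁₀) (j j' : Fin σ.n₁₁) (l l' : Fin σ.n₁₂)
    (v : Fin σ.n₂₁) (q : Fin σ.n₂₂)
    (hi : i' ≠ i) (hj : j' ≠ j) {g : (Fin σ.n₁₀ → Fin σ.k → W.X₁₁) → ℝ} (hg : ∀ x, 0 ≤ g x) :
    expect (P.cbLaw σ) (fun ω => g ω.x * expect (lawPhase2 ε₁ ω i j l v q) fun z =>
      ind (P.Typ₁ ε₂ (ω.x' i') (ω.u j') (fun m => ω.a (i', j', l') m (ω.u j' m, ω.x' i' m)) (ω.v v)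
        fun m => (z m).1)) ≤
      (2 : ℝ) ^ (-(σ.m * (P.i₆ - δ))) * expect (P.cbLaw σ) fun ω => g ω.x := by
  have hne : (i', j', l') ≠ (i, j, l) := fun h => hi (Prod.mk.inj h).1
  refine (((P.resamples_x' σ i').comp (P.resamples_u σ j')).comp (P.resamples_a σ (i', j', l'))).expect_mul_law_le (g := fun ω => g ω.x)
    (P.cbLaw_mem σ).1 (fun ω => lawPhase2_mem _ _ _ _ _ _ _) (fun ω a => ?_) (fun ω => hg ω.x)
    (fun _ _ => rfl) (fun ω z' => ?_)
  · simp only [lawPhase2, binIdx, Function.update_of_ne hi.symm, Function.update_of_ne hj.symm, Function.update_of_ne hne.symm]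
  · simp only [expect_prodW, Function.update_self]
    exact le_of_eq_of_le (congrArg (expect (P.seqX₁₁ σ.m)) (funext fun x => congrArg (expect (P.seqU₁₁ σ.m)) (funext fun u => P.expect_tabX₁₂ u x (fun a => ind (P.Typ₁ ε₂ x u a (ω.v v) fun m => (z' m).1)))))
      (hP.packs₆ σ.m (ω.v v) fun m => (z' m).1)

theorem expect_typ₁_le₇ (hP : P.Packs ε₂ δ) (i : Fin σ.n₁₀) (j : Fin σ.n₁₁) (l l' : Fin σ.n₁₂)
    (v v' : Fin σ.n₂₁) (q : Fin σ.n₂₂)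
    (hl : l' ≠ l) (hv : v' ≠ v) {g : (Fin σ.n₁₀ → Fin σ.k → W.X₁₁) → ℝ} (hg : ∀ x, 0 ≤ g x) :
    expect (P.cbLaw σ) (fun ω => g ω.x * expect (lawPhase2 ε₁ ω i j l v q) fun z =>
      ind (P.Typ₁ ε₂ (ω.x' i) (ω.u j) (fun m => ω.a (i, j, l') m (ω.u j m, ω.x' i m)) (ω.v v')
        fun m => (z m).1)) ≤
      (2 : ℝ) ^ (-(σ.m * (P.i₇ - δ))) * expect (P.cbLaw σ) fun ω => g ω.x := by
  have hne : (i, j, l') ≠ (i, j, l) := fun h => hl (Prod.mk.inj (Prod.mk.inj h).2).2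
  refine ((P.resamples_a σ (i, j, l')).comp (P.resamples_v σ v')).expect_mul_law_le (g := fun ω => g ω.x)
    (P.cbLaw_mem σ).1 (fun ω => lawPhase2_mem _ _ _ _ _ _ _) (fun ω a => ?_) (fun ω => hg ω.x)
    (fun _ _ => rfl) (fun ω z' => ?_)
  · simp only [lawPhase2, binIdx, Function.update_of_ne hv.symm, Function.update_of_ne hne.symm]
  · simp only [expect_prodW, Function.update_self]
    exact le_of_eq_of_le (P.expect_tabX₁₂ (ω.u j) (ω.x' i) (fun a => expect (P.seqU₂₁ σ.m) fun v => ind (P.Typ₁ ε₂ (ω.x' i) (ω.u j) a v fun m => (z' m).1)))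
      (hP.packs₇ σ.m (ω.x' i) (ω.u j) fun m => (z' m).1)

theorem expect_typ₁_le₈ (hP : P.Packs ε₂ δ) (i i' : Fin σ.n₁₀) (j : Fin σ.n₁₁) (l l' : Fin σ.n₁₂)
    (v v' : Fin σ.n₂₁) (q : Fin σ.n₂₂)
    (hi : i' ≠ i) (hv : v' ≠ v) {g : (Fin σ.n₁₀ → Fin σ.k → W.X₁₁) → ℝ} (hg : ∀ x, 0 ≤ g x) :
    expect (P.cbLaw σ) (fun ω => g ω.x * expect (lawPhase2 ε₁ ω i j l v q) fun z =>
      ind (P.Typ₁ ε₂ (ω.x' i') (ω.u j) (fun m => ω.a (i', j, l') m (ω.u j m, ω.x' i' m)) (ω.v v')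
        fun m => (z m).1)) ≤
      (2 : ℝ) ^ (-(σ.m * (P.i₈ - δ))) * expect (P.cbLaw σ) fun ω => g ω.x := by
  have hne : (i', j, l') ≠ (i, j, l) := fun h => hi (Prod.mk.inj h).1
  refine (((P.resamples_x' σ i').comp (P.resamples_a σ (i', j, l'))).comp (P.resamples_v σ v')).expect_mul_law_le (g := fun ω => g ω.x)
    (P.cbLaw_mem σ).1 (fun ω => lawPhase2_mem _ _ _ _ _ _ _) (fun ω a => ?_) (fun ω => hg ω.x)
    (fun _ _ => rfl) (fun ω z' => ?_)
  · simp only [lawPhase2, binIdx, Function.update_of_ne hi.symm, Function.update_of_ne hv.symm, Function.update_of_ne hne.symm]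
  · simp only [expect_prodW, Function.update_self]
    exact le_of_eq_of_le (congrArg (expect (P.seqX₁₁ σ.m)) (funext fun x => P.expect_tabX₁₂ (ω.u j) x (fun a => expect (P.seqU₂₁ σ.m) fun v => ind (P.Typ₁ ε₂ x (ω.u j) a v fun m => (z' m).1))))
      (hP.packs₈ σ.m (ω.u j) fun m => (z' m).1)

theorem expect_typ₁_le₉ (hP : P.Packs ε₂ δ) (i : Fin σ.n₁₀) (j j' : Fin σ.n₁₁) (l l' : Fin σ.n₁₂)
    (v v' : Fin σ.n₂₁) (q : Fin σ.n₂₂)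
    (hj : j' ≠ j) (hv : v' ≠ v) {g : (Fin σ.n₁₀ → Fin σ.k → W.X₁₁) → ℝ} (hg : ∀ x, 0 ≤ g x) :
    expect (P.cbLaw σ) (fun ω => g ω.x * expect (lawPhase2 ε₁ ω i j l v q) fun z =>
      ind (P.Typ₁ ε₂ (ω.x' i) (ω.u j') (fun m => ω.a (i, j', l') m (ω.u j' m, ω.x' i m)) (ω.v v')
        fun m => (z m).1)) ≤
      (2 : ℝ) ^ (-(σ.m * (P.i₉ - δ))) * expect (P.cbLaw σ) fun ω => g ω.x := by
  have hne : (i, j', l') ≠ (i, j, l) := fun h => hj (Prod.mk.inj (Prod.mk.inj h).2).1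
  refine (((P.resamples_u σ j').comp (P.resamples_a σ (i, j', l'))).comp (P.resamples_v σ v')).expect_mul_law_le (g := fun ω => g ω.x)
    (P.cbLaw_mem σ).1 (fun ω => lawPhase2_mem _ _ _ _ _ _ _) (fun ω a => ?_) (fun ω => hg ω.x)
    (fun _ _ => rfl) (fun ω z' => ?_)
  · simp only [lawPhase2, binIdx, Function.update_of_ne hj.symm, Function.update_of_ne hv.symm, Function.update_of_ne hne.symm]
  · simp only [expect_prodW, Function.update_self]
    exact le_of_eq_of_le (congrArg (expect (P.seqU₁₁ σ.m)) (funext fun u => P.expect_tabX₁₂ u (ω.x' i) (fun a => expect (P.seqU₂₁ σ.m) fun v => ind (P.Typ₁ ε₂ (ω.x' i) u a v fun m => (z' m).1))))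
      (hP.packs₉ σ.m (ω.x' i) fun m => (z' m).1)

theorem expect_typ₁_le₁₀ (hP : P.Packs ε₂ δ) (i i' : Fin σ.n₁₀) (j j' : Fin σ.n₁₁) (l l' : Fin σ.n₁₂)
    (v v' : Fin σ.n₂₁) (q : Fin σ.n₂₂)
    (hi : i' ≠ i) (hj : j' ≠ j) (hv : v' ≠ v) {g : (Fin σ.n₁₀ → Fin σ.k → W.X₁₁) → ℝ} (hg : ∀ x, 0 ≤ g x) :
    expect (P.cbLaw σ) (fun ω => g ω.x * expect (lawPhase2 ε₁ ω i j l v q) fun z =>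
      ind (P.Typ₁ ε₂ (ω.x' i') (ω.u j') (fun m => ω.a (i', j', l') m (ω.u j' m, ω.x' i' m)) (ω.v v')
        fun m => (z m).1)) ≤
      (2 : ℝ) ^ (-(σ.m * (P.i₁₀ - δ))) * expect (P.cbLaw σ) fun ω => g ω.x := by
  have hne : (i', j', l') ≠ (i, j, l) := fun h => hi (Prod.mk.inj h).1
  refine ((((P.resamples_x' σ i').comp (P.resamples_u σ j')).comp (P.resamples_a σ (i', j', l'))).comp (P.resamples_v σ v')).expect_mul_law_le (g := fun ω => g ω.x)
    (P.cbLaw_mem σ).1 (fun ω => lawPhase2_mem _ _ _ _ _ _ _) (fun ω a => ?_) (fun ω => hg ω.x)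
    (fun _ _ => rfl) (fun ω z' => ?_)
  · simp only [lawPhase2, binIdx, Function.update_of_ne hi.symm, Function.update_of_ne hj.symm, Function.update_of_ne hv.symm, Function.update_of_ne hne.symm]
  · simp only [expect_prodW, Function.update_self]
    exact le_of_eq_of_le (congrArg (expect (P.seqX₁₁ σ.m)) (funext fun x => congrArg (expect (P.seqU₁₁ σ.m)) (funext fun u => P.expect_tabX₁₂ u x (fun a => expect (P.seqU₂₁ σ.m) fun v => ind (P.Typ₁ ε₂ x u a v fun m => (z' m).1)))))
      (hP.packs₁₀ σ.m  fun m => (z' m).1)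

/-- Binning inspects only the bin of the sent pair. A codeword of a wrong pair lies in another bin,
so redrawing it changes neither the chosen index nor the output law. -/
theorem expect_typ₂_le₁₁ (hP : P.Packs ε₂ δ) (i : Fin σ.n₁₀) (j : Fin σ.n₁₁) (l : Fin σ.n₁₂)
    (v : Fin σ.n₂₁) (q q' : Fin σ.n₂₂) (b : Fin σ.nᵥ)
    (hq : q' ≠ q) :
    expect (P.cbLaw σ) (fun ω => expect (lawPhase2 ε₁ ω i j l v q) fun z =>
      ind (P.Typ₂ ε₂ (ω.u j) (ω.v v) (fun m => ω.s (v, q') b m (ω.v v m)) fun m => (z m).2)) ≤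
      (2 : ℝ) ^ (-(σ.m * (P.i₁₁ - δ))) := by
  have hne : (v, q') ≠ (v, q) := fun h => hq (Prod.mk.inj h).2
  refine (P.resamples_s σ (v, q') b).expect_law_le
    (P.cbLaw_mem σ) (fun ω => lawPhase2_mem _ _ _ _ _ _ _) (fun ω a => ?_) (fun ω z' => ?_)
  · simp only [lawPhase2, binIdx, Function.update_of_ne hne.symm]
  · simp only [Function.update_self]
    exact le_of_eq_of_le (P.expect_tabU₂₂ (ω.v v) (fun s => ind (P.Typ₂ ε₂ (ω.u j) (ω.v v) s fun m => (z' m).2)))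
      (hP.packs₁₁ σ.m (ω.u j) (ω.v v) fun m => (z' m).2)

theorem expect_typ₂_le₁₂ (hP : P.Packs ε₂ δ) (i : Fin σ.n₁₀) (j : Fin σ.n₁₁) (l : Fin σ.n₁₂)
    (v v' : Fin σ.n₂₁) (q q' : Fin σ.n₂₂) (b : Fin σ.nᵥ)
    (hv : v' ≠ v) :
    expect (P.cbLaw σ) (fun ω => expect (lawPhase2 ε₁ ω i j l v q) fun z =>
      ind (P.Typ₂ ε₂ (ω.u j) (ω.v v') (fun m => ω.s (v', q') b m (ω.v v' m)) fun m => (z m).2)) ≤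
      (2 : ℝ) ^ (-(σ.m * (P.i₁₂ - δ))) := by
  have hne : (v', q') ≠ (v, q) := fun h => hv (Prod.mk.inj h).1
  refine ((P.resamples_v σ v').comp (P.resamples_s σ (v', q') b)).expect_law_le
    (P.cbLaw_mem σ) (fun ω => lawPhase2_mem _ _ _ _ _ _ _) (fun ω a => ?_) (fun ω z' => ?_)
  · simp only [lawPhase2, binIdx, Function.update_of_ne hv.symm, Function.update_of_ne hne.symm]
  · simp only [expect_prodW, Function.update_self]
    exact le_of_eq_of_le (congrArg (expect (P.seqU₂₁ σ.m)) (funext fun v => P.expect_tabU₂₂ v (fun s => ind (P.Typ₂ ε₂ (ω.u j) v s fun m => (z' m).2))))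
      (hP.packs₁₂ σ.m (ω.u j) fun m => (z' m).2)

theorem expect_typ₂_le₁₃ (hP : P.Packs ε₂ δ) (i : Fin σ.n₁₀) (j j' : Fin σ.n₁₁) (l : Fin σ.n₁₂)
    (v : Fin σ.n₂₁) (q q' : Fin σ.n₂₂) (b : Fin σ.nᵥ)
    (hj : j' ≠ j) (hq : q' ≠ q) :
    expect (P.cbLaw σ) (fun ω => expect (lawPhase2 ε₁ ω i j l v q) fun z =>
      ind (P.Typ₂ ε₂ (ω.u j') (ω.v v) (fun m => ω.s (v, q') b m (ω.v v m)) fun m => (z m).2)) ≤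
      (2 : ℝ) ^ (-(σ.m * (P.i₁₃ - δ))) := by
  have hne : (v, q') ≠ (v, q) := fun h => hq (Prod.mk.inj h).2
  refine ((P.resamples_u σ j').comp (P.resamples_s σ (v, q') b)).expect_law_le
    (P.cbLaw_mem σ) (fun ω => lawPhase2_mem _ _ _ _ _ _ _) (fun ω a => ?_) (fun ω z' => ?_)
  · simp only [lawPhase2, binIdx, Function.update_of_ne hj.symm, Function.update_of_ne hne.symm]
  · simp only [expect_prodW, Function.update_self]
    exact le_of_eq_of_le (congrArg (expect (P.seqU₁₁ σ.m)) (funext fun u => P.expect_tabU₂₂ (ω.v v) (fun s => ind (P.Typ₂ ε₂ u (ω.v v) s fun m => (z' m).2))))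
      (hP.packs₁₃ σ.m (ω.v v) fun m => (z' m).2)

theorem expect_typ₂_le₁₄ (hP : P.Packs ε₂ δ) (i : Fin σ.n₁₀) (j j' : Fin σ.n₁₁) (l : Fin σ.n₁₂)
    (v v' : Fin σ.n₂₁) (q q' : Fin σ.n₂₂) (b : Fin σ.nᵥ)
    (hj : j' ≠ j) (hv : v' ≠ v) :
    expect (P.cbLaw σ) (fun ω => expect (lawPhase2 ε₁ ω i j l v q) fun z =>
      ind (P.Typ₂ ε₂ (ω.u j') (ω.v v') (fun m => ω.s (v', q') b m (ω.v v' m)) fun m => (z m).2)) ≤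
      (2 : ℝ) ^ (-(σ.m * (P.i₁₄ - δ))) := by
  have hne : (v', q') ≠ (v, q) := fun h => hv (Prod.mk.inj h).1
  refine (((P.resamples_u σ j').comp (P.resamples_v σ v')).comp (P.resamples_s σ (v', q') b)).expect_law_le
    (P.cbLaw_mem σ) (fun ω => lawPhase2_mem _ _ _ _ _ _ _) (fun ω a => ?_) (fun ω z' => ?_)
  · simp only [lawPhase2, binIdx, Function.update_of_ne hj.symm, Function.update_of_ne hv.symm, Function.update_of_ne hne.symm]
  · simp only [expect_prodW, Function.update_self]
    exact le_of_eq_of_le (congrArg (expect (P.seqU₁₁ σ.m)) (funext fun u => congrArg (expect (P.seqU₂₁ σ.m)) (funext fun v => P.expect_tabU₂₂ v (fun s => ind (P.Typ₂ ε₂ u v s fun m => (z' m).2)))))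
      (hP.packs₁₄ σ.m  fun m => (z' m).2)

end HKInput

end

/-! ### Atypical events and failure of binning -/

noncomputable section

open Filter Topology

namespace HKInput

variable {W : HDChannel.{u}} {P : HKInput W} {σ : HKSizes} {ε₁ ε₂ δ : ℝ}

/-- The law of the outputs of the first phase. -/
def lawPhase1 (x : Fin σ.n₁₀ → Fin σ.k → W.X₁₁) (i : Fin σ.n₁₀) :
    (Fin σ.k → W.Y₁₁ × W.Y₂₁ × W.Y) → ℝ :=
  prodWeight fun k => W.phase1 (x i k)

theorem lawPhase1_mem (x : Fin σ.n₁₀ → Fin σ.k → W.X₁₁) (i : Fin σ.n₁₀) :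
    lawPhase1 x i ∈ stdSimplex ℝ _ :=
  prodWeight_mem fun _ => (W.phase1 _).2

theorem expect_not_typ_phase1_le {K : ℝ} (hK : (expect (prodWeight fun _ : Fin σ.k => P.pX₁₁) fun x =>
      expect (prodWeight fun i => W.phase1 (x i)) fun y =>
        ind (¬ (P.TypY ε₂ x (fun i => (y i).2.2) ∧ P.TypY₁₁ ε₂ x (fun i => (y i).1)))) ≤ K)
    (i : Fin σ.n₁₀) :
    expect (P.cbLaw σ) (fun ω => expect (lawPhase1 ω.x i) fun y =>
      ind (¬ (P.TypY ε₂ (ω.x i) (fun k => (y k).2.2) ∧ P.TypY₁₁ ε₂ (ω.x i) fun k => (y k).1))) ≤ K := by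
  rw [P.resamples_x σ i]
  simp only [Function.update_self, lawPhase1]
  exact expect_le_of_le (P.cbLaw_mem σ) fun ω => hK

theorem expect_typY_le (hP : P.Packs ε₂ δ) {i i' : Fin σ.n₁₀} (hi : i' ≠ i) :
    expect (P.cbLaw σ) (fun ω => expect (lawPhase1 ω.x i) fun y =>
      ind (P.TypY ε₂ (ω.x i') fun k => (y k).2.2)) ≤ (2 : ℝ) ^ (-(σ.k * (P.i₂ - δ))) := by
  refine (P.resamples_x σ i').expect_law_le (P.cbLaw_mem σ) (fun ω => lawPhase1_mem _ _)
    (fun ω a => ?_) (fun ω y => ?_)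
  · simp only [lawPhase1, Function.update_of_ne hi.symm]
  · simp only [Function.update_self]
    exact hP.packs_Y σ.k fun k => (y k).2.2

theorem expect_typY₁₁_le (hP : P.Packs ε₂ δ) {i i' : Fin σ.n₁₀} (hi : i' ≠ i) :
    expect (P.cbLaw σ) (fun ω => expect (lawPhase1 ω.x i) fun y =>
      ind (P.TypY₁₁ ε₂ (ω.x i') fun k => (y k).1)) ≤ (2 : ℝ) ^ (-(σ.k * (P.iY₁₁ - δ))) := by
  refine (P.resamples_x σ i').expect_law_le (P.cbLaw_mem σ) (fun ω => lawPhase1_mem _ _)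
    (fun ω a => ?_) (fun ω y => ?_)
  · simp only [lawPhase1, Function.update_of_ne hi.symm]
  · simp only [Function.update_self]
    exact hP.packs_Y₁₁ σ.k fun k => (y k).1

theorem expect_not_typPair_le {ε K : ℝ} (hK : (expect (prodWeight fun _ : Fin σ.m => P.pX₁₁) fun x =>
      expect (prodWeight fun _ : Fin σ.m => P.pU₂₁) fun v => ind (¬ P.TypPair ε x v)) ≤ K)
    (i : Fin σ.n₁₀) (v : Fin σ.n₂₁) :
    expect (P.cbLaw σ) (fun ω => ind (¬ P.TypPair ε (ω.x' i) (ω.v v))) ≤ K := by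
  rw [(P.resamples_x' σ i).comp (P.resamples_v σ v)]
  simp only [Function.update_self, expect_prodW]
  exact expect_le_of_le (P.cbLaw_mem σ) fun ω => hK

theorem ind_forall_le_prod {A : Type*} [Fintype A] (p : A → Prop) :
    ind (∀ a, p a) ≤ ∏ a, ind (p a) := by
  by_cases h : ∀ a, p a
  · rw [ind_of h]
    exact (Finset.prod_eq_one fun a _ => ind_of (h a)).ge
  · rw [ind_of_not h]
    exact Finset.prod_nonneg fun a _ => ind_nonneg _

/-- The probability that conditional binning finds no codeword. -/
theorem expect_not_typBin_le {ε' c : ℝ}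
    (hc : ∀ (x : Fin σ.m → W.X₁₁) (v : Fin σ.m → P.U₂₁), P.TypPair ε' x v →
      c ≤ expect (prodWeight fun j => P.pU₂₂' (v j)) fun s => ind (P.TypBin ε₁ x v s))
    (i : Fin σ.n₁₀) (v : Fin σ.n₂₁) (q : Fin σ.n₂₂) :
    expect (P.cbLaw σ) (fun ω => ind (P.TypPair ε' (ω.x' i) (ω.v v)) * ∏ b,
      ind (¬ P.TypBin ε₁ (ω.x' i) (ω.v v) (fun m => ω.s (v, q) b m (ω.v v m)))) ≤
      Real.exp (-(σ.nᵥ * c)) := by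
  -- Given `u₂₁` the indices of a bin are independent, so the probability that all of them fail is a
  -- power; `1 - p ≤ exp (-p)` makes it an exponential.
  rw [P.resamples_s_all σ (v, q)]
  simp only [Function.update_self]
  refine expect_le_of_le (P.cbLaw_mem σ) fun ω => ?_
  rw [expect_mul_left]
  rw [expect_prodWeight_prod (fun _ : Fin σ.nᵥ => P.tabU₂₂ σ.m)
    (fun _ T => ind (¬ P.TypBin ε₁ (ω.x' i) (ω.v v) (fun m => T m (ω.v v m))))]
  rw [Finset.prod_const, Finset.card_univ, Fintype.card_fin]
  by_cases hT : P.TypPair ε' (ω.x' i) (ω.v v)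
  swap
  · rw [ind_of_not hT, zero_mul]
    exact (Real.exp_pos _).le
  rw [ind_of hT, one_mul, P.expect_tabU₂₂ (ω.v v)
    (fun s => ind (¬ P.TypBin ε₁ (ω.x' i) (ω.v v) s))]
  have hm : (prodWeight fun j => P.pU₂₂' (ω.v v j)) ∈ stdSimplex ℝ (Fin σ.m → P.U₂₂) :=
    prodWeight_mem fun _ => P.pU₂₂'_mem _
  have h1 : expect (prodWeight fun j => P.pU₂₂' (ω.v v j))
      (fun s => ind (¬ P.TypBin ε₁ (ω.x' i) (ω.v v) s)) +
      expect (prodWeight fun j => P.pU₂₂' (ω.v v j))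
      (fun s => ind (P.TypBin ε₁ (ω.x' i) (ω.v v) s)) = 1 := by
    rw [← expect_add]
    simp only [ind_not, sub_add_cancel]
    exact expect_const hm 1
  have h2 := hc _ _ hT
  have h3 : expect (prodWeight fun j => P.pU₂₂' (ω.v v j))
      (fun s => ind (¬ P.TypBin ε₁ (ω.x' i) (ω.v v) s)) ≤ Real.exp (-c) := by
    have := Real.add_one_le_exp (-c)
    linarith
  refine (pow_le_pow_left₀ (expect_nonneg hm.1 fun _ => ind_nonneg _) h3 _).trans_eq ?_
  rw [← Real.exp_nat_mul, mul_neg]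

/-- The probability that the true codewords are not jointly typical with the outputs of the second
phase. -/
theorem expect_not_typ_phase2_le {ε' c K₁ K₂ : ℝ}
    (hK₁ : (expect (prodWeight fun _ : Fin σ.m => P.pX₁₁) fun x =>
      expect (prodWeight fun _ : Fin σ.m => P.pU₂₁) fun v => ind (¬ P.TypPair ε' x v)) ≤ K₁)
    (hc : ∀ (x : Fin σ.m → W.X₁₁) (v : Fin σ.m → P.U₂₁), P.TypPair ε' x v →
      c ≤ expect (prodWeight fun j => P.pU₂₂' (v j)) fun s => ind (P.TypBin ε₁ x v s))
    (hK₂0 : 0 ≤ K₂)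
    (hK₂ : ∀ (x : Fin σ.m → W.X₁₁) (v : Fin σ.m → P.U₂₁) (s : Fin σ.m → P.U₂₂),
      P.TypBin ε₁ x v s → (expect (prodWeight fun _ : Fin σ.m => P.pU₁₁) fun u =>
      expect (prodWeight fun j => P.pX₁₂ (u j) (x j)) fun a =>
      expect (prodWeight fun j => P.pX₂₂ (x j) (v j) (s j)) fun t =>
      expect (prodWeight fun j => W.phase2 (a j) (t j)) fun z =>
        ind (¬ (P.Typ₁ ε₂ x u a v (fun j => (z j).1) ∧ P.Typ₂ ε₂ u v s (fun j => (z j).2)))) ≤ K₂)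
    (i : Fin σ.n₁₀) (j : Fin σ.n₁₁) (l : Fin σ.n₁₂) (v : Fin σ.n₂₁) (q : Fin σ.n₂₂) :
    expect (P.cbLaw σ) (fun ω => expect (lawPhase2 ε₁ ω i j l v q) fun z =>
      ind (¬ (P.Typ₁ ε₂ (ω.x' i) (ω.u j) (fun m => ω.a (i, j, l) m (ω.u j m, ω.x' i m)) (ω.v v)
        (fun m => (z m).1) ∧ P.Typ₂ ε₂ (ω.u j) (ω.v v)
          (fun m => ω.s (v, q) (binIdx ε₁ ω.x' ω.v ω.s i v q) m (ω.v v m)) fun m => (z m).2))) ≤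
      K₁ + Real.exp (-(σ.nᵥ * c)) + K₂ := by
  set T : P.Codebooks σ → Prop := fun ω => P.TypBin ε₁ (ω.x' i) (ω.v v)
    (fun m => ω.s (v, q) (binIdx ε₁ ω.x' ω.v ω.s i v q) m (ω.v v m)) with hT
  set F : P.Codebooks σ → ℝ := fun ω => expect (lawPhase2 ε₁ ω i j l v q) fun z =>
      ind (¬ (P.Typ₁ ε₂ (ω.x' i) (ω.u j) (fun m => ω.a (i, j, l) m (ω.u j m, ω.x' i m)) (ω.v v)
        (fun m => (z m).1) ∧ P.Typ₂ ε₂ (ω.u j) (ω.v v)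
          (fun m => ω.s (v, q) (binIdx ε₁ ω.x' ω.v ω.s i v q) m (ω.v v m)) fun m => (z m).2))
    with hF
  have hF1 : ∀ ω, F ω ≤ 1 := fun ω =>
    expect_le_of_le (lawPhase2_mem _ _ _ _ _ _ _) fun _ => ind_le_one _
  -- The chosen codeword is atypical only if the starting pair is atypical or every index fails,
  -- since `someOr` returns a good index whenever there is one.
  have hbad : ∀ ω, ind (¬ T ω) ≤ ind (¬ P.TypPair ε' (ω.x' i) (ω.v v)) +
      ind (P.TypPair ε' (ω.x' i) (ω.v v)) * ∏ b,
        ind (¬ P.TypBin ε₁ (ω.x' i) (ω.v v) (fun m => ω.s (v, q) b m (ω.v v m))) := by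
    intro ω
    by_cases hp : P.TypPair ε' (ω.x' i) (ω.v v)
    · rw [ind_of hp, ind_of_not (not_not.2 hp), zero_add, one_mul]
      refine (ind_mono fun h b hb => h ?_).trans (ind_forall_le_prod _)
      exact someOr_spec 0 (S := fun b => P.TypBin ε₁ (ω.x' i) (ω.v v)
        (fun m => ω.s (v, q) b m (ω.v v m))) ⟨b, hb⟩
    · rw [ind_of hp, ind_of_not hp, zero_mul, add_zero]
      exact ind_le_one _
  have hsplit : ∀ ω, F ω ≤ ind (¬ T ω) + F ω * ind (T ω) := by
    intro ω
    by_cases h : T ω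
    · rw [ind_of_not (not_not.2 h), ind_of h]; linarith
    · rw [ind_of h, ind_of_not h]; linarith [hF1 ω]
  -- `u₁₁`, the table of `x₁₂` and the table of `x₂₂` at the chosen index are redrawn. The event `T`
  -- involves none of them and stays as a factor, so the bound for typical triples applies.
  have hgood : expect (P.cbLaw σ) (fun ω => F ω * ind (T ω)) ≤ K₂ := by
    rw [((P.resamples_u σ j).comp (P.resamples_a σ (i, j, l))).comp
      (P.resamples_t σ i v q fun x' v' s' => binIdx ε₁ x' v' s' i v q)]
    refine expect_le_of_le (P.cbLaw_mem σ) fun ω => ?_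
    simp only [hF, hT, lawPhase2, Function.update_self, expect_mul_right, expect_prodW]
    by_cases h : T ω
    · rw [ind_of h, mul_one]
      refine le_of_eq_of_le ?_ (hK₂ _ _ _ h)
      refine congrArg (expect (P.seqU₁₁ σ.m)) (funext fun u => ?_)
      refine Eq.trans ?_ (P.expect_tabX₁₂ u (ω.x' i) _)
      refine congrArg (expect (P.tabX₁₂ σ.m)) (funext fun a => ?_)
      exact P.expect_tabX₂₂ (ω.x' i) (ω.v v)
        (fun m => ω.s (v, q) (binIdx ε₁ ω.x' ω.v ω.s i v q) m (ω.v v m))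
        (fun t => expect (prodWeight fun m => W.phase2 (a m (u m, ω.x' i m)) (t m)) fun z =>
        ind (¬ (P.Typ₁ ε₂ (ω.x' i) u (fun m => a m (u m, ω.x' i m)) (ω.v v)
          (fun m => (z m).1) ∧ P.Typ₂ ε₂ u (ω.v v)
          (fun m => ω.s (v, q) (binIdx ε₁ ω.x' ω.v ω.s i v q) m (ω.v v m)) fun m => (z m).2)))
    · rw [ind_of_not h, mul_zero]
      exact hK₂0
  calc expect (P.cbLaw σ) F
      ≤ expect (P.cbLaw σ) (fun ω => (ind (¬ P.TypPair ε' (ω.x' i) (ω.v v)) +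
          ind (P.TypPair ε' (ω.x' i) (ω.v v)) * ∏ b,
            ind (¬ P.TypBin ε₁ (ω.x' i) (ω.v v) (fun m => ω.s (v, q) b m (ω.v v m)))) +
          F ω * ind (T ω)) :=
        expect_mono (P.cbLaw_mem σ).1 fun ω =>
          (hsplit ω).trans (add_le_add (hbad ω) le_rfl)
    _ ≤ _ := by
        rw [expect_add, expect_add]
        exact add_le_add (add_le_add (expect_not_typPair_le hK₁ i v)
          (expect_not_typBin_le hc i v q)) hgood

end HKInput

end

/-! ### Expected error probability of the random code -/

noncomputable section

open Filter Topology

/-- One correct value and `n - 1` wrong ones. The exact count matters: a message set of size one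
must contribute no wrong candidates. -/
theorem sum_ite_eq_const {n : ℕ} (i : Fin n) (a b : ℝ) :
    ∑ i' : Fin n, (if i' = i then a else b) = a + (n - 1) * b := by
  have h : ∀ i' : Fin n, (if i' = i then a else b) = (if i' = i then a - b else 0) + b := by
    intro i'
    split_ifs <;> ring
  simp only [h, Finset.sum_add_distrib, Finset.sum_ite_eq', Finset.mem_univ, if_true,
    Finset.sum_const, Finset.card_univ, Fintype.card_fin, nsmul_eq_mul]
  ring

theorem expect_add_expect {Y Z : Type*} [Fintype Y] [Fintype Z] {p : Y → ℝ} {q : Z → ℝ}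
    (hp : p ∈ stdSimplex ℝ Y) (a b : Y → ℝ) (c e : Z → ℝ) (d : Y → Z → ℝ) :
    (expect p fun y => (a y + b y) + expect q fun z => (c z + d y z) + e z) =
      expect p a + expect p b +
        (expect q c + (expect p fun y => expect q (d y)) + expect q e) := by
  simp only [expect_add, expect_const hp]

namespace HKInput

variable {W : HDChannel.{u}} {P : HKInput W} {σ : HKSizes} {ε₁ ε₂ δ : ℝ}

/-- The expected number of wrong pairs of a message triple and an index `w₂₁` that pass the test of
the first destination is bounded by this. -/
def wrongBound₁ (P : HKInput W) (σ : HKSizes) (δ : ℝ) : ℝ :=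
  σ.n₁₂ * (((σ.n₁₁ : ℝ) - 1) * ((2 : ℝ) ^ (-(σ.m * (P.i₅ - δ))) +
      (σ.n₂₁ - 1) * (2 : ℝ) ^ (-(σ.m * (P.i₉ - δ))))) +
    ((σ.n₁₂ : ℝ) - 1) * ((2 : ℝ) ^ (-(σ.m * (P.i₃ - δ))) +
      (σ.n₂₁ - 1) * (2 : ℝ) ^ (-(σ.m * (P.i₇ - δ)))) +
    ((σ.n₁₀ : ℝ) - 1) * (2 : ℝ) ^ (-(σ.k * (P.iY₁₁ - δ))) * (σ.n₁₂ *
      (((2 : ℝ) ^ (-(σ.m * (P.i₄ - δ))) + (σ.n₂₁ - 1) * (2 : ℝ) ^ (-(σ.m * (P.i₈ - δ)))) +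
      (σ.n₁₁ - 1) * ((2 : ℝ) ^ (-(σ.m * (P.i₆ - δ))) +
        (σ.n₂₁ - 1) * (2 : ℝ) ^ (-(σ.m * (P.i₁₀ - δ))))))

/-- The expected number of wrong tuples that pass the test of the second destination is bounded by
this. -/
def wrongBound₂ (P : HKInput W) (σ : HKSizes) (δ : ℝ) : ℝ :=
  σ.nᵥ * (((σ.n₂₂ : ℝ) - 1) * ((2 : ℝ) ^ (-(σ.m * (P.i₁₁ - δ))) +
      (σ.n₁₁ - 1) * (2 : ℝ) ^ (-(σ.m * (P.i₁₃ - δ)))) +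
    (σ.n₂₁ - 1) * (σ.n₂₂ * ((2 : ℝ) ^ (-(σ.m * (P.i₁₂ - δ))) +
      (σ.n₁₁ - 1) * (2 : ℝ) ^ (-(σ.m * (P.i₁₄ - δ))))))

/-- With `w₁₀` correct, the first-phase test gives no help and is dropped. With `w₁₀` wrong, the
tests of the two phases concern independent parts of the wrong `x₁₁`, and their probabilities
multiply. The value `0` belongs to the true triple only, which is excluded. -/
theorem expect_wrong_term₁_le (hP : P.Packs ε₂ δ) (i i' : Fin σ.n₁₀) (j j' : Fin σ.n₁₁)
    (l l' : Fin σ.n₁₂) (v v' : Fin σ.n₂₁) (q : Fin σ.n₂₂) (hw : (i', j', l') ≠ (i, j, l)) :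
    expect (P.cbLaw σ) (fun ω => expect (lawPhase1 ω.x i) fun y =>
      expect (lawPhase2 ε₁ ω i j l v q) fun z =>
      ind (P.Typ₁ ε₂ (ω.x' i') (ω.u j') (fun m => ω.a (i', j', l') m (ω.u j' m, ω.x' i' m)) (ω.v v')
        (fun m => (z m).1) ∧ P.TypY₁₁ ε₂ (ω.x i') fun k => (y k).1)) ≤
      if i' = i then
        if j' = j then
          if l' = l then 0 else
            if v' = v then (2 : ℝ) ^ (-(σ.m * (P.i₃ - δ))) else (2 : ℝ) ^ (-(σ.m * (P.i₇ - δ)))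
        else if v' = v then (2 : ℝ) ^ (-(σ.m * (P.i₅ - δ))) else (2 : ℝ) ^ (-(σ.m * (P.i₉ - δ)))
      else (2 : ℝ) ^ (-(σ.k * (P.iY₁₁ - δ))) * if j' = j then
          if v' = v then (2 : ℝ) ^ (-(σ.m * (P.i₄ - δ))) else (2 : ℝ) ^ (-(σ.m * (P.i₈ - δ)))
        else if v' = v then (2 : ℝ) ^ (-(σ.m * (P.i₆ - δ))) else (2 : ℝ) ^ (-(σ.m * (P.i₁₀ - δ))) := by
  have hone : expect (P.cbLaw σ) (fun _ => 1) = 1 := expect_const (P.cbLaw_mem σ) 1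
  by_cases hi : i' = i
  · subst hi
    rw [if_pos rfl]
    have hdrop : ∀ ω : P.Codebooks σ, (expect (lawPhase1 ω.x i') fun y =>
        expect (lawPhase2 ε₁ ω i' j l v q) fun z =>
        ind (P.Typ₁ ε₂ (ω.x' i') (ω.u j') (fun m => ω.a (i', j', l') m (ω.u j' m, ω.x' i' m))
          (ω.v v') (fun m => (z m).1) ∧ P.TypY₁₁ ε₂ (ω.x i') fun k => (y k).1)) ≤
        1 * expect (lawPhase2 ε₁ ω i' j l v q) fun z =>
          ind (P.Typ₁ ε₂ (ω.x' i') (ω.u j') (fun m => ω.a (i', j', l') m (ω.u j' m, ω.x' i' m))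
            (ω.v v') fun m => (z m).1) := by
      intro ω
      rw [one_mul]
      exact expect_le_of_le (lawPhase1_mem _ _) fun y =>
        expect_mono (lawPhase2_mem _ _ _ _ _ _ _).1 fun z => ind_mono And.left
    refine (expect_mono (P.cbLaw_mem σ).1 hdrop).trans ?_
    have h0 : ∀ _ : Fin σ.n₁₀ → Fin σ.k → W.X₁₁, (0 : ℝ) ≤ 1 := fun _ => zero_le_one
    by_cases hj : j' = j
    · subst hj
      have hl : l' ≠ l := fun h => hw (by rw [h])
      rw [if_pos rfl, if_neg hl]
      by_cases hv : v' = v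
      · subst hv
        rw [if_pos rfl]
        exact (expect_typ₁_le₃ σ hP i' j' l l' v' q hl (g := fun _ => 1) h0).trans_eq (by rw [hone, mul_one])
      · rw [if_neg hv]
        exact (expect_typ₁_le₇ σ hP i' j' l l' v v' q hl hv (g := fun _ => 1) h0).trans_eq (by rw [hone, mul_one])
    · rw [if_neg hj]
      by_cases hv : v' = v
      · subst hv
        rw [if_pos rfl]
        exact (expect_typ₁_le₅ σ hP i' j j' l l' v' q hj (g := fun _ => 1) h0).trans_eq (by rw [hone, mul_one])
      · rw [if_neg hv]
        exact (expect_typ₁_le₉ σ hP i' j j' l l' v v' q hj hv (g := fun _ => 1) h0).trans_eq (by rw [hone, mul_one])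
  · rw [if_neg hi]
    set g : (Fin σ.n₁₀ → Fin σ.k → W.X₁₁) → ℝ := fun x => expect (lawPhase1 x i) fun y =>
      ind (P.TypY₁₁ ε₂ (x i') fun k => (y k).1) with hg
    have h0 : ∀ x, 0 ≤ g x := fun x =>
      expect_nonneg (lawPhase1_mem _ _).1 fun _ => ind_nonneg _
    have hgY : expect (P.cbLaw σ) (fun ω => g ω.x) ≤ (2 : ℝ) ^ (-(σ.k * (P.iY₁₁ - δ))) :=
      expect_typY₁₁_le hP hi
    have hfac : ∀ ω : P.Codebooks σ, (expect (lawPhase1 ω.x i) fun y =>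
        expect (lawPhase2 ε₁ ω i j l v q) fun z =>
        ind (P.Typ₁ ε₂ (ω.x' i') (ω.u j') (fun m => ω.a (i', j', l') m (ω.u j' m, ω.x' i' m))
          (ω.v v') (fun m => (z m).1) ∧ P.TypY₁₁ ε₂ (ω.x i') fun k => (y k).1)) =
        g ω.x * expect (lawPhase2 ε₁ ω i j l v q) fun z =>
          ind (P.Typ₁ ε₂ (ω.x' i') (ω.u j') (fun m => ω.a (i', j', l') m (ω.u j' m, ω.x' i' m))
            (ω.v v') fun m => (z m).1) := by
      intro ω
      simp only [ind_and, expect_mul_right, expect_mul_left, hg]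
      ring
    simp only [hfac]
    rw [mul_comm ((2 : ℝ) ^ (-(σ.k * (P.iY₁₁ - δ))))]
    have hpos : ∀ r : ℝ, (0 : ℝ) ≤ 2 ^ r := fun r => (Real.rpow_pos_of_pos two_pos r).le
    by_cases hj : j' = j
    · subst hj
      rw [if_pos rfl]
      by_cases hv : v' = v
      · subst hv
        rw [if_pos rfl]
        exact (expect_typ₁_le₄ σ hP i i' j' l l' v' q hi (g := g) h0).trans
          (mul_le_mul_of_nonneg_left hgY (hpos _))
      · rw [if_neg hv]
        exact (expect_typ₁_le₈ σ hP i i' j' l l' v v' q hi hv (g := g) h0).trans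
          (mul_le_mul_of_nonneg_left hgY (hpos _))
    · rw [if_neg hj]
      by_cases hv : v' = v
      · subst hv
        rw [if_pos rfl]
        exact (expect_typ₁_le₆ σ hP i i' j j' l l' v' q hi hj (g := g) h0).trans
          (mul_le_mul_of_nonneg_left hgY (hpos _))
      · rw [if_neg hv]
        exact (expect_typ₁_le₁₀ σ hP i i' j j' l l' v v' q hi hj hv (g := g) h0).trans
          (mul_le_mul_of_nonneg_left hgY (hpos _))

/-- Once `w₂₁` is wrong, `w₂₂` no longer matters: all bins of another `w₂₁` are fresh. -/
theorem expect_wrong_term₂_le (hP : P.Packs ε₂ δ) (i : Fin σ.n₁₀) (j j' : Fin σ.n₁₁)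
    (l : Fin σ.n₁₂) (v v' : Fin σ.n₂₁) (q q' : Fin σ.n₂₂) (b : Fin σ.nᵥ) (hw : (v', q') ≠ (v, q)) :
    expect (P.cbLaw σ) (fun ω => expect (lawPhase2 ε₁ ω i j l v q) fun z =>
      ind (P.Typ₂ ε₂ (ω.u j') (ω.v v') (fun m => ω.s (v', q') b m (ω.v v' m)) fun m => (z m).2)) ≤
      if v' = v then
        if q' = q then 0 else
          if j' = j then (2 : ℝ) ^ (-(σ.m * (P.i₁₁ - δ))) else (2 : ℝ) ^ (-(σ.m * (P.i₁₃ - δ)))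
      else if j' = j then (2 : ℝ) ^ (-(σ.m * (P.i₁₂ - δ))) else (2 : ℝ) ^ (-(σ.m * (P.i₁₄ - δ))) := by
  by_cases hv : v' = v
  · subst hv
    have hq : q' ≠ q := fun h => hw (by rw [h])
    rw [if_pos rfl, if_neg hq]
    by_cases hj : j' = j
    · subst hj
      rw [if_pos rfl]
      exact expect_typ₂_le₁₁ σ hP i j' l v' q q' b hq
    · rw [if_neg hj]
      exact expect_typ₂_le₁₃ σ hP i j j' l v' q q' b hj hq
  · rw [if_neg hv]
    by_cases hj : j' = j
    · subst hj
      rw [if_pos rfl]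
      exact expect_typ₂_le₁₂ σ hP i j' l v v' q q' b hv
    · rw [if_neg hj]
      exact expect_typ₂_le₁₄ σ hP i j j' l v v' q q' b hj hv

theorem expect_wrong₁_le (hP : P.Packs ε₂ δ) (h₁ : 0 < ε₁) (h₂ : 0 < ε₂) (i : Fin σ.n₁₀)
    (j : Fin σ.n₁₁) (l : Fin σ.n₁₂) (v : Fin σ.n₂₁) (q : Fin σ.n₂₂) :
    expect (P.cbLaw σ) (fun ω => expect (lawPhase1 ω.x i) fun y =>
      expect (lawPhase2 ε₁ ω i j l v q) fun z =>
        (P.scheme σ h₁ h₂ ω).wrong₁ (i, j, l) y z) ≤ wrongBound₁ P σ δ := by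
  classical
  set β : Fin σ.n₁₀ × Fin σ.n₁₁ × Fin σ.n₁₂ → Fin σ.n₂₁ → ℝ := fun w v' =>
      if w.1 = i then
        if w.2.1 = j then
          if w.2.2 = l then 0 else
            if v' = v then (2 : ℝ) ^ (-(σ.m * (P.i₃ - δ))) else (2 : ℝ) ^ (-(σ.m * (P.i₇ - δ)))
        else if v' = v then (2 : ℝ) ^ (-(σ.m * (P.i₅ - δ))) else (2 : ℝ) ^ (-(σ.m * (P.i₉ - δ)))
      else (2 : ℝ) ^ (-(σ.k * (P.iY₁₁ - δ))) * if w.2.1 = j then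
          if v' = v then (2 : ℝ) ^ (-(σ.m * (P.i₄ - δ))) else (2 : ℝ) ^ (-(σ.m * (P.i₈ - δ)))
        else if v' = v then (2 : ℝ) ^ (-(σ.m * (P.i₆ - δ))) else (2 : ℝ) ^ (-(σ.m * (P.i₁₀ - δ)))
    with hβ
  have hβ0 : ∀ w v', 0 ≤ β w v' := by
    intro w v'
    simp only [hβ]
    split_ifs <;> positivity
  have h1 : expect (P.cbLaw σ) (fun ω => expect (lawPhase1 ω.x i) fun y =>
      expect (lawPhase2 ε₁ ω i j l v q) fun z =>
        (P.scheme σ h₁ h₂ ω).wrong₁ (i, j, l) y z) ≤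
      ∑ w ∈ Finset.univ.filter (· ≠ (i, j, l)), ∑ v', β w v' := by
    have he : ∀ (ω : P.Codebooks σ) (y : Fin σ.k → W.Y₁₁ × W.Y₂₁ × W.Y)
        (z : Fin σ.m → W.Y₁₂ × W.Y₂₂), (P.scheme σ h₁ h₂ ω).wrong₁ (i, j, l) y z =
        ∑ w ∈ Finset.univ.filter (· ≠ (i, j, l)), ∑ v',
        ind (P.Typ₁ ε₂ (ω.x' w.1) (ω.u w.2.1)
          (fun m => ω.a (w.1, w.2.1, w.2.2) m (ω.u w.2.1 m, ω.x' w.1 m)) (ω.v v')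
          (fun m => (z m).1) ∧ P.TypY₁₁ ε₂ (ω.x w.1) fun k => (y k).1) := by
      intro ω y z
      refine Finset.sum_congr ?_ fun _ _ => rfl
      exact Finset.filter_congr_decidable _ _ _
    simp only [he, expect_sum]
    refine Finset.sum_le_sum fun w hw => Finset.sum_le_sum fun v' _ => ?_
    exact expect_wrong_term₁_le hP i w.1 j w.2.1 l w.2.2 v v' q (Finset.mem_filter.1 hw).2
  -- The true triple may be added because its bound is `0`; the sum then runs over a full product
  -- and is evaluated coordinate by coordinate.
  refine h1.trans ((Finset.sum_le_sum_of_subset_of_nonneg (Finset.filter_subset _ _)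
    fun w _ _ => Finset.sum_nonneg fun v' _ => hβ0 w v').trans_eq ?_)
  rw [Fintype.sum_prod_type]
  simp only [Fintype.sum_prod_type, hβ]
  have hsum : ∀ (i' : Fin σ.n₁₀) (j' : Fin σ.n₁₁) (l' : Fin σ.n₁₂), ∑ v', β (i', j', l') v' =
      if i' = i then
        if j' = j then
          if l' = l then 0 else
            (2 : ℝ) ^ (-(σ.m * (P.i₃ - δ))) + (σ.n₂₁ - 1) * (2 : ℝ) ^ (-(σ.m * (P.i₇ - δ)))
        else (2 : ℝ) ^ (-(σ.m * (P.i₅ - δ))) + (σ.n₂₁ - 1) * (2 : ℝ) ^ (-(σ.m * (P.i₉ - δ)))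
      else (2 : ℝ) ^ (-(σ.k * (P.iY₁₁ - δ))) * if j' = j then
          (2 : ℝ) ^ (-(σ.m * (P.i₄ - δ))) + (σ.n₂₁ - 1) * (2 : ℝ) ^ (-(σ.m * (P.i₈ - δ)))
        else (2 : ℝ) ^ (-(σ.m * (P.i₆ - δ))) + (σ.n₂₁ - 1) * (2 : ℝ) ^ (-(σ.m * (P.i₁₀ - δ))) := by
    intro i' j' l'
    simp only [hβ]
    split_ifs <;> simp only [← Finset.mul_sum, sum_ite_eq_const, Finset.sum_const_zero]
  have hsum' : ∀ (i' : Fin σ.n₁₀), ∑ j', ∑ l', ∑ v', β (i', j', l') v' =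
      if i' = i then ((σ.n₁₂ : ℝ) - 1) * ((2 : ℝ) ^ (-(σ.m * (P.i₃ - δ))) +
          (σ.n₂₁ - 1) * (2 : ℝ) ^ (-(σ.m * (P.i₇ - δ)))) +
        (σ.n₁₁ - 1) * (σ.n₁₂ * ((2 : ℝ) ^ (-(σ.m * (P.i₅ - δ))) +
          (σ.n₂₁ - 1) * (2 : ℝ) ^ (-(σ.m * (P.i₉ - δ)))))
      else σ.n₁₂ * ((2 : ℝ) ^ (-(σ.k * (P.iY₁₁ - δ))) *
        (((2 : ℝ) ^ (-(σ.m * (P.i₄ - δ))) + (σ.n₂₁ - 1) * (2 : ℝ) ^ (-(σ.m * (P.i₈ - δ)))) +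
        (σ.n₁₁ - 1) * ((2 : ℝ) ^ (-(σ.m * (P.i₆ - δ))) +
          (σ.n₂₁ - 1) * (2 : ℝ) ^ (-(σ.m * (P.i₁₀ - δ)))))) := by
    intro i'
    simp only [hsum]
    split_ifs with hi
    · have : ∀ j', (∑ l', if j' = j then
          if l' = l then 0 else
            (2 : ℝ) ^ (-(σ.m * (P.i₃ - δ))) + (σ.n₂₁ - 1) * (2 : ℝ) ^ (-(σ.m * (P.i₇ - δ)))
        else (2 : ℝ) ^ (-(σ.m * (P.i₅ - δ))) + (σ.n₂₁ - 1) * (2 : ℝ) ^ (-(σ.m * (P.i₉ - δ)))) =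
        if j' = j then ((σ.n₁₂ : ℝ) - 1) * ((2 : ℝ) ^ (-(σ.m * (P.i₃ - δ))) +
          (σ.n₂₁ - 1) * (2 : ℝ) ^ (-(σ.m * (P.i₇ - δ)))) else
          σ.n₁₂ * ((2 : ℝ) ^ (-(σ.m * (P.i₅ - δ))) +
          (σ.n₂₁ - 1) * (2 : ℝ) ^ (-(σ.m * (P.i₉ - δ)))) := by
        intro j'
        split_ifs
        · rw [sum_ite_eq_const, zero_add]
        · rw [Finset.sum_const, Finset.card_univ, Fintype.card_fin, nsmul_eq_mul]
      simp only [this, sum_ite_eq_const]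
    · simp only [Finset.sum_const, Finset.card_univ, Fintype.card_fin, nsmul_eq_mul,
        ← Finset.mul_sum, sum_ite_eq_const]
  refine (Finset.sum_congr rfl fun i' _ => hsum' i').trans ?_
  rw [sum_ite_eq_const, wrongBound₁]
  ring

theorem expect_wrong₂_le (hP : P.Packs ε₂ δ) (h₁ : 0 < ε₁) (h₂ : 0 < ε₂) (i : Fin σ.n₁₀)
    (j : Fin σ.n₁₁) (l : Fin σ.n₁₂) (v : Fin σ.n₂₁) (q : Fin σ.n₂₂) :
    expect (P.cbLaw σ) (fun ω => expect (lawPhase2 ε₁ ω i j l v q) fun z =>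
        (P.scheme σ h₁ h₂ ω).wrong₂ (v, q) z) ≤ wrongBound₂ P σ δ := by
  classical
  set β : Fin σ.n₂₁ × Fin σ.n₂₂ → Fin σ.n₁₁ → ℝ := fun w j' =>
      if w.1 = v then
        if w.2 = q then 0 else
          if j' = j then (2 : ℝ) ^ (-(σ.m * (P.i₁₁ - δ))) else (2 : ℝ) ^ (-(σ.m * (P.i₁₃ - δ)))
      else if j' = j then (2 : ℝ) ^ (-(σ.m * (P.i₁₂ - δ))) else (2 : ℝ) ^ (-(σ.m * (P.i₁₄ - δ)))
    with hβ
  have hβ0 : ∀ w j', 0 ≤ β w j' := by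
    intro w j'
    simp only [hβ]
    split_ifs <;> positivity
  have h1 : expect (P.cbLaw σ) (fun ω => expect (lawPhase2 ε₁ ω i j l v q) fun z =>
        (P.scheme σ h₁ h₂ ω).wrong₂ (v, q) z) ≤
      ∑ w ∈ Finset.univ.filter (· ≠ (v, q)), ∑ j', ∑ _b : Fin σ.nᵥ, β w j' := by
    have he : ∀ (ω : P.Codebooks σ)
        (z : Fin σ.m → W.Y₁₂ × W.Y₂₂), (P.scheme σ h₁ h₂ ω).wrong₂ (v, q) z =
        ∑ w ∈ Finset.univ.filter (· ≠ (v, q)), ∑ j', ∑ b, ind (P.Typ₂ ε₂ (ω.u j') (ω.v w.1)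
          (fun m => ω.s (w.1, w.2) b m (ω.v w.1 m)) fun m => (z m).2) := by
      intro ω z
      refine Finset.sum_congr ?_ fun _ _ => rfl
      exact Finset.filter_congr_decidable _ _ _
    simp only [he, expect_sum]
    refine Finset.sum_le_sum fun w hw => Finset.sum_le_sum fun j' _ =>
      Finset.sum_le_sum fun b _ => ?_
    exact expect_wrong_term₂_le hP i j j' l v w.1 q w.2 b (Finset.mem_filter.1 hw).2
  refine h1.trans ((Finset.sum_le_sum_of_subset_of_nonneg (Finset.filter_subset _ _)
    fun w _ _ => Finset.sum_nonneg fun j' _ => Finset.sum_nonneg fun _ _ => hβ0 w j').trans_eq ?_)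
  have hsum : ∀ (v' : Fin σ.n₂₁) (q' : Fin σ.n₂₂), ∑ j', ∑ _b : Fin σ.nᵥ, β (v', q') j' =
      if v' = v then
        if q' = q then 0 else σ.nᵥ * ((2 : ℝ) ^ (-(σ.m * (P.i₁₁ - δ))) +
          (σ.n₁₁ - 1) * (2 : ℝ) ^ (-(σ.m * (P.i₁₃ - δ))))
      else σ.nᵥ * ((2 : ℝ) ^ (-(σ.m * (P.i₁₂ - δ))) +
        (σ.n₁₁ - 1) * (2 : ℝ) ^ (-(σ.m * (P.i₁₄ - δ)))) := by
    intro v' q'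
    simp only [hβ, Finset.sum_const, Finset.card_univ, Fintype.card_fin, nsmul_eq_mul]
    split_ifs <;> simp only [← Finset.mul_sum, sum_ite_eq_const, Finset.sum_const_zero, mul_zero]
  have hsum' : ∀ v' : Fin σ.n₂₁, ∑ q', ∑ j', ∑ _b : Fin σ.nᵥ, β (v', q') j' =
      if v' = v then (σ.n₂₂ - 1) * (σ.nᵥ * ((2 : ℝ) ^ (-(σ.m * (P.i₁₁ - δ))) +
          (σ.n₁₁ - 1) * (2 : ℝ) ^ (-(σ.m * (P.i₁₃ - δ)))))
      else σ.n₂₂ * (σ.nᵥ * ((2 : ℝ) ^ (-(σ.m * (P.i₁₂ - δ))) +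
        (σ.n₁₁ - 1) * (2 : ℝ) ^ (-(σ.m * (P.i₁₄ - δ))))) := by
    intro v'
    simp only [hsum]
    split_ifs
    · rw [sum_ite_eq_const, zero_add]
    · rw [Finset.sum_const, Finset.card_univ, Fintype.card_fin, nsmul_eq_mul]
  rw [Fintype.sum_prod_type]
  refine (Finset.sum_congr rfl fun v' _ => hsum' v').trans ?_
  rw [sum_ite_eq_const, wrongBound₂]
  ring

/-- Random coding: some code with the given sizes is at least as good as the average. -/
theorem exists_scheme_errorProb_le (hP : P.Packs ε₂ δ) (h₁ : 0 < ε₁) (h₂ : 0 < ε₂)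
    {ε' c K₀ K₁ K₂ : ℝ}
    (hK₀ : (expect (prodWeight fun _ : Fin σ.k => P.pX₁₁) fun x =>
      expect (prodWeight fun i => W.phase1 (x i)) fun y =>
        ind (¬ (P.TypY ε₂ x (fun i => (y i).2.2) ∧ P.TypY₁₁ ε₂ x (fun i => (y i).1)))) ≤ K₀)
    (hK₁ : (expect (prodWeight fun _ : Fin σ.m => P.pX₁₁) fun x =>
      expect (prodWeight fun _ : Fin σ.m => P.pU₂₁) fun v => ind (¬ P.TypPair ε' x v)) ≤ K₁)
    (hc : ∀ (x : Fin σ.m → W.X₁₁) (v : Fin σ.m → P.U₂₁), P.TypPair ε' x v →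
      c ≤ expect (prodWeight fun j => P.pU₂₂' (v j)) fun s => ind (P.TypBin ε₁ x v s))
    (hK₂0 : 0 ≤ K₂)
    (hK₂ : ∀ (x : Fin σ.m → W.X₁₁) (v : Fin σ.m → P.U₂₁) (s : Fin σ.m → P.U₂₂),
      P.TypBin ε₁ x v s → (expect (prodWeight fun _ : Fin σ.m => P.pU₁₁) fun u =>
      expect (prodWeight fun j => P.pX₁₂ (u j) (x j)) fun a =>
      expect (prodWeight fun j => P.pX₂₂ (x j) (v j) (s j)) fun t =>
      expect (prodWeight fun j => W.phase2 (a j) (t j)) fun z =>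
        ind (¬ (P.Typ₁ ε₂ x u a v (fun j => (z j).1) ∧ P.Typ₂ ε₂ u v s (fun j => (z j).2)))) ≤ K₂) :
    ∃ ω, (P.scheme σ h₁ h₂ ω).toCode.errorProb ≤
      K₀ + (σ.n₁₀ - 1) * (2 : ℝ) ^ (-(σ.k * (P.i₂ - δ))) + (K₁ + Real.exp (-(σ.nᵥ * c)) + K₂ +
        wrongBound₁ P σ δ + wrongBound₂ P σ δ) := by
  classical
  set B := K₀ + (σ.n₁₀ - 1) * (2 : ℝ) ^ (-(σ.k * (P.i₂ - δ))) + (K₁ + Real.exp (-(σ.nᵥ * c)) + K₂ +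
        wrongBound₁ P σ δ + wrongBound₂ P σ δ) with hB
  refine exists_le_of_expect_le (P.cbLaw_mem σ) ?_
  -- The bound is uniform in the messages, so it passes to the average over them.
  have hw : ∀ (w₁ : Fin σ.n₁₀ × Fin σ.n₁₁ × Fin σ.n₁₂) (w₂ : Fin σ.n₂₁ × Fin σ.n₂₂),
      expect (P.cbLaw σ) (fun ω => (P.scheme σ h₁ h₂ ω).toCode.errorProbAt w₁ w₂) ≤ B := by
    rintro ⟨i, j, l⟩ ⟨v, q⟩
    have hY : ∀ (ω : P.Codebooks σ) (y : Fin σ.k → W.Y₁₁ × W.Y₂₁ × W.Y),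
        (∑ w ∈ Finset.univ.filter (· ≠ i), ind (P.TypY ε₂ (ω.x w) fun i => (y i).2.2)) =
        ∑ w : Fin σ.n₁₀, if w = i then 0 else ind (P.TypY ε₂ (ω.x w) fun i => (y i).2.2) := by
      intro ω y
      rw [Finset.sum_filter]
      exact Finset.sum_congr rfl fun w _ => by simp only [ne_eq, ite_not]
    have hle : ∀ ω : P.Codebooks σ,
        (P.scheme σ h₁ h₂ ω).toCode.errorProbAt (i, j, l) (v, q) ≤ (expect (lawPhase1 ω.x i) fun y =>
        ind (¬ (P.TypY ε₂ (ω.x i) (fun k => (y k).2.2) ∧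
          P.TypY₁₁ ε₂ (ω.x i) fun k => (y k).1))) +
        (∑ w : Fin σ.n₁₀, if w = i then 0 else expect (lawPhase1 ω.x i) fun y =>
          ind (P.TypY ε₂ (ω.x w) fun i => (y i).2.2)) +
        ((expect (lawPhase2 ε₁ ω i j l v q) fun z =>
          ind (¬ (P.Typ₁ ε₂ (ω.x' i) (ω.u j) (fun m => ω.a (i, j, l) m (ω.u j m, ω.x' i m)) (ω.v v)
            (fun m => (z m).1) ∧ P.Typ₂ ε₂ (ω.u j) (ω.v v)
            (fun m => ω.s (v, q) (binIdx ε₁ ω.x' ω.v ω.s i v q) m (ω.v v m)) fun m => (z m).2))) +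
        (expect (lawPhase1 ω.x i) fun y => expect (lawPhase2 ε₁ ω i j l v q) fun z =>
          (P.scheme σ h₁ h₂ ω).wrong₁ (i, j, l) y z) +
        (expect (lawPhase2 ε₁ ω i j l v q) fun z =>
          (P.scheme σ h₁ h₂ ω).wrong₂ (v, q) z)) := by
      intro ω
      have h : (P.scheme σ h₁ h₂ ω).toCode.errorProbAt (i, j, l) (v, q) ≤
        expect (lawPhase1 ω.x i) (fun y =>
        (ind (¬ (P.TypY ε₂ (ω.x i) (fun k => (y k).2.2) ∧
          P.TypY₁₁ ε₂ (ω.x i) fun k => (y k).1)) +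
        ∑ w ∈ Finset.univ.filter (· ≠ i), ind (P.TypY ε₂ (ω.x w) fun i => (y i).2.2)) +
        expect (lawPhase2 ε₁ ω i j l v q) fun z => (
          ind (¬ (P.Typ₁ ε₂ (ω.x' i) (ω.u j) (fun m => ω.a (i, j, l) m (ω.u j m, ω.x' i m)) (ω.v v)
            (fun m => (z m).1) ∧ P.Typ₂ ε₂ (ω.u j) (ω.v v)
            (fun m => ω.s (v, q) (binIdx ε₁ ω.x' ω.v ω.s i v q) m (ω.v v m)) fun m => (z m).2)) +
          (P.scheme σ h₁ h₂ ω).wrong₁ (i, j, l) y z) +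
          (P.scheme σ h₁ h₂ ω).wrong₂ (v, q) z) := by
        refine ((P.scheme σ h₁ h₂ ω).errorProbAt_le i j l v q).trans_eq ?_
        refine congrArg (expect (lawPhase1 ω.x i)) (funext fun y => ?_)
        refine congrArg₂ (· + ·) (congrArg₂ (· + ·) rfl ?_) rfl
        exact Finset.sum_congr (by congr) fun _ _ => rfl
      refine h.trans_eq ?_
      refine (expect_add_expect (lawPhase1_mem _ _) _ _ _ _ _).trans ?_
      refine congrArg₂ (· + ·) (congrArg₂ (· + ·) rfl ?_) rfl
      simp only [hY, expect_sum]
      refine Finset.sum_congr rfl fun w _ => ?_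
      split_ifs
      · exact expect_const (lawPhase1_mem _ _) 0
      · rfl
    refine (expect_mono (P.cbLaw_mem σ).1 hle).trans ?_
    simp only [expect_add, expect_sum]
    refine add_le_add (add_le_add (expect_not_typ_phase1_le hK₀ i) ?_)
      (add_le_add (add_le_add (expect_not_typ_phase2_le hK₁ hc hK₂0 hK₂ i j l v q)
      (expect_wrong₁_le hP h₁ h₂ i j l v q)) (expect_wrong₂_le hP h₁ h₂ i j l v q))
    have := sum_ite_eq_const i 0 ((2 : ℝ) ^ (-(σ.k * (P.i₂ - δ))))
    rw [zero_add] at this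
    rw [← this]
    refine Finset.sum_le_sum fun w _ => ?_
    split_ifs with h
    · exact (expect_const (P.cbLaw_mem σ) 0).le
    · exact expect_typY_le hP h
  have hsum : expect (P.cbLaw σ) (fun ω => (P.scheme σ h₁ h₂ ω).toCode.errorProb) =
      (∑ w₁ : Fin σ.n₁₀ × Fin σ.n₁₁ × Fin σ.n₁₂, ∑ w₂ : Fin σ.n₂₁ × Fin σ.n₂₂,
        expect (P.cbLaw σ) fun ω => (P.scheme σ h₁ h₂ ω).toCode.errorProbAt w₁ w₂) /
      (Fintype.card (Fin σ.n₁₀ × Fin σ.n₁₁ × Fin σ.n₁₂) * Fintype.card (Fin σ.n₂₁ × Fin σ.n₂₂)) := by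
    simp only [← expect_sum]
    rw [div_eq_mul_inv, ← expect_mul_right]
    rfl
  rw [hsum]
  have hcard : (0 : ℝ) < Fintype.card (Fin σ.n₁₀ × Fin σ.n₁₁ × Fin σ.n₁₂) *
      Fintype.card (Fin σ.n₂₁ × Fin σ.n₂₂) := by
    have h1 : 0 < Fintype.card (Fin σ.n₁₀ × Fin σ.n₁₁ × Fin σ.n₁₂) := Fintype.card_pos
    have h2 : 0 < Fintype.card (Fin σ.n₂₁ × Fin σ.n₂₂) := Fintype.card_pos
    positivity
  rw [div_le_iff₀ hcard]
  refine (Finset.sum_le_sum fun w₁ _ => Finset.sum_le_sum fun w₂ _ => hw w₁ w₂).trans_eq ?_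
  simp only [Finset.sum_const, Finset.card_univ, nsmul_eq_mul]
  ring

end HKInput

end

/-! ### Code sizes, exponents and vanishing error -/

noncomputable section

open Filter Topology

/-- `t` is non-negative and at most `c 2 ^ x`. -/
def ExpBound (t c x : ℝ) : Prop := 0 ≤ t ∧ t ≤ c * (2 : ℝ) ^ x

theorem expBound_rpow (x : ℝ) : ExpBound ((2 : ℝ) ^ x) 1 x :=
  ⟨(Real.rpow_pos_of_pos two_pos x).le, (one_mul _).ge⟩

theorem ExpBound.mul {t c x t' c' x' : ℝ} (h : ExpBound t c x) (h' : ExpBound t' c' x') :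
    ExpBound (t * t') (c * c') (x + x') := by
  refine ⟨mul_nonneg h.1 h'.1, (mul_le_mul h.2 h'.2 h'.1 (h.1.trans h.2)).trans_eq ?_⟩
  rw [Real.rpow_add two_pos]
  ring

theorem ExpBound.le {t c x c' x' : ℝ} (h : ExpBound t c x) (hc : c ≤ c') (hc' : 0 ≤ c')
    (hx : x ≤ x') : t ≤ c' * (2 : ℝ) ^ x' :=
  h.2.trans (mul_le_mul hc (Real.rpow_le_rpow_of_exponent_le one_le_two hx)
    (Real.rpow_pos_of_pos two_pos x).le hc')

theorem natCeil_rpow_pos (x : ℝ) : 0 < ⌈(2 : ℝ) ^ x⌉₊ :=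
  Nat.ceil_pos.2 (Real.rpow_pos_of_pos two_pos x)

instance (x : ℝ) : NeZero ⌈(2 : ℝ) ^ x⌉₊ := ⟨(natCeil_rpow_pos x).ne'⟩

/-- Rounding up adds less than one, so `N - 1` is controlled by the bare power even if `x < 0` and
the set is a singleton. Each term for wrong candidates carries such a factor, which supplies the
decay. -/
theorem expBound_natCeil_sub_one (x : ℝ) : ExpBound ((⌈(2 : ℝ) ^ x⌉₊ : ℝ) - 1) 1 x := by
  have h1 : (1 : ℝ) ≤ ⌈(2 : ℝ) ^ x⌉₊ := by exact_mod_cast natCeil_rpow_pos x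
  have h2 := Nat.ceil_lt_add_one (Real.rpow_pos_of_pos two_pos x).le
  exact ⟨by linarith, by linarith⟩

/-- For parts that may be right or wrong the full count appears, and only a nonnegative exponent is
available, with a factor `2` for rounding. -/
theorem expBound_natCeil {x y : ℝ} (h : x ≤ y) (hy : 0 ≤ y) :
    ExpBound (⌈(2 : ℝ) ^ x⌉₊ : ℝ) 2 y := by
  have h1 := (expBound_natCeil_sub_one x).le le_rfl zero_le_one h
  have h2 := Real.one_le_rpow one_le_two hy
  exact ⟨Nat.cast_nonneg _, by linarith⟩

namespace HKInput

variable {W : HDChannel.{u}}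

/-- The rates of the message parts satisfy the constraints of the decoders, when the phases are
used `α n` and `β n` times. -/
structure Admissible (P : HKInput W) (α β R₁₀ R₁₁ R₁₂ R₂₁ R₂₂ : ℝ) : Prop where
  nn₁₀ : 0 ≤ R₁₀
  nn₁₁ : 0 ≤ R₁₁
  nn₁₂ : 0 ≤ R₁₂
  nn₂₁ : 0 ≤ R₂₁
  nn₂₂ : 0 ≤ R₂₂
  c₂ : R₁₀ ≤ α * P.i₂
  c₃ : R₁₂ ≤ β * P.i₃
  c₄ : R₁₀ + R₁₂ ≤ α * P.iY₁₁ + β * P.i₄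
  c₅ : R₁₁ + R₁₂ ≤ β * P.i₅
  c₆ : R₁₀ + R₁₁ + R₁₂ ≤ α * P.iY₁₁ + β * P.i₆
  c₇ : R₁₂ + R₂₁ ≤ β * P.i₇
  c₈ : R₁₀ + R₁₂ + R₂₁ ≤ α * P.iY₁₁ + β * P.i₈
  c₉ : R₁₁ + R₁₂ + R₂₁ ≤ β * P.i₉
  c₁₀ : R₁₀ + R₁₁ + R₁₂ + R₂₁ ≤ α * P.iY₁₁ + β * P.i₁₀
  c₁₁ : R₂₂ ≤ β * P.i₁₁ - β * P.i₁
  c₁₂ : R₂₁ + R₂₂ ≤ β * P.i₁₂ - β * P.i₁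
  c₁₃ : R₁₁ + R₂₂ ≤ β * P.i₁₃ - β * P.i₁
  c₁₄ : R₁₁ + R₂₁ + R₂₂ ≤ β * P.i₁₄ - β * P.i₁

variable {P : HKInput W} {α β R₁₀ R₁₁ R₁₂ R₂₁ R₂₂ δ : ℝ}

/-- The sizes of a code of length `n` with the given rates. -/
abbrev sizes (n k m : ℕ) (R₁₀ R₁₁ R₁₂ R₂₁ R₂₂ Rᵥ δ : ℝ) : HKSizes where
  k := k
  m := m
  n₁₀ := ⌈(2 : ℝ) ^ (n * (R₁₀ - δ))⌉₊
  n₁₁ := ⌈(2 : ℝ) ^ (n * (R₁₁ - δ))⌉₊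
  n₁₂ := ⌈(2 : ℝ) ^ (n * (R₁₂ - δ))⌉₊
  n₂₁ := ⌈(2 : ℝ) ^ (n * (R₂₁ - δ))⌉₊
  n₂₂ := ⌈(2 : ℝ) ^ (n * (R₂₂ - δ))⌉₊
  nᵥ := ⌈(2 : ℝ) ^ (n * Rᵥ)⌉₊

section

variable {n k m : ℕ} (hA : P.Admissible α β R₁₀ R₁₁ R₁₂ R₂₁ R₂₂) (hδ : 0 < δ) (hk : k ≤ n)
  (hm : m ≤ n) {J : ℝ} (hα : ∀ i, |i| ≤ J → n * (α * i) - k * i ≤ n * (δ / 16))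
  (hβ : ∀ i, |i| ≤ J → n * (β * i) - m * i ≤ n * (δ / 16))

include hδ hk hα in
-- The rate is reduced by `δ`; packing and the deviation of `k / n` from `α` cost `δ / 16` each, so
-- more than `δ / 4` is left.
theorem relay_term_le (h₂ : |P.i₂| ≤ J) (c₂ : R₁₀ ≤ α * P.i₂) :
    ((⌈(2 : ℝ) ^ (n * (R₁₀ - δ))⌉₊ : ℝ) - 1) * (2 : ℝ) ^ (-(k * (P.i₂ - δ / 16))) ≤
      16 * (2 : ℝ) ^ (-(n * (δ / 4))) := by
  have hn : (0 : ℝ) ≤ n := Nat.cast_nonneg n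
  have hkn : (k : ℝ) * δ ≤ n * δ := mul_le_mul_of_nonneg_right (by exact_mod_cast hk) hδ.le
  have hnδ : 0 ≤ n * δ := mul_nonneg hn hδ.le
  refine ((expBound_natCeil_sub_one _).mul (expBound_rpow _)).le (by norm_num) (by norm_num) ?_
  linarith [hα _ h₂, mul_le_mul_of_nonneg_left c₂ hn]

include hA hδ hk hm hα hβ in
-- Expanding gives eight terms. Each has at least one factor `N - 1`, worth `-δ` in the exponent,
-- while packing slack and drift of the two phases cost at most `4 δ / 16`.
theorem wrongBound₁_le {Rᵥ : ℝ} (hY : |P.iY₁₁| ≤ J) (h₃ : |P.i₃| ≤ J) (h₄ : |P.i₄| ≤ J)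
    (h₅ : |P.i₅| ≤ J) (h₆ : |P.i₆| ≤ J) (h₇ : |P.i₇| ≤ J) (h₈ : |P.i₈| ≤ J) (h₉ : |P.i₉| ≤ J)
    (h₁₀ : |P.i₁₀| ≤ J) :
    wrongBound₁ P (sizes n k m R₁₀ R₁₁ R₁₂ R₂₁ R₂₂ Rᵥ δ) (δ / 16) ≤
      128 * (2 : ℝ) ^ (-(n * (δ / 4))) := by
  have hn : (0 : ℝ) ≤ n := Nat.cast_nonneg n
  have hkn : (k : ℝ) * δ ≤ n * δ := mul_le_mul_of_nonneg_right (by exact_mod_cast hk) hδ.le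
  have hmn : (m : ℝ) * δ ≤ n * δ := mul_le_mul_of_nonneg_right (by exact_mod_cast hm) hδ.le
  have hnδ : 0 ≤ n * δ := mul_nonneg hn hδ.le
  have sub_one : ∀ R : ℝ, ExpBound ((⌈(2 : ℝ) ^ (n * (R - δ))⌉₊ : ℝ) - 1) 1 (n * (R - δ)) :=
    fun R => expBound_natCeil_sub_one _
  have all : ∀ R : ℝ, 0 ≤ R → ExpBound (⌈(2 : ℝ) ^ (n * (R - δ))⌉₊ : ℝ) 2 (n * R) :=
    fun R hR => expBound_natCeil (by linarith) (mul_nonneg hn hR)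
  have n12 := all R₁₂ hA.nn₁₂
  have s10 := sub_one R₁₀
  have s11 := sub_one R₁₁
  have s12 := sub_one R₁₂
  have s21 := sub_one R₂₁
  set N₁₀ : ℝ := (⌈(2 : ℝ) ^ (n * (R₁₀ - δ))⌉₊ : ℝ)
  set N₁₁ : ℝ := (⌈(2 : ℝ) ^ (n * (R₁₁ - δ))⌉₊ : ℝ)
  set N₁₂ : ℝ := (⌈(2 : ℝ) ^ (n * (R₁₂ - δ))⌉₊ : ℝ)
  set N₂₁ : ℝ := (⌈(2 : ℝ) ^ (n * (R₂₁ - δ))⌉₊ : ℝ)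
  have e := fun i : ℝ => expBound_rpow (-(m * (i - δ / 16)))
  have eY := expBound_rpow (-(k * (P.iY₁₁ - δ / 16)))
  have q1 := (n12.mul (s11.mul (e P.i₅))).le (c' := 16) (x' := -(n * (δ / 4)))
    (by norm_num) (by norm_num)
    (by linarith [hβ _ h₅, mul_le_mul_of_nonneg_left hA.c₅ hn])
  have q2 := (n12.mul (s11.mul (s21.mul (e P.i₉)))).le (c' := 16) (x' := -(n * (δ / 4)))
    (by norm_num) (by norm_num)
    (by linarith [hβ _ h₉, mul_le_mul_of_nonneg_left hA.c₉ hn])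
  have q3 := (s12.mul (e P.i₃)).le (c' := 16) (x' := -(n * (δ / 4)))
    (by norm_num) (by norm_num)
    (by linarith [hβ _ h₃, mul_le_mul_of_nonneg_left hA.c₃ hn])
  have q4 := (s12.mul (s21.mul (e P.i₇))).le (c' := 16) (x' := -(n * (δ / 4)))
    (by norm_num) (by norm_num)
    (by linarith [hβ _ h₇, mul_le_mul_of_nonneg_left hA.c₇ hn])
  have q5 := ((s10.mul eY).mul (n12.mul (e P.i₄))).le (c' := 16) (x' := -(n * (δ / 4)))
    (by norm_num) (by norm_num)
    (by linarith [hα _ hY, hβ _ h₄, mul_le_mul_of_nonneg_left hA.c₄ hn])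
  have q6 := ((s10.mul eY).mul (n12.mul (s21.mul (e P.i₈)))).le (c' := 16) (x' := -(n * (δ / 4)))
    (by norm_num) (by norm_num)
    (by linarith [hα _ hY, hβ _ h₈, mul_le_mul_of_nonneg_left hA.c₈ hn])
  have q7 := ((s10.mul eY).mul (n12.mul (s11.mul (e P.i₆)))).le (c' := 16) (x' := -(n * (δ / 4)))
    (by norm_num) (by norm_num)
    (by linarith [hα _ hY, hβ _ h₆, mul_le_mul_of_nonneg_left hA.c₆ hn])
  have q8 := ((s10.mul eY).mul (n12.mul (s11.mul (s21.mul (e P.i₁₀))))).le (c' := 16)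
    (x' := -(n * (δ / 4))) (by norm_num) (by norm_num)
    (by linarith [hα _ hY, hβ _ h₁₀, mul_le_mul_of_nonneg_left hA.c₁₀ hn])
  refine le_trans (le_of_eq ?_) ((add_le_add (add_le_add (add_le_add (add_le_add (add_le_add
    (add_le_add (add_le_add q1 q2) q3) q4) q5) q6) q7) q8).trans_eq (by ring))
  rw [wrongBound₁]
  ring

include hA hδ hm hβ in
-- Each wrong pair is tested with all binning indices, about `2 ^ (n (β i₁ + δ / 2))` of them. This
-- is where `I₁` is subtracted from the second destination's constraints; the extra `δ / 2` fits
-- into the gain `δ`.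
theorem wrongBound₂_le (hi₁ : 0 ≤ β * P.i₁) (h₁₁ : |P.i₁₁| ≤ J) (h₁₂ : |P.i₁₂| ≤ J)
    (h₁₃ : |P.i₁₃| ≤ J) (h₁₄ : |P.i₁₄| ≤ J) :
    wrongBound₂ P (sizes n k m R₁₀ R₁₁ R₁₂ R₂₁ R₂₂ (β * P.i₁ + δ / 2) δ) (δ / 16) ≤
      64 * (2 : ℝ) ^ (-(n * (δ / 4))) := by
  have hn : (0 : ℝ) ≤ n := Nat.cast_nonneg n
  have hmn : (m : ℝ) * δ ≤ n * δ := mul_le_mul_of_nonneg_right (by exact_mod_cast hm) hδ.le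
  have hnδ : 0 ≤ n * δ := mul_nonneg hn hδ.le
  have sub_one : ∀ R : ℝ, ExpBound ((⌈(2 : ℝ) ^ (n * (R - δ))⌉₊ : ℝ) - 1) 1 (n * (R - δ)) :=
    fun R => expBound_natCeil_sub_one _
  have nv : ExpBound (⌈(2 : ℝ) ^ (n * (β * P.i₁ + δ / 2))⌉₊ : ℝ) 2 (n * (β * P.i₁ + δ / 2)) :=
    expBound_natCeil le_rfl (mul_nonneg hn (by linarith))
  have n22 : ExpBound (⌈(2 : ℝ) ^ (n * (R₂₂ - δ))⌉₊ : ℝ) 2 (n * R₂₂) :=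
    expBound_natCeil (by linarith) (mul_nonneg hn hA.nn₂₂)
  have s11 := sub_one R₁₁
  have s22 := sub_one R₂₂
  have s21 := sub_one R₂₁
  set N₁₁ : ℝ := (⌈(2 : ℝ) ^ (n * (R₁₁ - δ))⌉₊ : ℝ)
  set N₂₁ : ℝ := (⌈(2 : ℝ) ^ (n * (R₂₁ - δ))⌉₊ : ℝ)
  set N₂₂ : ℝ := (⌈(2 : ℝ) ^ (n * (R₂₂ - δ))⌉₊ : ℝ)
  set Nᵥ : ℝ := (⌈(2 : ℝ) ^ (n * (β * P.i₁ + δ / 2))⌉₊ : ℝ)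
  have e := fun i : ℝ => expBound_rpow (-(m * (i - δ / 16)))
  have q1 := (nv.mul (s22.mul (e P.i₁₁))).le (c' := 16) (x' := -(n * (δ / 4)))
    (by norm_num) (by norm_num)
    (by linarith [hβ _ h₁₁, mul_le_mul_of_nonneg_left hA.c₁₁ hn])
  have q2 := (nv.mul (s22.mul (s11.mul (e P.i₁₃)))).le (c' := 16) (x' := -(n * (δ / 4)))
    (by norm_num) (by norm_num)
    (by linarith [hβ _ h₁₃, mul_le_mul_of_nonneg_left hA.c₁₃ hn])
  have q3 := (nv.mul (s21.mul (n22.mul (e P.i₁₂)))).le (c' := 16) (x' := -(n * (δ / 4)))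
    (by norm_num) (by norm_num)
    (by linarith [hβ _ h₁₂, mul_le_mul_of_nonneg_left hA.c₁₂ hn])
  have q4 := (nv.mul (s21.mul (n22.mul (s11.mul (e P.i₁₄))))).le (c' := 16) (x' := -(n * (δ / 4)))
    (by norm_num) (by norm_num)
    (by linarith [hβ _ h₁₄, mul_le_mul_of_nonneg_left hA.c₁₄ hn])
  refine le_trans (le_of_eq ?_) ((add_le_add (add_le_add (add_le_add q1 q2) q3) q4).trans_eq
    (by ring))
  rw [wrongBound₂]
  ring

end

theorem i₁_nonneg (P : HKInput W) : 0 ≤ P.i₁ := condMutualInfo_nonneg P.joint_mem _ _ _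

/-- Codes with admissible rates and vanishing error probability. -/
theorem Admissible.exists_scheme (hA : P.Admissible α β R₁₀ R₁₁ R₁₂ R₂₁ R₂₂) (hβ0 : 0 ≤ β)
    {k m : ℕ → ℕ} (hk : ∀ n, k n ≤ n) (hm : ∀ n, m n ≤ n)
    (hkα : Tendsto (fun n => (k n : ℝ) / n) atTop (𝓝 α))
    (hmβ : Tendsto (fun n => (m n : ℝ) / n) atTop (𝓝 β))
    (hk0 : Tendsto k atTop atTop ∨ ∀ n, k n = 0) (hm0 : Tendsto m atTop atTop ∨ ∀ n, m n = 0)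
    {δ : ℝ} (hδ : 0 < δ) {ε : ℝ} (hε : 0 < ε) :
    ∀ᶠ n in atTop, ∃ s : HKScheme W, s.k = k n ∧ s.m = m n ∧
      (2 : ℝ) ^ (n * (R₁₀ + R₁₁ + R₁₂ - 3 * δ)) ≤ Fintype.card s.toCode.M₁ ∧
      (2 : ℝ) ^ (n * (R₂₁ + R₂₂ - 2 * δ)) ≤ Fintype.card s.toCode.M₂ ∧
      s.toCode.errorProb ≤ ε := by
  have hδ' : 0 < δ / 16 := by positivity
  -- The decoding tolerance `ε₂` is fixed by packing, the binning tolerance `ε₁` is taken below it,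
  -- and the starting pair is tested at `ε₁ / 2`. Conditional typicality needs both gaps.
  obtain ⟨ε₂, hP, h₂⟩ := ((P.eventually_packs hδ').and self_mem_nhdsWithin).exists
  obtain ⟨ε₁, ⟨hcov, h₁⟩, h₁₂⟩ := (((P.covering_bin hδ').and self_mem_nhdsWithin).and
    (Ioo_mem_nhdsGT h₂)).exists
  have h₁ : 0 < ε₁ := h₁
  have h₂ : 0 < ε₂ := h₂
  obtain ⟨Kc, hKc0, hKc⟩ := hcov (ε₁ / 2) (half_lt_self h₁)
  obtain ⟨K₀, hK₀0, hK₀⟩ := P.typicality_phase1 h₂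
  obtain ⟨K₁, hK₁0, hK₁⟩ := P.typicality_pair (half_pos h₁)
  obtain ⟨K₂, hK₂0, hK₂⟩ := P.typicality_phase2 h₁₂.2
  set J : ℝ := |P.i₂| + |P.iY₁₁| + |P.i₁| + |P.i₃| + |P.i₄| + |P.i₅| + |P.i₆| + |P.i₇| + |P.i₈| +
    |P.i₉| + |P.i₁₀| + |P.i₁₁| + |P.i₁₂| + |P.i₁₃| + |P.i₁₄| + 1 with hJ
  have a2 := abs_nonneg P.i₂
  have aY := abs_nonneg P.iY₁₁
  have a1 := abs_nonneg P.i₁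
  have a3 := abs_nonneg P.i₃
  have a4 := abs_nonneg P.i₄
  have a5 := abs_nonneg P.i₅
  have a6 := abs_nonneg P.i₆
  have a7 := abs_nonneg P.i₇
  have a8 := abs_nonneg P.i₈
  have a9 := abs_nonneg P.i₉
  have a10 := abs_nonneg P.i₁₀
  have a11 := abs_nonneg P.i₁₁
  have a12 := abs_nonneg P.i₁₂
  have a13 := abs_nonneg P.i₁₃
  have a14 := abs_nonneg P.i₁₄
  have hJ0 : 0 < J := by linarith
  -- The phase lengths are `α n` and `β n` only asymptotically. All information quantities are
  -- bounded by `J`, so the error in the exponents is eventually at most `n δ / 16` for all of them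
  -- at once.
  have drift : ∀ {q : ℕ → ℕ} {γ : ℝ}, Tendsto (fun n => (q n : ℝ) / n) atTop (𝓝 γ) →
      ∀ᶠ n : ℕ in atTop, ∀ i, |i| ≤ J → |n * (γ * i) - q n * i| ≤ n * (δ / 16) := by
    intro q γ hq
    have hη : 0 < δ / 16 / J := by positivity
    filter_upwards [(Metric.tendsto_nhds.1 hq) _ hη, eventually_gt_atTop 0] with n hn hn0 i hi
    have hn0' : (0 : ℝ) < n := by exact_mod_cast hn0
    rw [Real.dist_eq] at hn
    have h1 : (n : ℝ) * (γ * i) - q n * i = -(n * ((q n / n - γ) * i)) := by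
      field_simp
      ring
    rw [h1, abs_neg, abs_mul, abs_mul, abs_of_pos hn0']
    refine mul_le_mul_of_nonneg_left ?_ hn0'.le
    calc |(q n : ℝ) / n - γ| * |i| ≤ δ / 16 / J * J :=
          mul_le_mul hn.le hi (abs_nonneg _) hη.le
      _ = δ / 16 := by field_simp
  -- A phase of length zero contributes `K / 0 = 0`, in accordance with its tests being vacuous.
  have vanish : ∀ {q : ℕ → ℕ} (K : ℝ), (Tendsto q atTop atTop ∨ ∀ n, q n = 0) →
      Tendsto (fun n => K / (q n : ℝ)) atTop (𝓝 0) := by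
    intro q K hq
    rcases hq with hq | hq
    · exact (tendsto_const_nhds (x := K)).div_atTop (tendsto_natCast_atTop_atTop.comp hq)
    · simp [hq]
  have hexp : Tendsto (fun n : ℕ => (2 : ℝ) ^ (-((n : ℝ) * (δ / 4)))) atTop (𝓝 0) := by
    have h1 : Tendsto (fun n : ℕ => (n : ℝ) * (δ / 4)) atTop atTop :=
      tendsto_natCast_atTop_atTop.atTop_mul_const (by positivity)
    have h2 := (tendsto_rpow_atBot_of_base_gt_one 2 one_lt_two).comp (tendsto_neg_atTop_atBot.comp h1)
    exact h2
  have hcovlim : Tendsto (fun n : ℕ => Real.exp (-((2 : ℝ) ^ ((n : ℝ) * (δ / 4)) / 2))) atTop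
      (𝓝 0) := by
    have h1 : Tendsto (fun n : ℕ => (n : ℝ) * (δ / 4)) atTop atTop :=
      tendsto_natCast_atTop_atTop.atTop_mul_const (by positivity)
    have h2 := (tendsto_rpow_atTop_of_base_gt_one 2 one_lt_two).comp h1
    exact Real.tendsto_exp_neg_atTop_nhds_zero.comp (h2.atTop_div_const two_pos)
  have htotal : Tendsto (fun n : ℕ => K₀ / (k n : ℝ) + 16 * (2 : ℝ) ^ (-((n : ℝ) * (δ / 4))) +
      (K₁ / (m n : ℝ) + Real.exp (-((2 : ℝ) ^ ((n : ℝ) * (δ / 4)) / 2)) + K₂ / (m n : ℝ) +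
        128 * (2 : ℝ) ^ (-((n : ℝ) * (δ / 4))) + 64 * (2 : ℝ) ^ (-((n : ℝ) * (δ / 4))))) atTop
      (𝓝 (0 + 16 * 0 + (0 + 0 + 0 + 128 * 0 + 64 * 0))) :=
    ((vanish K₀ hk0).add (hexp.const_mul 16)).add (((((vanish K₁ hm0).add hcovlim).add
      (vanish K₂ hm0)).add (hexp.const_mul 128)).add (hexp.const_mul 64))
  have hlt := htotal.eventually_le_const (u := ε) (by simpa using hε)
  filter_upwards [hlt, drift hkα, drift hmβ, (vanish Kc hm0).eventually_le_const
    (u := 1 / 2) (by norm_num)] with n hn hdk hdm hcn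
  have hdk' : ∀ i, |i| ≤ J → n * (α * i) - k n * i ≤ n * (δ / 16) := fun i hi =>
    (le_abs_self _).trans (hdk i hi)
  have hdm' : ∀ i, |i| ≤ J → n * (β * i) - m n * i ≤ n * (δ / 16) := fun i hi =>
    (le_abs_self _).trans (hdm i hi)
  have hi₁ : 0 ≤ β * P.i₁ := mul_nonneg hβ0 P.i₁_nonneg
  set σ := sizes n (k n) (m n) R₁₀ R₁₁ R₁₂ R₂₁ R₂₂ (β * P.i₁ + δ / 2) δ with hσ
  obtain ⟨ω, hω⟩ := exists_scheme_errorProb_le (σ := σ) hP h₁ h₂ (hK₀ (k n)) (hK₁ (m n))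
    (hKc (m n)) (div_nonneg hK₂0 (Nat.cast_nonneg _)) (hK₂ (m n))
  have hn0 : (0 : ℝ) ≤ n := Nat.cast_nonneg n
  refine ⟨P.scheme σ h₁ h₂ ω, rfl, rfl, ?_, ?_, hω.trans (le_trans ?_ hn)⟩
  · have hcard : (Fintype.card (P.scheme σ h₁ h₂ ω).toCode.M₁ : ℝ) =
        (σ.n₁₀ : ℝ) * (σ.n₁₁ * σ.n₁₂) := by
      have : Fintype.card (Fin σ.n₁₀ × Fin σ.n₁₁ × Fin σ.n₁₂) = σ.n₁₀ * (σ.n₁₁ * σ.n₁₂) := by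
        simp only [Fintype.card_prod, Fintype.card_fin]
      exact_mod_cast this
    rw [hcard, show (n : ℝ) * (R₁₀ + R₁₁ + R₁₂ - 3 * δ) = n * (R₁₀ - δ) + (n * (R₁₁ - δ) +
      n * (R₁₂ - δ)) by ring, Real.rpow_add two_pos, Real.rpow_add two_pos]
    have hp : ∀ r : ℝ, (0 : ℝ) ≤ 2 ^ r := fun r => (Real.rpow_pos_of_pos two_pos r).le
    exact mul_le_mul (Nat.le_ceil _) (mul_le_mul (Nat.le_ceil _) (Nat.le_ceil _) (hp _)
      (Nat.cast_nonneg _)) (mul_nonneg (hp _) (hp _)) (Nat.cast_nonneg _)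
  · have hcard : (Fintype.card (P.scheme σ h₁ h₂ ω).toCode.M₂ : ℝ) = (σ.n₂₁ : ℝ) * σ.n₂₂ := by
      have : Fintype.card (Fin σ.n₂₁ × Fin σ.n₂₂) = σ.n₂₁ * σ.n₂₂ := by
        simp only [Fintype.card_prod, Fintype.card_fin]
      exact_mod_cast this
    rw [hcard, show (n : ℝ) * (R₂₁ + R₂₂ - 2 * δ) = n * (R₂₁ - δ) + n * (R₂₂ - δ) by ring,
      Real.rpow_add two_pos]
    have hp : ∀ r : ℝ, (0 : ℝ) ≤ 2 ^ r := fun r => (Real.rpow_pos_of_pos two_pos r).le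
    exact mul_le_mul (Nat.le_ceil _) (Nat.le_ceil _) (hp _) (Nat.cast_nonneg _)
  · refine add_le_add (add_le_add le_rfl ?_) (add_le_add (add_le_add (add_le_add (add_le_add
      le_rfl ?_) le_rfl) ?_) ?_)
    · exact relay_term_le hδ (hk n) hdk' (by linarith) hA.c₂
    -- The expected number of good indices is at least `2 ^ (n δ / 4) / 2`: of the surplus `δ / 2`,
    -- covering and drift take at most `δ / 16` each, and `1 - Kc / m ≥ 1 / 2`.
    · rw [Real.exp_le_exp, neg_le_neg_iff]
      have h3 : (2 : ℝ) ^ (n * (β * P.i₁ + δ / 2)) ≤ (σ.nᵥ : ℝ) := Nat.le_ceil _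
      have h4 : (1 : ℝ) / 2 ≤ 1 - Kc / (m n : ℝ) := by linarith
      have h5 : (m n : ℝ) * δ ≤ n * δ := mul_le_mul_of_nonneg_right (by exact_mod_cast hm n) hδ.le
      have h6 := (abs_le.1 (hdm P.i₁ (by linarith))).1
      have hnδ : 0 ≤ n * δ := mul_nonneg hn0 hδ.le
      have h7 : (2 : ℝ) ^ ((n : ℝ) * (δ / 4)) ≤
          2 ^ (n * (β * P.i₁ + δ / 2)) * 2 ^ (-((m n : ℝ) * (P.i₁ + δ / 16))) := by
        rw [← Real.rpow_add two_pos]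
        exact Real.rpow_le_rpow_of_exponent_le one_le_two (by linarith)
      have hp : ∀ r : ℝ, (0 : ℝ) ≤ 2 ^ r := fun r => (Real.rpow_pos_of_pos two_pos r).le
      calc (2 : ℝ) ^ ((n : ℝ) * (δ / 4)) / 2
          ≤ (2 ^ (n * (β * P.i₁ + δ / 2)) * 2 ^ (-((m n : ℝ) * (P.i₁ + δ / 16)))) / 2 := by linarith
        _ = 2 ^ (n * (β * P.i₁ + δ / 2)) * (1 / 2 * 2 ^ (-((m n : ℝ) * (P.i₁ + δ / 16)))) := by ring
        _ ≤ _ := mul_le_mul h3 (mul_le_mul_of_nonneg_right h4 (hp _))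
          (mul_nonneg (by norm_num) (hp _)) (Nat.cast_nonneg _)
    · exact wrongBound₁_le hA hδ (hk n) (hm n) hdk' hdm' (by linarith) (by linarith) (by linarith)
        (by linarith) (by linarith) (by linarith) (by linarith) (by linarith) (by linarith)
    · exact wrongBound₂_le hA hδ (hm n) hdm' hi₁ (by linarith) (by linarith) (by linarith)
        (by linarith)

end HKInput

end

/-! ### Inequalities between the mutual informations -/

noncomputable section

open Filter Topology

section

variable {Ω A B C D A' B' C' : Type*} [Fintype Ω] [Fintype A] [Fintype B] [Fintype C] [Fintype D]
  [Fintype A'] [Fintype B'] [Fintype C']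

/-- The entropy depends only on the partition that a random variable generates. -/
theorem shannonEntropy_congr (p : Ω → ℝ) {f : Ω → A} {g : Ω → B}
    (h : ∀ ω ω', f ω = f ω' ↔ g ω = g ω') : shannonEntropy p f = shannonEntropy p g := by
  simp only [shannonEntropy_eq_expect, pmfOf_eq_expect, h]

theorem condMutualInfo_congr (p : Ω → ℝ) {f : Ω → A} {f' : Ω → A'} {g : Ω → B} {g' : Ω → B'}
    {h : Ω → C} {h' : Ω → C'} (hf : ∀ ω ω', f ω = f ω' ↔ f' ω = f' ω')
    (hg : ∀ ω ω', g ω = g ω' ↔ g' ω = g' ω') (hh : ∀ ω ω', h ω = h ω' ↔ h' ω = h' ω') :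
    condMutualInfo p f g h = condMutualInfo p f' g' h' := by
  unfold condMutualInfo
  rw [shannonEntropy_congr p (f := fun ω => (f ω, h ω)) (g := fun ω => (f' ω, h' ω)),
    shannonEntropy_congr p (f := fun ω => (g ω, h ω)) (g := fun ω => (g' ω, h' ω)),
    shannonEntropy_congr p (f := fun ω => (f ω, g ω, h ω)) (g := fun ω => (f' ω, g' ω, h' ω)),
    shannonEntropy_congr p hh]
  all_goals intro ω ω'; simp only [Prod.mk.injEq, hf, hg, hh]

theorem condMutualInfo_comm (p : Ω → ℝ) (f : Ω → A) (g : Ω → B) (h : Ω → C) :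
    condMutualInfo p f g h = condMutualInfo p g f h := by
  unfold condMutualInfo
  rw [shannonEntropy_congr p (f := fun ω => (f ω, g ω, h ω)) (g := fun ω => (g ω, f ω, h ω))]
  · ring
  · intro ω ω'
    simp only [Prod.mk.injEq]
    tauto

/-- The chain rule. -/
theorem condMutualInfo_chain (p : Ω → ℝ) (f₁ : Ω → A) (f₂ : Ω → D) (g : Ω → B) (h : Ω → C) :
    condMutualInfo p (fun ω => (f₁ ω, f₂ ω)) g h =
      condMutualInfo p f₁ g h + condMutualInfo p f₂ g (fun ω => (f₁ ω, h ω)) := by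
  unfold condMutualInfo
  rw [shannonEntropy_congr p (f := fun ω => ((f₁ ω, f₂ ω), h ω)) (g := fun ω => (f₂ ω, f₁ ω, h ω)),
    shannonEntropy_congr p (f := fun ω => ((f₁ ω, f₂ ω), g ω, h ω))
      (g := fun ω => (f₂ ω, g ω, f₁ ω, h ω)),
    shannonEntropy_congr p (f := fun ω => (f₁ ω, g ω, h ω)) (g := fun ω => (g ω, f₁ ω, h ω))]
  · ring
  all_goals
    intro ω ω'
    simp only [Prod.mk.injEq]
    tauto

theorem condMutualInfo_le_pair {p : Ω → ℝ} (hp : p ∈ stdSimplex ℝ Ω) (f₁ : Ω → A) (f₂ : Ω → D)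
    (g : Ω → B) (h : Ω → C) :
    condMutualInfo p f₁ g h ≤ condMutualInfo p (fun ω => (f₁ ω, f₂ ω)) g h := by
  rw [condMutualInfo_chain]
  exact le_add_of_nonneg_right (condMutualInfo_nonneg hp _ _ _)

/-- Conditioning on an independent random variable does not decrease the mutual information. -/
theorem condMutualInfo_le_of_indep {p : Ω → ℝ} (hp : p ∈ stdSimplex ℝ Ω) (f : Ω → A) (g : Ω → B)
    (k : Ω → D) (h : Ω → C) (hk : condMutualInfo p f k h = 0) :
    condMutualInfo p f g h ≤ condMutualInfo p f g (fun ω => (k ω, h ω)) := by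
  -- `I(k, g; f | h)` is at least `I(g; f | h)`, and by the chain rule it equals `I(g; f | k, h)`,
  -- because `I(k; f | h)` vanishes.
  have h1 := condMutualInfo_chain p k g f h
  have h2 := condMutualInfo_le_pair hp g k f h
  have h3 : condMutualInfo p (fun ω => (g ω, k ω)) f h =
      condMutualInfo p (fun ω => (k ω, g ω)) f h :=
    condMutualInfo_congr p (by intro ω ω'; simp only [Prod.mk.injEq]; tauto) (fun _ _ => Iff.rfl)
      (fun _ _ => Iff.rfl)
  rw [condMutualInfo_comm p k f, hk] at h1
  rw [condMutualInfo_comm p f g h, condMutualInfo_comm p f g]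
  linarith

theorem condMutualInfo_of_subsingleton [Subsingleton A] (p : Ω → ℝ) (f : Ω → A) (g : Ω → B)
    (h : Ω → C) : condMutualInfo p f g h = 0 := by
  unfold condMutualInfo
  rw [shannonEntropy_congr p (f := fun ω => (f ω, h ω)) (g := h),
    shannonEntropy_congr p (f := fun ω => (f ω, g ω, h ω)) (g := fun ω => (g ω, h ω))]
  · ring
  all_goals
    intro ω ω'
    simp only [Prod.mk.injEq, Subsingleton.elim (f ω) (f ω'), true_and]

/-- The mutual information of conditionally independent random variables vanishes. -/
theorem condMutualInfo_eq_zero {p : Ω → ℝ} (hp : p ∈ stdSimplex ℝ Ω) (f : Ω → A) (g : Ω → B)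
    (h : Ω → C) (F : A → C → ℝ) (G : B → C → ℝ)
    (hfac : ∀ a b c, pmfOf p (fun ω => (f ω, g ω, h ω)) (a, b, c) = F a c * G b c) :
    condMutualInfo p f g h = 0 := by
  rw [condMutualInfo_eq_expect]
  refine Finset.sum_eq_zero fun x _ => ?_
  obtain ⟨a, b, c⟩ := x
  have hq := pmfOf_mem hp (fun ω => (f ω, g ω, h ω))
  rcases (hq.1 (a, b, c)).eq_or_lt with h0 | h0
  · rw [← h0, zero_mul]
  obtain ⟨h1, h2, h3, h4⟩ := rpow_infoDensity hp f g h h0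
  -- The marginals inherit the factorisation, and the density ratio is then one on the support.
  have e1 : ∀ b, pmfOf p (fun ω => (g ω, h ω)) (b, c) = (∑ a, F a c) * G b c := by
    intro b
    rw [← sum_pmfOf_pair p f (fun ω => (g ω, h ω)), Finset.sum_mul]
    exact Finset.sum_congr rfl fun a _ => hfac a b c
  have e2 : pmfOf p (fun ω => (f ω, h ω)) (a, c) = F a c * ∑ b, G b c := by
    rw [← sum_pmfOf_pair p g (fun ω => (f ω, h ω)), Finset.mul_sum]
    refine Finset.sum_congr rfl fun b _ => ?_
    rw [← hfac, pmfOf_eq_expect, pmfOf_eq_expect]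
    simp only [Prod.mk.injEq, and_left_comm]
  have e3 : pmfOf p h c = (∑ a, F a c) * ∑ b, G b c := by
    rw [← sum_pmfOf_pair p g h, Finset.mul_sum]
    exact Finset.sum_congr rfl fun b _ => e1 b
  have hd : densityRatio p f g h (a, b, c) = 1 := by
    unfold densityRatio
    simp only at h0 h1 h2 h3 ⊢
    rw [div_eq_one_iff_eq (mul_pos h0 h1).ne', e1, e2, e3, hfac]
    ring
  rw [h4, hd, Real.logb_one, neg_zero, mul_zero]

end

namespace HKInput

variable {W : HDChannel.{u}} (P : HKInput W)

theorem indep_U₁₁_X₁₁ : condMutualInfo P.joint P.rU₁₁ P.rX₁₁ P.rU₂₁ = 0 :=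
  condMutualInfo_eq_zero P.joint_mem _ _ _ (fun u v => P.pU₁₁ u * P.pU₂₁ v) (fun x _ => P.pX₁₁ x)
    fun u x v => by
      rw [pmfOf_eq_expect, expect_joint]
      simp only [rX₁₁, rU₁₁, rU₂₁, Prod.mk.injEq, ind_and, expect_stdSimplex_const,
        expect_mul_left, expect_ind_mul, expect_ind]
      ring

theorem indep_X₁₁ : condMutualInfo P.joint P.rX₁₁ (fun ω => (P.rU₁₁ ω, P.rU₂₁ ω))
    (fun _ => ()) = 0 :=
  condMutualInfo_eq_zero P.joint_mem _ _ _ (fun x _ => P.pX₁₁ x) (fun b _ => P.pU₁₁ b.1 * P.pU₂₁ b.2)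
    fun x b c => by
      obtain ⟨u, v⟩ := b
      rw [pmfOf_eq_expect, expect_joint]
      simp only [rX₁₁, rU₁₁, rU₂₁, Prod.mk.injEq, ind_and, expect_stdSimplex_const,
        expect_mul_left, expect_ind_mul, expect_ind, ind_of, mul_one]

theorem indep_U₁₁ : condMutualInfo P.joint P.rU₁₁ (fun ω => (P.rX₁₁ ω, P.rU₂₁ ω))
    (fun _ => ()) = 0 :=
  condMutualInfo_eq_zero P.joint_mem _ _ _ (fun u _ => P.pU₁₁ u) (fun b _ => P.pX₁₁ b.1 * P.pU₂₁ b.2)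
    fun u b c => by
      obtain ⟨x, v⟩ := b
      rw [pmfOf_eq_expect, expect_joint]
      simp only [rX₁₁, rU₁₁, rU₂₁, Prod.mk.injEq, ind_and, expect_stdSimplex_const,
        expect_mul_left, expect_ind_mul, expect_ind, ind_of, mul_one]

theorem indep_U₂₁_X₁₁ : condMutualInfo P.joint P.rU₂₁ P.rX₁₁ P.rU₁₁ = 0 :=
  condMutualInfo_eq_zero P.joint_mem _ _ _ (fun v u => P.pU₁₁ u * P.pU₂₁ v) (fun x _ => P.pX₁₁ x)
    fun v x u => by
      rw [pmfOf_eq_expect, expect_joint]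
      simp only [rX₁₁, rU₁₁, rU₂₁, Prod.mk.injEq, ind_and, expect_stdSimplex_const,
        expect_mul_left, expect_ind_mul, expect_ind]
      ring

theorem indep_U₂₁ : condMutualInfo P.joint P.rU₂₁ P.rX₁₁ (fun _ => ()) = 0 :=
  condMutualInfo_eq_zero P.joint_mem _ _ _ (fun v _ => P.pU₂₁ v) (fun x _ => P.pX₁₁ x)
    fun v x u => by
      rw [pmfOf_eq_expect, expect_joint]
      simp only [rX₁₁, rU₂₁, Prod.mk.injEq, ind_and, expect_stdSimplex_const,
        expect_mul_left, expect_ind_mul, expect_ind, ind_of, mul_one]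

theorem indep_U₁₁_U₂₁ : condMutualInfo P.joint P.rU₁₁ P.rU₂₁ P.rX₁₁ = 0 :=
  condMutualInfo_eq_zero P.joint_mem _ _ _ (fun u x => P.pX₁₁ x * P.pU₁₁ u) (fun v _ => P.pU₂₁ v)
    fun u v x => by
      rw [pmfOf_eq_expect, expect_joint]
      simp only [rX₁₁, rU₁₁, rU₂₁, Prod.mk.injEq, ind_and, expect_stdSimplex_const,
        expect_mul_left, expect_ind_mul, expect_ind]
      ring

/-- The output of the first destination depends on the first sender's common codeword only through
the channel inputs. -/
theorem markov_U₁₁ : condMutualInfo P.joint P.rU₁₁ P.rY₁₂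
    (fun ω => (P.rX₁₁ ω, P.rX₁₂ ω, P.rU₂₁ ω)) = 0 :=
  condMutualInfo_eq_zero P.joint_mem _ _ _
    (fun u c => P.pX₁₁ c.1 * P.pU₁₁ u * P.pX₁₂ u c.1 c.2.1 * P.pU₂₁ c.2.2)
    (fun y c => expect (P.pU₂₂ c.2.2 c.1) fun s => expect (P.pX₂₂ c.1 c.2.2 s) fun t =>
      expect (W.phase2 c.2.1 t) fun z => ind (z.1 = y))
    fun u y c => by
      obtain ⟨x, a, v⟩ := c
      rw [pmfOf_eq_expect, expect_joint]
      simp only [rX₁₁, rU₁₁, rX₁₂, rU₂₁, rY₁₂, Prod.mk.injEq, ind_and, expect_stdSimplex_const]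
      -- Sorted by the layers of the joint law, each indicator is absorbed when its variable is
      -- summed.
      have h : ∀ (x' : W.X₁₁) (u' : P.U₁₁) (a' : W.X₁₂) (v' : P.U₂₁) (q : ℝ),
          ind (u' = u) * (q * (ind (x' = x) * (ind (a' = a) * ind (v' = v)))) =
          ind (x' = x) * (ind (u' = u) * (ind (a' = a) * (ind (v' = v) * q))) := by
        intros; ring
      simp only [expect_mul_left, h, expect_ind_mul]
      ring

/-- Chain rules of this kind, with the variables in a suitable order, provide the monotonicity among
the informations that the elimination of the partial rates needs. -/
theorem i₇_eq_add_i₃ : P.i₇ = condMutualInfo P.joint P.rU₂₁ P.rY₁₂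
    (fun ω => (P.rX₁₁ ω, P.rU₁₁ ω)) + P.i₃ := by
  have h := condMutualInfo_chain P.joint P.rU₂₁ P.rX₁₂ P.rY₁₂ (fun ω => (P.rX₁₁ ω, P.rU₁₁ ω))
  have h7 : P.i₇ = condMutualInfo P.joint (fun ω => (P.rU₂₁ ω, P.rX₁₂ ω)) P.rY₁₂
      (fun ω => (P.rX₁₁ ω, P.rU₁₁ ω)) :=
    condMutualInfo_congr _ (by intro ω ω'; simp only [Prod.mk.injEq]; tauto) (fun _ _ => Iff.rfl)
      (fun _ _ => Iff.rfl)
  have h3 : P.i₃ = condMutualInfo P.joint P.rX₁₂ P.rY₁₂ (fun ω => (P.rU₂₁ ω, P.rX₁₁ ω, P.rU₁₁ ω)) :=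
    condMutualInfo_congr _ (fun _ _ => Iff.rfl) (fun _ _ => Iff.rfl)
      (by intro ω ω'; simp only [Prod.mk.injEq]; tauto)
  rw [h7, h3, h]

theorem i₃_le_i₇ : P.i₃ ≤ P.i₇ := by
  rw [i₇_eq_add_i₃]
  exact le_add_of_nonneg_left (condMutualInfo_nonneg P.joint_mem _ _ _)

/-- `I(X₁₁, X₁₂, U₂₁; Y₁₂ | U₁₁)`, expanded so that `U₂₁` comes first. -/
theorem i₈_eq_add_i₄ : P.i₈ = condMutualInfo P.joint P.rU₂₁ P.rY₁₂ P.rU₁₁ + P.i₄ := by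
  have h := condMutualInfo_chain P.joint P.rU₂₁ (fun ω => (P.rX₁₁ ω, P.rX₁₂ ω)) P.rY₁₂ P.rU₁₁
  have h8 : P.i₈ = condMutualInfo P.joint (fun ω => (P.rU₂₁ ω, P.rX₁₁ ω, P.rX₁₂ ω)) P.rY₁₂ P.rU₁₁ :=
    condMutualInfo_congr _ (by intro ω ω'; simp only [Prod.mk.injEq]; tauto) (fun _ _ => Iff.rfl)
      (fun _ _ => Iff.rfl)
  have h4 : P.i₄ = condMutualInfo P.joint (fun ω => (P.rX₁₁ ω, P.rX₁₂ ω)) P.rY₁₂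
      (fun ω => (P.rU₂₁ ω, P.rU₁₁ ω)) :=
    condMutualInfo_congr _ (fun _ _ => Iff.rfl) (fun _ _ => Iff.rfl)
      (by intro ω ω'; simp only [Prod.mk.injEq]; tauto)
  rw [h8, h, h4]

theorem i₈_eq_add_i₇ : P.i₈ = condMutualInfo P.joint P.rX₁₁ P.rY₁₂ P.rU₁₁ + P.i₇ :=
  condMutualInfo_chain P.joint P.rX₁₁ (fun ω => (P.rX₁₂ ω, P.rU₂₁ ω)) P.rY₁₂ P.rU₁₁

theorem i₉_eq_add_i₇ : P.i₉ = condMutualInfo P.joint P.rU₁₁ P.rY₁₂ P.rX₁₁ + P.i₇ := by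
  have h := condMutualInfo_chain P.joint P.rU₁₁ (fun ω => (P.rX₁₂ ω, P.rU₂₁ ω)) P.rY₁₂ P.rX₁₁
  have h7 : P.i₇ = condMutualInfo P.joint (fun ω => (P.rX₁₂ ω, P.rU₂₁ ω)) P.rY₁₂
      (fun ω => (P.rU₁₁ ω, P.rX₁₁ ω)) :=
    condMutualInfo_congr _ (fun _ _ => Iff.rfl) (fun _ _ => Iff.rfl)
      (by intro ω ω'; simp only [Prod.mk.injEq]; tauto)
  rw [h7]
  exact h

theorem i₉_eq_add_i₅ : P.i₉ = condMutualInfo P.joint P.rU₂₁ P.rY₁₂ P.rX₁₁ + P.i₅ := by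
  have h := condMutualInfo_chain P.joint P.rU₂₁ (fun ω => (P.rU₁₁ ω, P.rX₁₂ ω)) P.rY₁₂ P.rX₁₁
  have h9 : P.i₉ = condMutualInfo P.joint (fun ω => (P.rU₂₁ ω, P.rU₁₁ ω, P.rX₁₂ ω)) P.rY₁₂ P.rX₁₁ :=
    condMutualInfo_congr _ (by intro ω ω'; simp only [Prod.mk.injEq]; tauto) (fun _ _ => Iff.rfl)
      (fun _ _ => Iff.rfl)
  have h5 : P.i₅ = condMutualInfo P.joint (fun ω => (P.rU₁₁ ω, P.rX₁₂ ω)) P.rY₁₂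
      (fun ω => (P.rU₂₁ ω, P.rX₁₁ ω)) :=
    condMutualInfo_congr _ (fun _ _ => Iff.rfl) (fun _ _ => Iff.rfl)
      (by intro ω ω'; simp only [Prod.mk.injEq]; tauto)
  rw [h9, h, h5]

theorem i₆_eq_add_i₄ : P.i₆ = condMutualInfo P.joint P.rU₁₁ P.rY₁₂ P.rU₂₁ + P.i₄ := by
  have h := condMutualInfo_chain P.joint P.rU₁₁ (fun ω => (P.rX₁₁ ω, P.rX₁₂ ω)) P.rY₁₂ P.rU₂₁
  have h6 : P.i₆ = condMutualInfo P.joint (fun ω => (P.rU₁₁ ω, P.rX₁₁ ω, P.rX₁₂ ω)) P.rY₁₂ P.rU₂₁ :=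
    condMutualInfo_congr _ (by intro ω ω'; simp only [Prod.mk.injEq]; tauto) (fun _ _ => Iff.rfl)
      (fun _ _ => Iff.rfl)
  rw [h6, h]
  rfl

theorem i₁₀_eq_condMutualInfo : P.i₁₀ = condMutualInfo P.joint
    (fun ω => (P.rX₁₁ ω, P.rU₁₁ ω, P.rX₁₂ ω, P.rU₂₁ ω)) P.rY₁₂ (fun _ => ()) :=
  mutualInfo_eq_condMutualInfo P.joint_mem _ _

theorem i₁₀_eq_add_i₉ :
    P.i₁₀ = condMutualInfo P.joint P.rX₁₁ P.rY₁₂ (fun _ => ()) + P.i₉ := by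
  rw [i₁₀_eq_condMutualInfo, condMutualInfo_chain]
  refine congrArg₂ (· + ·) rfl ?_
  exact condMutualInfo_congr _ (fun _ _ => Iff.rfl) (fun _ _ => Iff.rfl)
      (by intro ω ω'; simp only [Prod.mk.injEq, and_true])

theorem i₁₀_eq_add_i₈ :
    P.i₁₀ = condMutualInfo P.joint P.rU₁₁ P.rY₁₂ (fun _ => ()) + P.i₈ := by
  rw [i₁₀_eq_condMutualInfo]
  refine (condMutualInfo_congr (f' := fun ω => (P.rU₁₁ ω, P.rX₁₁ ω, P.rX₁₂ ω, P.rU₂₁ ω)) _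
    (by intro ω ω'; simp only [Prod.mk.injEq]; tauto) (fun _ _ => Iff.rfl)
    (fun _ _ => Iff.rfl)).trans ?_
  rw [condMutualInfo_chain]
  refine congrArg₂ (· + ·) rfl ?_
  exact condMutualInfo_congr _ (fun _ _ => Iff.rfl) (fun _ _ => Iff.rfl)
      (by intro ω ω'; simp only [Prod.mk.injEq, and_true])

theorem i₁₀_eq_add_i₆ :
    P.i₁₀ = condMutualInfo P.joint P.rU₂₁ P.rY₁₂ (fun _ => ()) + P.i₆ := by
  rw [i₁₀_eq_condMutualInfo]
  refine (condMutualInfo_congr (f' := fun ω => (P.rU₂₁ ω, P.rX₁₁ ω, P.rU₁₁ ω, P.rX₁₂ ω)) _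
    (by intro ω ω'; simp only [Prod.mk.injEq]; tauto) (fun _ _ => Iff.rfl)
    (fun _ _ => Iff.rfl)).trans ?_
  rw [condMutualInfo_chain]
  refine congrArg₂ (· + ·) rfl ?_
  exact condMutualInfo_congr _ (fun _ _ => Iff.rfl) (fun _ _ => Iff.rfl)
      (by intro ω ω'; simp only [Prod.mk.injEq, and_true])

theorem i₄_le_i₈ : P.i₄ ≤ P.i₈ := by
  rw [i₈_eq_add_i₄]
  exact le_add_of_nonneg_left (condMutualInfo_nonneg P.joint_mem _ _ _)

theorem i₇_le_i₈ : P.i₇ ≤ P.i₈ := by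
  rw [i₈_eq_add_i₇]
  exact le_add_of_nonneg_left (condMutualInfo_nonneg P.joint_mem _ _ _)

theorem i₇_le_i₉ : P.i₇ ≤ P.i₉ := by
  rw [i₉_eq_add_i₇]
  exact le_add_of_nonneg_left (condMutualInfo_nonneg P.joint_mem _ _ _)

theorem i₅_le_i₉ : P.i₅ ≤ P.i₉ := by
  rw [i₉_eq_add_i₅]
  exact le_add_of_nonneg_left (condMutualInfo_nonneg P.joint_mem _ _ _)

theorem i₆_le_i₁₀ : P.i₆ ≤ P.i₁₀ := by
  rw [i₁₀_eq_add_i₆]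
  exact le_add_of_nonneg_left (condMutualInfo_nonneg P.joint_mem _ _ _)

theorem condMutualInfo_U₁₁_le_i₅ :
    condMutualInfo P.joint P.rU₁₁ P.rY₁₂ (fun ω => (P.rX₁₁ ω, P.rU₂₁ ω)) ≤ P.i₅ :=
  condMutualInfo_le_pair P.joint_mem _ _ _ _

/-- Giving the independent `X₁₁` does not decrease `I(U₁₁; Y₁₂ | U₂₁)`, which then is a part of
`i₅`. The other bounds of a total by two parts combine a chain rule with independence in the same
manner. -/
theorem i₆_le : P.i₆ ≤ P.i₅ + P.i₄ := by
  rw [i₆_eq_add_i₄]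
  exact add_le_add ((condMutualInfo_le_of_indep P.joint_mem _ _ _ _ P.indep_U₁₁_X₁₁).trans
    P.condMutualInfo_U₁₁_le_i₅) le_rfl

theorem i₁₀_le_i₄_add_i₉ : P.i₁₀ ≤ P.i₄ + P.i₉ := by
  rw [i₁₀_eq_add_i₉]
  refine add_le_add ((condMutualInfo_le_of_indep P.joint_mem _ _ _ _ P.indep_X₁₁).trans ?_) le_rfl
  refine (condMutualInfo_le_pair P.joint_mem _ P.rX₁₂ _ _).trans_eq ?_
  exact condMutualInfo_congr _ (fun _ _ => Iff.rfl) (fun _ _ => Iff.rfl)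
      (by intro ω ω'; simp only [Prod.mk.injEq, and_true])

theorem condMutualInfo_U₂₁_le_i₇ :
    condMutualInfo P.joint P.rU₂₁ P.rY₁₂ (fun ω => (P.rX₁₁ ω, P.rU₁₁ ω)) ≤ P.i₇ := by
  refine (condMutualInfo_le_pair P.joint_mem _ P.rX₁₂ _ _).trans_eq ?_
  exact condMutualInfo_congr _ (by intro ω ω'; simp only [Prod.mk.injEq]; tauto)
    (fun _ _ => Iff.rfl) (fun _ _ => Iff.rfl)

theorem i₈_le : P.i₈ ≤ P.i₇ + P.i₄ := by
  rw [i₈_eq_add_i₄]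
  exact add_le_add ((condMutualInfo_le_of_indep P.joint_mem _ _ _ _ P.indep_U₂₁_X₁₁).trans
    P.condMutualInfo_U₂₁_le_i₇) le_rfl

theorem i₉_le : P.i₉ ≤ P.i₅ + P.i₇ := by
  rw [i₉_eq_add_i₇]
  refine add_le_add ((condMutualInfo_le_of_indep P.joint_mem _ _ _ _ P.indep_U₁₁_U₂₁).trans
    (le_of_eq_of_le ?_ P.condMutualInfo_U₁₁_le_i₅)) le_rfl
  exact condMutualInfo_congr _ (fun _ _ => Iff.rfl) (fun _ _ => Iff.rfl)
      (by intro ω ω'; simp only [Prod.mk.injEq]; tauto)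

theorem i₁₀_le_i₅_add_i₈ : P.i₁₀ ≤ P.i₅ + P.i₈ := by
  rw [i₁₀_eq_add_i₈]
  refine add_le_add ((condMutualInfo_le_of_indep P.joint_mem _ _ _ _ P.indep_U₁₁).trans
    (le_of_eq_of_le ?_ P.condMutualInfo_U₁₁_le_i₅)) le_rfl
  exact condMutualInfo_congr _ (fun _ _ => Iff.rfl) (fun _ _ => Iff.rfl)
      (by intro ω ω'; simp only [Prod.mk.injEq, and_true])

/-- `i₁₀ - i₉` and `i₈ - i₇` are the information that `X₁₁` gives about `Y₁₂`, without and with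
`U₁₁` known; by independence the second is at least the first. This enters the bound on `R₁₁ + R₂₁`.
-/
theorem i₇_add_i₁₀_le : P.i₇ + P.i₁₀ ≤ P.i₉ + P.i₈ := by
  have h : condMutualInfo P.joint P.rX₁₁ P.rU₁₁ (fun _ => ()) = 0 := by
    refine le_antisymm ?_ (condMutualInfo_nonneg P.joint_mem _ _ _)
    have := condMutualInfo_le_pair P.joint_mem P.rU₁₁ P.rU₂₁ P.rX₁₁ (fun _ => ())
    rwa [condMutualInfo_comm, condMutualInfo_comm _ _ P.rX₁₁, P.indep_X₁₁] at this
  have h1 := condMutualInfo_le_of_indep P.joint_mem P.rX₁₁ P.rY₁₂ P.rU₁₁ (fun _ => ()) h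
  have h2 : condMutualInfo P.joint P.rX₁₁ P.rY₁₂ (fun ω => (P.rU₁₁ ω, ())) =
      condMutualInfo P.joint P.rX₁₁ P.rY₁₂ P.rU₁₁ :=
    condMutualInfo_congr _ (fun _ _ => Iff.rfl) (fun _ _ => Iff.rfl)
      (by intro ω ω'; simp only [Prod.mk.injEq, and_true])
  rw [i₁₀_eq_add_i₉, i₈_eq_add_i₇]
  linarith

theorem i₁₄_eq_condMutualInfo : P.i₁₄ = condMutualInfo P.joint
    (fun ω => (P.rU₁₁ ω, P.rU₂₁ ω, P.rU₂₂ ω)) P.rY₂₂ (fun _ => ()) :=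
  mutualInfo_eq_condMutualInfo P.joint_mem _ _

theorem i₁₂_eq_add_i₁₁ : P.i₁₂ = condMutualInfo P.joint P.rU₂₁ P.rY₂₂ P.rU₁₁ + P.i₁₁ :=
  condMutualInfo_chain P.joint P.rU₂₁ P.rU₂₂ P.rY₂₂ P.rU₁₁

theorem i₁₃_eq_add_i₁₁ : P.i₁₃ = condMutualInfo P.joint P.rU₁₁ P.rY₂₂ P.rU₂₁ + P.i₁₁ := by
  have h := condMutualInfo_chain P.joint P.rU₁₁ P.rU₂₂ P.rY₂₂ P.rU₂₁
  refine h.trans (congrArg₂ (· + ·) rfl ?_)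
  exact condMutualInfo_congr _ (fun _ _ => Iff.rfl) (fun _ _ => Iff.rfl)
      (by intro ω ω'; simp only [Prod.mk.injEq]; tauto)

theorem i₁₄_eq_add_i₁₂ :
    P.i₁₄ = condMutualInfo P.joint P.rU₁₁ P.rY₂₂ (fun _ => ()) + P.i₁₂ := by
  rw [i₁₄_eq_condMutualInfo, condMutualInfo_chain]
  refine congrArg₂ (· + ·) rfl ?_
  exact condMutualInfo_congr _ (fun _ _ => Iff.rfl) (fun _ _ => Iff.rfl)
      (by intro ω ω'; simp only [Prod.mk.injEq, and_true])

theorem i₁₄_eq_add_i₁₃ :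
    P.i₁₄ = condMutualInfo P.joint P.rU₂₁ P.rY₂₂ (fun _ => ()) + P.i₁₃ := by
  rw [i₁₄_eq_condMutualInfo]
  refine (condMutualInfo_congr (f' := fun ω => (P.rU₂₁ ω, P.rU₁₁ ω, P.rU₂₂ ω)) _
    (by intro ω ω'; simp only [Prod.mk.injEq]; tauto) (fun _ _ => Iff.rfl)
    (fun _ _ => Iff.rfl)).trans ?_
  rw [condMutualInfo_chain]
  refine congrArg₂ (· + ·) rfl ?_
  exact condMutualInfo_congr _ (fun _ _ => Iff.rfl) (fun _ _ => Iff.rfl)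
      (by intro ω ω'; simp only [Prod.mk.injEq, and_true])

theorem i₁₁_le_i₁₂ : P.i₁₁ ≤ P.i₁₂ := by
  rw [i₁₂_eq_add_i₁₁]
  exact le_add_of_nonneg_left (condMutualInfo_nonneg P.joint_mem _ _ _)

theorem i₁₁_le_i₁₃ : P.i₁₁ ≤ P.i₁₃ := by
  rw [i₁₃_eq_add_i₁₁]
  exact le_add_of_nonneg_left (condMutualInfo_nonneg P.joint_mem _ _ _)

theorem i₁₂_le_i₁₄ : P.i₁₂ ≤ P.i₁₄ := by
  rw [i₁₄_eq_add_i₁₂]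
  exact le_add_of_nonneg_left (condMutualInfo_nonneg P.joint_mem _ _ _)

theorem i₁₃_le_i₁₄ : P.i₁₃ ≤ P.i₁₄ := by
  rw [i₁₄_eq_add_i₁₃]
  exact le_add_of_nonneg_left (condMutualInfo_nonneg P.joint_mem _ _ _)

theorem i₂_nonneg : 0 ≤ P.i₂ := mutualInfo_nonneg P.joint_mem _ _

theorem iY₁₁_nonneg : 0 ≤ P.iY₁₁ := mutualInfo_nonneg P.joint_mem _ _

theorem i₃_nonneg : 0 ≤ P.i₃ := condMutualInfo_nonneg P.joint_mem _ _ _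

theorem i₄_nonneg : 0 ≤ P.i₄ := condMutualInfo_nonneg P.joint_mem _ _ _

theorem i₅_nonneg : 0 ≤ P.i₅ := condMutualInfo_nonneg P.joint_mem _ _ _

end HKInput

end

/-! ### Splitting the rates for a fixed distribution -/

noncomputable section

open Filter Topology

namespace HKInput

variable {W : HDChannel.{u}}

/-- Some input distribution admits a splitting of the rates. -/
def Splittable (W : HDChannel.{u}) (α β R₁ R₂ : ℝ) : Prop :=
  ∃ (P : HKInput W) (R₁₀ R₁₁ R₁₂ R₂₁ R₂₂ : ℝ), P.Admissible α β R₁₀ R₁₁ R₁₂ R₂₁ R₂₂ ∧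
    R₁₀ + R₁₁ + R₁₂ = R₁ ∧ R₂₁ + R₂₂ = R₂

/-- Fourier–Motzkin elimination made explicit. Each partial rate receives the least value its lower
bounds allow, and the remaining constraints are checked by cases on which lower bound is attained.
The three extra hypotheses serve to make `R₂₂` nonnegative and to keep `R₂₁` below `I₇`. -/
theorem splittable_of_mem_rateRegion (P : HKInput W) {τ : ℝ} (hτ : τ ∈ Set.Icc (0 : ℝ) 1)
    {R : ℝ × ℝ} (hR : R ∈ P.rateRegion τ) (ha₂ : 0 ≤ P.I₁₁ τ - P.I₁ τ)
    (h₁ : R.1 ≤ min (P.I₂ τ + P.I₃ τ) (P.I₄ τ) + (P.I₁₃ τ - P.I₁ τ))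
    (h₂ : R.2 ≤ P.I₁₁ τ - P.I₁ τ + P.I₇ τ) : Splittable W τ (1 - τ) R.1 R.2 := by
  obtain ⟨R₁, R₂⟩ := R
  obtain ⟨hR₁, hR₂, hd₁, hd₂, h3, h4, h5, h6, h7⟩ := hR
  have hτ0 := hτ.1
  have hτ1 : 0 ≤ 1 - τ := by linarith [hτ.2]
  have hm : ∀ {a b : ℝ}, a ≤ b → (1 - τ) * a ≤ (1 - τ) * b := fun h =>
    mul_le_mul_of_nonneg_left h hτ1
  have e1 : P.I₁ τ = (1 - τ) * P.i₁ := rfl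
  have e2 : P.I₂ τ = τ * P.i₂ := rfl
  have e3 : P.I₃ τ = (1 - τ) * P.i₃ := rfl
  have e4 : P.I₄ τ = τ * P.iY₁₁ + (1 - τ) * P.i₄ := rfl
  have e5 : P.I₅ τ = (1 - τ) * P.i₅ := rfl
  have e6 : P.I₆ τ = τ * P.iY₁₁ + (1 - τ) * P.i₆ := rfl
  have e7 : P.I₇ τ = (1 - τ) * P.i₇ := rfl
  have e8 : P.I₈ τ = τ * P.iY₁₁ + (1 - τ) * P.i₈ := rfl
  have e9 : P.I₉ τ = (1 - τ) * P.i₉ := rfl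
  have e10 : P.I₁₀ τ = τ * P.iY₁₁ + (1 - τ) * P.i₁₀ := rfl
  have e11 : P.I₁₁ τ = (1 - τ) * P.i₁₁ := rfl
  have e12 : P.I₁₂ τ = (1 - τ) * P.i₁₂ := rfl
  have e13 : P.I₁₃ τ = (1 - τ) * P.i₁₃ := rfl
  have e14 : P.I₁₄ τ = (1 - τ) * P.i₁₄ := rfl
  have n2 : 0 ≤ P.I₂ τ := mul_nonneg hτ0 P.i₂_nonneg
  have nY : 0 ≤ τ * P.iY₁₁ := mul_nonneg hτ0 P.iY₁₁_nonneg
  have n3 : 0 ≤ P.I₃ τ := mul_nonneg hτ1 P.i₃_nonneg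
  have n4 : 0 ≤ P.I₄ τ := add_nonneg nY (mul_nonneg hτ1 P.i₄_nonneg)
  have n5 : 0 ≤ P.I₅ τ := mul_nonneg hτ1 P.i₅_nonneg
  have f37 : P.I₃ τ ≤ P.I₇ τ := hm P.i₃_le_i₇
  have f48 : P.I₄ τ ≤ P.I₈ τ := by rw [e4, e8]; linarith [hm P.i₄_le_i₈]
  have f78 : P.I₇ τ ≤ P.I₈ τ := by rw [e7, e8]; linarith [hm P.i₇_le_i₈]
  have f79 : P.I₇ τ ≤ P.I₉ τ := hm P.i₇_le_i₉
  have f59 : P.I₅ τ ≤ P.I₉ τ := hm P.i₅_le_i₉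
  have f610 : P.I₆ τ ≤ P.I₁₀ τ := by rw [e6, e10]; linarith [hm P.i₆_le_i₁₀]
  have g6 : P.I₆ τ ≤ P.I₅ τ + P.I₄ τ := by rw [e6, e5, e4]; linarith [hm P.i₆_le]
  have g10 : P.I₁₀ τ ≤ P.I₄ τ + P.I₉ τ := by rw [e10, e4, e9]; linarith [hm P.i₁₀_le_i₄_add_i₉]
  have g8 : P.I₈ τ ≤ P.I₇ τ + P.I₄ τ := by rw [e8, e7, e4]; linarith [hm P.i₈_le]
  have g9 : P.I₉ τ ≤ P.I₅ τ + P.I₇ τ := by rw [e9, e5, e7]; linarith [hm P.i₉_le]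
  have g10' : P.I₁₀ τ ≤ P.I₅ τ + P.I₈ τ := by
    rw [e10, e5, e8]; linarith [hm P.i₁₀_le_i₅_add_i₈]
  have g710 : P.I₇ τ + P.I₁₀ τ ≤ P.I₉ τ + P.I₈ τ := by
    rw [e7, e10, e9, e8]; linarith [hm P.i₇_add_i₁₀_le]
  have k1 : P.I₁₁ τ ≤ P.I₁₃ τ := hm P.i₁₁_le_i₁₃
  have k2 : P.I₁₂ τ ≤ P.I₁₄ τ := hm P.i₁₂_le_i₁₄
  have k3 : P.I₁₃ τ ≤ P.I₁₄ τ := hm P.i₁₃_le_i₁₄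
  simp only at hR₁ hR₂ hd₁ hd₂ h3 h4 h5 h6 h7 h₁ h₂
  set a := min (P.I₂ τ + P.I₃ τ) (P.I₄ τ) with ha
  set d := min (P.I₂ τ + P.I₅ τ) (P.I₆ τ) with hd
  set e := min (P.I₂ τ + P.I₇ τ) (P.I₈ τ) with he
  set g := min (P.I₂ τ + P.I₉ τ) (P.I₁₀ τ) with hg
  have a_le : a ≤ P.I₂ τ + P.I₃ τ := min_le_left _ _
  have a_le' : a ≤ P.I₄ τ := min_le_right _ _
  have d_le : d ≤ P.I₂ τ + P.I₅ τ := min_le_left _ _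
  have d_le' : d ≤ P.I₆ τ := min_le_right _ _
  have e_le : e ≤ P.I₂ τ + P.I₇ τ := min_le_left _ _
  have e_le' : e ≤ P.I₈ τ := min_le_right _ _
  have g_le : g ≤ P.I₂ τ + P.I₉ τ := min_le_left _ _
  have g_le' : g ≤ P.I₁₀ τ := min_le_right _ _
  have a_nn : 0 ≤ a := le_min (by linarith) n4
  have a_le_e : a ≤ e := le_min (by linarith) (by linarith)
  have I7_le_e : P.I₇ τ ≤ e := le_min (by linarith) f78
  have d_le_g : d ≤ g := le_min (by linarith) (by linarith)
  -- To compare two minima, the argument at which the subtracted one is attained is paired with the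
  -- corresponding argument of the other.
  have ea : e - a ≤ P.I₇ τ := by
    rcases min_choice (P.I₂ τ + P.I₃ τ) (P.I₄ τ) with h | h <;> rw [← ha] at h <;> linarith
  have da : d - a ≤ P.I₅ τ := by
    rcases min_choice (P.I₂ τ + P.I₃ τ) (P.I₄ τ) with h | h <;> rw [← ha] at h <;> linarith
  have ge : g - e ≤ P.I₅ τ := by
    rcases min_choice (P.I₂ τ + P.I₇ τ) (P.I₈ τ) with h | h <;> rw [← he] at h <;> linarith
  have ga : g - a ≤ P.I₉ τ := by
    rcases min_choice (P.I₂ τ + P.I₃ τ) (P.I₄ τ) with h | h <;> rw [← ha] at h <;> linarith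
  have ge7 : g - e + P.I₇ τ ≤ P.I₉ τ := by
    rcases min_choice (P.I₂ τ + P.I₇ τ) (P.I₈ τ) with h | h <;> rw [← he] at h <;> linarith
  -- `t` is `R₂₁`. Its lower bounds come from nonnegativity, from the constraint on `R₂₂`, and from
  -- the one on `R₁₁ + R₂₂` combined with `R₁₁ ≥ R₁ - a`.
  obtain ⟨t, ht0, ht1, ht2, htc⟩ : ∃ t, 0 ≤ t ∧ R₂ - (P.I₁₁ τ - P.I₁ τ) ≤ t ∧
      R₁ + R₂ - a - (P.I₁₃ τ - P.I₁ τ) ≤ t ∧ (t = 0 ∨ t = R₂ - (P.I₁₁ τ - P.I₁ τ) ∨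
        t = R₁ + R₂ - a - (P.I₁₃ τ - P.I₁ τ)) := by
    refine ⟨max 0 (max (R₂ - (P.I₁₁ τ - P.I₁ τ)) (R₁ + R₂ - a - (P.I₁₃ τ - P.I₁ τ))),
      le_max_left _ _, (le_max_left _ _).trans (le_max_right _ _),
      (le_max_right _ _).trans (le_max_right _ _), ?_⟩
    rcases max_choice 0 (max (R₂ - (P.I₁₁ τ - P.I₁ τ)) (R₁ + R₂ - a - (P.I₁₃ τ - P.I₁ τ)))
      with h | h
    · exact Or.inl h
    · rw [h]
      exact Or.inr (max_choice _ _)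
  -- `s` is `R₁₁`. The rest `R₁ - s` belongs to `w₁₀` and `w₁₂`; it is limited by `a`, and together
  -- with `t` by `e`.
  obtain ⟨s, hs0, hs1, hs2, hsc⟩ : ∃ s, 0 ≤ s ∧ R₁ - a ≤ s ∧ R₁ + t - e ≤ s ∧
      (s = 0 ∨ s = R₁ - a ∨ s = R₁ + t - e) := by
    refine ⟨max 0 (max (R₁ - a) (R₁ + t - e)), le_max_left _ _,
      (le_max_left _ _).trans (le_max_right _ _), (le_max_right _ _).trans (le_max_right _ _), ?_⟩
    rcases max_choice 0 (max (R₁ - a) (R₁ + t - e)) with h | h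
    · exact Or.inl h
    · rw [h]
      exact Or.inr (max_choice _ _)
  have ht7 : t ≤ P.I₇ τ := by rcases htc with h | h | h <;> linarith
  have htR : t ≤ R₂ := by rcases htc with h | h | h <;> linarith
  have hRtg : R₁ + t ≤ g := by rcases htc with h | h | h <;> linarith
  have hs5 : s ≤ P.I₅ τ := by rcases hsc with h | h | h <;> linarith
  -- In the third case `t` counts twice: one copy is absorbed by `R₁ + t ≤ g`, the other by `t ≤ I₇`
  -- and `ge7`.
  have hst9 : s + t ≤ P.I₉ τ := by
    rcases hsc with h | h | h
    · linarith
    · linarith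
    · linarith
  have hsR : s ≤ R₁ := by rcases hsc with h | h | h <;> linarith
  have hse : R₂ - t + s ≤ P.I₁₃ τ - P.I₁ τ := by rcases hsc with h | h | h <;> linarith
  -- In the third case the value of `t` decides: `h4` with `a ≤ e`, then the bound `h7` on `R₁ + 2
  -- R₂`, then the sum of `h3` and `h4`.
  have hsg : R₂ + s ≤ P.I₁₄ τ - P.I₁ τ := by
    rcases hsc with h | h | h
    · linarith
    · linarith
    · rcases htc with h' | h' | h' <;> linarith
  -- `r` is `R₁₂`. As much as possible is put into `w₁₀`, up to the limit `I₂` of the second sender.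
  obtain ⟨r, hr0, hr1, hrA, hrc⟩ : ∃ r, 0 ≤ r ∧ R₁ - s - P.I₂ τ ≤ r ∧ r ≤ R₁ - s ∧
      (r = 0 ∨ r = R₁ - s - P.I₂ τ) :=
    ⟨max 0 (R₁ - s - P.I₂ τ), le_max_left _ _, le_max_right _ _,
      max_le (by linarith) (by linarith), max_choice _ _⟩
  refine ⟨P, R₁ - s - r, s, r, t, R₂ - t, ?_, by ring, by ring⟩
  rw [e4] at *
  rw [e6] at *
  rw [e8] at *
  rw [e10] at *
  constructor
  case nn₁₀ => linarith
  case nn₁₁ => exact hs0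
  case nn₁₂ => exact hr0
  case nn₂₁ => exact ht0
  case nn₂₂ => linarith
  case c₂ => linarith
  case c₃ => rcases hrc with h | h <;> linarith
  case c₄ => linarith
  case c₅ => rcases hrc with h | h <;> linarith
  case c₆ => linarith
  case c₇ => rcases hrc with h | h <;> linarith
  case c₈ => linarith
  case c₉ => rcases hrc with h | h <;> linarith
  case c₁₀ => linarith
  case c₁₁ => linarith
  case c₁₂ => linarith
  case c₁₃ => linarith
  case c₁₄ => linarith

end HKInput

end

/-! ### Simpler input distributions when a condition fails -/

noncomputable section

open Filter Topology

theorem expect_mem_stdSimplex {A B : Type*} [Fintype A] [Fintype B] {p : A → ℝ}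
    (hp : p ∈ stdSimplex ℝ A) {κ : A → B → ℝ} (hκ : ∀ a, κ a ∈ stdSimplex ℝ B) :
    (fun b => expect p fun a => κ a b) ∈ stdSimplex ℝ B := by
  refine ⟨fun b => expect_nonneg hp.1 fun a => (hκ a).1 b, ?_⟩
  rw [← expect_sum Finset.univ p fun b a => κ a b]
  simp only [(hκ _).2]
  exact expect_const hp 1

theorem expect_expect_kernel {A B : Type*} [Fintype A] [Fintype B] (p : A → ℝ) (κ : A → B → ℝ)
    (f : B → ℝ) : expect (fun b => expect p fun a => κ a b) f =
      expect p fun a => expect (κ a) f := by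
  simp only [expect, Finset.sum_mul, Finset.mul_sum, mul_assoc]
  exact Finset.sum_comm

theorem expect_kernel_prod {A B : Type*} [Fintype A] [Fintype B] (p : A → ℝ) (κ : A → B → ℝ)
    (f : A × B → ℝ) : expect (fun x : A × B => p x.1 * κ x.1 x.2) f =
      expect p fun a => expect (κ a) fun b => f (a, b) := by
  simp only [expect, Fintype.sum_prod_type, Finset.mul_sum, mul_assoc]

namespace HKInput

variable {W : HDChannel.{u}} (P : HKInput W)

theorem expect_single {A : Type*} [Fintype A] [Unique A] (f : A → ℝ) :
    expect (fun _ : A => 1) f = f default := by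
  simp [expect]

/-- The law of the trivial random variable. -/
def trivialLaw : stdSimplex ℝ Unit := ⟨fun _ => 1, fun _ => zero_le_one, by simp⟩

theorem expect_trivialLaw (f : Unit → ℝ) : expect trivialLaw f = f () :=
  expect_single f

/-- Point indicators as test functions identify the new law as an image of the old one, so its
informations can be read as informations of the old law. -/
theorem joint_eq_pmfOf {P Q : HKInput W} (φ : P.Outcome → Q.Outcome)
    (h : ∀ f : Q.Outcome → ℝ, expect Q.joint f = expect P.joint fun ω => f (φ ω)) :
    Q.joint = pmfOf P.joint φ := by
  ext ω
  have h1 := h fun ω' => ind (ω' = ω)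
  rw [expect_ind, ← pmfOf_eq_expect] at h1
  exact h1

/-- The input distribution without the auxiliary variable `U₂₂`. -/
abbrev dropU₂₂ : HKInput W where
  U₁₁ := P.U₁₁
  U₂₁ := P.U₂₁
  U₂₂ := Unit
  pX₁₁ := P.pX₁₁
  pU₁₁ := P.pU₁₁
  pX₁₂ := P.pX₁₂
  pU₂₁ := P.pU₂₁
  pU₂₂ _ _ := trivialLaw
  pX₂₂ x v _ := ⟨fun t => expect (P.pU₂₂ v x) fun s => P.pX₂₂ x v s t,
    expect_mem_stdSimplex (P.pU₂₂ v x).2 fun s => (P.pX₂₂ x v s).2⟩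

theorem dropU₂₂_joint : P.dropU₂₂.joint = pmfOf P.joint
    fun (x, u, a, v, _, t, y, z) => (x, u, a, v, (), t, y, z) := by
  refine joint_eq_pmfOf _ fun f => ?_
  rw [expect_joint, expect_joint]
  simp only [expect_trivialLaw]
  refine congrArg _ (funext fun x => congrArg _ (funext fun u => congrArg _ (funext fun a =>
    congrArg _ (funext fun v => ?_))))
  exact expect_expect_kernel _ _ _

/-- The input distribution without the auxiliary variable `U₁₁`. -/
abbrev dropU₁₁ : HKInput W where
  U₁₁ := Unit
  U₂₁ := P.U₂₁
  U₂₂ := P.U₂₂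
  pX₁₁ := P.pX₁₁
  pU₁₁ := trivialLaw
  pX₁₂ _ x := ⟨fun a => expect P.pU₁₁ fun u => P.pX₁₂ u x a,
    expect_mem_stdSimplex P.pU₁₁.2 fun u => (P.pX₁₂ u x).2⟩
  pU₂₁ := P.pU₂₁
  pU₂₂ := P.pU₂₂
  pX₂₂ := P.pX₂₂

theorem dropU₁₁_joint : P.dropU₁₁.joint = pmfOf P.joint
    fun (x, _, a, v, s, t, y, z) => (x, (), a, v, s, t, y, z) := by
  refine joint_eq_pmfOf _ fun f => ?_
  rw [expect_joint, expect_joint]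
  simp only [expect_trivialLaw]
  refine congrArg _ (funext fun x => ?_)
  exact expect_expect_kernel _ _ _

/-- The input distribution with `(U₂₁, U₂₂)` in the place of `U₂₂` and no `U₂₁`. -/
abbrev mergeU₂₁ : HKInput W where
  U₁₁ := P.U₁₁
  U₂₁ := Unit
  U₂₂ := P.U₂₁ × P.U₂₂
  pX₁₁ := P.pX₁₁
  pU₁₁ := P.pU₁₁
  pX₁₂ := P.pX₁₂
  pU₂₁ := trivialLaw
  pU₂₂ _ x := ⟨fun vs => P.pU₂₁ vs.1 * P.pU₂₂ vs.1 x vs.2,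
    fun vs => mul_nonneg (P.pU₂₁.2.1 _) ((P.pU₂₂ _ _).2.1 _), by
      rw [Fintype.sum_prod_type]
      simp only [← Finset.mul_sum]
      have h : ∀ v, ∑ s, P.pU₂₂ v x s = 1 := fun v => (P.pU₂₂ v x).2.2
      simp only [h, mul_one]
      exact P.pU₂₁.2.2⟩
  pX₂₂ x _ vs := P.pX₂₂ x vs.1 vs.2

theorem mergeU₂₁_joint : P.mergeU₂₁.joint = pmfOf P.joint
    fun (x, u, a, v, s, t, y, z) => (x, u, a, (), (v, s), t, y, z) := by
  refine joint_eq_pmfOf _ fun f => ?_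
  rw [expect_joint, expect_joint]
  simp only [expect_trivialLaw]
  refine congrArg _ (funext fun x => congrArg _ (funext fun u => congrArg _ (funext fun a => ?_)))
  exact expect_kernel_prod P.pU₂₁ (fun v s => P.pU₂₂ v x s) fun vs : P.U₂₁ × P.U₂₂ =>
    expect (P.pX₂₂ x vs.1 vs.2) fun t => expect (W.phase1 x) fun y => expect (W.phase2 a t) fun z =>
      f (x, u, a, (), vs, t, y, z)

section dropU₂₂

theorem i₁_dropU₂₂ : P.dropU₂₂.i₁ = 0 :=
  condMutualInfo_of_subsingleton (A := Unit) _ _ _ _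

theorem i₁₁_dropU₂₂ : P.dropU₂₂.i₁₁ = 0 :=
  condMutualInfo_of_subsingleton (A := Unit) _ _ _ _

theorem i₂_dropU₂₂ : P.dropU₂₂.i₂ = P.i₂ := by
  rw [i₂, dropU₂₂_joint, mutualInfo_pmfOf]; rfl

theorem iY₁₁_dropU₂₂ : P.dropU₂₂.iY₁₁ = P.iY₁₁ := by
  rw [iY₁₁, dropU₂₂_joint, mutualInfo_pmfOf]; rfl

theorem i₃_dropU₂₂ : P.dropU₂₂.i₃ = P.i₃ := by
  rw [i₃, dropU₂₂_joint, condMutualInfo_pmfOf]; rfl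

theorem i₄_dropU₂₂ : P.dropU₂₂.i₄ = P.i₄ := by
  rw [i₄, dropU₂₂_joint, condMutualInfo_pmfOf]; rfl

theorem i₅_dropU₂₂ : P.dropU₂₂.i₅ = P.i₅ := by
  rw [i₅, dropU₂₂_joint, condMutualInfo_pmfOf]; rfl

theorem i₆_dropU₂₂ : P.dropU₂₂.i₆ = P.i₆ := by
  rw [i₆, dropU₂₂_joint, condMutualInfo_pmfOf]; rfl

theorem i₇_dropU₂₂ : P.dropU₂₂.i₇ = P.i₇ := by
  rw [i₇, dropU₂₂_joint, condMutualInfo_pmfOf]; rfl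

theorem i₈_dropU₂₂ : P.dropU₂₂.i₈ = P.i₈ := by
  rw [i₈, dropU₂₂_joint, condMutualInfo_pmfOf]; rfl

theorem i₉_dropU₂₂ : P.dropU₂₂.i₉ = P.i₉ := by
  rw [i₉, dropU₂₂_joint, condMutualInfo_pmfOf]; rfl

theorem i₁₀_dropU₂₂ : P.dropU₂₂.i₁₀ = P.i₁₀ := by
  rw [i₁₀, dropU₂₂_joint, mutualInfo_pmfOf]; rfl

/-- `i₁₁` is the last term of the chain rule in each of `i₁₂`, `i₁₃`, `i₁₄`; it is what the loss of
`U₂₂` removes. -/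
theorem i₁₂_dropU₂₂ : P.dropU₂₂.i₁₂ = P.i₁₂ - P.i₁₁ := by
  rw [i₁₂_eq_add_i₁₁, i₁₁_dropU₂₂, i₁₂_eq_add_i₁₁ P, dropU₂₂_joint, condMutualInfo_pmfOf, add_zero,
    add_sub_cancel_right]
  rfl

theorem i₁₃_dropU₂₂ : P.dropU₂₂.i₁₃ = P.i₁₃ - P.i₁₁ := by
  rw [i₁₃_eq_add_i₁₁, i₁₁_dropU₂₂, i₁₃_eq_add_i₁₁ P, dropU₂₂_joint, condMutualInfo_pmfOf, add_zero,
    add_sub_cancel_right]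
  rfl

theorem i₁₄_dropU₂₂ : P.dropU₂₂.i₁₄ = P.i₁₄ - P.i₁₁ := by
  have h : condMutualInfo P.dropU₂₂.joint P.dropU₂₂.rU₂₁ P.dropU₂₂.rY₂₂ (fun _ => ()) =
      condMutualInfo P.joint P.rU₂₁ P.rY₂₂ (fun _ => ()) := by
    rw [dropU₂₂_joint, condMutualInfo_pmfOf]; rfl
  rw [i₁₄_eq_add_i₁₃, i₁₃_dropU₂₂, i₁₄_eq_add_i₁₃ P, h]
  ring

end dropU₂₂

section dropU₁₁

theorem i₂_dropU₁₁ : P.dropU₁₁.i₂ = P.i₂ := by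
  rw [i₂, dropU₁₁_joint, mutualInfo_pmfOf]; rfl

theorem iY₁₁_dropU₁₁ : P.dropU₁₁.iY₁₁ = P.iY₁₁ := by
  rw [iY₁₁, dropU₁₁_joint, mutualInfo_pmfOf]; rfl

variable {P} in
/-- Given the channel input, the auxiliary variable `U₁₁` may be dropped. -/
theorem condMutualInfo_drop_U₁₁ {A B C : Type*} [Fintype A] [Fintype B] [Fintype C]
    {f : P.Outcome → A} {g : P.Outcome → B} {c : P.Outcome → C}
    (h : ∀ ω ω', (f ω = f ω' ∧ c ω = c ω') ↔
      (g ω = g ω' ∧ P.rU₁₁ ω = P.rU₁₁ ω') ∧ c ω = c ω')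
    (hg : ∀ ω ω', (g ω = g ω' ∧ c ω = c ω') ↔
      (P.rX₁₁ ω = P.rX₁₁ ω' ∧ P.rX₁₂ ω = P.rX₁₂ ω' ∧ P.rU₂₁ ω = P.rU₂₁ ω')) :
    condMutualInfo P.joint f P.rY₁₂ c = condMutualInfo P.joint g P.rY₁₂ c := by
  have h1 : condMutualInfo P.joint f P.rY₁₂ c =
      condMutualInfo P.joint (fun ω => (g ω, P.rU₁₁ ω)) P.rY₁₂ c := by
    unfold condMutualInfo
    rw [shannonEntropy_congr P.joint (f := fun ω => (f ω, c ω))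
      (g := fun ω => ((g ω, P.rU₁₁ ω), c ω)),
      shannonEntropy_congr P.joint (f := fun ω => (f ω, P.rY₁₂ ω, c ω))
      (g := fun ω => ((g ω, P.rU₁₁ ω), P.rY₁₂ ω, c ω))]
    · intro ω ω'
      have := h ω ω'
      simp only [Prod.mk.injEq]
      tauto
    · intro ω ω'
      have := h ω ω'
      simp only [Prod.mk.injEq]
      tauto
  have h2 : condMutualInfo P.joint P.rU₁₁ P.rY₁₂ (fun ω => (g ω, c ω)) = 0 := by
    rw [← P.markov_U₁₁]
    refine condMutualInfo_congr _ (fun _ _ => Iff.rfl) (fun _ _ => Iff.rfl) fun ω ω' => ?_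
    simp only [Prod.mk.injEq]
    exact hg ω ω'
  rw [h1, condMutualInfo_chain, h2, add_zero]

/-- By the Markov property `U₁₁` adds nothing once `X₁₁`, `X₁₂`, `U₂₁` are included, so the bounds
with `u₁₁` wrong survive its removal. -/
theorem i₅_eq_drop : P.i₅ = condMutualInfo P.joint P.rX₁₂ P.rY₁₂ (fun ω => (P.rX₁₁ ω, P.rU₂₁ ω)) :=
  condMutualInfo_drop_U₁₁ (by intro ω ω'; simp only [Prod.mk.injEq]; tauto)
    (by intro ω ω'; simp only [Prod.mk.injEq]; tauto)

theorem i₆_eq_drop : P.i₆ = condMutualInfo P.joint (fun ω => (P.rX₁₁ ω, P.rX₁₂ ω)) P.rY₁₂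
    P.rU₂₁ :=
  condMutualInfo_drop_U₁₁ (by intro ω ω'; simp only [Prod.mk.injEq]; tauto)
    (by intro ω ω'; simp only [Prod.mk.injEq]; tauto)

theorem i₉_eq_drop : P.i₉ = condMutualInfo P.joint (fun ω => (P.rX₁₂ ω, P.rU₂₁ ω)) P.rY₁₂
    P.rX₁₁ :=
  condMutualInfo_drop_U₁₁ (by intro ω ω'; simp only [Prod.mk.injEq]; tauto)
    (by intro ω ω'; simp only [Prod.mk.injEq]; tauto)

theorem i₁₀_eq_drop : P.i₁₀ = condMutualInfo P.joint (fun ω => (P.rX₁₁ ω, P.rX₁₂ ω, P.rU₂₁ ω))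
    P.rY₁₂ (fun _ => ()) := by
  rw [i₁₀_eq_condMutualInfo]
  exact condMutualInfo_drop_U₁₁ (by intro ω ω'; simp only [Prod.mk.injEq]; tauto)
    (by intro ω ω'; simp only [Prod.mk.injEq]; tauto)

theorem i₃_dropU₁₁ : P.dropU₁₁.i₃ = P.i₅ := by
  rw [i₃, dropU₁₁_joint, condMutualInfo_pmfOf, i₅_eq_drop]
  refine condMutualInfo_congr _ (fun _ _ => Iff.rfl) (fun _ _ => Iff.rfl) fun ω ω' => ?_
  simp only [Prod.mk.injEq, rX₁₁, rU₁₁, rU₂₁, true_and]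

theorem i₄_dropU₁₁ : P.dropU₁₁.i₄ = P.i₆ := by
  rw [i₄, dropU₁₁_joint, condMutualInfo_pmfOf, i₆_eq_drop]
  refine condMutualInfo_congr _ (fun _ _ => Iff.rfl) (fun _ _ => Iff.rfl) fun ω ω' => ?_
  simp only [Prod.mk.injEq, rU₁₁, rU₂₁, true_and]

theorem i₅_dropU₁₁ : P.dropU₁₁.i₅ = P.i₅ := by
  rw [i₅_eq_drop, dropU₁₁_joint, condMutualInfo_pmfOf, i₅_eq_drop P]; rfl

theorem i₆_dropU₁₁ : P.dropU₁₁.i₆ = P.i₆ := by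
  rw [i₆_eq_drop, dropU₁₁_joint, condMutualInfo_pmfOf, i₆_eq_drop P]; rfl

theorem i₇_dropU₁₁ : P.dropU₁₁.i₇ = P.i₉ := by
  rw [i₇, dropU₁₁_joint, condMutualInfo_pmfOf, i₉_eq_drop]
  refine condMutualInfo_congr _ (fun _ _ => Iff.rfl) (fun _ _ => Iff.rfl) fun ω ω' => ?_
  simp only [Prod.mk.injEq, rX₁₁, rU₁₁, and_true]

theorem i₈_dropU₁₁ : P.dropU₁₁.i₈ = P.i₁₀ := by
  rw [i₈, dropU₁₁_joint, condMutualInfo_pmfOf, i₁₀_eq_drop]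
  rfl

theorem i₉_dropU₁₁ : P.dropU₁₁.i₉ = P.i₉ := by
  rw [i₉_eq_drop, dropU₁₁_joint, condMutualInfo_pmfOf, i₉_eq_drop P]; rfl

theorem i₁₀_dropU₁₁ : P.dropU₁₁.i₁₀ = P.i₁₀ := by
  rw [i₁₀_eq_drop, dropU₁₁_joint, condMutualInfo_pmfOf, i₁₀_eq_drop P]; rfl

theorem i₁₃_dropU₁₁ : P.dropU₁₁.i₁₃ = P.dropU₁₁.i₁₁ := by
  rw [i₁₃_eq_add_i₁₁, condMutualInfo_of_subsingleton (A := Unit), zero_add]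

theorem i₁₄_dropU₁₁ : P.dropU₁₁.i₁₄ = P.dropU₁₁.i₁₂ := by
  rw [i₁₄_eq_add_i₁₂, condMutualInfo_of_subsingleton (A := Unit), zero_add]

/-- `i₁₄ - i₁₃` is `I(U₂₁; Y₂₂)`, which does not involve `U₁₁`. -/
theorem i₁₂_dropU₁₁ : P.dropU₁₁.i₁₂ = P.i₁₄ - P.i₁₃ + P.dropU₁₁.i₁₁ := by
  have h : condMutualInfo P.dropU₁₁.joint P.dropU₁₁.rU₂₁ P.dropU₁₁.rY₂₂ (fun _ => ()) =
      condMutualInfo P.joint P.rU₂₁ P.rY₂₂ (fun _ => ()) := by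
    rw [dropU₁₁_joint, condMutualInfo_pmfOf]; rfl
  rw [← i₁₄_dropU₁₁, i₁₄_eq_add_i₁₃, h, i₁₄_eq_add_i₁₃ P, i₁₃_dropU₁₁]
  ring

end dropU₁₁

section mergeU₂₁

theorem i₂_mergeU₂₁ : P.mergeU₂₁.i₂ = P.i₂ := by
  rw [i₂, mergeU₂₁_joint, mutualInfo_pmfOf]; rfl

theorem iY₁₁_mergeU₂₁ : P.mergeU₂₁.iY₁₁ = P.iY₁₁ := by
  rw [iY₁₁, mergeU₂₁_joint, mutualInfo_pmfOf]; rfl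

/-- `U₂₁` is independent of `X₁₁`, so binning it along with `U₂₂` costs nothing. -/
theorem i₁_mergeU₂₁ : P.mergeU₂₁.i₁ = P.i₁ := by
  rw [i₁, mergeU₂₁_joint, condMutualInfo_pmfOf]
  refine (condMutualInfo_chain P.joint P.rU₂₁ P.rU₂₂ P.rX₁₁ (fun _ => ())).trans ?_
  rw [P.indep_U₂₁, zero_add]
  exact condMutualInfo_congr _ (fun _ _ => Iff.rfl) (fun _ _ => Iff.rfl)
    (by intro ω ω'; simp only [Prod.mk.injEq, and_true])

theorem i₇_mergeU₂₁ : P.mergeU₂₁.i₇ = P.mergeU₂₁.i₃ := by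
  rw [i₇_eq_add_i₃, condMutualInfo_of_subsingleton (A := Unit), zero_add]

theorem i₈_mergeU₂₁ : P.mergeU₂₁.i₈ = P.mergeU₂₁.i₄ := by
  rw [i₈_eq_add_i₄, condMutualInfo_of_subsingleton (A := Unit), zero_add]

theorem i₉_mergeU₂₁ : P.mergeU₂₁.i₉ = P.mergeU₂₁.i₅ := by
  rw [i₉_eq_add_i₅, condMutualInfo_of_subsingleton (A := Unit), zero_add]

theorem i₁₀_mergeU₂₁ : P.mergeU₂₁.i₁₀ = P.mergeU₂₁.i₆ := by
  rw [i₁₀_eq_add_i₆, condMutualInfo_of_subsingleton (A := Unit), zero_add]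

theorem i₁₂_mergeU₂₁ : P.mergeU₂₁.i₁₂ = P.mergeU₂₁.i₁₁ := by
  rw [i₁₂_eq_add_i₁₁, condMutualInfo_of_subsingleton (A := Unit), zero_add]

theorem i₁₄_mergeU₂₁ : P.mergeU₂₁.i₁₄ = P.mergeU₂₁.i₁₃ := by
  rw [i₁₄_eq_add_i₁₃, condMutualInfo_of_subsingleton (A := Unit), zero_add]

theorem i₁₁_mergeU₂₁ : P.mergeU₂₁.i₁₁ = P.i₁₂ := by
  rw [i₁₁, mergeU₂₁_joint, condMutualInfo_pmfOf]
  refine condMutualInfo_congr _ (fun _ _ => Iff.rfl) (fun _ _ => Iff.rfl) fun ω ω' => ?_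
  simp only [Prod.mk.injEq, rU₁₁, rU₂₁, true_and]

theorem i₁₃_mergeU₂₁ : P.mergeU₂₁.i₁₃ = P.i₁₄ := by
  rw [i₁₃, mergeU₂₁_joint, condMutualInfo_pmfOf, i₁₄_eq_condMutualInfo]
  rfl

/-- `I(U₂₁; Y₁₂ | X₁₁, U₁₁, X₁₂)`, the loss of the first destination by not decoding `U₂₁`. -/
def iMerge : ℝ := condMutualInfo P.joint P.rU₂₁ P.rY₁₂ (fun ω => (P.rX₁₁ ω, P.rU₁₁ ω, P.rX₁₂ ω))

variable {P} in
-- With `U₂₁` last in the chain rule, its term is conditioned on `X₁₁`, `U₁₁`, `X₁₂` in every case.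
-- The four bounds with a wrong `u₂₁` therefore lose the same amount, which cancels when they are
-- compared.
theorem condMutualInfo_split_U₂₁ {A B C : Type*} [Fintype A] [Fintype B] [Fintype C]
    {f : P.Outcome → A} {g : P.Outcome → B} {c : P.Outcome → C}
    (h : ∀ ω ω', f ω = f ω' ↔ g ω = g ω' ∧ P.rU₂₁ ω = P.rU₂₁ ω')
    (hg : ∀ ω ω', (g ω = g ω' ∧ c ω = c ω') ↔
      (P.rX₁₁ ω = P.rX₁₁ ω' ∧ P.rU₁₁ ω = P.rU₁₁ ω' ∧ P.rX₁₂ ω = P.rX₁₂ ω')) :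
    condMutualInfo P.joint f P.rY₁₂ c = condMutualInfo P.joint g P.rY₁₂ c + P.iMerge := by
  have h1 : condMutualInfo P.joint f P.rY₁₂ c =
      condMutualInfo P.joint (fun ω => (g ω, P.rU₂₁ ω)) P.rY₁₂ c :=
    condMutualInfo_congr _ (fun ω ω' => by rw [h, Prod.mk.injEq]) (fun _ _ => Iff.rfl)
      (fun _ _ => Iff.rfl)
  have h2 : condMutualInfo P.joint P.rU₂₁ P.rY₁₂ (fun ω => (g ω, c ω)) = P.iMerge := by
    refine condMutualInfo_congr _ (fun _ _ => Iff.rfl) (fun _ _ => Iff.rfl) fun ω ω' => ?_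
    simp only [Prod.mk.injEq]
    exact hg ω ω'
  rw [h1, condMutualInfo_chain, h2]

theorem i₇_eq_mergeU₂₁ : P.i₇ = P.mergeU₂₁.i₃ + P.iMerge := by
  rw [i₃, mergeU₂₁_joint, condMutualInfo_pmfOf]
  refine (condMutualInfo_split_U₂₁ (g := P.rX₁₂) (by intro ω ω'; simp only [Prod.mk.injEq])
    (by intro ω ω'; simp only [Prod.mk.injEq]; tauto)).trans (congrArg₂ (· + ·) ?_ rfl)
  refine condMutualInfo_congr _ (fun _ _ => Iff.rfl) (fun _ _ => Iff.rfl) fun ω ω' => ?_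
  simp only [Prod.mk.injEq, rX₁₁, rU₁₁, rU₂₁, and_true]

theorem i₈_eq_mergeU₂₁ : P.i₈ = P.mergeU₂₁.i₄ + P.iMerge := by
  rw [i₄, mergeU₂₁_joint, condMutualInfo_pmfOf]
  refine (condMutualInfo_split_U₂₁ (g := fun ω => (P.rX₁₁ ω, P.rX₁₂ ω))
    (by intro ω ω'; simp only [Prod.mk.injEq]; tauto)
    (by intro ω ω'; simp only [Prod.mk.injEq]; tauto)).trans (congrArg₂ (· + ·) ?_ rfl)
  refine condMutualInfo_congr _ (fun _ _ => Iff.rfl) (fun _ _ => Iff.rfl) fun ω ω' => ?_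
  simp only [Prod.mk.injEq, rU₁₁, rU₂₁, and_true]

theorem i₉_eq_mergeU₂₁ : P.i₉ = P.mergeU₂₁.i₅ + P.iMerge := by
  rw [i₅, mergeU₂₁_joint, condMutualInfo_pmfOf]
  refine (condMutualInfo_split_U₂₁ (g := fun ω => (P.rU₁₁ ω, P.rX₁₂ ω))
    (by intro ω ω'; simp only [Prod.mk.injEq]; tauto)
    (by intro ω ω'; simp only [Prod.mk.injEq]; tauto)).trans (congrArg₂ (· + ·) ?_ rfl)
  refine condMutualInfo_congr _ (fun _ _ => Iff.rfl) (fun _ _ => Iff.rfl) fun ω ω' => ?_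
  simp only [Prod.mk.injEq, rX₁₁, rU₂₁, and_true]

theorem i₁₀_eq_mergeU₂₁ : P.i₁₀ = P.mergeU₂₁.i₆ + P.iMerge := by
  rw [i₆, mergeU₂₁_joint, condMutualInfo_pmfOf, i₁₀_eq_condMutualInfo]
  exact condMutualInfo_split_U₂₁ (g := fun ω => (P.rX₁₁ ω, P.rU₁₁ ω, P.rX₁₂ ω))
    (by intro ω ω'; simp only [Prod.mk.injEq]; tauto)
    (by intro ω ω'; simp only [Prod.mk.injEq]; tauto)

end mergeU₂₁

variable {P} {τ : ℝ} {R : ℝ × ℝ}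

/-- If `R₂ > I₁₁ - I₁ + I₇`, the first destination gives up decoding `u₂₁`, which is merged into
`u₂₂`. Subtracting this inequality from the bounds on `R₁ + R₂` with `I₁₁` and on `R₁ + 2 R₂` gives
the constraints on the new distribution, as `I₇` contains the loss `iMerge`. -/
theorem splittable_of_relay_bound (hτ : τ ∈ Set.Icc (0 : ℝ) 1) (hR : R ∈ P.rateRegion τ)
    (ha₂ : 0 ≤ P.I₁₁ τ - P.I₁ τ)
    (h₁ : R.1 ≤ min (P.I₂ τ + P.I₃ τ) (P.I₄ τ) + (P.I₁₃ τ - P.I₁ τ)) :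
    Splittable W τ (1 - τ) R.1 R.2 := by
  by_cases h₂ : R.2 ≤ P.I₁₁ τ - P.I₁ τ + P.I₇ τ
  · exact P.splittable_of_mem_rateRegion hτ hR ha₂ h₁ h₂
  push Not at h₂
  have hτ1 : 0 ≤ 1 - τ := by linarith [hτ.2]
  set Q := P.mergeU₂₁ with hQ
  have e1 : Q.I₁ τ = P.I₁ τ := congrArg ((1 - τ) * ·) P.i₁_mergeU₂₁
  have e2 : Q.I₂ τ = P.I₂ τ := congrArg (τ * ·) P.i₂_mergeU₂₁
  have e7 : Q.I₇ τ = Q.I₃ τ := congrArg ((1 - τ) * ·) P.i₇_mergeU₂₁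
  have e8 : Q.I₈ τ = Q.I₄ τ := congrArg (τ * Q.iY₁₁ + (1 - τ) * ·) P.i₈_mergeU₂₁
  have e9 : Q.I₉ τ = Q.I₅ τ := congrArg ((1 - τ) * ·) P.i₉_mergeU₂₁
  have e10 : Q.I₁₀ τ = Q.I₆ τ := congrArg (τ * Q.iY₁₁ + (1 - τ) * ·) P.i₁₀_mergeU₂₁
  have e11 : Q.I₁₁ τ = P.I₁₂ τ := congrArg ((1 - τ) * ·) P.i₁₁_mergeU₂₁
  have e12 : Q.I₁₂ τ = P.I₁₂ τ :=
    congrArg ((1 - τ) * ·) (P.i₁₂_mergeU₂₁.trans P.i₁₁_mergeU₂₁)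
  have e13 : Q.I₁₃ τ = P.I₁₄ τ := congrArg ((1 - τ) * ·) P.i₁₃_mergeU₂₁
  have e14 : Q.I₁₄ τ = P.I₁₄ τ :=
    congrArg ((1 - τ) * ·) (P.i₁₄_mergeU₂₁.trans P.i₁₃_mergeU₂₁)
  have f7 : P.I₇ τ = Q.I₃ τ + (1 - τ) * P.iMerge :=
    (congrArg ((1 - τ) * ·) P.i₇_eq_mergeU₂₁).trans (mul_add _ _ _)
  have f9 : P.I₉ τ = Q.I₅ τ + (1 - τ) * P.iMerge :=
    (congrArg ((1 - τ) * ·) P.i₉_eq_mergeU₂₁).trans (mul_add _ _ _)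
  have f8 : P.I₈ τ = Q.I₄ τ + (1 - τ) * P.iMerge := by
    have h : P.I₈ τ = τ * P.iY₁₁ + (1 - τ) * P.i₈ := rfl
    have h' : Q.I₄ τ = τ * Q.iY₁₁ + (1 - τ) * Q.i₄ := rfl
    rw [h, h', i₈_eq_mergeU₂₁, ← iY₁₁_mergeU₂₁]
    ring
  have f10 : P.I₁₀ τ = Q.I₆ τ + (1 - τ) * P.iMerge := by
    have h : P.I₁₀ τ = τ * P.iY₁₁ + (1 - τ) * P.i₁₀ := rfl
    have h' : Q.I₆ τ = τ * Q.iY₁₁ + (1 - τ) * Q.i₆ := rfl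
    rw [h, h', i₁₀_eq_mergeU₂₁, ← iY₁₁_mergeU₂₁]
    ring
  have n3 : 0 ≤ Q.I₃ τ := mul_nonneg hτ1 Q.i₃_nonneg
  have n12 : P.I₁₁ τ ≤ P.I₁₂ τ := mul_le_mul_of_nonneg_left P.i₁₁_le_i₁₂ hτ1
  obtain ⟨hR₁, hR₂, hd₁, hd₂, h3, h4, h5, h6, h7⟩ := hR
  have m1 := min_le_left (P.I₂ τ + P.I₉ τ) (P.I₁₀ τ)
  have m2 := min_le_right (P.I₂ τ + P.I₉ τ) (P.I₁₀ τ)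
  have m3 := min_le_left (P.I₂ τ + P.I₇ τ) (P.I₈ τ)
  have m4 := min_le_right (P.I₂ τ + P.I₇ τ) (P.I₈ τ)
  have hd : R.1 ≤ min (Q.I₂ τ + Q.I₅ τ) (Q.I₆ τ) := le_min (by linarith) (by linarith)
  have ha : R.1 + R.2 - (P.I₁₄ τ - P.I₁ τ) ≤ min (Q.I₂ τ + Q.I₃ τ) (Q.I₄ τ) :=
    le_min (by linarith) (by linarith)
  refine Q.splittable_of_mem_rateRegion (R := R) hτ ⟨hR₁, hR₂, hd, ?_, ?_, ?_, ?_, ?_, ?_⟩ ?_ ?_ ?_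
  · rw [e12, e1]; exact hd₂
  · rw [e7, e8, e13, e1]; linarith
  · rw [e14, e1]; linarith
  · rw [e9, e10, e11, e1]; linarith
  · rw [e9, e10, e13, e1]; linarith
  · rw [e7, e8, e11, e14, e1]; linarith
  · rw [e11, e1]; linarith
  · rw [e13, e1]; linarith
  · rw [e11, e1, e7]; linarith

/-- If `R₁` is too large for the condition, `U₂₂` and `U₁₁` are both removed. The first destination
keeps its bounds with `u₁₁` wrong, and the second decodes `u₂₁` alone, at a rate up to `I₁₄ - I₁₃`.
Subtracting the violated condition from `h4` bounds `R₂`, and from `h6` it bounds `R₁ + R₂`. -/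
theorem splittable_of_bin_nonneg (hτ : τ ∈ Set.Icc (0 : ℝ) 1) (hR : R ∈ P.rateRegion τ)
    (ha₂ : 0 ≤ P.I₁₁ τ - P.I₁ τ) : Splittable W τ (1 - τ) R.1 R.2 := by
  by_cases h₁ : R.1 ≤ min (P.I₂ τ + P.I₃ τ) (P.I₄ τ) + (P.I₁₃ τ - P.I₁ τ)
  · exact splittable_of_relay_bound hτ hR ha₂ h₁
  push Not at h₁
  set Q := P.dropU₂₂.dropU₁₁ with hQ
  have z1 : Q.i₁ = 0 := condMutualInfo_of_subsingleton (A := Unit) _ _ _ _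
  have z11 : Q.i₁₁ = 0 := condMutualInfo_of_subsingleton (A := Unit) _ _ _ _
  have e1 : Q.I₁ τ = 0 := (congrArg ((1 - τ) * ·) z1).trans (mul_zero _)
  have e11 : Q.I₁₁ τ = 0 := (congrArg ((1 - τ) * ·) z11).trans (mul_zero _)
  have e13 : Q.I₁₃ τ = 0 :=
    (congrArg ((1 - τ) * ·) (P.dropU₂₂.i₁₃_dropU₁₁.trans z11)).trans (mul_zero _)
  have z12 : Q.i₁₂ = P.i₁₄ - P.i₁₃ := by
    rw [hQ, i₁₂_dropU₁₁, ← hQ, z11, i₁₄_dropU₂₂, i₁₃_dropU₂₂]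
    ring
  have e12 : Q.I₁₂ τ = P.I₁₄ τ - P.I₁₃ τ :=
    (congrArg ((1 - τ) * ·) z12).trans (mul_sub _ _ _)
  have e14 : Q.I₁₄ τ = P.I₁₄ τ - P.I₁₃ τ :=
    (congrArg ((1 - τ) * ·) P.dropU₂₂.i₁₄_dropU₁₁).trans e12
  have e2 : Q.I₂ τ = P.I₂ τ :=
    congrArg (τ * ·) (P.dropU₂₂.i₂_dropU₁₁.trans P.i₂_dropU₂₂)
  have zY : Q.iY₁₁ = P.iY₁₁ := P.dropU₂₂.iY₁₁_dropU₁₁.trans P.iY₁₁_dropU₂₂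
  have e3 : Q.I₃ τ = P.I₅ τ := congrArg ((1 - τ) * ·) (P.dropU₂₂.i₃_dropU₁₁.trans P.i₅_dropU₂₂)
  have e5 : Q.I₅ τ = P.I₅ τ := congrArg ((1 - τ) * ·) (P.dropU₂₂.i₅_dropU₁₁.trans P.i₅_dropU₂₂)
  have e7 : Q.I₇ τ = P.I₉ τ := congrArg ((1 - τ) * ·) (P.dropU₂₂.i₇_dropU₁₁.trans P.i₉_dropU₂₂)
  have e9 : Q.I₉ τ = P.I₉ τ := congrArg ((1 - τ) * ·) (P.dropU₂₂.i₉_dropU₁₁.trans P.i₉_dropU₂₂)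
  have e4 : Q.I₄ τ = P.I₆ τ := congrArg₂ (fun a b => τ * a + (1 - τ) * b) zY
    (P.dropU₂₂.i₄_dropU₁₁.trans P.i₆_dropU₂₂)
  have e6 : Q.I₆ τ = P.I₆ τ := congrArg₂ (fun a b => τ * a + (1 - τ) * b) zY
    (P.dropU₂₂.i₆_dropU₁₁.trans P.i₆_dropU₂₂)
  have e8 : Q.I₈ τ = P.I₁₀ τ := congrArg₂ (fun a b => τ * a + (1 - τ) * b) zY
    (P.dropU₂₂.i₈_dropU₁₁.trans P.i₁₀_dropU₂₂)
  have e10 : Q.I₁₀ τ = P.I₁₀ τ := congrArg₂ (fun a b => τ * a + (1 - τ) * b) zY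
    (P.dropU₂₂.i₁₀_dropU₁₁.trans P.i₁₀_dropU₂₂)
  obtain ⟨hR₁, hR₂, hd₁, hd₂, h3, h4, h5, h6, h7⟩ := hR
  refine splittable_of_relay_bound (P := Q) hτ ⟨hR₁, hR₂, ?_, ?_, ?_, ?_, ?_, ?_, ?_⟩ ?_ ?_
  · rw [e2, e5, e6]; exact hd₁
  · rw [e12, e1]; linarith
  · rw [e2, e7, e8, e13, e1]; linarith
  · rw [e2, e3, e4, e14, e1]; linarith
  · rw [e2, e9, e10, e11, e1]; linarith
  · rw [e2, e3, e4, e9, e10, e13, e1]; linarith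
  · rw [e2, e7, e8, e11, e14, e1]; linarith
  · rw [e11, e1, sub_zero]
  · rw [e2, e3, e4, e13, e1]; linarith

/-- Every point of the rate region can be split into rates of the message parts. -/
theorem splittable (hτ : τ ∈ Set.Icc (0 : ℝ) 1) (hR : R ∈ P.rateRegion τ) :
    Splittable W τ (1 - τ) R.1 R.2 := by
  by_cases ha₂ : 0 ≤ P.I₁₁ τ - P.I₁ τ
  · exact splittable_of_bin_nonneg hτ hR ha₂
  push Not at ha₂
  -- Binning costs more than `U₂₂` conveys. Without it `I₁₂`, `I₁₃`, `I₁₄` lose `I₁₁` but no longer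
  -- pay the larger `I₁`, and the first destination's informations are unchanged.
  set Q := P.dropU₂₂ with hQ
  have e1 : Q.I₁ τ = 0 := (congrArg ((1 - τ) * ·) P.i₁_dropU₂₂).trans (mul_zero _)
  have e11 : Q.I₁₁ τ = 0 := (congrArg ((1 - τ) * ·) P.i₁₁_dropU₂₂).trans (mul_zero _)
  have e12 : Q.I₁₂ τ = P.I₁₂ τ - P.I₁₁ τ :=
    (congrArg ((1 - τ) * ·) P.i₁₂_dropU₂₂).trans (mul_sub _ _ _)
  have e13 : Q.I₁₃ τ = P.I₁₃ τ - P.I₁₁ τ :=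
    (congrArg ((1 - τ) * ·) P.i₁₃_dropU₂₂).trans (mul_sub _ _ _)
  have e14 : Q.I₁₄ τ = P.I₁₄ τ - P.I₁₁ τ :=
    (congrArg ((1 - τ) * ·) P.i₁₄_dropU₂₂).trans (mul_sub _ _ _)
  have e2 : Q.I₂ τ = P.I₂ τ := congrArg (τ * ·) P.i₂_dropU₂₂
  have e3 : Q.I₃ τ = P.I₃ τ := congrArg ((1 - τ) * ·) P.i₃_dropU₂₂
  have e5 : Q.I₅ τ = P.I₅ τ := congrArg ((1 - τ) * ·) P.i₅_dropU₂₂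
  have e7 : Q.I₇ τ = P.I₇ τ := congrArg ((1 - τ) * ·) P.i₇_dropU₂₂
  have e9 : Q.I₉ τ = P.I₉ τ := congrArg ((1 - τ) * ·) P.i₉_dropU₂₂
  have e4 : Q.I₄ τ = P.I₄ τ := congrArg₂ (fun a b => τ * a + (1 - τ) * b) P.iY₁₁_dropU₂₂
    P.i₄_dropU₂₂
  have e6 : Q.I₆ τ = P.I₆ τ := congrArg₂ (fun a b => τ * a + (1 - τ) * b) P.iY₁₁_dropU₂₂
    P.i₆_dropU₂₂
  have e8 : Q.I₈ τ = P.I₈ τ := congrArg₂ (fun a b => τ * a + (1 - τ) * b) P.iY₁₁_dropU₂₂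
    P.i₈_dropU₂₂
  have e10 : Q.I₁₀ τ = P.I₁₀ τ := congrArg₂ (fun a b => τ * a + (1 - τ) * b) P.iY₁₁_dropU₂₂
    P.i₁₀_dropU₂₂
  obtain ⟨hR₁, hR₂, hd₁, hd₂, h3, h4, h5, h6, h7⟩ := hR
  refine splittable_of_bin_nonneg (P := Q) hτ ⟨hR₁, hR₂, ?_, ?_, ?_, ?_, ?_, ?_, ?_⟩ ?_
  · rw [e2, e5, e6]; exact hd₁
  · rw [e12, e1]; linarith
  · rw [e2, e7, e8, e13, e1]; linarith
  · rw [e2, e3, e4, e14, e1]; linarith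
  · rw [e2, e9, e10, e11, e1]; linarith
  · rw [e2, e3, e4, e9, e10, e13, e1]; linarith
  · rw [e2, e7, e8, e11, e14, e1]; linarith
  · rw [e11, e1, sub_zero]

end HKInput

end

/-! ### Error probability under time sharing -/

noncomputable section

open Filter Topology

section

variable {ι κ A B : Type*} [Fintype ι] [Fintype κ] [Fintype A] [Fintype B] [DecidableEq ι]
  [DecidableEq κ]

theorem expect_prodWeight_equiv (p : ι → A → ℝ) (σ : κ ≃ ι) (f : (ι → A) → ℝ) :
    expect (prodWeight p) f = expect (prodWeight fun j => p (σ j)) fun x => f fun i => x (σ.symm i) := by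
  unfold expect
  refine Fintype.sum_equiv (σ.symm.arrowCongr (Equiv.refl A)) _ _ fun x => ?_
  refine congrArg₂ (· * ·) ?_ ?_
  · exact (Equiv.prod_comp σ fun i => p i (x i)).symm
  · refine congrArg f (funext fun i => ?_)
    simp [Equiv.arrowCongr]

theorem expect_prodWeight_inl {p : κ ⊕ ι → A → ℝ} (hp : ∀ i, p i ∈ stdSimplex ℝ A)
    (f : (κ → A) → ℝ) : expect (prodWeight p) (fun y => f fun j => y (Sum.inl j)) =
      expect (prodWeight fun j => p (Sum.inl j)) f := by
  have h1 : expect (prodWeight p) (fun y => f fun j => y (Sum.inl j)) =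
      expect (prodW (prodWeight fun j => p (Sum.inl j)) (prodWeight fun j => p (Sum.inr j)))
        fun x => f x.1 := by
    unfold expect
    refine Fintype.sum_equiv (Equiv.sumArrowEquivProdArrow κ ι A) _ _ fun y => ?_
    refine congrArg₂ (· * ·) ?_ rfl
    exact Fintype.prod_sum_type _
  rw [h1, expect_prodW]
  refine congrArg _ (funext fun x => ?_)
  exact expect_const (prodWeight_mem (p := fun j => p (Sum.inr j)) fun _ => hp _) (f x)

/-- The marginal law of some of the coordinates under a product weight. -/
theorem expect_prodWeight_injective {p : ι → A → ℝ} (hp : ∀ i, p i ∈ stdSimplex ℝ A) {e : κ → ι}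
    (he : Function.Injective e) (f : (κ → A) → ℝ) :
    expect (prodWeight p) (fun y => f fun j => y (e j)) =
      expect (prodWeight fun j => p (e j)) f := by
  classical
  -- The coordinates outside the range of `e` are independent of the others and are averaged away.
  set σ : κ ⊕ ((Set.range e)ᶜ : Set ι) ≃ ι :=
    ((Equiv.ofInjective e he).sumCongr (Equiv.refl _)).trans (Equiv.Set.sumCompl (Set.range e)) with hσ
  have hl : ∀ j, σ (Sum.inl j) = e j := fun j => by simp [hσ]
  have hl' : ∀ j, σ.symm (e j) = Sum.inl j := fun j => by rw [← hl, Equiv.symm_apply_apply]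
  rw [expect_prodWeight_equiv p σ]
  simp only [hl']
  rw [expect_prodWeight_inl (fun _ => hp _)]
  simp only [hl]

end

theorem sum_pi_eval_div {L : ℕ} {M : Fin L → Type} [∀ l, Fintype (M l)] [∀ l, Nonempty (M l)]
    (l₀ : Fin L) (f : M l₀ → ℝ) :
    (∑ w : ∀ l, M l, f (w l₀)) / Fintype.card (∀ l, M l) = (∑ a, f a) / Fintype.card (M l₀) := by
  classical
  have h1 : ∑ w : ∀ l, M l, f (w l₀) =
      (∑ a, f a) * Fintype.card (∀ j : {j // j ≠ l₀}, M j) := by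
    rw [Fintype.sum_equiv (Equiv.piSplitAt l₀ M) (fun w => f (w l₀)) (fun x => f x.1) fun _ => rfl,
      Fintype.sum_prod_type]
    simp only [Finset.sum_const, Finset.card_univ, nsmul_eq_mul, Finset.sum_mul]
    exact Finset.sum_congr rfl fun _ _ => mul_comm _ _
  have h2 : Fintype.card (∀ l, M l) =
      Fintype.card (M l₀) * Fintype.card (∀ j : {j // j ≠ l₀}, M j) := by
    rw [Fintype.card_congr (Equiv.piSplitAt l₀ M), Fintype.card_prod]
  have h3 : (Fintype.card (∀ j : {j // j ≠ l₀}, M j) : ℝ) ≠ 0 :=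
    Nat.cast_ne_zero.2 Fintype.card_ne_zero
  rw [h1, h2, Nat.cast_mul, mul_div_mul_right _ _ h3]

namespace HDCode

variable {W : HDChannel.{u}}

theorem errorProbAt_eq_expect (c : HDCode W) (w₁ : c.M₁) (w₂ : c.M₂) :
    c.errorProbAt w₁ w₂ = expect (prodWeight fun i => W.phase1 (c.enc₁₁ w₁ i)) fun y =>
      expect (prodWeight fun j => W.phase2 (c.enc₁₂ w₁ j) (c.enc₂₂ w₂ (fun i => (y i).2.2) j))
        fun z => ind (¬ (c.dec₁ (fun i => (y i).1) (fun j => (z j).1) = w₁ ∧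
          c.dec₂ (fun i => (y i).2.1) (fun j => (z j).2) = w₂)) := by
  unfold errorProbAt expect
  refine Finset.sum_congr rfl fun y _ => ?_
  rw [Finset.mul_sum]
  refine Finset.sum_congr rfl fun z _ => ?_
  rw [← mul_assoc]
  refine congrArg₂ (· * ·) rfl ?_
  split_ifs with h1
  · exact (ind_of_not (not_not.2 h1)).symm
  · exact (ind_of h1).symm

variable {L : ℕ} (c : Fin L → HDCode W)

/-- The joint code errs only if a component errs. The inputs of a component depend on the first
phase only through its own outputs, so the marginal of the product law on its coordinates is exactly
the law of the component used alone. -/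
theorem errorProbAt_timeShare_le (w₁ : ∀ l, (c l).M₁) (w₂ : ∀ l, (c l).M₂) :
    (timeShare c).errorProbAt w₁ w₂ ≤ ∑ l, (c l).errorProbAt (w₁ l) (w₂ l) := by
  classical
  set F₁ : (Σ l, Fin (c l).k) → W.X₁₁ := fun s => (c s.1).enc₁₁ (w₁ s.1) s.2
  set F₂ : (Σ l, Fin (c l).m) → W.X₁₂ := fun s => (c s.1).enc₁₂ (w₁ s.1) s.2
  set F₃ : ((Fin (∑ l, (c l).k)) → W.Y) → (Σ l, Fin (c l).m) → W.X₂₂ := fun y s =>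
    (c s.1).enc₂₂ (w₂ s.1) (fun i => y (finSigmaFinEquiv ⟨s.1, i⟩)) s.2
  set p₁ : Fin (∑ l, (c l).k) → W.Y₁₁ × W.Y₂₁ × W.Y → ℝ := fun i =>
    W.phase1 (F₁ (finSigmaFinEquiv.symm i))
  set p₂ : ((Fin (∑ l, (c l).k)) → W.Y) → Fin (∑ l, (c l).m) → W.Y₁₂ × W.Y₂₂ → ℝ := fun y j =>
    W.phase2 (F₂ (finSigmaFinEquiv.symm j)) (F₃ y (finSigmaFinEquiv.symm j))
  set bad : ∀ l, (Fin (c l).k → W.Y₁₁ × W.Y₂₁ × W.Y) → (Fin (c l).m → W.Y₁₂ × W.Y₂₂) → ℝ :=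
    fun l y z => ind (¬ ((c l).dec₁ (fun i => (y i).1) (fun j => (z j).1) = w₁ l ∧
      (c l).dec₂ (fun i => (y i).2.1) (fun j => (z j).2) = w₂ l))
  have hp₁ : ∀ i, p₁ i ∈ stdSimplex ℝ _ := fun i => (W.phase1 _).2
  have hp₂ : ∀ y j, p₂ y j ∈ stdSimplex ℝ _ := fun y j => (W.phase2 _ _).2
  have hbound : (timeShare c).errorProbAt w₁ w₂ ≤ expect (prodWeight p₁) fun y =>
      expect (prodWeight (p₂ fun i => (y i).2.2)) fun z => ∑ l,
        bad l (fun i => y (finSigmaFinEquiv ⟨l, i⟩)) (fun j => z (finSigmaFinEquiv ⟨l, j⟩)) := by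
    refine (errorProbAt_eq_expect (timeShare c) w₁ w₂).trans_le ?_
    refine expect_mono (prodWeight_mem hp₁).1 fun y =>
      expect_mono (prodWeight_mem (hp₂ fun i => (y i).2.2)).1 fun z => ?_
    refine (ind_mono fun h => ?_).trans (ind_exists_le _)
    by_contra! hc
    exact h ⟨funext fun l => (hc l).1, funext fun l => (hc l).2⟩
  refine hbound.trans (le_of_eq ?_)
  simp only [expect_sum]
  refine Finset.sum_congr rfl fun l _ => ?_
  have hinj : ∀ (k : Fin L → ℕ), Function.Injective
      fun i : Fin (k l) => finSigmaFinEquiv (⟨l, i⟩ : Σ l, Fin (k l)) := fun k i j h =>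
    eq_of_heq (Sigma.mk.inj (finSigmaFinEquiv.injective h)).2
  set g : (Fin (c l).k → W.Y₁₁ × W.Y₂₁ × W.Y) → ℝ := fun y' => expect (prodWeight fun j =>
    W.phase2 ((c l).enc₁₂ (w₁ l) j) ((c l).enc₂₂ (w₂ l) (fun i => (y' i).2.2) j)) (bad l y')
  have hz : ∀ y : Fin (∑ l, (c l).k) → W.Y₁₁ × W.Y₂₁ × W.Y,
      (expect (prodWeight (p₂ fun i => (y i).2.2)) fun z =>
        bad l (fun i => y (finSigmaFinEquiv ⟨l, i⟩)) (fun j => z (finSigmaFinEquiv ⟨l, j⟩))) =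
      g fun i => y (finSigmaFinEquiv ⟨l, i⟩) := by
    intro y
    refine (expect_prodWeight_injective (hp₂ fun i => (y i).2.2) (hinj fun l => (c l).m)
      (fun z => bad l (fun i => y (finSigmaFinEquiv ⟨l, i⟩)) z)).trans ?_
    have hlaw : (fun j : Fin (c l).m => p₂ (fun i => (y i).2.2) (finSigmaFinEquiv ⟨l, j⟩)) =
        fun j => ⇑(W.phase2 ((c l).enc₁₂ (w₁ l) j) ((c l).enc₂₂ (w₂ l)
          (fun i => (y (finSigmaFinEquiv ⟨l, i⟩)).2.2) j)) := by
      funext j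
      simp only [p₂, Equiv.symm_apply_apply]
      rfl
    rw [hlaw]
  have hlaw : (fun i : Fin (c l).k => p₁ (finSigmaFinEquiv ⟨l, i⟩)) =
      fun i => ⇑(W.phase1 ((c l).enc₁₁ (w₁ l) i)) := by
    funext j
    simp only [p₁, Equiv.symm_apply_apply]
    rfl
  refine (congrArg (expect (prodWeight p₁)) (funext hz)).trans ?_
  refine (expect_prodWeight_injective hp₁ (hinj fun l => (c l).k) g).trans ?_
  rw [hlaw]
  exact (errorProbAt_eq_expect (c l) (w₁ l) (w₂ l)).symm

/-- The union bound for time sharing. -/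
theorem errorProb_timeShare_le : (timeShare c).errorProb ≤ ∑ l, (c l).errorProb := by
  have h1 : (timeShare c).errorProb ≤ (∑ w₁ : ∀ l, (c l).M₁, ∑ w₂ : ∀ l, (c l).M₂,
      ∑ l, (c l).errorProbAt (w₁ l) (w₂ l)) /
      (Fintype.card (∀ l, (c l).M₁) * Fintype.card (∀ l, (c l).M₂)) :=
    div_le_div_of_nonneg_right (Finset.sum_le_sum fun w₁ _ => Finset.sum_le_sum fun w₂ _ =>
      errorProbAt_timeShare_le c w₁ w₂) (by positivity)
  refine h1.trans (le_of_eq ?_)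
  have h2 : ∀ w₁ : ∀ l, (c l).M₁, ∑ w₂ : ∀ l, (c l).M₂, ∑ l, (c l).errorProbAt (w₁ l) (w₂ l) =
      ∑ l, ∑ w₂ : ∀ l, (c l).M₂, (c l).errorProbAt (w₁ l) (w₂ l) := fun _ => Finset.sum_comm
  simp only [h2]
  rw [Finset.sum_comm, Finset.sum_div]
  refine Finset.sum_congr rfl fun l _ => ?_
  unfold errorProb
  rw [← div_div, ← div_div, sum_pi_eval_div (M := fun l => (c l).M₁) l
    fun a => ∑ w₂ : ∀ l, (c l).M₂, (c l).errorProbAt a (w₂ l), div_right_comm, Finset.sum_div,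
    div_right_comm, Finset.sum_div _ _ (Fintype.card (c l).M₂ : ℝ)]
  refine congrArg (· / _) (Finset.sum_congr rfl fun a _ => ?_)
  exact sum_pi_eval_div (M := fun l => (c l).M₂) l fun b => (c l).errorProbAt a b

end HDCode

end

/-! ### Convex combinations through time sharing -/

noncomputable section

open Filter Topology

/-- A phase of length `q n ∼ (∑ l, a l) n` is split into parts of lengths `∼ a l * n`. -/
theorem exists_apportionment {L : ℕ} {a : Fin L → ℝ} (ha : ∀ l, 0 ≤ a l) {q : ℕ → ℕ}
    (hq : Tendsto (fun n => (q n : ℝ) / n) atTop (𝓝 (∑ l, a l)))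
    (hle : ∀ n : ℕ, ∑ l, ⌊a l * n⌋₊ ≤ q n) (h0 : ∑ l, a l = 0 → ∀ n, q n = 0) :
    ∃ k : Fin L → ℕ → ℕ, (∀ n, ∑ l, k l n = q n) ∧
      (∀ l, Tendsto (fun n => (k l n : ℝ) / n) atTop (𝓝 (a l))) ∧
      ∀ l, Tendsto (k l) atTop atTop ∨ ∀ n, k l n = 0 := by
  have hfl : ∀ l, Tendsto (fun n : ℕ => (⌊a l * n⌋₊ : ℝ) / n) atTop (𝓝 (a l)) := fun l =>
    (tendsto_nat_floor_mul_div_atTop (ha l)).comp tendsto_natCast_atTop_atTop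
  by_cases hs : ∑ l, a l = 0
  · have hz : ∀ l, a l = 0 := fun l =>
      (Finset.sum_eq_zero_iff_of_nonneg fun i _ => ha i).1 hs l (Finset.mem_univ l)
    exact ⟨fun _ _ => 0, fun n => by simp [h0 hs n], fun l => by simp [hz l], fun l =>
      Or.inr fun _ => rfl⟩
  · obtain ⟨l₀, -, hl₀⟩ := Finset.exists_ne_zero_of_sum_ne_zero hs
    have hpos : 0 < a l₀ := (ha l₀).lt_of_ne' hl₀
    -- Every part gets its floor, and the remainder, which is `o(n)`, goes to one part of positive
    -- share. A part of share zero thus has length exactly zero, as the estimates for empty phases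
    -- require.
    refine ⟨fun l n => ⌊a l * n⌋₊ + if l = l₀ then q n - ∑ j, ⌊a j * n⌋₊ else 0, fun n => ?_,
      fun l => ?_, fun l => ?_⟩
    · simp [Finset.sum_add_distrib, Nat.add_sub_cancel' (hle n)]
    · have hrem : Tendsto (fun n => ((if l = l₀ then q n - ∑ j, ⌊a j * n⌋₊ else 0 : ℕ) : ℝ) / n)
          atTop (𝓝 0) := by
        split_ifs
        · have := hq.sub (tendsto_finsetSum Finset.univ fun l _ => hfl l)
          rw [sub_self] at this
          refine this.congr fun n => ?_
          rw [Nat.cast_sub (hle n), sub_div, Nat.cast_sum, Finset.sum_div]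
        · simp
      have := (hfl l).add hrem
      rw [add_zero] at this
      exact this.congr fun n => by push_cast; rw [add_div]
    · rcases (ha l).eq_or_lt with h | h
      · refine Or.inr fun n => ?_
        have : l ≠ l₀ := fun e => hpos.ne (e ▸ h)
        simp [this, ← h]
      · exact Or.inl (tendsto_atTop_mono (fun n => Nat.le_add_right _ _)
          (tendsto_nat_floor_mul_atTop _ h))

/-- Sizes multiply, so rates and losses add. Where the loss would make the rate negative, the rate
is `0` and one message suffices. -/
theorem two_rpow_le_card_pi {L : ℕ} {M : Fin L → Type} [∀ l, Fintype (M l)]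
    [∀ l, Nonempty (M l)] {n : ℕ} {r : Fin L → ℝ} {η δ : ℝ}
    (h : ∀ l, (2 : ℝ) ^ (n * (r l - η)) ≤ Fintype.card (M l)) (hη : L * η ≤ δ) :
    (2 : ℝ) ^ (n * max (∑ l, r l - δ) 0) ≤ Fintype.card (∀ l, M l) := by
  rcases max_choice (∑ l, r l - δ) 0 with hm | hm
  · rw [hm, Fintype.card_pi, Nat.cast_prod]
    refine le_trans ?_ (Finset.prod_le_prod (fun _ _ => by positivity) fun l _ => h l)
    rw [← Real.rpow_sum_of_pos two_pos, ← Finset.mul_sum, Finset.sum_sub_distrib]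
    refine Real.rpow_le_rpow_of_exponent_le one_le_two (mul_le_mul_of_nonneg_left ?_ n.cast_nonneg)
    have : ∑ _l : Fin L, η = L * η := by simp
    linarith
  · rw [hm, mul_zero, Real.rpow_zero]
    exact_mod_cast Fintype.card_pos

namespace HKInput

variable {W : HDChannel.{u}}

/-- The constraints are linear and homogeneous in phase lengths and rates together, which is why `α`
and `β` are left free. A weight in a convex combination becomes a share of the block, even if `τ`
varies between the components. -/
theorem Splittable.smul {α β R₁ R₂ w : ℝ} (h : Splittable W α β R₁ R₂) (hw : 0 ≤ w) :
    Splittable W (w * α) (w * β) (w * R₁) (w * R₂) := by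
  obtain ⟨P, R₁₀, R₁₁, R₁₂, R₂₁, R₂₂, hA, rfl, rfl⟩ := h
  refine ⟨P, w * R₁₀, w * R₁₁, w * R₁₂, w * R₂₁, w * R₂₂, ?_, by ring, by ring⟩
  constructor
  · exact mul_nonneg hw hA.nn₁₀
  · exact mul_nonneg hw hA.nn₁₁
  · exact mul_nonneg hw hA.nn₁₂
  · exact mul_nonneg hw hA.nn₂₁
  · exact mul_nonneg hw hA.nn₂₂
  · linarith [mul_le_mul_of_nonneg_left hA.c₂ hw]
  · linarith [mul_le_mul_of_nonneg_left hA.c₃ hw]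
  · linarith [mul_le_mul_of_nonneg_left hA.c₄ hw]
  · linarith [mul_le_mul_of_nonneg_left hA.c₅ hw]
  · linarith [mul_le_mul_of_nonneg_left hA.c₆ hw]
  · linarith [mul_le_mul_of_nonneg_left hA.c₇ hw]
  · linarith [mul_le_mul_of_nonneg_left hA.c₈ hw]
  · linarith [mul_le_mul_of_nonneg_left hA.c₉ hw]
  · linarith [mul_le_mul_of_nonneg_left hA.c₁₀ hw]
  · linarith [mul_le_mul_of_nonneg_left hA.c₁₁ hw]
  · linarith [mul_le_mul_of_nonneg_left hA.c₁₂ hw]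
  · linarith [mul_le_mul_of_nonneg_left hA.c₁₃ hw]
  · linarith [mul_le_mul_of_nonneg_left hA.c₁₄ hw]

end HKInput

variable {W : HDChannel.{u}}

/-- Time sharing of codes with the rates `(R₁ l, R₂ l)`, where the `l`-th code takes the fractions
`α l` and `β l` of the block for its two phases. -/
theorem mem_achievableRates_of_splittable {L : ℕ} {α β R₁ R₂ : Fin L → ℝ} (hα : ∀ l, 0 ≤ α l)
    (hβ : ∀ l, 0 ≤ β l) (h1 : ∑ l, α l + ∑ l, β l = 1)
    (h : ∀ l, HKInput.Splittable W (α l) (β l) (R₁ l) (R₂ l)) {δ : ℝ} (hδ : 0 < δ) :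
    (max (∑ l, R₁ l - δ) 0, max (∑ l, R₂ l - δ) 0) ∈
      achievableRates W (hkBinningCodes W) (∑ l, α l) := by
  refine ⟨le_max_right _ _, le_max_right _ _, fun ε hε => ?_⟩
  set τ := ∑ l, α l with hτ
  have hτ0 : 0 ≤ τ := Finset.sum_nonneg fun l _ => hα l
  have hβ0 : 0 ≤ ∑ l, β l := Finset.sum_nonneg fun l _ => hβ l
  have hfloor : ∀ n : ℕ, (⌊τ * n⌋₊ : ℝ) ≤ τ * n := fun n => Nat.floor_le (by positivity)
  have hτn : ∀ n : ℕ, ⌊τ * n⌋₊ ≤ n := fun n => by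
    have : (⌊τ * n⌋₊ : ℝ) ≤ n := (hfloor n).trans
      (mul_le_of_le_one_left n.cast_nonneg (by linarith))
    exact_mod_cast this
  have hsum : ∀ (a : Fin L → ℝ), (∀ l, 0 ≤ a l) → ∀ n : ℕ,
      ((∑ l, ⌊a l * n⌋₊ : ℕ) : ℝ) ≤ (∑ l, a l) * n := fun a ha n => by
    rw [Nat.cast_sum, Finset.sum_mul]
    exact Finset.sum_le_sum fun l _ => Nat.floor_le (mul_nonneg (ha l) n.cast_nonneg)
  have hτlim : Tendsto (fun n : ℕ => (⌊τ * n⌋₊ : ℝ) / n) atTop (𝓝 τ) :=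
    (tendsto_nat_floor_mul_div_atTop hτ0).comp tendsto_natCast_atTop_atTop
  obtain ⟨k, hk, hkα, hk0⟩ := exists_apportionment hα (q := fun n => ⌊τ * n⌋₊) hτlim
    (fun n => Nat.le_floor (hsum α hα n)) fun h0 n => by
      have : τ = 0 := h0
      simp [this]
  obtain ⟨m, hm, hmβ, hm0⟩ := exists_apportionment hβ (q := fun n => n - ⌊τ * n⌋₊)
    (by
      have h2 : Tendsto (fun n : ℕ => 1 - (⌊τ * n⌋₊ : ℝ) / n) atTop (𝓝 (∑ l, β l)) := by
        have := hτlim.const_sub 1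
        rwa [show 1 - τ = ∑ l, β l by linarith] at this
      refine h2.congr' ?_
      filter_upwards [eventually_gt_atTop 0] with n hn
      have : (n : ℝ) ≠ 0 := by positivity
      rw [Nat.cast_sub (hτn n), sub_div, div_self this])
    (fun n => by
      have : ((∑ l, ⌊β l * n⌋₊ : ℕ) : ℝ) ≤ ((n - ⌊τ * n⌋₊ : ℕ) : ℝ) := by
        rw [Nat.cast_sub (hτn n)]
        have := hsum β hβ n
        rw [show ∑ l, β l = 1 - τ by linarith] at this
        linarith [hfloor n]
      exact_mod_cast this)
    fun h0 n => by
      have : τ = 1 := by linarith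
      simp [this]
  have hkn : ∀ l n, k l n ≤ n := fun l n =>
    (Finset.single_le_sum (f := fun l => k l n) (fun _ _ => Nat.zero_le _)
      (Finset.mem_univ l)).trans ((hk n).trans_le (hτn n))
  have hmn : ∀ l n, m l n ≤ n := fun l n =>
    (Finset.single_le_sum (f := fun l => m l n) (fun _ _ => Nat.zero_le _)
      (Finset.mem_univ l)).trans ((hm n).trans_le (Nat.sub_le _ _))
  -- Each component loses `η` per message part: `3 η` for the first sender and `2 η` for the second.
  -- The total stays within `δ`, and `L + 1` keeps the denominator positive for `L = 0`.
  set η := δ / (3 * (L + 1)) with hη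
  have hη0 : 0 < η := by positivity
  have hηδ : η * (3 * (L + 1)) = δ := div_mul_cancel₀ _ (by positivity)
  have hη₁ : L * (3 * η) ≤ δ := by linarith
  have hη₂ : L * (2 * η) ≤ δ := by nlinarith [L.cast_nonneg (α := ℝ)]
  have hε' : 0 < ε / (L + 1) := by positivity
  have hs : ∀ᶠ n : ℕ in atTop, ∀ l, ∃ s : HKScheme W, s.k = k l n ∧ s.m = m l n ∧
      (2 : ℝ) ^ (n * (R₁ l - 3 * η)) ≤ Fintype.card s.toCode.M₁ ∧
      (2 : ℝ) ^ (n * (R₂ l - 2 * η)) ≤ Fintype.card s.toCode.M₂ ∧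
      s.toCode.errorProb ≤ ε / (L + 1) := by
    refine eventually_all.2 fun l => ?_
    obtain ⟨P, R₁₀, R₁₁, R₁₂, R₂₁, R₂₂, hA, e₁, e₂⟩ := h l
    rw [← e₁, ← e₂]
    exact hA.exists_scheme (hβ l) (hkn l) (hmn l) (hkα l) (hmβ l) (hk0 l) (hm0 l) hη0 hε'
  obtain ⟨N, hN⟩ := eventually_atTop.1 hs
  refine ⟨N, fun n hn => ?_⟩
  choose s hsk hsm hs₁ hs₂ hsε using hN n hn
  have hK : (HDCode.timeShare fun l => (s l).toCode).k = ⌊τ * n⌋₊ :=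
    (Finset.sum_congr rfl fun l _ => hsk l).trans (hk n)
  have hM : (HDCode.timeShare fun l => (s l).toCode).m = n - ⌊τ * n⌋₊ :=
    (Finset.sum_congr rfl fun l _ => hsm l).trans (hm n)
  refine ⟨_, ⟨L, s, rfl⟩, hK, ?_, two_rpow_le_card_pi hs₁ hη₁, two_rpow_le_card_pi hs₂ hη₂, ?_⟩
  · rw [hK, hM, Nat.add_sub_cancel' (hτn n)]
  · refine (HDCode.errorProb_timeShare_le _).trans
      ((Finset.sum_le_sum fun l _ => hsε l).trans ?_)
    rw [Finset.sum_const, Finset.card_univ, Fintype.card_fin, nsmul_eq_mul, mul_div_assoc',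
      div_le_iff₀ (by positivity)]
    linarith

/-- Convex combinations of pairs of the rate regions are limits of achievable pairs. -/
theorem sum_smul_mem_closure_achievableRates {ι : Type} [Fintype ι] {w τ : ι → ℝ} {x : ι → ℝ × ℝ}
    {P : ι → HKInput W} (hw : ∀ i, 0 ≤ w i) (hw1 : ∑ i, w i = 1)
    (hτ : ∀ i, τ i ∈ Set.Icc (0 : ℝ) 1) (hx : ∀ i, x i ∈ (P i).rateRegion (τ i)) :
    ∑ i, w i • x i ∈ closure (achievableRates W (hkBinningCodes W) (∑ i, w i * τ i)) := by
  set σ := (Fintype.equivFin ι).symm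
  have hσ : ∀ f : ι → ℝ, ∑ l, f (σ l) = ∑ i, f i := fun f => Equiv.sum_comp σ f
  have hfst : (∑ i, w i • x i).1 = ∑ i, w i * (x i).1 := by simp [Prod.fst_sum]
  have hsnd : (∑ i, w i • x i).2 = ∑ i, w i * (x i).2 := by simp [Prod.snd_sum]
  have h0₁ : 0 ≤ ∑ i, w i * (x i).1 := Finset.sum_nonneg fun i _ => mul_nonneg (hw i) (hx i).1
  have h0₂ : 0 ≤ ∑ i, w i * (x i).2 := Finset.sum_nonneg fun i _ => mul_nonneg (hw i) (hx i).2.1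
  refine Metric.mem_closure_iff.2 fun ε hε => ?_
  -- A component of weight `w` gets the fraction `w τ` of the block in the first phase and `w (1 -
  -- τ)` in the second, so the overall phase fraction is the weighted mean. The loss `ε / 2` is
  -- absorbed by the closure.
  have hmem := mem_achievableRates_of_splittable (W := W) (δ := ε / 2)
    (α := fun l => w (σ l) * τ (σ l)) (β := fun l => w (σ l) * (1 - τ (σ l)))
    (R₁ := fun l => w (σ l) * (x (σ l)).1) (R₂ := fun l => w (σ l) * (x (σ l)).2)
    (fun l => mul_nonneg (hw _) (hτ _).1) (fun l => mul_nonneg (hw _) (sub_nonneg.2 (hτ _).2))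
    (by
      rw [← Finset.sum_add_distrib]
      exact (Finset.sum_congr rfl fun l _ => by ring).trans ((hσ w).trans hw1))
    (fun l => (HKInput.splittable (hτ _) (hx _)).smul (hw _)) (half_pos hε)
  rw [hσ fun i => w i * τ i, hσ fun i => w i * (x i).1, hσ fun i => w i * (x i).2] at hmem
  refine ⟨_, hmem, ?_⟩
  rw [Prod.dist_eq, hfst, hsnd]
  have hd : ∀ a : ℝ, 0 ≤ a → dist a (max (a - ε / 2) 0) < ε := fun a ha => by
    rw [Real.dist_eq, abs_lt]
    constructor
    · have : max (a - ε / 2) 0 ≤ a := max_le (by linarith) ha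
      linarith
    · linarith [le_max_left (a - ε / 2) 0]
  exact max_lt (hd _ h0₁) (hd _ h0₂)

theorem theorem5 (W : HDChannel.{u}) :
    (∀ τ ∈ Set.Icc (0 : ℝ) 1,
      convexHull ℝ (⋃ P : HKInput W, P.rateRegion τ) ⊆
        closure (achievableRates W (hkBinningCodes W) τ)) ∧
    convexHull ℝ (⋃ τ ∈ Set.Icc (0 : ℝ) 1, ⋃ P : HKInput W, P.rateRegion τ) ⊆
      closure (⋃ τ ∈ Set.Icc (0 : ℝ) 1, achievableRates W (hkBinningCodes W) τ) := by
  constructor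
  · intro τ hτ y hy
    obtain ⟨ι, _, w, x, hw, hw1, hx, rfl⟩ := mem_convexHull_iff_exists_fintype.1 hy
    choose P hP using fun i => Set.mem_iUnion.1 (hx i)
    have := sum_smul_mem_closure_achievableRates hw hw1 (fun _ => hτ) hP
    rwa [← Finset.sum_mul, hw1, one_mul] at this
  · intro y hy
    obtain ⟨ι, _, w, x, hw, hw1, hx, rfl⟩ := mem_convexHull_iff_exists_fintype.1 hy
    choose τ hτ hx' using fun i => Set.mem_iUnion₂.1 (hx i)
    choose P hP using fun i => Set.mem_iUnion.1 (hx' i)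
    -- The phase fraction of the combination is itself a convex combination, hence again in `[0,
    -- 1]`.
    refine closure_mono (Set.subset_iUnion₂_of_subset (∑ i, w i * τ i) ?_ subset_rfl)
      (sum_smul_mem_closure_achievableRates hw hw1 hτ hP)
    refine ⟨Finset.sum_nonneg fun i _ => mul_nonneg (hw i) (hτ i).1, ?_⟩
    rw [← hw1]
    exact Finset.sum_le_sum fun i _ => mul_le_of_le_one_right (hw i) (hτ i).2

end
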